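/- Let $k$ be an algebraically closed field of characteristic zero, $X$ a smooth $n$-dimensional variety over $k$ and $D=\bigcup_{i\in\iota}D_i$ a simple normal crossings divisor with finitely many irreducible components $D_i$, such that every non-empty intersection $\bigcap_{i\in I}D_i$ is connected (for instance a log Calabi–Yau pair, i.e. $K_X+D=0$). Assume either that $X$ is proper over $k$ (absolute case), or that there is a proper morphism $p:X\to\mathbb A^1$ over $k$ with $p^{-1}(0)\subseteq D$ (relative case). Let $\mathscr P$ be the set of cones $\rho=\sum_{i\in I}\mathbb R_{\ge 0}D_i^*\subseteq \mathrm{Div}_D(X)^*_{\mathbb R}=\mathbb R^{\iota}$ with $D_\rho:=\bigcap_{i\in I}D_i\neq\emptyset$, let $B$ be their union, $\mathrm{Star}(\tau)=\bigcup_{\tau\subseteq\rho\in\mathscr P}\mathrm{Int}(\rho)$, let $\partial B$ be the union of the $(n-1)$-dimensional cones contained in exactly one $n$-dimensional cone, and let $\Delta$ be the union of the cones of codimension $\ge 2$. Off $\Delta$, consider the following charts, given by maps linear on every cone. On the interior of an $n$-dimensional cone $\sigma$, and on $\mathrm{Star}(\rho)$ for $\rho$ of codimension one contained in a single $n$-dimensional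 cone $\sigma$, the chart maps the generators $D_i^*$ of $\sigma$ to a basis of $\mathbb Z^n$. On $\mathrm{Star}(\rho)$, for $\rho$ of codimension one contained in exactly two $n$-dimensional cones $\sigma=\rho+\mathbb R_{\ge0}D_a^*$ and $\sigma'=\rho+\mathbb R_{\ge0}D_b^*$, the chart $\psi_\rho$ maps the generators of $\sigma$, and those of $\sigma'$, to a basis of $\mathbb Z^n$, and satisfies $$\psi_\rho(D_a^*)+\psi_\rho(D_b^*)=-\sum_{D_j^*\in\rho}(D_j\cdot D_\rho)\,\psi_\rho(D_j^*).$$ Let $\tau\in\mathscr P$ have codimension $d$, and suppose that the stratum $D_\tau$ is isomorphic over $k$ to the toric variety of a fan $\Sigma_\tau$ in $\mathbb R^d$, in such a way that the strata $D_\rho$, $\tau\subseteq\rho\in\mathscr P$, are exactly the closed toric strata. Then: 1. The integral affine structure on $\mathrm{Star}(\tau)\setminus\Delta$ defined by the charts above extends to an integral affine structure (with boundary $\mathrm{Star}(\tau)\cap\partial B$) on $\mathrm{Star}(\tau)$, and there is an (integral) affine submersion $\upsilon:\mathrm{Star}(\tau)\to\mathbb R^d$ such that for every $\omega\in\Sigma_\tau$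 there is $\rho\in\mathscr P$ with $\tau\subseteq\rho$, $\upsilon^{-1}(\mathrm{Int}(\omega))=\mathrm{Int}(\rho)$ and $\upsilon(\mathrm{Int}(\rho))=\mathrm{Int}(\omega)$. If $X$ is proper over $k$, then $\mathrm{Star}(\tau)\cap\partial B=\emptyset$. 2. Let $N_1(X)$ be the group of $1$-cycles of proper integral curves modulo numerical equivalence, and let $\varphi$ be the multivalued piecewise linear function whose kink along every codimension one cone $\rho$ contained in exactly two $n$-dimensional cones is $[D_\rho]\in N_1(X)$. Here a function has kink $\kappa$ along $\rho=\sigma\cap\sigma'$ if its integral slopes $m$ on $\sigma$ and $m'$ on $\sigma'$, in the chart $\psi_\rho$, satisfy $m'-m=\delta\cdot\kappa$, where $\delta:\mathbb Z^n\to\mathbb Z$ is the quotient by the sublattice tangent to $\psi_\rho(\rho)$, positive on $\psi_\rho(\sigma')$ off $\psi_\rho(\rho)$. Then $\varphi$ has a single-valued representative on $\mathrm{Star}(\tau)$: there is a function $\varphi_\tau:\mathrm{Star}(\tau)\to N_1(X)\otimes_{\mathbb Z}\mathbb R$, linear on the intersection of $\mathrm{Star}(\tau)$ with every cone of $\mathscr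 P$ containing $\tau$, with kink $[D_\rho]$ along every codimension one cone $\rho\supseteq\tau$ contained in exactly two $n$-dimensional cones. -/

import Mathlib

open CategoryTheory AlgebraicGeometry TopologicalSpace Topology TensorProduct

universe u

noncomputable section

namespace LogPair

/-! ### Divisors, curves and numerical equivalence -/

/-- A Cartier divisor on an integral scheme: a local equation `eqn x` in the function field at
every point `x`, such that near `x` the local equations differ from `eqn x` by units. -/
structure CartierDivisor (X : Scheme.{u}) [IsIntegral X] where
  eqn : X → X.functionField
  eqn_ne_zero : ∀ x, eqn x ≠ 0
  locally_eq : ∀ x, ∃ U : X.Opens, x ∈ U ∧ ∀ y ∈ U, ∃ a : (X.presheaf.stalk y)ˣ,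
    eqn y = algebraMap (X.presheaf.stalk y) X.functionField (a : X.presheaf.stalk y) * eqn x

/-- The reduced closed subscheme with underlying closed set `Z`. -/
abbrev redSubscheme {X : Scheme.{u}} (Z : Closeds X) : Scheme.{u} :=
  (Scheme.IdealSheafData.vanishingIdeal Z).subscheme

/-- The closed immersion of the reduced closed subscheme with underlying closed set `Z`. -/
abbrev redι {X : Scheme.{u}} (Z : Closeds X) : redSubscheme Z ⟶ X :=
  (Scheme.IdealSheafData.vanishingIdeal Z).subschemeι

open Classical in
/-- Let `i : C ⟶ X` be a morphism of integral schemes and `E` a Cartier divisor on `X` with local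
equations `f_x`.  Writing `η` for the generic point of `C`, the quotient `f_{i z} / f_{i η}`
is a unit of the local ring of `X` at `i η`, and this is its image in the function field of `C`.
As `z` varies, these are the coordinates, with respect to the local generators `f_{i z}⁻¹` of
`𝒪_X(E)`, of the rational section of `i^* 𝒪_X(E)` that is the generator `f_{i η}⁻¹` at `η`. -/
def CartierDivisor.ratSection {X C : Scheme.{u}} [IsIntegral X] [IsIntegral C]
    (E : CartierDivisor X) (i : C ⟶ X) (z : C) : C.functionField :=
  if h : ∃ a : (X.presheaf.stalk (i (genericPoint C)))ˣ,
      E.eqn (i z) = algebraMap (X.presheaf.stalk (i (genericPoint C))) X.functionField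
        (a : X.presheaf.stalk (i (genericPoint C))) * E.eqn (i (genericPoint C))
  then (i.stalkMap (genericPoint C)).hom (h.choose : X.presheaf.stalk (i (genericPoint C)))
  else 0

open Classical in
/-- The intersection number `E · Z = deg (𝒪_X(E)|_Z)` of a Cartier divisor `E` on a variety over an
algebraically closed field with an integral proper curve `Z`: the degree of the divisor of the
rational section above, i.e. the sum of its orders at the closed points of `Z`. -/
def CartierDivisor.inter {X : Scheme.{u}} [IsIntegral X] (E : CartierDivisor X)
    (Z : Closeds X) : ℤ :=
  if h : IsIntegral (redSubscheme Z) ∧ IsLocallyNoetherian (redSubscheme Z) then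
    haveI := h.1
    haveI := h.2
    ∑ᶠ z : redSubscheme Z, Scheme.ord (E.ratSection (redι Z) z) z
  else 0

/-- The integral curves in `X` that are proper (equivalently, projective) over the base field. -/
structure ProperCurve {k : Type u} [Field k] {X : Scheme.{u}}
    (s : X ⟶ Spec (CommRingCat.of k)) where
  carrier : Closeds X
  isIntegral : IsIntegral (redSubscheme carrier)
  isProper : IsProper (redι carrier ≫ s)
  dim_eq_one : topologicalKrullDim (redSubscheme carrier) = 1

/-- The intersection pairing of a Cartier divisor with `1`-cycles. -/
def CartierDivisor.pairing {k : Type u} [Field k] {X : Scheme.{u}} [IsIntegral X]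
    (s : X ⟶ Spec (CommRingCat.of k)) (E : CartierDivisor X) : (ProperCurve s →₀ ℤ) →+ ℤ :=
  Finsupp.liftAddHom fun C => AddMonoidHom.mulRight (E.inter C.carrier)

/-- The `1`-cycles that are numerically equivalent to zero. -/
def numTrivial {k : Type u} [Field k] {X : Scheme.{u}} [IsIntegral X]
    (s : X ⟶ Spec (CommRingCat.of k)) : AddSubgroup (ProperCurve s →₀ ℤ) :=
  ⨅ E : CartierDivisor X, (E.pairing s).ker

/-- `N_1(X)`: `1`-cycles modulo numerical equivalence. -/
abbrev N1 {k : Type u} [Field k] {X : Scheme.{u}} [IsIntegral X]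
    (s : X ⟶ Spec (CommRingCat.of k)) : Type u :=
  (ProperCurve s →₀ ℤ) ⧸ numTrivial s

open Classical in
/-- The class in `N_1(X)` of a closed subset that is an integral proper curve. -/
def curveClass {k : Type u} [Field k] {X : Scheme.{u}} [IsIntegral X]
    (s : X ⟶ Spec (CommRingCat.of k)) (Z : Closeds X) : N1 s :=
  if h : ∃ C : ProperCurve s, C.carrier = Z then
    QuotientAddGroup.mk (Finsupp.single h.choose 1)
  else 0

/-! ### Simple normal crossings divisors -/

/-- A simple normal crossings divisor `D = ∑ D_i` (`i ∈ ι`) on an integral regular scheme.  Every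
`D_i` is an effective Cartier divisor with local equation `loc i x` in the local ring at `x`, its
support is irreducible, and at every point `x` the local equations of the `D_i` through
`x` are part of a regular system of parameters (their classes in the cotangent space are linearly
independent; in particular every `D_i` is reduced and the `D_i` are distinct). -/
structure SNCDivisor (X : Scheme.{u}) [IsIntegral X] (ι : Type) where
  comp : ι → CartierDivisor X
  loc : ∀ (_ : ι) (x : X), X.presheaf.stalk x
  comp_eqn : ∀ i x,
    (comp i).eqn x = algebraMap (X.presheaf.stalk x) X.functionField (loc i x)
  irreducible : ∀ i, IsIrreducible {x : X | loc i x ∈ IsLocalRing.maximalIdeal (X.presheaf.stalk x)}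
  snc : ∀ x : X, LinearIndependent (IsLocalRing.ResidueField (X.presheaf.stalk x))
    (fun i : {i : ι // loc i x ∈ IsLocalRing.maximalIdeal (X.presheaf.stalk x)} =>
      ((IsLocalRing.maximalIdeal (X.presheaf.stalk x)).toCotangent ⟨loc i x, i.2⟩ :
        IsLocalRing.CotangentSpace (X.presheaf.stalk x)))

namespace SNCDivisor

variable {X : Scheme.{u}} [IsIntegral X] {ι : Type} (D : SNCDivisor X ι)

/-- The support of the component `D_i`. -/
def supp (i : ι) : Set X :=
  {x : X | D.loc i x ∈ IsLocalRing.maximalIdeal (X.presheaf.stalk x)}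

theorem isClosed_supp (i : ι) : IsClosed (D.supp i) := by
  rw [← isOpen_compl_iff, isOpen_iff_forall_mem_open]
  intro x hx
  have hu : IsUnit (D.loc i x) := by
    by_contra h
    exact hx ((IsLocalRing.mem_maximalIdeal _).2 h)
  obtain ⟨U, hxU, hU⟩ := (D.comp i).locally_eq x
  obtain ⟨V, hxV, f, hf⟩ := X.presheaf.exists_germ_eq (D.loc i x)
  have hxB : x ∈ X.basicOpen f := by
    rw [Scheme.mem_basicOpen X f x hxV, hf]
    exact hu
  refine ⟨(U ⊓ X.basicOpen f : X.Opens), ?_, (U ⊓ X.basicOpen f).isOpen, ⟨hxU, hxB⟩⟩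
  rintro y ⟨hyU, hyB⟩ hy
  have hyV : y ∈ V := X.basicOpen_le f hyB
  obtain ⟨a, ha⟩ := hU y hyU
  have : Nonempty V := ⟨⟨x, hxV⟩⟩
  have hyu : IsUnit (X.presheaf.germ V y hyV f) := (Scheme.mem_basicOpen X f y hyV).1 hyB
  have key : D.loc i y = (a : X.presheaf.stalk y) * X.presheaf.germ V y hyV f := by
    apply IsFractionRing.injective (X.presheaf.stalk y) X.functionField
    rw [← D.comp_eqn, ha, D.comp_eqn, ← hf, map_mul,
      Scheme.algebraMap_germ_eq_germToFunctionField X hxV,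
      Scheme.algebraMap_germ_eq_germToFunctionField X hyV]
  exact (IsLocalRing.mem_maximalIdeal _).1 hy (key ▸ a.isUnit.mul hyu)

/-- The stratum `D_I = ⋂_{i ∈ I} D_i` (with `D_∅ = X`). -/
def stratum (I : Finset ι) : Closeds X :=
  ⟨⋂ i ∈ I, D.supp i, isClosed_biInter fun i _ => D.isClosed_supp i⟩

/-! ### The tropicalization

The space `Div_D(X)_ℝ^*` is `ι → ℝ`, in coordinates with respect to the dual basis `D_i^*`.  A cone
of `𝒫` is given by its index set `I`. -/

/-- `∑_{i ∈ I} ℝ_{≥ 0} D_i^*` belongs to `𝒫`. -/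
def IsCone (I : Finset ι) : Prop := (D.stratum I : Set X).Nonempty

/-- The cone `∑_{i ∈ I} ℝ_{≥ 0} D_i^*`. -/
def cone (I : Finset ι) : Set (ι → ℝ) := {v | (∀ i ∈ I, 0 ≤ v i) ∧ ∀ i ∉ I, v i = 0}

/-- The (relative) interior of the cone `∑_{i ∈ I} ℝ_{≥ 0} D_i^*`. -/
def coneInt (I : Finset ι) : Set (ι → ℝ) := {v | (∀ i ∈ I, 0 < v i) ∧ ∀ i ∉ I, v i = 0}

/-- The open star of a cone: the union of the interiors of the cones of `𝒫` containing it. -/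
def star (τ : Finset ι) : Set (ι → ℝ) := ⋃ ρ ∈ {ρ | D.IsCone ρ ∧ τ ⊆ ρ}, coneInt ρ

/-- The maximal (i.e. `n`-dimensional) cones of `𝒫` containing a given one. -/
def maxCones (n : ℕ) (ρ : Finset ι) : Set (Finset ι) :=
  {σ | D.IsCone σ ∧ σ.card = n ∧ ρ ⊆ σ}

/-- `ρ ∈ 𝒫` has codimension one and is contained in exactly one maximal cone `σ`. -/
def IsBoundaryWall (n : ℕ) (ρ σ : Finset ι) : Prop :=
  D.IsCone ρ ∧ ρ.card + 1 = n ∧ D.maxCones n ρ = {σ}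

/-- `ρ ∈ 𝒫` has codimension one and is contained in exactly two maximal cones, `σ` and `σ'`. -/
def IsInteriorWall (n : ℕ) (ρ σ σ' : Finset ι) : Prop :=
  D.IsCone ρ ∧ ρ.card + 1 = n ∧ σ ≠ σ' ∧ D.maxCones n ρ = {σ, σ'}

/-- The boundary `∂B`. -/
def boundary (n : ℕ) : Set (ι → ℝ) :=
  ⋃ ρ ∈ {ρ | ∃ σ, D.IsBoundaryWall n ρ σ}, cone ρ

/-! ### The integral affine structure off the codimension two cones -/

/-- The map `∑ v_i D_i^* ↦ ∑ v_i w_i`, linear on every cone of `𝒫`. -/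
def plMap [Fintype ι] {n : ℕ} (w : ι → Fin n → ℤ) (v : ι → ℝ) : Fin n → ℝ :=
  fun l => ∑ i, v i * (w i l : ℝ)

/-- The vectors `w_i` (`i ∈ σ`) form a basis of the lattice `ℤⁿ`. -/
def IsLatticeBasis {n : ℕ} (w : ι → Fin n → ℤ) (σ : Finset ι) : Prop :=
  LinearIndependent ℤ (fun i : σ => w i) ∧ Submodule.span ℤ (w '' (σ : Set ι)) = ⊤

/-- The map `ψ_ρ = plMap w` on `σ ∪ σ'` maps both `σ` and `σ'` to standard cones and satisfies
`ψ_ρ(m_n) + ψ_ρ(m_n') = - ∑_{j} (D_{τ_j} · D_ρ) ψ_ρ(m_j)`. -/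
def IsWallChart {n : ℕ} (ρ σ σ' : Finset ι) (w : ι → Fin n → ℤ) : Prop :=
  IsLatticeBasis w σ ∧ IsLatticeBasis w σ' ∧
    ∀ a ∈ σ, a ∉ ρ → ∀ b ∈ σ', b ∉ ρ →
      w a + w b = - ∑ j ∈ ρ, (D.comp j).inter (D.stratum ρ) • w j

/-- The charts defining the integral affine structure on `B ∖ Δ`, where `Δ` is the union of the
cones of codimension at least two: `IsChartOf n U w` says that `plMap w` is a chart on `U`. -/
inductive IsChartOf (n : ℕ) : Set (ι → ℝ) → (ι → Fin n → ℤ) → Prop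
  | maximal (σ : Finset ι) (w : ι → Fin n → ℤ) (hσ : D.IsCone σ) (hn : σ.card = n)
      (hw : IsLatticeBasis w σ) : IsChartOf n (coneInt σ) w
  | boundaryWall (ρ σ : Finset ι) (w : ι → Fin n → ℤ) (h : D.IsBoundaryWall n ρ σ)
      (hw : IsLatticeBasis w σ) : IsChartOf n (D.star ρ) w
  | interiorWall (ρ σ σ' : Finset ι) (w : ι → Fin n → ℤ) (h : D.IsInteriorWall n ρ σ σ')
      (hw : D.IsWallChart ρ σ σ' w) : IsChartOf n (D.star ρ) w

end SNCDivisor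

/-! ### Integral affine manifolds -/

/-- The maps `ψ` on `U` and `ψ'` on `U'` differ locally on `U ∩ U'` by an element of
`Aff(ℤⁿ) = ℤⁿ ⋊ GL_n(ℤ)`. -/
def AffCompatible {S : Type*} [TopologicalSpace S] {n : ℕ}
    (c c' : Set S × (S → Fin n → ℝ)) : Prop :=
  ∀ x ∈ c.1 ∩ c'.1, ∃ N ∈ 𝓝 x, ∃ (A : GL (Fin n) ℤ) (b : Fin n → ℤ), ∀ y ∈ N ∩ (c.1 ∩ c'.1),
    c'.2 y = ((A : Matrix (Fin n) (Fin n) ℤ).map (Int.cast : ℤ → ℝ)).mulVec (c.2 y) +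
      fun l => (b l : ℝ)

/-- An integral affine structure (an atlas) on a space `S` of dimension `n` with boundary `bd`.  A
chart is a homeomorphism of an open set onto an open subset of `ℝⁿ` (and then the set does not
meet `bd`) or onto a relatively open subset of a rational closed half-space (and then the points
of `bd` are those mapping to the boundary hyperplane). -/
structure IntegralAffineStructure (S : Type*) [TopologicalSpace S] (n : ℕ) (bd : Set S) where
  charts : Set (Set S × (S → Fin n → ℝ))
  isOpen : ∀ c ∈ charts, IsOpen c.1
  isEmbedding : ∀ c ∈ charts, IsEmbedding (c.1.domRestrict c.2)
  image : ∀ c ∈ charts,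
    (Disjoint c.1 bd ∧ IsOpen (c.2 '' c.1)) ∨
    ∃ (l : Fin n → ℤ) (t : ℝ), l ≠ 0 ∧
      (∃ O : Set (Fin n → ℝ), IsOpen O ∧ c.2 '' c.1 = O ∩ {y | t ≤ ∑ j, (l j : ℝ) * y j}) ∧
      ∀ x ∈ c.1, x ∈ bd ↔ ∑ j, (l j : ℝ) * c.2 x j = t
  cover : ∀ x, ∃ c ∈ charts, x ∈ c.1
  compatible : ∀ c ∈ charts, ∀ c' ∈ charts, AffCompatible c c'

/-- A map to `ℝᵈ` which in every chart is locally an integral affine map with surjective linear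
part. -/
def IntegralAffineStructure.IsAffineSubmersion {S : Type*} [TopologicalSpace S] {n d : ℕ}
    {bd : Set S} (𝒜 : IntegralAffineStructure S n bd) (f : S → Fin d → ℝ) : Prop :=
  ∀ c ∈ 𝒜.charts, ∀ x ∈ c.1, ∃ N ∈ 𝓝 x, ∃ (L : Matrix (Fin d) (Fin n) ℤ) (b : Fin d → ℤ),
    Function.Surjective L.mulVec ∧
    ∀ y ∈ N ∩ c.1, f y = (L.map (Int.cast : ℤ → ℝ)).mulVec (c.2 y) + fun l => (b l : ℝ)

/-- The integral affine structure `𝒜` on `Star(τ)` extends the one on `Star(τ) ∖ Δ`. -/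
def SNCDivisor.Extends {X : Scheme.{u}} [IsIntegral X] {ι : Type} [Fintype ι]
    (D : SNCDivisor X ι) {n : ℕ} (τ : Finset ι) {bd : Set (D.star τ)}
    (𝒜 : IntegralAffineStructure (D.star τ) n bd) : Prop :=
  ∀ (U : Set (ι → ℝ)) (w : ι → Fin n → ℤ), D.IsChartOf n U w →
    ∀ c ∈ 𝒜.charts, AffCompatible (Subtype.val ⁻¹' U, fun x => SNCDivisor.plMap w x.1) c

/-! ### Toric varieties -/

/-- `τ` is a face of the cone `σ`. -/
def IsFaceOf {d : ℕ} (τ σ : PointedCone ℝ (Fin d → ℝ)) : Prop :=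
  ∃ m : Fin d → ℝ, (∀ x ∈ σ, 0 ≤ ∑ j, m j * x j) ∧ ∀ x, x ∈ τ ↔ x ∈ σ ∧ ∑ j, m j * x j = 0

/-- A fan in `ℝᵈ`: a finite collection of strongly convex rational polyhedral cones, closed under
taking faces, any two of which meet along a common face. -/
structure Fan (d : ℕ) where
  cones : Set (PointedCone ℝ (Fin d → ℝ))
  finite : cones.Finite
  rational : ∀ σ ∈ cones, ∃ S : Finset (Fin d → ℤ),
    σ = PointedCone.hull ℝ ((fun m : Fin d → ℤ => fun j => (m j : ℝ)) '' (S : Set (Fin d → ℤ)))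
  strongly_convex : ∀ σ ∈ cones, ∀ x ∈ σ, -x ∈ σ → x = 0
  face_mem : ∀ σ ∈ cones, ∀ τ, IsFaceOf τ σ → τ ∈ cones
  inf_face : ∀ σ ∈ cones, ∀ σ' ∈ cones, IsFaceOf (σ ⊓ σ') σ

theorem IsFaceOf.le {d : ℕ} {τ σ : PointedCone ℝ (Fin d → ℝ)} (h : IsFaceOf τ σ) : τ ≤ σ := by
  obtain ⟨m, -, hm⟩ := h
  exact fun x hx => ((hm x).1 hx).1

/-- The monoid `σ^∨ ∩ ℤᵈ`. -/
def dualMonoid {d : ℕ} (σ : PointedCone ℝ (Fin d → ℝ)) : AddSubmonoid (Fin d → ℤ) where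
  carrier := {m | ∀ x ∈ σ, 0 ≤ ∑ j, (m j : ℝ) * x j}
  zero_mem' := by simp
  add_mem' := by
    intro a b ha hb x hx
    have := add_nonneg (ha x hx) (hb x hx)
    simpa [add_mul, Finset.sum_add_distrib] using this

theorem dualMonoid_anti {d : ℕ} {τ σ : PointedCone ℝ (Fin d → ℝ)} (h : τ ≤ σ) :
    dualMonoid σ ≤ dualMonoid τ := fun _ hm x hx => hm x (h hx)

/-- The affine toric variety `U_σ = Spec k[σ^∨ ∩ ℤᵈ]`. -/
abbrev affineToric (k : Type u) [Field k] {d : ℕ} (σ : PointedCone ℝ (Fin d → ℝ)) : Scheme.{u} :=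
  Spec (CommRingCat.of (AddMonoidAlgebra k (dualMonoid σ)))

/-- The morphism `U_τ ⟶ U_σ` for `τ ≤ σ`. -/
def affineToricMap (k : Type u) [Field k] {d : ℕ} {τ σ : PointedCone ℝ (Fin d → ℝ)} (h : τ ≤ σ) :
    affineToric k τ ⟶ affineToric k σ :=
  Spec.map (CommRingCat.ofHom
    (AddMonoidAlgebra.mapDomainRingHom k (AddSubmonoid.inclusion (dualMonoid_anti h))))

/-- An identification of the `k`-scheme `Y` with the toric variety of the fan `F`, i.e. with the
scheme glued from the `U_σ`, `σ ∈ F`, along the open subschemes `U_{σ ∩ σ'}`. -/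
structure ToricStructure {k : Type u} [Field k] {Y : Scheme.{u}}
    (s : Y ⟶ Spec (CommRingCat.of k)) {d : ℕ} (F : Fan d) where
  chart : ∀ σ : F.cones, affineToric k σ.1 ⟶ Y
  isOpenImmersion : ∀ σ, IsOpenImmersion (chart σ)
  chart_over : ∀ σ, chart σ ≫ s =
    Spec.map (CommRingCat.ofHom (algebraMap k (AddMonoidAlgebra k (dualMonoid σ.1))))
  compatible : ∀ (τ σ : F.cones) (h : τ.1 ≤ σ.1), affineToricMap k h ≫ chart σ = chart τ
  inter : ∀ σ σ' : F.cones, Set.range (chart σ) ∩ Set.range (chart σ') =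
    Set.range (chart ⟨σ.1 ⊓ σ'.1, F.face_mem _ σ.2 _ (F.inf_face _ σ.2 _ σ'.2)⟩)
  cover : ∀ y : Y, ∃ σ, y ∈ Set.range (chart σ)

namespace ToricStructure

variable {k : Type u} [Field k] {Y : Scheme.{u}} {s : Y ⟶ Spec (CommRingCat.of k)} {d : ℕ}
  {F : Fan d} (T : ToricStructure s F)

/-- The torus orbit of a cone `σ`: the points of `U_σ` in no `U_τ`, `τ` a proper face of `σ`. -/
def orbit (σ : F.cones) : Set Y :=
  Set.range (T.chart σ) \ ⋃ τ ∈ {τ : F.cones | τ.1 < σ.1}, Set.range (T.chart τ)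

/-- The closed toric stratum of a cone: the closure of its orbit. -/
def closedStratum (σ : F.cones) : Set Y := closure (T.orbit σ)

end ToricStructure

/-- The stratum `D_τ`, with its reduced scheme structure, is identified by `T` with a toric variety
in such a way that the strata of `(X, D)` contained in `D_τ` and indexed by the cones containing
`τ` are precisely the closed toric strata. -/
def SNCDivisor.StratificationAgrees {k : Type u} [Field k] {X : Scheme.{u}} [IsIntegral X]
    {s : X ⟶ Spec (CommRingCat.of k)} {ι : Type} (D : SNCDivisor X ι) (τ : Finset ι) {d : ℕ}
    {F : Fan d} (T : ToricStructure (redι (D.stratum τ) ≫ s) F) : Prop :=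
  {Z : Set X | ∃ ρ, D.IsCone ρ ∧ τ ⊆ ρ ∧ Z = D.stratum ρ} =
    {Z : Set X | ∃ σ, Z = redι (D.stratum τ) '' T.closedStratum σ}

/-! ### The multivalued piecewise linear function -/

/-- The real-linear extension `ℝⁿ → ℝ ⊗ G` of an additive map `ℤⁿ → G`. -/
def extendScalars {G : Type*} [AddCommGroup G] {n : ℕ} (m : (Fin n → ℤ) →+ G)
    (y : Fin n → ℝ) : ℝ ⊗[ℤ] G :=
  ∑ l, y l ⊗ₜ[ℤ] m (Pi.single l 1)

/-- The function `φ` on `Star(τ)` is affine on the interiors of the maximal cones `σ` and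
`σ'`, with integral slopes `m` and `m'` in the chart `plMap w` along `ρ = σ ∩ σ'`, and
has kink `κ` along `ρ`: `m' - m = δ • κ` where `δ` is the quotient of the lattice by the
sublattice tangent to `ρ`, with its sign fixed by being positive on `σ'`. -/
def SNCDivisor.HasKink {X : Scheme.{u}} [IsIntegral X] {ι : Type} [Fintype ι]
    (D : SNCDivisor X ι) {n : ℕ} {τ : Finset ι} {G : Type*} [AddCommGroup G]
    (φ : D.star τ → ℝ ⊗[ℤ] G) (ρ σ σ' : Finset ι) (w : ι → Fin n → ℤ) (κ : G) : Prop :=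
  ∃ (m m' : (Fin n → ℤ) →+ G) (c c' : ℝ ⊗[ℤ] G),
    (∀ x : D.star τ, x.1 ∈ coneInt σ → φ x = extendScalars m (plMap w x.1) + c) ∧
    (∀ x : D.star τ, x.1 ∈ coneInt σ' → φ x = extendScalars m' (plMap w x.1) + c') ∧
    ∀ δ : (Fin n → ℤ) →+ ℤ, Function.Surjective δ → (∀ i ∈ ρ, δ (w i) = 0) →
      (∀ b ∈ σ', b ∉ ρ → 0 < δ (w b)) → ∀ z, m' z - m z = δ z • κ

/-- `φ` is continuous and linear on every cone: it is the restriction of a linear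
map on the intersection of `Star(τ)` with every (closed) cone. -/
def SNCDivisor.IsPiecewiseLinear {X : Scheme.{u}} [IsIntegral X] {ι : Type}
    (D : SNCDivisor X ι) {τ : Finset ι} {V : Type*} [AddCommGroup V] [Module ℝ V]
    (φ : D.star τ → V) : Prop :=
  ∀ ρ, D.IsCone ρ → τ ⊆ ρ → ∃ l : (ι → ℝ) →ₗ[ℝ] V, ∀ x : D.star τ, x.1 ∈ cone ρ → φ x = l x.1

/-- `φ` represents on `Star(τ)` the multivalued piecewise linear function whose kink along every
codimension one cone `ρ` not in the boundary is `κ ρ`. -/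
def SNCDivisor.IsSingleValuedRepresentative {X : Scheme.{u}} [IsIntegral X] {ι : Type} [Fintype ι]
    (D : SNCDivisor X ι) (n : ℕ) {τ : Finset ι} {G : Type*} [AddCommGroup G]
    (κ : Finset ι → G) (φ : D.star τ → ℝ ⊗[ℤ] G) : Prop :=
  D.IsPiecewiseLinear φ ∧
    ∀ ρ σ σ', τ ⊆ ρ → D.IsInteriorWall n ρ σ σ' → ∀ w : ι → Fin n → ℤ,
      D.IsWallChart ρ σ σ' w → D.HasKink φ ρ σ σ' w (κ ρ)

/-- The canonical choice of kinks: `κ_ρ = [D_ρ]` in `N_1(X)`. -/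
def SNCDivisor.canonicalKink {k : Type u} [Field k] {X : Scheme.{u}} [IsIntegral X]
    (s : X ⟶ Spec (CommRingCat.of k)) {ι : Type} (D : SNCDivisor X ι) (ρ : Finset ι) : N1 s :=
  curveClass s (D.stratum ρ)

/-- Either `X` is proper over `k`, or there is a proper morphism `p : X ⟶ 𝔸¹` over `k` with
`p⁻¹(0)` contained in `D`. -/
def SNCDivisor.AbsoluteOrRelative {k : Type u} [Field k] {X : Scheme.{u}} [IsIntegral X]
    (s : X ⟶ Spec (CommRingCat.of k)) {ι : Type} (D : SNCDivisor X ι) : Prop :=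
  IsProper s ∨
  ∃ p : X ⟶ Spec (CommRingCat.of (Polynomial k)),
    p ≫ Spec.map (CommRingCat.ofHom Polynomial.C) = s ∧ IsProper p ∧
    ∀ x : X, (Polynomial.X : Polynomial k) ∈ (p x).asIdeal → ∃ i, x ∈ D.supp i

end LogPair

end

/-!
The strata through `D_τ` are controlled by the fan of the toric variety `D_τ`, once this fan is known
to be smooth, to have a half-space or the whole space as support, and to have its rays labelled by
the components of `D` that meet `D_τ` properly. The statement then becomes one about fans.

*Smoothness.* At a rational point of `X`, the cotangent space has dimension at most `n`
(`finrank_cotangentSpace_stalk_le`), and the local equations of the components of `D` are independent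
in it. At the fixed point of the chart of a full-dimensional cone, the indecomposable elements of the
dual monoid give independent tangent vectors of `D_τ`, so there are no more than `d` of them
(`linearIndependent_snd_of_cotangentSpace`), and the cone is generated by a lattice basis
(`ToricStructure.exists_isSmoothBasis`). Components not containing `D_τ` do not meet its torus; on a
smooth chart, whose ring is factorial, they are given by monomials, and the independence of their
derivatives at the fixed point forces these to be distinct elements of the dual basis
(`ToricStructure.exists_fixedPoint`). This labels the rays (`ToricStructure.exists_isChart`).

*Support.* A vector `v` defines a point of the torus with values in the field of Hahn series with
real exponents. By the valuative criterion, `v` is in the support if and only if the image of the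
point under a proper morphism extends to the valuation ring. In the absolute case it always does.
In the relative case, the coordinate of the affine line restricts to `0` or to a monomial on the
torus, since its zeros are contained in `D`; so the support is everything or a half-space
(`ToricStructure.exists_support_eq`). Gluing the charts gives `ToricStructure.exists_isAtlas`.

*Curves.* The stratum of a wall between two maximal cones is a projective line, and a proper curve in
`X`. A Cartier divisor on `X` restricts to a piecewise linear function on the fan, and its
intersection number with the curve is the bend of this function along the wall
(`inter_eq_of_unitEq`, `inter_comp`, `exists_inter_eq`, `exists_properCurve`). What is used from
here on is collected in `SNCDivisor.IsStarFan`.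

*The affine structure.* For `j ∈ τ` let `e_j` be the values on the rays of the piecewise linear
function given by the Cartier divisor `D_j`, and `u_i` the ray of the component `D_i`. Send
`D_i^*` to `(u_i, -(e_j(i))_j) ∈ ℤᵈ × ℤ^τ` if `i ∉ τ`, and `D_j^*` to the basis vector of `j` if
`j ∈ τ`. By the formulas for the intersection numbers these vectors satisfy the relation required of
the charts along every wall (`starVec_relation`), so one chart defines the affine structure on the
whole star (`affineStructure`, `affCompatible_chart`), and `υ` is the projection to `ℝᵈ`. The
inverse of the chart (`chartInv`) is found from the coordinates of a point of the support with
respect to the rays of a cone containing it. The boundary of the star lies over the boundary of the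
half-space, which is empty in the absolute case.

*The function.* The curve classes satisfy every linear relation that the bends of all integral
piecewise linear functions satisfy, because intersection numbers with Cartier divisors are such
bends. Since any two maximal cones are connected by crossing walls (`adjacent_induction`), slopes in
`N_1(X)` along the rays with the prescribed bends can be found (`exists_slopes`), and they define
the representative (`isSingleValuedRepresentative`).
-/

noncomputable section

namespace LogPair

/-! ### Cotangent spaces of smooth varieties -/

open IsLocalRing in
/-- The cotangent space at a rational point of a smooth algebra of relative dimension `n` has
dimension at most `n`. The retraction `c` of `R → O` makes the point rational, and
`a ↦ [a - c(a)]` is a derivation from `A` to the cotangent space; since its values span, so do the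
images of the `n` generators of the module of differentials. -/
theorem finrank_cotangentSpace_le {R A O : Type*} [CommRing R] [CommRing A] [CommRing O]
    [IsLocalRing O] [Algebra R A] [Algebra A O] [Algebra R O] [IsScalarTower R A O] (n : ℕ)
    [Algebra.IsStandardSmoothOfRelativeDimension n R A] (P : Ideal A) [P.IsPrime]
    [IsLocalization.AtPrime O P] (c : O →+* R) (hc : ∀ r, c (algebraMap R O r) = r)
    (hm : ∀ x, x ∈ maximalIdeal O ↔ c x = 0) :
    Module.Finite (ResidueField O) (CotangentSpace O) ∧
      Module.finrank (ResidueField O) (CotangentSpace O) ≤ n := by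
  have hsub : ∀ x : O, x - algebraMap R O (c x) ∈ maximalIdeal O := fun x => by
    rw [hm, map_sub, hc, sub_self]
  let ev : A →ₗ[R] CotangentSpace O :=
    { toFun := fun a => (maximalIdeal O).toCotangent ⟨_, hsub (algebraMap A O a)⟩
      map_add' := fun a b => by
        rw [← map_add]; congr 1; ext; simp; ring
      map_smul' := fun r a => by
        have h : ∀ z : maximalIdeal O, r • (maximalIdeal O).toCotangent z =
            (maximalIdeal O).toCotangent (algebraMap R O r • z) := fun z => by
          rw [map_smul, algebraMap_smul]
        rw [RingHom.id_apply, h]; congr 1; ext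
        simp only [Algebra.smul_def, map_mul, ← IsScalarTower.algebraMap_apply, hc,
          SetLike.mk_smul_mk]
        ring }
  have hev : ∀ a, ev a = (maximalIdeal O).toCotangent ⟨_, hsub (algebraMap A O a)⟩ := fun _ => rfl
  have hmul : ∀ x : O, ∀ hx : x ∈ maximalIdeal O, ∀ y : CotangentSpace O, x • y = 0 := by
    intro x hx y
    obtain ⟨y, rfl⟩ := (maximalIdeal O).toCotangent_surjective y
    rw [← map_smul, Ideal.toCotangent_eq_zero, pow_two]
    exact Ideal.mul_mem_mul hx y.2
  let D : Derivation R A (CotangentSpace O) := Derivation.mk' ev (by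
    intro a b
    have e1 : a • ev b = (maximalIdeal O).toCotangent
        (algebraMap A O a • ⟨_, hsub (algebraMap A O b)⟩) := by
      rw [map_smul, hev, algebraMap_smul]
    have e2 : b • ev a = (maximalIdeal O).toCotangent
        (algebraMap A O b • ⟨_, hsub (algebraMap A O a)⟩) := by
      rw [map_smul, hev, algebraMap_smul]
    rw [e1, e2, hev, ← map_add, Ideal.toCotangent_eq, pow_two]
    have := Ideal.mul_mem_mul (hsub (algebraMap A O a)) (hsub (algebraMap A O b))
    convert neg_mem this using 1
    simp only [Submodule.coe_add, SetLike.mk_smul_mk, smul_eq_mul, map_mul]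
    ring)
  have hD : ∀ a, D a = ev a := fun _ => rfl
  obtain ⟨ω, hω⟩ : ∃ ω : Fin n → Ω[A⁄R], Submodule.span A (Set.range ω) = ⊤ := by
    have : Nontrivial A := RingHom.domain_nontrivial (algebraMap A O)
    have : Algebra.IsStandardSmooth R A :=
      Algebra.IsStandardSmoothOfRelativeDimension.isStandardSmooth n
    have h := Algebra.IsStandardSmoothOfRelativeDimension.rank_kaehlerDifferential (R := R)
      (S := A) n
    have h' : Module.finrank A (Ω[A⁄R]) = n := Module.finrank_eq_of_rank_eq h
    have : Module.Free A Ω[A⁄R] := inferInstance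
    exact ⟨Module.finBasisOfFinrankEq A _ h', (Module.finBasisOfFinrankEq A _ h').span_eq⟩
  let S := Submodule.span (ResidueField O) (Set.range (D.liftKaehlerDifferential ∘ ω))
  -- every element of the maximal ideal of `O` is, up to a unit, in the image of `A`
  have hS : S = ⊤ := by
    have hA : ∀ w : Ω[A⁄R], D.liftKaehlerDifferential w ∈ S := by
      intro w
      have hw : w ∈ Submodule.span A (Set.range ω) := hω ▸ Submodule.mem_top
      induction hw using Submodule.span_induction with
      | mem x hx => obtain ⟨i, rfl⟩ := hx; exact Submodule.subset_span ⟨i, rfl⟩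
      | zero => simp
      | add x y _ _ hx hy => rw [map_add]; exact S.add_mem hx hy
      | smul a x _ hx =>
        rw [map_smul]
        have : a • D.liftKaehlerDifferential x =
          residue O (algebraMap A O a) • D.liftKaehlerDifferential x := by
          conv_rhs => rw [← ResidueField.algebraMap_eq, algebraMap_smul, algebraMap_smul]
        rw [this]
        exact S.smul_mem _ hx
    rw [eq_top_iff]
    rintro y -
    obtain ⟨⟨y, hy⟩, rfl⟩ := (maximalIdeal O).toCotangent_surjective y
    obtain ⟨⟨b, t⟩, hb⟩ := IsLocalization.surj P.primeCompl y
    have hbm : algebraMap A O b ∈ maximalIdeal O := by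
      rw [← hb]; exact Ideal.mul_mem_right _ _ hy
    have h1 := hA (KaehlerDifferential.D R A b)
    rw [Derivation.liftKaehlerDifferential_comp_D, hD, hev] at h1
    have ht : IsUnit (algebraMap A O t) := IsLocalization.map_units O t
    have ht' : residue O (algebraMap A O t) ≠ 0 := by
      rw [residue_ne_zero_iff_isUnit]; exact ht
    rw [← inv_smul_smul₀ ht' ((maximalIdeal O).toCotangent ⟨y, hy⟩)]
    refine S.smul_mem _ ?_
    convert h1 using 1
    rw [← ResidueField.algebraMap_eq, algebraMap_smul, ← map_smul]
    congr 1
    ext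
    simp only [SetLike.mk_smul_mk, smul_eq_mul]
    rw [(hm _).1 hbm, map_zero, sub_zero, ← hb, mul_comm]
  constructor
  · exact ⟨⟨(Set.finite_range _).toFinset, by simpa using hS⟩⟩
  · simpa using finrank_le_of_span_eq_top hS

open IsLocalRing in
/-- The bound on the cotangent space at the image `x` of the closed point of a local `k`-algebra `L`
with residue field `k`, which makes `x` rational. -/
theorem finrank_cotangentSpace_stalk_le {k : Type u} [Field k] {X : Scheme.{u}}
    (s : X ⟶ Spec (CommRingCat.of k)) (n : ℕ) [SmoothOfRelativeDimension n s]
    {L : Type u} [CommRing L] [IsLocalRing L] [Algebra k L] (ε : L →ₐ[k] k)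
    (t : Spec (CommRingCat.of L) ⟶ X)
    (ht : t ≫ s = Spec.map (CommRingCat.ofHom (algebraMap k L))) :
    Module.Finite (ResidueField (X.presheaf.stalk (t (closedPoint L))))
      (CotangentSpace (X.presheaf.stalk (t (closedPoint L)))) ∧
    Module.finrank (ResidueField (X.presheaf.stalk (t (closedPoint L))))
      (CotangentSpace (X.presheaf.stalk (t (closedPoint L)))) ≤ n := by
  obtain ⟨V, hV, U, hU, hx, e, hs⟩ :=
    SmoothOfRelativeDimension.exists_isStandardSmoothOfRelativeDimension (n := n) (f := s)
      (t (closedPoint L))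
  obtain rfl : V = ⊤ := by
    ext z
    simp only [Opens.coe_top, Set.mem_univ, iff_true]
    have : s (t (closedPoint L)) ∈ V := e hx
    have h2 : Subsingleton (Spec (CommRingCat.of k)) := inferInstanceAs (Subsingleton (PrimeSpectrum k))
    rwa [Subsingleton.elim z (s (t (closedPoint L)))]
  set x := t (closedPoint L) with hxdef
  let A := Γ(X, U)
  let R := Γ(Spec (CommRingCat.of k), ⊤)
  let O := X.presheaf.stalk x
  let _ : Algebra R A := (s.appLE ⊤ U e).hom.toAlgebra
  let _ : Algebra A O := (X.presheaf.germ U x hx).hom.toAlgebra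
  let _ : Algebra R O := ((X.presheaf.germ U x hx).hom.comp (s.appLE ⊤ U e).hom).toAlgebra
  have : IsScalarTower R A O := IsScalarTower.of_algebraMap_eq' rfl
  have : Algebra.IsStandardSmoothOfRelativeDimension n R A := hs
  have : IsLocalization.AtPrime O (hU.primeIdealOf ⟨x, hx⟩).asIdeal :=
    hU.isLocalization_stalk ⟨x, hx⟩
  let ψ : O →+* L := (Scheme.stalkClosedPointTo t).hom
  let i : R →+* k := (Scheme.ΓSpecIso (CommRingCat.of k)).hom.hom
  let j : k →+* R := (Scheme.ΓSpecIso (CommRingCat.of k)).inv.hom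
  have hij : ∀ r, i (j r) = r := fun r => by
    change ((Scheme.ΓSpecIso (CommRingCat.of k)).inv ≫
      (Scheme.ΓSpecIso (CommRingCat.of k)).hom).hom r = r
    rw [Iso.inv_hom_id]; rfl
  have hji : ∀ r, j (i r) = r := fun r => by
    change ((Scheme.ΓSpecIso (CommRingCat.of k)).hom ≫
      (Scheme.ΓSpecIso (CommRingCat.of k)).inv).hom r = r
    rw [Iso.hom_inv_id]; rfl
  have hψ : ∀ r : R, ψ (algebraMap R O r) = algebraMap k L (i r) := by
    intro r
    have h1 : s.appLE ⊤ U e ≫ X.presheaf.germ U x hx ≫ Scheme.stalkClosedPointTo t =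
        (Scheme.ΓSpecIso (CommRingCat.of k)).hom ≫ CommRingCat.ofHom (algebraMap k L) := by
      have h2 : ∀ (f : Spec (CommRingCat.of L) ⟶ Spec (CommRingCat.of k)),
          f = Spec.map (CommRingCat.ofHom (algebraMap k L)) →
          (Spec (CommRingCat.of k)).presheaf.germ ⊤ _ trivial ≫ Scheme.stalkClosedPointTo f =
            (Scheme.ΓSpecIso (CommRingCat.of k)).hom ≫ CommRingCat.ofHom (algebraMap k L) := by
        rintro f rfl
        exact Scheme.germ_stalkClosedPointTo_Spec _
      have h3 : s.appLE ⊤ U e ≫ X.presheaf.germ U x hx =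
          (Spec (CommRingCat.of k)).presheaf.germ ⊤ (s x) trivial ≫ s.stalkMap x := by
        refine Eq.trans ?_ (s.germ_stalkMap ⊤ x trivial).symm
        rw [Scheme.Hom.appLE, Category.assoc, TopCat.Presheaf.germ_res]
      calc _ = (s.appLE ⊤ U e ≫ X.presheaf.germ U x hx) ≫ Scheme.stalkClosedPointTo t :=
            (Category.assoc _ _ _).symm
        _ = ((Spec (CommRingCat.of k)).presheaf.germ ⊤ (s x) trivial ≫ s.stalkMap x) ≫
            Scheme.stalkClosedPointTo t := congrArg (· ≫ Scheme.stalkClosedPointTo t) h3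
        _ = _ := Category.assoc _ _ _
        _ = (Spec (CommRingCat.of k)).presheaf.germ ⊤ ((t ≫ s) (closedPoint L)) trivial ≫
            Scheme.stalkClosedPointTo (t ≫ s) :=
          congrArg _ (Scheme.stalkClosedPointTo_comp t s).symm
        _ = _ := h2 _ ht
    exact congr($(h1).hom r)
  refine finrank_cotangentSpace_le (R := R) (A := A) (O := O) n
    (hU.primeIdealOf ⟨x, hx⟩).asIdeal (j.comp ((ε : L →+* k).comp ψ)) ?_ ?_
  · intro r
    change j (ε (ψ _)) = _
    rw [hψ, AlgHom.commutes]
    exact hji r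
  · intro y
    have h3 : j (ε (ψ y)) = 0 ↔ ε (ψ y) = 0 :=
      map_eq_zero_iff j (Function.HasLeftInverse.injective ⟨i, hij⟩)
    refine Iff.trans ?_ h3.symm
    rw [mem_maximalIdeal, mem_nonunits_iff, not_iff_comm, ← ne_eq, ← isUnit_iff_ne_zero]
    have : IsLocalHom ψ := inferInstanceAs (IsLocalHom (Scheme.stalkClosedPointTo t).hom)
    have h4 : IsLocalHom (ε : L →+* k) := by
      refine (inferInstance : IsLocalHom (IsLocalRing.residue L)) |> fun _ => ?_
      constructor
      intro a ha
      by_contra hna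
      have h5 : RingHom.ker (ε : L →+* k) = maximalIdeal L :=
        eq_maximalIdeal (RingHom.ker_isMaximal_of_surjective _
          (fun r => ⟨algebraMap k L r, ε.commutes r⟩))
      have h6 : a ∈ RingHom.ker (ε : L →+* k) := h5 ▸ (mem_maximalIdeal a).2 hna
      rw [RingHom.mem_ker] at h6
      rw [h6] at ha
      exact not_isUnit_zero ha
    exact ⟨fun h => (isUnit_of_map_unit ψ y (isUnit_of_map_unit (ε : L →+* k) _ h)),
      fun h => (h.map ψ).map (ε : L →+* k)⟩

/-- The trivial square-zero extension of a field is a local ring. -/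
instance isLocalRing_trivSqZeroExt {k V : Type*} [Field k] [AddCommGroup V] [Module k V]
    [Module kᵐᵒᵖ V] [IsCentralScalar k V] : IsLocalRing (TrivSqZeroExt k V) :=
  have : IsLocalHom (TrivSqZeroExt.fstHom k k V) :=
    ⟨fun _ ha => TrivSqZeroExt.isUnit_iff_isUnit_fst.2 ha⟩
  RingHom.domain_isLocalRing (TrivSqZeroExt.fstHom k k V : TrivSqZeroExt k V →+* k)

open IsLocalRing in
/-- Let `f` be elements of a local ring with independent classes in a cotangent space of dimension at
most `n`, and let `ψ` be a tuple of `r` independent tangent vectors along which the `f i`, `i ∈ τ`,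
vanish. Then `r + |τ| ≤ n`; in the case of equality the tangent space of the common zeros of the
`f i`, `i ∈ τ`, is spanned by the tangent vectors, so the derivatives of the other elements along
them are independent. -/
theorem linearIndependent_snd_of_cotangentSpace {k A I : Type*} [Field k] [CommRing A]
    [IsLocalRing A]
    {n r : ℕ} [Module.Finite (ResidueField A) (CotangentSpace A)]
    (hn : Module.finrank (ResidueField A) (CotangentSpace A) ≤ n)
    (ψ : A →+* TrivSqZeroExt k (Fin r → k)) (hψ : IsLocalHom ψ)
    (hsurj : Function.Surjective ψ) [Fintype I] (f : I → maximalIdeal A)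
    (hf : LinearIndependent (ResidueField A)
      (fun i => ((maximalIdeal A).toCotangent (f i) : CotangentSpace A)))
    (τ : Finset I) (hτ : ∀ i ∈ τ, ψ (f i) = 0) :
    r + τ.card ≤ n ∧
      (r + τ.card = n → LinearIndependent k fun i : {i // i ∉ τ} => (ψ (f i)).snd) := by
  classical
  have hfst : ∀ a : A, a ∈ maximalIdeal A ↔ (ψ a).fst = 0 := fun a => by
    rw [mem_maximalIdeal, mem_nonunits_iff, ← isUnit_map_iff ψ,
      TrivSqZeroExt.isUnit_iff_isUnit_fst, isUnit_iff_ne_zero, not_not]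
  have hsq : ∀ x : maximalIdeal A, (maximalIdeal A).toCotangent x = 0 → (ψ x).snd = 0 := by
    intro x hx
    rw [Ideal.toCotangent_eq_zero, pow_two] at hx
    obtain ⟨x, hx'⟩ := x
    dsimp only at hx ⊢
    clear hx'
    induction hx using Submodule.mul_induction_on' with
    | mem_mul_mem a ha b hb =>
      rw [map_mul, TrivSqZeroExt.snd_mul, (hfst a).1 ha, (hfst b).1 hb]; simp
    | add a _ b _ ha hb => rw [map_add, TrivSqZeroExt.snd_add, ha, hb, add_zero]
  have hmul : ∀ a : A, ∀ x : maximalIdeal A, (ψ (a * x)).snd = (ψ a).fst • (ψ x).snd := by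
    intro a x
    rw [map_mul, TrivSqZeroExt.snd_mul, (hfst x).1 x.2]; simp
  choose g0 hg0 using fun j : Fin r => hsurj (TrivSqZeroExt.inr (Pi.single j 1))
  let g : Fin r → maximalIdeal A := fun j => ⟨g0 j, by rw [hfst, hg0]; simp⟩
  have hg : ∀ j, (ψ (g j)).snd = Pi.single j 1 := fun j => by simp [g, hg0]
  have hres : ∀ a : A, residue A a = 0 ↔ (ψ a).fst = 0 := fun a => by
    rw [residue_eq_zero_iff, hfst]
  have hsmul : ∀ (a : A) (x : CotangentSpace A), residue A a • x = a • x := fun a x => by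
    rw [← ResidueField.algebraMap_eq, algebraMap_smul]
  -- the classes of the `f i`, `i ∈ τ`, with a dual family of the tangent vectors
  let F : τ ⊕ Fin r → CotangentSpace A :=
    Sum.elim (fun i => (maximalIdeal A).toCotangent (f i)) fun j => (maximalIdeal A).toCotangent (g j)
  -- a cotangent vector killed by the tangent vectors has no components along the dual family
  have key : ∀ (x : maximalIdeal A) (c : τ ⊕ Fin r → ResidueField A), (ψ x).snd = 0 →
      (maximalIdeal A).toCotangent x = ∑ i, c i • F i → ∀ j, c (Sum.inr j) = 0 := by
    intro x c hx h j
    choose b hb using fun i => residue_surjective (c i)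
    have h1 : (maximalIdeal A).toCotangent (x - (∑ i, b (Sum.inl i) • f i + ∑ j, b (Sum.inr j) • g j))
        = 0 := by
      rw [map_sub, h, map_add, map_sum, map_sum, Fintype.sum_sum_type, sub_eq_zero]
      simp only [← hb, hsmul, map_smul, F, Sum.elim_inl, Sum.elim_inr]
    have h2 := hsq _ h1
    simp only [Submodule.coe_sub, Submodule.coe_add, Submodule.coe_sum, Submodule.coe_smul,
      smul_eq_mul, map_sub, map_add, map_sum, TrivSqZeroExt.snd_sub, TrivSqZeroExt.snd_add,
      TrivSqZeroExt.snd_sum, hmul, hg, hx] at h2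
    have h3 : ∑ i : τ, (ψ (b (Sum.inl i))).fst • (ψ (f i)).snd = 0 :=
      Finset.sum_eq_zero fun i _ => by rw [hτ i i.2]; simp
    rw [h3, zero_add, zero_sub, neg_eq_zero] at h2
    have h4 := congrFun h2 j
    simp only [Finset.sum_apply, Pi.smul_apply, smul_eq_mul, Pi.zero_apply] at h4
    rw [Finset.sum_eq_single j] at h4
    · rw [← hb, hres]; simpa using h4
    · intro i _ hi; rw [Pi.single_apply, if_neg (Ne.symm hi), mul_zero]
    · simp
  have hF : LinearIndependent (ResidueField A) F := by
    rw [Fintype.linearIndependent_iff]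
    intro c hc
    have h1 := key 0 c (by simp) (by rw [hc, map_zero])
    have h2 := hf.comp (fun i : τ => (i : I)) Subtype.val_injective
    rw [Fintype.linearIndependent_iff] at h2
    have h3 := h2 (fun i => c (Sum.inl i)) (by
      rw [← hc, Fintype.sum_sum_type]
      simp [h1, F])
    rintro (i | j)
    exacts [h3 i, h1 j]
  have hcard := hF.fintype_card_le_finrank
  rw [Fintype.card_sum, Fintype.card_coe, Fintype.card_fin, add_comm] at hcard
  refine ⟨hcard.trans hn, fun heq => ?_⟩
  have hspan : Submodule.span (ResidueField A) (Set.range F) = ⊤ :=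
    hF.span_eq_top_of_card_eq_finrank' (by
      rw [Fintype.card_sum, Fintype.card_coe, Fintype.card_fin, add_comm]; omega)
  rw [Fintype.linearIndependent_iff]
  intro c hc
  -- in the case of equality `F` is a basis; a relation between the derivatives lifts to a
  -- combination of the `f i`, `i ∉ τ`, which by `key` is a combination of the `f i`, `i ∈ τ`
  choose b hb using fun i : {i // i ∉ τ} => hsurj (TrivSqZeroExt.inl (c i))
  let y : maximalIdeal A := ∑ i, b i • f i
  have hy : (ψ y).snd = 0 := by
    simp only [y, Submodule.coe_sum, Submodule.coe_smul, smul_eq_mul, map_sum,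
      TrivSqZeroExt.snd_sum, hmul, hb, TrivSqZeroExt.fst_inl]
    exact hc
  obtain ⟨e, he⟩ := (Submodule.mem_span_range_iff_exists_fun (ResidueField A)).1
    (hspan ▸ Submodule.mem_top : (maximalIdeal A).toCotangent y ∈
      Submodule.span (ResidueField A) (Set.range F))
  have h1 := key y e hy he.symm
  rw [Fintype.linearIndependent_iff] at hf
  have h2 := hf (fun i => if h : i ∈ τ then - e (Sum.inl ⟨i, h⟩) else residue A (b ⟨i, h⟩)) (by
    rw [Fintype.sum_sum_type] at he
    simp only [h1, zero_smul, Finset.sum_const_zero, add_zero, F, Sum.elim_inl, y, map_sum,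
      map_smul] at he
    rw [← Fintype.sum_subtype_add_sum_subtype (fun i => i ∈ τ)]
    have e1 : ∀ i : {i // i ∈ τ}, (if h : (i : I) ∈ τ then - e (Sum.inl ⟨i, h⟩)
      else residue A (b ⟨i, h⟩)) = - e (Sum.inl i) := fun i => dif_pos i.2
    have e2 : ∀ i : {i // i ∉ τ}, (if h : (i : I) ∈ τ then - e (Sum.inl ⟨i, h⟩)
      else residue A (b ⟨i, h⟩)) = residue A (b i) := fun i => dif_neg i.2
    simp only [e1, e2, neg_smul, Finset.sum_neg_distrib, hsmul]
    rw [← he, neg_add_eq_zero]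
    convert rfl)
  intro i
  have h3 := h2 i
  rw [dif_neg i.2, hres, hb, TrivSqZeroExt.fst_inl] at h3
  exact h3

/-! ### Rational cones -/

/-- The linear functional on `ℝᵈ` defined by an integral covector. -/
def dotR {d : ℕ} (m : Fin d → ℤ) : (Fin d → ℝ) →ₗ[ℝ] ℝ where
  toFun x := ∑ j, (m j : ℝ) * x j
  map_add' x y := by simp [mul_add, Finset.sum_add_distrib]
  map_smul' c x := by simp [Finset.mul_sum]; exact Finset.sum_congr rfl fun _ _ => by ring

theorem dotR_apply {d : ℕ} (m : Fin d → ℤ) (x : Fin d → ℝ) : dotR m x = ∑ j, (m j : ℝ) * x j := rfl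

/-- The inclusion `ℤᵈ → ℝᵈ`. -/
def castR {d : ℕ} : (Fin d → ℤ) →+ (Fin d → ℝ) where
  toFun v j := v j
  map_zero' := by ext; simp
  map_add' x y := by ext; simp

@[simp] theorem castR_apply {d : ℕ} (v : Fin d → ℤ) (j : Fin d) : castR v j = v j := rfl

theorem castR_injective {d : ℕ} : Function.Injective (castR (d := d)) := fun x y h => by
  ext j; simpa using congrFun h j

theorem dotR_castR {d : ℕ} (m v : Fin d → ℤ) : dotR m (castR v) = ((m ⬝ᵥ v : ℤ) : ℝ) := by
  simp [dotR_apply, dotProduct]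

theorem dotR_add {d : ℕ} (m m' : Fin d → ℤ) : dotR (m + m') = dotR m + dotR m' := by
  ext; simp [dotR_apply, add_mul, Finset.sum_add_distrib]

theorem dotR_zero {d : ℕ} : dotR (0 : Fin d → ℤ) = 0 := by ext; simp [dotR_apply]

theorem continuous_dotR {d : ℕ} (m : Fin d → ℤ) : Continuous (dotR m) :=
  LinearMap.continuous_of_finiteDimensional _

theorem mem_dualMonoid {d : ℕ} {σ : PointedCone ℝ (Fin d → ℝ)} {m : Fin d → ℤ} :
    m ∈ dualMonoid σ ↔ ∀ x ∈ σ, 0 ≤ dotR m x := Iff.rfl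

theorem eq_zero_of_dotR_eq_zero {d : ℕ} {m : Fin d → ℤ} (h : dotR m = 0) : m = 0 := by
  ext j
  have := LinearMap.congr_fun h (Pi.single j 1)
  simpa [dotR_apply, Pi.single_apply] using this

/-- If the origin is not in the convex hull of a finite set, then some integral functional is
positive on the set. -/
theorem exists_dotR_pos {d : ℕ} (P : Finset (Fin d → ℝ))
    (hP : (0 : Fin d → ℝ) ∉ convexHull ℝ (P : Set (Fin d → ℝ))) :
    ∃ m : Fin d → ℤ, ∀ p ∈ P, 0 < dotR m p := by
  have hc : IsCompact (convexHull ℝ (P : Set (Fin d → ℝ))) := P.finite_toSet.isCompact_convexHull ℝ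
  obtain ⟨f, a, b, hfa, hab, hfb⟩ := geometric_hahn_banach_compact_closed
    (convex_convexHull ℝ _) hc (convex_singleton (0 : Fin d → ℝ)) isClosed_singleton
    (Set.disjoint_singleton_right.2 hP)
  have hf : ∀ p ∈ P, 0 < ∑ j, (-f (Pi.single j 1)) * p j := by
    intro p hp
    have h1 := hfa p (subset_convexHull ℝ _ hp)
    have h2 := hfb 0 rfl
    rw [map_zero] at h2
    have h3 : f p = ∑ j, f (Pi.single j 1) * p j := by
      conv_lhs => rw [← Finset.univ_sum_single p, map_sum]
      refine Finset.sum_congr rfl fun j _ => ?_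
      have : (Pi.single j (p j) : Fin d → ℝ) = p j • Pi.single j 1 := by
        rw [← Pi.single_smul, smul_eq_mul, mul_one]
      rw [this, map_smul, smul_eq_mul, mul_comm]
    simp only [neg_mul, Finset.sum_neg_distrib, ← h3]
    linarith
  let U : Set (Fin d → ℝ) := {y | ∀ p ∈ P, 0 < ∑ j, y j * p j}
  have hU : IsOpen U := by
    have : U = ⋂ p ∈ P, {y | 0 < ∑ j, y j * p j} := by ext; simp [U]
    rw [this]
    exact isOpen_biInter_finset fun p _ => isOpen_lt continuous_const (by fun_prop)
  have hdense : DenseRange (fun (q : Fin d → ℚ) j => (q j : ℝ)) :=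
    DenseRange.piMap fun _ => Rat.denseRange_cast
  obtain ⟨q, hq⟩ := hdense.exists_mem_open hU ⟨_, hf⟩
  let N : ℕ := ∏ j, (q j).den
  have hN : 0 < N := Finset.prod_pos fun j _ => (q j).den_pos
  have hint : ∀ j, ∃ z : ℤ, (z : ℝ) = N * (q j : ℝ) := by
    intro j
    obtain ⟨c, hc⟩ : (q j).den ∣ N := Finset.dvd_prod_of_mem _ (Finset.mem_univ j)
    refine ⟨(q j).num * c, ?_⟩
    have h1 : (q j : ℝ) * (q j).den = (q j).num := by exact_mod_cast Rat.mul_den_eq_num (q j)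
    rw [hc]; push_cast; rw [← h1]; ring
  choose m hm using hint
  refine ⟨m, fun p hp => ?_⟩
  rw [dotR_apply]
  simp only [hm, mul_assoc, ← Finset.mul_sum]
  exact mul_pos (by exact_mod_cast hN) (hq p hp)

/-- `σ` is a strongly convex cone generated by the finite set `S` of lattice vectors. -/
structure IsStronglyConvexHull {d : ℕ} (σ : PointedCone ℝ (Fin d → ℝ)) (S : Finset (Fin d → ℤ)) :
    Prop where
  eq_hull : σ = PointedCone.hull ℝ (castR '' (S : Set (Fin d → ℤ)))
  eq_zero : ∀ x ∈ σ, -x ∈ σ → x = 0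

theorem Fan.exists_isStronglyConvexHull {d : ℕ} (F : Fan d) {σ} (hσ : σ ∈ F.cones) :
    ∃ S, IsStronglyConvexHull σ S := by
  obtain ⟨S, hS⟩ := F.rational σ hσ
  exact ⟨S, hS, F.strongly_convex σ hσ⟩

namespace IsStronglyConvexHull

variable {d : ℕ} {σ : PointedCone ℝ (Fin d → ℝ)} {S : Finset (Fin d → ℤ)}

theorem castR_mem (h : IsStronglyConvexHull σ S) {s} (hs : s ∈ S) : castR s ∈ σ := by
  rw [h.eq_hull]; exact Submodule.subset_span ⟨s, hs, rfl⟩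

theorem induction (h : IsStronglyConvexHull σ S) {p : (Fin d → ℝ) → Prop} (h0 : p 0)
    (hS : ∀ s ∈ S, p (castR s)) (hadd : ∀ x y, p x → p y → p (x + y))
    (hsmul : ∀ (c : ℝ) x, 0 ≤ c → p x → p (c • x)) : ∀ x ∈ σ, p x := by
  intro x hx
  rw [h.eq_hull] at hx
  induction hx using Submodule.span_induction with
  | mem x hx => obtain ⟨s, hs, rfl⟩ := hx; exact hS s hs
  | zero => exact h0
  | add x y _ _ hx hy => exact hadd x y hx hy
  | smul c x _ hx => exact hsmul c x c.2 hx

theorem mem_dualMonoid_of_forall (h : IsStronglyConvexHull σ S) {m : Fin d → ℤ}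
    (hm : ∀ s ∈ S, 0 ≤ dotR m (castR s)) : m ∈ dualMonoid σ := by
  refine mem_dualMonoid.2 (h.induction (by simp) hm (fun x y hx hy => ?_) fun c x hc hx => ?_)
  · rw [map_add]; exact add_nonneg hx hy
  · rw [map_smul]; exact mul_nonneg hc hx

theorem convex_diff_zero (h : IsStronglyConvexHull σ S) :
    Convex ℝ {x : Fin d → ℝ | x ∈ σ ∧ x ≠ 0} := by
  intro x hx y hy a b ha hb hab
  have hax : a • x ∈ σ := σ.smul_mem ha hx.1
  have hby : b • y ∈ σ := σ.smul_mem hb hy.1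
  refine ⟨σ.add_mem hax hby, fun h0 => ?_⟩
  have h1 : a • x = 0 := h.eq_zero _ hax (by rw [neg_eq_of_add_eq_zero_right h0]; exact hby)
  have h2 : b • y = 0 := by rwa [h1, zero_add] at h0
  rw [smul_eq_zero, or_iff_left hx.2] at h1
  rw [smul_eq_zero, or_iff_left hy.2] at h2
  rw [h1, h2] at hab
  norm_num at hab

/-- Some integral functional is positive on the nonzero generators, and negative at a given point
outside of the cone. -/
theorem exists_separating (h : IsStronglyConvexHull σ S) {x : Fin d → ℝ} (hx : x ∉ σ) :
    ∃ m : Fin d → ℤ, (∀ s ∈ S, s ≠ 0 → 0 < dotR m (castR s)) ∧ dotR m x < 0 := by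
  classical
  let P : Finset (Fin d → ℝ) := (S.filter (· ≠ 0)).image castR
  have hP : (P : Set (Fin d → ℝ)) ⊆ {x | x ∈ σ ∧ x ≠ 0} := by
    intro p hp
    obtain ⟨s, hs, rfl⟩ := Finset.mem_image.1 (Finset.mem_coe.1 hp)
    rw [Finset.mem_filter] at hs
    exact ⟨h.castR_mem hs.1, fun h0 => hs.2 (castR_injective (h0.trans (map_zero castR).symm))⟩
  have hP' := convexHull_min hP h.convex_diff_zero
  have hx0 : x ≠ 0 := fun h0 => hx (h0 ▸ σ.zero_mem)
  obtain ⟨m, hm⟩ := exists_dotR_pos (insert (-x) P) (by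
    rw [Finset.coe_insert]
    rcases (P : Set (Fin d → ℝ)).eq_empty_or_nonempty with h1 | h1
    · rw [h1]; simpa using hx0
    · rw [convexHull_insert h1]
      intro h0
      rw [convexJoin_singleton_left] at h0
      simp only [Set.mem_iUnion] at h0
      obtain ⟨y, hy, a, b, ha, hb, hab, h0⟩ := h0
      rcases ha.eq_or_lt with rfl | ha
      · simp only [zero_smul, zero_add] at h0 hab
        rw [hab, one_smul] at h0
        exact (hP' hy).2 h0
      · refine hx ?_
        have : x = (a⁻¹ * b) • y := by
          rw [smul_neg, neg_add_eq_zero] at h0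
          rw [mul_smul, ← h0, inv_smul_smul₀ ha.ne']
        rw [this]
        exact σ.smul_mem (by positivity) (hP' hy).1)
  refine ⟨m, fun s hs hs0 => hm _ ?_, ?_⟩
  · exact Finset.mem_insert_of_mem (Finset.mem_image_of_mem _ (Finset.mem_filter.2 ⟨hs, hs0⟩))
  · have := hm (-x) (Finset.mem_insert_self _ _)
    rw [map_neg] at this
    linarith

theorem exists_pos (h : IsStronglyConvexHull σ S) :
    ∃ m : Fin d → ℤ, ∀ s ∈ S, s ≠ 0 → 0 < dotR m (castR s) := by
  by_cases h1 : ∃ x, x ∉ σ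
  · obtain ⟨x, hx⟩ := h1
    obtain ⟨m, hm, -⟩ := h.exists_separating hx
    exact ⟨m, hm⟩
  · push Not at h1
    exact ⟨0, fun s _ hs0 => (hs0 (castR_injective
      ((h.eq_zero _ (h1 _) (h1 _)).trans (map_zero castR).symm))).elim⟩

/-- A rational strongly convex cone is determined by the lattice points of its dual. -/
theorem mem_iff (h : IsStronglyConvexHull σ S) {x : Fin d → ℝ} :
    x ∈ σ ↔ ∀ m ∈ dualMonoid σ, 0 ≤ dotR m x := by
  refine ⟨fun hx m hm => hm x hx, fun hx => ?_⟩
  by_contra hxσ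
  obtain ⟨m, hm, hmx⟩ := h.exists_separating hxσ
  refine hmx.not_ge (hx m (h.mem_dualMonoid_of_forall fun s hs => ?_))
  by_cases hs0 : s = 0
  · simp [hs0]
  · exact (hm s hs hs0).le

theorem isClosed (h : IsStronglyConvexHull σ S) : IsClosed (σ : Set (Fin d → ℝ)) := by
  have : (σ : Set (Fin d → ℝ)) = ⋂ m ∈ dualMonoid σ, {x | 0 ≤ dotR m x} := by
    ext x; simp only [SetLike.mem_coe, h.mem_iff, Set.mem_iInter, Set.mem_ofPred_eq]
  rw [this]
  exact isClosed_biInter fun m _ => isClosed_le continuous_const (continuous_dotR m)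

theorem exists_sub_eq (h : IsStronglyConvexHull σ S) (m : Fin d → ℤ) :
    ∃ a ∈ dualMonoid σ, ∃ b ∈ dualMonoid σ, m = a - b := by
  obtain ⟨m₁, hm₁⟩ := h.exists_pos
  have hm₁' : m₁ ∈ dualMonoid σ := h.mem_dualMonoid_of_forall fun s hs => by
    by_cases hs0 : s = 0
    · simp [hs0]
    · exact (hm₁ s hs hs0).le
  let N : ℕ := ∑ s ∈ S, (m ⬝ᵥ s).natAbs
  refine ⟨m + N • m₁, h.mem_dualMonoid_of_forall fun s hs => ?_, N • m₁,
    AddSubmonoid.nsmul_mem _ hm₁' N, by abel⟩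
  by_cases hs0 : s = 0
  · simp [hs0]
  have h1 := hm₁ s hs hs0
  rw [dotR_castR] at h1 ⊢
  have h1' : 0 < m₁ ⬝ᵥ s := by exact_mod_cast h1
  have h2 : (m ⬝ᵥ s).natAbs ≤ N := Finset.single_le_sum (f := fun s => (m ⬝ᵥ s).natAbs)
    (fun _ _ => Nat.zero_le _) hs
  have : 0 ≤ (m + N • m₁) ⬝ᵥ s := by
    rw [add_dotProduct, smul_dotProduct, nsmul_eq_mul]
    have h3 : (N : ℤ) ≤ N * (m₁ ⬝ᵥ s) := le_mul_of_one_le_right (by positivity) h1'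
    omega
  exact_mod_cast this

theorem eq_zero_or_pos (h : IsStronglyConvexHull σ S) {m : Fin d → ℤ}
    (hm : ∀ s ∈ S, s ≠ 0 → 0 < dotR m (castR s)) : ∀ x ∈ σ, x = 0 ∨ 0 < dotR m x := by
  refine h.induction (Or.inl rfl) (fun s hs => ?_) (fun x y hx hy => ?_) fun c x hc hx => ?_
  · by_cases hs0 : s = 0
    · left; simp [hs0]
    · exact Or.inr (hm s hs hs0)
  · rcases hx with rfl | hx
    · simpa using hy
    · rcases hy with rfl | hy
      · simpa using Or.inr hx
      · right; rw [map_add]; exact add_pos hx hy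
  · rcases hx with rfl | hx
    · simp
    · rcases hc.eq_or_lt with rfl | hc
      · simp
      · right; rw [map_smul]; exact mul_pos hc hx

theorem isFaceOf_bot (h : IsStronglyConvexHull σ S) : IsFaceOf ⊥ σ := by
  obtain ⟨m, hm⟩ := h.exists_pos
  have h1 := h.eq_zero_or_pos hm
  refine ⟨fun j => m j, fun x hx => ?_, fun x => ?_⟩
  · rcases h1 x hx with rfl | h2
    · simp
    · exact h2.le
  · rw [Submodule.mem_bot]
    refine ⟨fun h => by simp [h], fun ⟨hx, hx0⟩ => ?_⟩
    rcases h1 x hx with h2 | h2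
    · exact h2
    · exact absurd hx0 h2.ne'

/-- If a cone spans, then its dual monoid is graded by a sum of generators, with only zero in
degree zero. -/
theorem exists_degree (h : IsStronglyConvexHull σ S)
    (hspan : Submodule.span ℝ (σ : Set (Fin d → ℝ)) = ⊤) :
    ∃ v : Fin d → ℤ, castR v ∈ σ ∧ ∀ m ∈ dualMonoid σ, m ⬝ᵥ v = 0 → m = 0 := by
  refine ⟨∑ s ∈ S, s, ?_, fun m hm h0 => ?_⟩
  · rw [map_sum]; exact Submodule.sum_mem _ fun s hs => h.castR_mem hs
  · have h1 : ∑ s ∈ S, dotR m (castR s) = 0 := by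
      rw [← map_sum, ← map_sum, dotR_castR, h0, Int.cast_zero]
    have h1 := (Finset.sum_eq_zero_iff_of_nonneg fun s hs => mem_dualMonoid.1 hm _ (h.castR_mem hs)).1 h1
    apply eq_zero_of_dotR_eq_zero
    have h2 : ∀ x ∈ σ, dotR m x = 0 := h.induction (by simp) h1
      (fun x y hx hy => by rw [map_add, hx, hy, add_zero])
      fun c x _ hx => by rw [map_smul, hx, smul_zero]
    exact LinearMap.ext_on hspan fun x hx => by rw [h2 x hx, LinearMap.zero_apply]

end IsStronglyConvexHull

theorem Fan.bot_mem {d : ℕ} (F : Fan d) (hF : F.cones.Nonempty) : ⊥ ∈ F.cones := by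
  obtain ⟨σ, hσ⟩ := hF
  obtain ⟨S, hS⟩ := F.exists_isStronglyConvexHull hσ
  exact F.face_mem σ hσ ⊥ hS.isFaceOf_bot

/-- A cone of the fan that spans `ℝᵈ`. -/
def Fan.IsFull {d : ℕ} (F : Fan d) (σ : PointedCone ℝ (Fin d → ℝ)) : Prop :=
  σ ∈ F.cones ∧ Submodule.span ℝ (σ : Set (Fin d → ℝ)) = ⊤

theorem Fan.isFaceOf_of_le {d : ℕ} (F : Fan d) {ω σ} (hω : ω ∈ F.cones) (hσ : σ ∈ F.cones)
    (h : ω ≤ σ) : IsFaceOf ω σ := by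
  have := F.inf_face σ hσ ω hω
  rwa [inf_eq_right.2 h] at this

/-- If the support of a fan is a half-space or everything, then it is the union of the cones
of full dimension. -/
theorem Fan.exists_isFull_mem {d : ℕ} (F : Fan d) (m : Fin d → ℤ)
    (hF : ∀ x, (∃ σ ∈ F.cones, x ∈ σ) ↔ 0 ≤ dotR m x) {x : Fin d → ℝ} (hx : 0 ≤ dotR m x) :
    ∃ σ, F.IsFull σ ∧ x ∈ σ := by
  classical
  let B : Set (PointedCone ℝ (Fin d → ℝ)) := {σ | σ ∈ F.cones ∧ ¬ F.IsFull σ}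
  have hB : B.Finite := F.finite.subset fun σ h => h.1
  let G : Set (PointedCone ℝ (Fin d → ℝ)) := {σ | F.IsFull σ}
  have hG : G.Finite := F.finite.subset fun σ h => h.1
  -- off the spans of the other cones, a dense set, the support is covered by the full cones, whose
  -- union is closed
  have hdense : Dense (⋂ σ ∈ B, (Submodule.span ℝ (σ : Set (Fin d → ℝ)) : Set (Fin d → ℝ))ᶜ) := by
    refine dense_biInter_of_isOpen (fun σ hσ => ?_) hB.countable fun σ hσ => ?_
    · exact (Submodule.closed_of_finiteDimensional _).isOpen_compl
    · rw [← interior_eq_empty_iff_dense_compl, Set.eq_empty_iff_forall_notMem]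
      intro y hy
      exact hσ.2 ⟨hσ.1, Submodule.eq_top_of_nonempty_interior' _ ⟨y, hy⟩⟩
  let H : Set (Fin d → ℝ) := {x | m = 0 ∨ 0 < dotR m x}
  have hH : IsOpen H := by
    by_cases h0 : m = 0
    · simp [H, h0]
    · simp only [H, h0, false_or]; exact isOpen_lt continuous_const (continuous_dotR m)
  have hHx : x ∈ closure H := by
    by_cases h0 : m = 0
    · simp [H, h0]
    obtain ⟨v, hv⟩ : ∃ v, 0 < dotR m v := by
      by_contra hcon
      push Not at hcon
      refine h0 (eq_zero_of_dotR_eq_zero (LinearMap.ext fun v => le_antisymm (hcon v) ?_))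
      have := hcon (-v)
      rw [map_neg] at this
      simp only [LinearMap.zero_apply]
      linarith
    have ht : Filter.Tendsto (fun t : ℝ => x + t • v) (𝓝[>] 0) (𝓝 x) := by
      have : Continuous fun t : ℝ => x + t • v := by fun_prop
      have h1 := this.tendsto 0
      simp only [zero_smul, add_zero] at h1
      exact h1.mono_left nhdsWithin_le_nhds
    refine mem_closure_of_tendsto ht (eventually_mem_nhdsWithin.mono fun t ht => Or.inr ?_)
    rw [map_add, map_smul, smul_eq_mul]
    have : 0 < t * dotR m v := mul_pos ht hv
    linarith
  have hcl : IsClosed (⋃ σ ∈ G, (σ : Set (Fin d → ℝ))) := hG.isClosed_biUnion fun σ hσ => by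
    obtain ⟨S, hS⟩ := F.exists_isStronglyConvexHull hσ.1
    exact hS.isClosed
  have hsub : H ∩ (⋂ σ ∈ B, (Submodule.span ℝ (σ : Set (Fin d → ℝ)) : Set (Fin d → ℝ))ᶜ) ⊆
      ⋃ σ ∈ G, (σ : Set (Fin d → ℝ)) := by
    rintro y ⟨hy, hy'⟩
    have : 0 ≤ dotR m y := by
      rcases hy with h | h
      · simp [h, dotR_zero]
      · exact h.le
    obtain ⟨σ, hσ, hyσ⟩ := (hF y).2 this
    have hfull : F.IsFull σ := by
      by_contra hcon
      simp only [Set.mem_iInter] at hy'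
      exact hy' σ ⟨hσ, hcon⟩ (Submodule.subset_span hyσ)
    simp only [Set.mem_iUnion]
    exact ⟨σ, hfull, hyσ⟩
  have := closure_minimal ((hdense.open_subset_closure_inter hH).trans (closure_mono hsub))
    isClosed_closure hHx
  rw [hcl.closure_eq] at this
  simp only [Set.mem_iUnion] at this
  obtain ⟨σ, hσ, hxσ⟩ := this
  exact ⟨σ, hσ, hxσ⟩

/-- If the support of a fan is a half-space or everything, then every cone is in a cone of full
dimension, namely in one that contains the sum of its generators. -/
theorem Fan.exists_isFull_le {d : ℕ} (F : Fan d) (m : Fin d → ℤ)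
    (hF : ∀ x, (∃ σ ∈ F.cones, x ∈ σ) ↔ 0 ≤ dotR m x) {ω} (hω : ω ∈ F.cones) :
    ∃ σ, F.IsFull σ ∧ ω ≤ σ := by
  obtain ⟨S, hS⟩ := F.exists_isStronglyConvexHull hω
  have hx : ∑ s ∈ S, castR s ∈ ω := Submodule.sum_mem _ fun s hs => hS.castR_mem hs
  obtain ⟨σ, hσ, hxσ⟩ := F.exists_isFull_mem m hF ((hF _).1 ⟨ω, hω, hx⟩)
  refine ⟨σ, hσ, ?_⟩
  obtain ⟨l, hl, hl'⟩ := F.inf_face ω hω σ hσ.1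
  have h1 : ∑ s ∈ S, ∑ j, l j * castR s j = 0 := by
    have := ((hl' _).1 ⟨hx, hxσ⟩).2
    simp only [Finset.sum_apply, Finset.mul_sum] at this
    rw [Finset.sum_comm] at this
    exact this
  rw [Finset.sum_eq_zero_iff_of_nonneg fun s hs => hl _ (hS.castR_mem hs)] at h1
  have h2 : ∀ s ∈ S, castR s ∈ σ := fun s hs => ((hl' _).2 ⟨hS.castR_mem hs, h1 s hs⟩).2
  rw [hS.eq_hull]
  refine Submodule.span_le.2 ?_
  rintro _ ⟨s, hs, rfl⟩
  exact h2 s hs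

/-! ### Smooth cones -/

/-- The indecomposable elements of the dual monoid of a cone. -/
def IsIndecomposable {d : ℕ} (σ : PointedCone ℝ (Fin d → ℝ)) (s : Fin d → ℤ) : Prop :=
  s ∈ dualMonoid σ ∧ s ≠ 0 ∧
    ∀ a ∈ dualMonoid σ, ∀ b ∈ dualMonoid σ, a + b = s → a = 0 ∨ b = 0

/-- The cone `σ` is generated by the basis `u` of the lattice `ℤᵈ`; `m` is the dual basis. This is
expressed by the dual monoid of `σ`, which determines a strongly convex rational cone. -/
structure IsSmoothBasis {d : ℕ} (σ : PointedCone ℝ (Fin d → ℝ)) (u m : Fin d → Fin d → ℤ) :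
    Prop where
  pair : ∀ i j, m i ⬝ᵥ u j = if i = j then 1 else 0
  mem_dualMonoid_iff : ∀ a, a ∈ dualMonoid σ ↔ ∀ j, 0 ≤ a ⬝ᵥ u j

/-- A full-dimensional strongly convex rational cone whose dual monoid has at most `d`
indecomposable elements is generated by a basis of the lattice. -/
theorem IsStronglyConvexHull.exists_isSmoothBasis {d : ℕ} {σ : PointedCone ℝ (Fin d → ℝ)}
    {S : Finset (Fin d → ℤ)} (h : IsStronglyConvexHull σ S)
    (hspan : Submodule.span ℝ (σ : Set (Fin d → ℝ)) = ⊤)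
    (hcard : ∀ T : Finset (Fin d → ℤ), (∀ s ∈ T, IsIndecomposable σ s) → T.card ≤ d) :
    ∃ u m, IsSmoothBasis σ u m := by
  classical
  have hfin : {s | IsIndecomposable σ s}.Finite := by
    by_contra hinf
    obtain ⟨T, hT, hTc⟩ := Set.Infinite.exists_subset_card_eq hinf (d + 1)
    have := hcard T fun s hs => hT hs
    omega
  let I : Finset (Fin d → ℤ) := hfin.toFinset
  have hI : ∀ s, s ∈ I ↔ IsIndecomposable σ s := fun s => hfin.mem_toFinset
  have hIc : I.card ≤ d := hcard I fun s hs => (hI s).1 hs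
  obtain ⟨v, hv, hv0⟩ := h.exists_degree hspan
  have hdeg : ∀ a ∈ dualMonoid σ, 0 ≤ a ⬝ᵥ v := fun a ha => by
    have := mem_dualMonoid.1 ha _ hv
    rw [dotR_castR] at this
    exact_mod_cast this
  -- by induction on the degree `a ⬝ᵥ v`, the indecomposable elements generate the dual monoid
  have hgen : ∀ n : ℕ, ∀ a ∈ dualMonoid σ, a ⬝ᵥ v ≤ n →
      a ∈ AddSubmonoid.closure (I : Set (Fin d → ℤ)) := by
    intro n
    induction n with
    | zero =>
      intro a ha hn
      rw [hv0 a ha (le_antisymm (by exact_mod_cast hn) (hdeg a ha))]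
      exact zero_mem _
    | succ n ih =>
      intro a ha hn
      by_cases h0 : a = 0
      · rw [h0]; exact zero_mem _
      by_cases hind : IsIndecomposable σ a
      · exact AddSubmonoid.subset_closure ((hI a).2 hind)
      · simp only [IsIndecomposable, ha, h0, ne_eq, not_false_iff, true_and] at hind
        push Not at hind
        obtain ⟨b, hb, c, hc, rfl, hb0, hc0⟩ := hind
        rw [add_dotProduct] at hn
        have h1 : 0 < b ⬝ᵥ v := lt_of_le_of_ne (hdeg b hb) fun h => hb0 (hv0 b hb h.symm)
        have h2 : 0 < c ⬝ᵥ v := lt_of_le_of_ne (hdeg c hc) fun h => hc0 (hv0 c hc h.symm)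
        exact add_mem (ih b hb (by push_cast at hn; linarith)) (ih c hc (by push_cast at hn; linarith))
  have hgen' : ∀ a ∈ dualMonoid σ, a ∈ AddSubmonoid.closure (I : Set (Fin d → ℤ)) :=
    fun a ha => hgen (a ⬝ᵥ v).toNat a ha (Int.self_le_toNat _)
  have hsp : ∀ a ∈ dualMonoid σ, a ∈ Submodule.span ℤ (Set.range (Subtype.val : I → Fin d → ℤ)) := by
    intro a ha
    refine AddSubmonoid.closure_induction (fun s hs => Submodule.subset_span ⟨⟨s, hs⟩, rfl⟩)
      (zero_mem _) (fun _ _ _ _ => add_mem) (hgen' a ha)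
  have htop : ⊤ ≤ Submodule.span ℤ (Set.range (Subtype.val : I → Fin d → ℤ)) := by
    rintro a -
    obtain ⟨b, hb, c, hc, rfl⟩ := h.exists_sub_eq a
    exact sub_mem (hsp b hb) (hsp c hc)
  -- `d` generators of `ℤᵈ` are a basis
  have hli : LinearIndependent ℤ (Subtype.val : I → Fin d → ℤ) :=
    linearIndependent_of_top_le_span_of_card_le_finrank htop (by simpa using hIc)
  let B0 : Module.Basis I ℤ (Fin d → ℤ) := Module.Basis.mk hli htop
  have hcard' : Fintype.card I = d := by
    rw [← Module.finrank_eq_card_basis B0, Module.finrank_fin_fun]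
  let e : I ≃ Fin d := Fintype.equivFinOfCardEq hcard'
  let B := B0.reindex e
  have hB : ∀ j, B j = (e.symm j : Fin d → ℤ) := fun j => by simp [B, B0]
  let u : Fin d → Fin d → ℤ := fun j l => B.repr (Pi.single l 1) j
  have hu : ∀ a j, a ⬝ᵥ u j = B.repr a j := by
    intro a j
    conv_rhs => rw [← Finset.univ_sum_single a, map_sum, Finsupp.finsetSum_apply]
    refine Finset.sum_congr rfl fun l _ => ?_
    have : (Pi.single l (a l) : Fin d → ℤ) = a l • Pi.single l 1 := by
      rw [← Pi.single_smul, smul_eq_mul, mul_one]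
    rw [this, map_smul, Finsupp.smul_apply, smul_eq_mul]
  refine ⟨u, fun j => B j, ⟨fun i j => ?_, fun a => ⟨fun ha j => ?_, fun ha => ?_⟩⟩⟩
  · rw [hu, B.repr_self, Finsupp.single_apply]
  · rw [hu]
    refine AddSubmonoid.closure_induction (motive := fun a _ => 0 ≤ B.repr a j) (fun s hs => ?_)
      (by simp) (fun x y _ _ hx hy => ?_) (hgen' a ha)
    · have : s = B (e ⟨s, hs⟩) := by rw [hB, Equiv.symm_apply_apply]
      rw [this, B.repr_self, Finsupp.single_apply]
      split_ifs <;> norm_num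
    · rw [map_add, Finsupp.add_apply]; exact add_nonneg hx hy
  · rw [← B.sum_repr a]
    refine sum_mem fun j _ => ?_
    have h1 : 0 ≤ B.repr a j := by rw [← hu]; exact ha j
    obtain ⟨n, hn⟩ := Int.eq_ofNat_of_zero_le h1
    rw [hn, hB, natCast_zsmul]
    exact nsmul_mem ((hI _).1 (e.symm j).2).1 n

namespace IsSmoothBasis

variable {d : ℕ} {σ : PointedCone ℝ (Fin d → ℝ)} {u m : Fin d → Fin d → ℤ}

theorem mul_eq_one (h : IsSmoothBasis σ u m) : Matrix.of u * (Matrix.of m).transpose = 1 ∧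
    (Matrix.of m).transpose * Matrix.of u = 1 := by
  have h1 : Matrix.of u * (Matrix.of m).transpose = 1 := by
    ext i j
    rw [Matrix.mul_apply, Matrix.one_apply]
    have := h.pair j i
    rw [dotProduct_comm] at this
    simpa [dotProduct, eq_comm] using this
  exact ⟨h1, mul_eq_one_comm.1 h1⟩

/-- Expansion of a covector in the dual basis. -/
theorem sum_dual (h : IsSmoothBasis σ u m) (a : Fin d → ℤ) : ∑ j, (a ⬝ᵥ u j) • m j = a := by
  have h1 : Matrix.vecMul a ((Matrix.of u).transpose * Matrix.of m) = a := by
    have := congrArg Matrix.transpose h.mul_eq_one.2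
    rw [Matrix.transpose_mul, Matrix.transpose_transpose, Matrix.transpose_one] at this
    rw [this, Matrix.vecMul_one]
  rw [← Matrix.vecMul_vecMul] at h1
  conv_rhs => rw [← h1]
  ext l
  simp [Matrix.vecMul, dotProduct]

/-- Expansion of a vector in the basis. -/
theorem sum_basis (h : IsSmoothBasis σ u m) (x : Fin d → ℝ) :
    ∑ j, dotR (m j) x • castR (u j) = x := by
  ext l
  have h1 : ∀ l' : Fin d, ∑ j, (m j l' : ℝ) * u j l = if l' = l then 1 else 0 := fun l' => by
    have := congrFun (congrFun h.mul_eq_one.2 l') l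
    rw [Matrix.mul_apply, Matrix.one_apply] at this
    exact_mod_cast this
  simp only [Finset.sum_apply, Pi.smul_apply, smul_eq_mul, castR_apply, dotR_apply, Finset.sum_mul]
  rw [Finset.sum_comm]
  have h2 : ∀ l', ∑ j, (m j l' : ℝ) * x l' * u j l = x l' * if l' = l then 1 else 0 := fun l' => by
    rw [← h1, Finset.mul_sum]; exact Finset.sum_congr rfl fun _ _ => by ring
  simp [h2]

theorem dual_mem (h : IsSmoothBasis σ u m) (j) : m j ∈ dualMonoid σ :=
  (h.mem_dualMonoid_iff _).2 fun i => by rw [h.pair]; split_ifs <;> norm_num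

theorem mem_iff (h : IsSmoothBasis σ u m) {S} (hS : IsStronglyConvexHull σ S) {x : Fin d → ℝ} :
    x ∈ σ ↔ ∀ j, 0 ≤ dotR (m j) x := by
  refine ⟨fun hx j => h.dual_mem j x hx, fun hx => hS.mem_iff.2 fun a ha => ?_⟩
  rw [← h.sum_dual a, ← h.sum_basis x, map_sum]
  refine Finset.sum_nonneg fun j _ => ?_
  rw [map_smul, smul_eq_mul, h.sum_dual, dotR_castR]
  exact mul_nonneg (hx j) (by exact_mod_cast (h.mem_dualMonoid_iff a).1 ha j)

end IsSmoothBasis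

/-! ### Tangent vectors at the fixed point of an affine toric variety -/

/-- The homomorphism from `k[σ^∨ ∩ ℤᵈ]` to a square-zero extension given by the tangent vectors at
the fixed point dual to the indecomposable elements `s j`. -/
def tangentHom (k : Type*) [Field k] {d r : ℕ} {σ : PointedCone ℝ (Fin d → ℝ)}
    (s : Fin r → Fin d → ℤ) (hs : ∀ j, IsIndecomposable σ (s j))
    (hp : ∀ a ∈ dualMonoid σ, ∀ b ∈ dualMonoid σ, a + b = 0 → a = 0) :
    AddMonoidAlgebra k (dualMonoid σ) →ₐ[k] TrivSqZeroExt k (Fin r → k) := by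
  classical
  exact AddMonoidAlgebra.lift k _ _
    { toFun := fun m => if (m.toAdd : Fin d → ℤ) = 0 then 1 else
        TrivSqZeroExt.inr fun j => if (m.toAdd : Fin d → ℤ) = s j then 1 else 0
      map_one' := if_pos rfl
      map_mul' := fun a b => by
        rw [toAdd_mul, AddSubmonoid.coe_add]
        by_cases ha : (a.toAdd : Fin d → ℤ) = 0
        · simp [ha]
        by_cases hb : (b.toAdd : Fin d → ℤ) = 0
        · simp [hb]
        have hab : (a.toAdd : Fin d → ℤ) + b.toAdd ≠ 0 := fun h =>
          ha (hp _ a.toAdd.2 _ b.toAdd.2 h)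
        rw [if_neg ha, if_neg hb, if_neg hab, TrivSqZeroExt.inr_mul_inr]
        refine (congrArg TrivSqZeroExt.inr (funext fun j => ?_)).trans (TrivSqZeroExt.inr_zero k)
        rw [Pi.zero_apply, if_neg]
        intro h
        rcases (hs j).2.2 _ a.toAdd.2 _ b.toAdd.2 h with h | h
        exacts [ha h, hb h] }

open Classical in
theorem tangentHom_single {k : Type*} [Field k] {d r : ℕ} {σ : PointedCone ℝ (Fin d → ℝ)}
    (s : Fin r → Fin d → ℤ) (hs : ∀ j, IsIndecomposable σ (s j))
    (hp : ∀ a ∈ dualMonoid σ, ∀ b ∈ dualMonoid σ, a + b = 0 → a = 0) (m : dualMonoid σ) :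
    tangentHom k s hs hp (AddMonoidAlgebra.single m 1) = if (m : Fin d → ℤ) = 0 then 1 else
        TrivSqZeroExt.inr fun j => if (m : Fin d → ℤ) = s j then 1 else 0 := by
  rw [tangentHom, AddMonoidAlgebra.lift_single, one_smul]
  simp only [MonoidHom.coe_mk, OneHom.coe_mk, toAdd_ofAdd]

theorem tangentHom_surjective {k : Type*} [Field k] {d r : ℕ} {σ : PointedCone ℝ (Fin d → ℝ)}
    (s : Fin r → Fin d → ℤ) (hs : ∀ j, IsIndecomposable σ (s j))
    (hp : ∀ a ∈ dualMonoid σ, ∀ b ∈ dualMonoid σ, a + b = 0 → a = 0)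
    (hinj : Function.Injective s) : Function.Surjective (tangentHom k s hs hp) := by
  classical
  intro y
  refine ⟨algebraMap k _ y.fst + ∑ j, y.snd j • AddMonoidAlgebra.single ⟨s j, (hs j).1⟩ 1, ?_⟩
  rw [map_add, AlgHom.commutes, map_sum]
  have : ∀ j, tangentHom k s hs hp (y.snd j • AddMonoidAlgebra.single ⟨s j, (hs j).1⟩ 1) =
      TrivSqZeroExt.inr (Pi.single j (y.snd j)) := by
    intro j
    rw [map_smul, tangentHom_single, if_neg (hs j).2.1, ← TrivSqZeroExt.inr_smul]
    congr 1
    ext i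
    simp only [Pi.smul_apply, hinj.eq_iff, smul_eq_mul, Pi.single_apply, mul_ite, mul_one, mul_zero]
    simp only [eq_comm]
  simp only [this]
  rw [← TrivSqZeroExt.inr_sum, Finset.univ_sum_single, TrivSqZeroExt.algebraMap_eq_inl]
  exact TrivSqZeroExt.inl_fst_add_inr_snd_eq y

namespace SNCDivisor

variable {X : Scheme.{u}} [IsIntegral X] {ι : Type} (D : SNCDivisor X ι)

theorem mem_supp_iff {i : ι} {x : X} : x ∈ D.supp i ↔ ¬ IsUnit (D.loc i x) :=
  IsLocalRing.mem_maximalIdeal _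

/-- Near every point, a component of `D` has an equation given by a section. -/
theorem exists_section (i : ι) (x : X) : ∃ (V : X.Opens) (_ : x ∈ V) (f : Γ(X, V)),
    ∀ (y : X) (hy : y ∈ V), ∃ a : (X.presheaf.stalk y)ˣ,
      D.loc i y = (a : X.presheaf.stalk y) * X.presheaf.germ V y hy f := by
  obtain ⟨U, hxU, hU⟩ := (D.comp i).locally_eq x
  obtain ⟨V, hxV, f, hf⟩ := X.presheaf.exists_germ_eq (D.loc i x)
  refine ⟨U ⊓ V, ⟨hxU, hxV⟩, X.presheaf.map (homOfLE inf_le_right).op f, ?_⟩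
  intro y hy
  obtain ⟨a, ha⟩ := hU y hy.1
  have hyV : y ∈ V := hy.2
  have : Nonempty V := ⟨⟨x, hxV⟩⟩
  refine ⟨a, ?_⟩
  rw [TopCat.Presheaf.germ_res_apply]
  apply IsFractionRing.injective (X.presheaf.stalk y) X.functionField
  rw [← D.comp_eqn, ha, D.comp_eqn, ← hf, map_mul,
    Scheme.algebraMap_germ_eq_germToFunctionField X hxV,
    Scheme.algebraMap_germ_eq_germToFunctionField X hyV]

/-- The equation of a component of `D` vanishes on reduced schemes mapping into the component. -/
theorem stalkMap_loc_eq_zero {Y : Scheme.{u}} [IsReduced Y] (g : Y ⟶ X) (i : ι)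
    (hg : ∀ y, g y ∈ D.supp i) (y : Y) : g.stalkMap y (D.loc i (g y)) = 0 := by
  obtain ⟨V, hV, f, hf⟩ := D.exists_section i (g y)
  have h0 : g.app V f = 0 := by
    rw [← basicOpen_eq_bot_iff, ← Scheme.preimage_basicOpen, eq_bot_iff]
    intro z hz
    have hzV : g z ∈ V := X.basicOpen_le f hz
    obtain ⟨a, ha⟩ := hf (g z) hzV
    refine ((D.mem_supp_iff).1 (hg z) ?_).elim
    rw [ha]
    exact a.isUnit.mul ((Scheme.mem_basicOpen X f (g z) hzV).1 hz)
  obtain ⟨a, ha⟩ := hf (g y) hV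
  have h1 : g.stalkMap y (X.presheaf.germ V (g y) hV f) = 0 := by
    have := congr($(g.germ_stalkMap V y hV).hom f)
    change g.stalkMap y (X.presheaf.germ V (g y) hV f) = Y.presheaf.germ _ y hV (g.app V f) at this
    rw [this, h0, map_zero]
  rw [ha, map_mul, h1, mul_zero]

end SNCDivisor

theorem stalkClosedPointTo_specMap_surjective {R S : CommRingCat.{u}} [IsLocalRing S] (φ : R ⟶ S)
    (h : Function.Surjective φ.hom) :
    Function.Surjective (Scheme.stalkClosedPointTo (Spec.map φ)).hom := by
  intro y
  obtain ⟨x, rfl⟩ := h y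
  have := Scheme.germ_stalkClosedPointTo_Spec φ
  refine ⟨(Spec R).presheaf.germ ⊤ _ trivial ((Scheme.ΓSpecIso R).inv x), ?_⟩
  have h2 := congr($(this).hom ((Scheme.ΓSpecIso R).inv x))
  refine h2.trans ?_
  change φ.hom (((Scheme.ΓSpecIso R).inv ≫ (Scheme.ΓSpecIso R).hom).hom x) = _
  rw [Iso.inv_hom_id]
  rfl

/-! ### Reduced subschemes and toric charts -/

instance isDomain_addMonoidAlgebra {k : Type*} [Field k] {d : ℕ} (S : AddSubmonoid (Fin d → ℤ)) :
    IsDomain (AddMonoidAlgebra k S) :=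
  have : UniqueSums S := UniqueSums.of_injective_addHom S.subtype.toAddHom
    Subtype.val_injective inferInstance
  NoZeroDivisors.to_isDomain _

instance isReduced_redSubscheme {X : Scheme.{u}} (Z : Closeds X) : IsReduced (redSubscheme Z) := by
  let I := Scheme.IdealSheafData.vanishingIdeal Z
  have : ∀ i, IsReduced (I.subschemeCover.openCover.X i) := by
    intro (U : X.affineOpens)
    have hU : (I.ideal U).IsRadical := by
      change (PrimeSpectrum.vanishingIdeal _).IsRadical
      exact PrimeSpectrum.isRadical_vanishingIdeal _
    have : _root_.IsReduced (Γ(X, U.1) ⧸ I.ideal U) :=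
      (Ideal.isRadical_iff_quotient_reduced _).1 hU
    change IsReduced (Spec (CommRingCat.of (Γ(X, U.1) ⧸ I.ideal U)))
    infer_instance
  exact IsReduced.of_openCover _ I.subschemeCover.openCover

theorem range_redι {X : Scheme.{u}} (Z : Closeds X) : Set.range (redι Z) = Z := by
  rw [Scheme.IdealSheafData.range_subschemeι, Scheme.IdealSheafData.coe_support_vanishingIdeal]

theorem redι_mem {X : Scheme.{u}} (Z : Closeds X) (y : redSubscheme Z) : redι Z y ∈ (Z : Set X) := by
  rw [← range_redι]; exact ⟨y, rfl⟩

theorem vanishingIdeal_le_ker {X Y : Scheme.{u}} [IsReduced Y] (g : Y ⟶ X) [QuasiCompact g]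
    (Z : Closeds X) (hg : ∀ y, g y ∈ (Z : Set X)) :
    Scheme.IdealSheafData.vanishingIdeal Z ≤ g.ker := by
  intro (U : X.affineOpens) f hf
  rw [Scheme.Hom.ker_apply, RingHom.mem_ker]
  change g.app U f = 0
  rw [← basicOpen_eq_bot_iff, ← Scheme.preimage_basicOpen, eq_bot_iff]
  intro w hw
  have hwU : g w ∈ U.1 := X.basicOpen_le f hw
  have h1 : f ∈ PrimeSpectrum.vanishingIdeal (U.2.fromSpec ⁻¹' (Z : Set X)) := hf
  rw [PrimeSpectrum.mem_vanishingIdeal] at h1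
  have h2 := h1 (U.2.primeIdealOf ⟨g w, hwU⟩)
    (Set.mem_preimage.2 ((U.2.fromSpec_primeIdealOf ⟨g w, hwU⟩).symm ▸ hg w))
  have h3 := (Scheme.mem_basicOpen X f (g w) hwU).1 hw
  let _ := TopCat.Presheaf.algebra_section_stalk X.presheaf (⟨g w, hwU⟩ : (U.1 : X.Opens))
  have h4 := U.2.isLocalization_stalk ⟨g w, hwU⟩
  exact ((IsLocalization.AtPrime.isUnit_to_map_iff (X.presheaf.stalk (g w))
    (U.2.primeIdealOf ⟨g w, hwU⟩).asIdeal f).1 h3) h2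

/-- A morphism from a reduced scheme with image in `Z` factors through the reduced subscheme. -/
theorem exists_lift_redι {X Y : Scheme.{u}} [IsReduced Y] (g : Y ⟶ X) [QuasiCompact g]
    (Z : Closeds X) (hg : ∀ y, g y ∈ (Z : Set X)) : ∃ h : Y ⟶ redSubscheme Z, h ≫ redι Z = g :=
  ⟨IsClosedImmersion.lift (redι Z) g (by
    rw [Scheme.IdealSheafData.ker_subschemeι]; exact vanishingIdeal_le_ker g Z hg),
    IsClosedImmersion.lift_fac _ _ _⟩

namespace ToricStructure

variable {k : Type u} [Field k] {Y : Scheme.{u}} {s : Y ⟶ Spec (CommRingCat.of k)} {d : ℕ}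
  {F : Fan d} (T : ToricStructure s F)

instance (σ : F.cones) : IsOpenImmersion (T.chart σ) := T.isOpenImmersion σ

theorem range_chart_mono {ω σ : F.cones} (h : ω.1 ≤ σ.1) :
    Set.range (T.chart ω) ⊆ Set.range (T.chart σ) := by
  rw [← T.compatible ω σ h]
  rintro _ ⟨x, rfl⟩
  exact ⟨affineToricMap k h x, by rw [Scheme.Hom.comp_apply]⟩

theorem cones_nonempty (T : ToricStructure s F) [Nonempty Y] : F.cones.Nonempty := by
  obtain ⟨σ, -⟩ := T.cover (Classical.arbitrary Y)
  exact ⟨σ.1, σ.2⟩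

/-- The toric variety of a fan is integral if it is reduced. -/
theorem isIntegral (T : ToricStructure s F) [Nonempty Y] [IsReduced Y] : IsIntegral Y := by
  have : IrreducibleSpace Y := by
    let o : F.cones := ⟨⊥, F.bot_mem T.cones_nonempty⟩
    have hirr : ∀ σ : F.cones, IsIrreducible (Set.range (T.chart σ)) := fun σ => by
      rw [← Set.image_univ]
      exact (IrreducibleSpace.isIrreducible_univ _).image _ (T.chart σ).continuous.continuousOn
    have hd : closure (Set.range (T.chart o)) = Set.univ := by
      rw [Set.eq_univ_iff_forall]
      intro y
      obtain ⟨σ, hy⟩ := T.cover y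
      have h1 : closure (Set.range (T.chart o)) ∩ Set.range (T.chart σ) = Set.range (T.chart σ) := by
        rw [Set.inter_eq_right]
        have := (hirr σ).2
        have hsub : Set.range (T.chart o) ⊆ Set.range (T.chart σ) := T.range_chart_mono bot_le
        have h2 := subset_closure_inter_of_isPreirreducible_of_isOpen this
          (T.chart o).isOpenEmbedding.isOpen_range
          (by rw [Set.inter_eq_right.2 hsub]; exact Set.range_nonempty _)
        exact h2.trans (closure_mono Set.inter_subset_right)
      exact (h1.ge hy).1
    have h3 := (hirr o).closure
    rw [hd] at h3
    exact (irreducibleSpace_def Y).2 h3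
  exact isIntegral_of_irreducibleSpace_of_isReduced Y

theorem closedStratum_eq_univ_of_eq_bot (σ : F.cones) (h : σ.1 = ⊥) [IrreducibleSpace Y] :
    T.closedStratum σ = Set.univ := by
  have horb : T.orbit σ = Set.range (T.chart σ) := by
    rw [orbit, sdiff_eq_left, Set.disjoint_right]
    intro y hy _
    simp only [Set.mem_iUnion] at hy
    obtain ⟨τ, hτ, -⟩ := hy
    rw [Set.mem_ofPred_eq, h] at hτ
    exact not_lt_bot hτ
  rw [closedStratum, horb]
  exact ((T.chart σ).isOpenEmbedding.isOpen_range.dense (Set.range_nonempty _)).closure_eq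

/-- A closed stratum meets the charts of the cones containing its cone only. -/
theorem le_of_mem_closedStratum {ω σ : F.cones} {y : Y} (hy : y ∈ T.closedStratum ω)
    (hσ : y ∈ Set.range (T.chart σ)) : ω.1 ≤ σ.1 := by
  obtain ⟨z, hzσ, hz⟩ := mem_closure_iff.1 hy _ (T.chart σ).isOpenEmbedding.isOpen_range hσ
  have h1 : z ∈ Set.range (T.chart ω) ∩ Set.range (T.chart σ) := ⟨hz.1, hzσ⟩
  rw [T.inter] at h1
  by_contra hle
  refine hz.2 ?_
  simp only [Set.mem_iUnion]
  exact ⟨_, lt_of_le_of_ne inf_le_left fun h => hle (inf_eq_left.1 h), h1⟩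

end ToricStructure

/-! ### Tangent vectors at the fixed points of a toric stratum -/

section

variable {k : Type u} [Field k] {X : Scheme.{u}} [IsIntegral X]
  {s : X ⟶ Spec (CommRingCat.of k)} {ι : Type} {D : SNCDivisor X ι} {τ : Finset ι} {d : ℕ}
  {F : Fan d} (T : ToricStructure (redι (D.stratum τ) ≫ s) F)

/-- The composition of the chart of a toric stratum with its inclusion. -/
def ToricStructure.emb (σ : F.cones) : affineToric k σ.1 ⟶ X := T.chart σ ≫ redι (D.stratum τ)

theorem ToricStructure.emb_mem_supp (σ : F.cones) {i : ι} (hi : i ∈ τ) (y : affineToric k σ.1) :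
    T.emb σ y ∈ D.supp i := by
  have := redι_mem (D.stratum τ) (T.chart σ y)
  rw [ToricStructure.emb, Scheme.Hom.comp_apply]
  exact Set.mem_iInter₂.1 this i hi

variable [Fintype ι] {n : ℕ} [SmoothOfRelativeDimension n s]

/-- The fixed point `y` of a toric chart, with the tangent vectors dual to distinct indecomposable
elements of the dual monoid. Composed with the closed immersion into `X`, they are tangent vectors
of the smooth variety `X` along which the equations of the components containing the stratum vanish,
so their number `r` is at most `n - |τ|`. If `r = n - |τ|`, then normal crossings make the
derivatives of the equations of the other components through the point independent. -/
theorem ToricStructure.exists_tangent (σ : F.cones) {r : ℕ}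
    (e : Fin r → Fin d → ℤ) (he : ∀ j, IsIndecomposable σ.1 (e j)) (hinj : Function.Injective e)
    (hp : ∀ a ∈ dualMonoid σ.1, ∀ b ∈ dualMonoid σ.1, a + b = 0 → a = 0) :
    ∃ (y : affineToric k σ.1) (_ : ∀ a, a ∈ y.asIdeal ↔ (tangentHom k e he hp a).fst = 0)
      (ψ : (affineToric k σ.1).presheaf.stalk y →+* TrivSqZeroExt k (Fin r → k)),
      IsLocalHom ψ ∧
      (∀ a, ψ ((StructureSheaf.toStalk _ y).hom a) = tangentHom k e he hp a) ∧
      r + τ.card ≤ n ∧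
      (r + τ.card = n → LinearIndependent k
        fun i : {i // T.emb σ y ∈ D.supp i ∧ i ∉ τ} =>
          (ψ ((T.emb σ).stalkMap y (D.loc i (T.emb σ y)))).snd) := by
  classical
  let φ : CommRingCat.of (AddMonoidAlgebra k (dualMonoid σ.1)) ⟶ CommRingCat.of (TrivSqZeroExt k (Fin r → k)) :=
    CommRingCat.ofHom (tangentHom k e he hp).toRingHom
  let c : Spec (CommRingCat.of (TrivSqZeroExt k (Fin r → k))) := IsLocalRing.closedPoint (TrivSqZeroExt k (Fin r → k))
  let y : affineToric k σ.1 := (Spec.map φ) c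
  let ψ : (affineToric k σ.1).presheaf.stalk y →+* TrivSqZeroExt k (Fin r → k) := (Scheme.stalkClosedPointTo (Spec.map φ)).hom
  have hψs : Function.Surjective ψ :=
    stalkClosedPointTo_specMap_surjective φ (tangentHom_surjective e he hp hinj)
  have hψl : IsLocalHom ψ := Scheme.isLocalHom_stalkClosedPointTo (R := CommRingCat.of (TrivSqZeroExt k (Fin r → k))) (Spec.map φ)
  let t : Spec (CommRingCat.of (TrivSqZeroExt k (Fin r → k))) ⟶ X := Spec.map φ ≫ T.emb σ
  have ht : t ≫ s = Spec.map (CommRingCat.ofHom (algebraMap k (TrivSqZeroExt k (Fin r → k)))) := by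
    have h1 : T.emb σ ≫ s = Spec.map (CommRingCat.ofHom (algebraMap k _)) :=
      (Category.assoc _ _ _).trans (T.chart_over σ)
    have h2 : t ≫ s = Spec.map φ ≫ (T.emb σ ≫ s) := Category.assoc _ _ _
    rw [h2, h1, ← Spec.map_comp]
    congr 1
    exact CommRingCat.hom_ext (RingHom.ext fun a => (tangentHom k e he hp).commutes a)
  obtain ⟨hfin, hn⟩ := finrank_cotangentSpace_stalk_le s n (TrivSqZeroExt.fstHom k k (Fin r → k)) t ht
  let x : X := T.emb σ y
  let Ψ : X.presheaf.stalk x →+* TrivSqZeroExt k (Fin r → k) := ψ.comp ((T.emb σ).stalkMap y).hom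
  have hsurj1 : Function.Surjective ((T.emb σ).stalkMap y).hom := by
    have h1 : (T.emb σ).stalkMap y = (redι (D.stratum τ)).stalkMap (T.chart σ y) ≫
        (T.chart σ).stalkMap y := Scheme.Hom.stalkMap_comp _ _ _
    have h2 : Function.Surjective ((redι (D.stratum τ)).stalkMap (T.chart σ y)).hom :=
      Scheme.Hom.stalkMap_surjective _ _
    have h3 : Function.Surjective ((T.chart σ).stalkMap y).hom :=
      (ConcreteCategory.bijective_of_isIso ((T.chart σ).stalkMap y)).2
    rw [h1]
    exact h3.comp h2
  have hΨl : IsLocalHom Ψ := by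
    have : IsLocalHom ((T.emb σ).stalkMap y).hom := inferInstance
    exact RingHom.isLocalHom_comp _ _
  let I := {i : ι // D.loc i x ∈ IsLocalRing.maximalIdeal (X.presheaf.stalk x)}
  let τ' : Finset I := Finset.univ.filter fun i => i.1 ∈ τ
  have hτ' : ∀ i ∈ τ', Ψ (D.loc i.1 x) = 0 := by
    intro i hi
    have h0 := D.stalkMap_loc_eq_zero (T.emb σ) i.1
      (fun z => T.emb_mem_supp σ (Finset.mem_filter.1 hi).2 z) y
    change ψ ((T.emb σ).stalkMap y (D.loc i.1 (T.emb σ y))) = 0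
    rw [h0, map_zero]
  have hcard : τ'.card = τ.card := by
    refine Finset.card_bij (fun i _ => i.1) (fun i hi => (Finset.mem_filter.1 hi).2)
      (fun i _ j _ h => Subtype.ext h) fun i hi => ?_
    exact ⟨⟨i, T.emb_mem_supp σ hi y⟩, Finset.mem_filter.2 ⟨Finset.mem_univ _, hi⟩, rfl⟩
  have hmain := linearIndependent_snd_of_cotangentSpace (n := n) hn Ψ hΨl (hψs.comp hsurj1)
    (fun i : I => ⟨D.loc i.1 x, i.2⟩) (D.snc x) τ' hτ'
  rw [hcard] at hmain
  refine ⟨y, fun a => ?_, ψ, hψl, fun a => ?_, hmain.1, fun h => ?_⟩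
  · change tangentHom k e he hp a ∈ IsLocalRing.maximalIdeal (TrivSqZeroExt k (Fin r → k)) ↔ _
    rw [IsLocalRing.mem_maximalIdeal, mem_nonunits_iff, TrivSqZeroExt.isUnit_iff_isUnit_fst,
      isUnit_iff_ne_zero, not_not]
  · have := congr($(Scheme.germ_stalkClosedPointTo_Spec φ).hom ((Scheme.ΓSpecIso _).inv a))
    refine Eq.trans ?_ (this.trans ?_)
    · rfl
    · change φ.hom (((Scheme.ΓSpecIso _).inv ≫ (Scheme.ΓSpecIso _).hom).hom a) = _
      rw [Iso.inv_hom_id]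
      rfl
  · refine (hmain.2 h).comp (fun i : {i // T.emb σ y ∈ D.supp i ∧ i ∉ τ} =>
      (⟨⟨i.1, i.2.1⟩, fun hi => i.2.2 (Finset.mem_filter.1 hi).2⟩ : {i // i ∉ τ'})) ?_
    intro i j h
    exact Subtype.ext (congrArg (fun z => z.1.1) h)

/-- The full-dimensional cones of the fan of a toric stratum of a simple normal crossings divisor
are generated by lattice bases. -/
theorem ToricStructure.exists_isSmoothBasis (T : ToricStructure (redι (D.stratum τ) ≫ s) F)
    (hd : τ.card + d = n) (σ : F.cones)
    (hσ : F.IsFull σ.1) : ∃ u m, IsSmoothBasis σ.1 u m := by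
  obtain ⟨S, hS⟩ := F.exists_isStronglyConvexHull σ.2
  refine hS.exists_isSmoothBasis hσ.2 fun I hI => ?_
  obtain ⟨v, hv, hv0⟩ := hS.exists_degree hσ.2
  have hp : ∀ a ∈ dualMonoid σ.1, ∀ b ∈ dualMonoid σ.1, a + b = 0 → a = 0 := by
    intro a ha b hb hab
    have h1 := mem_dualMonoid.1 ha _ hv
    have h2 := mem_dualMonoid.1 hb _ hv
    rw [dotR_castR] at h1 h2
    refine hv0 a ha ?_
    have : a ⬝ᵥ v + b ⬝ᵥ v = 0 := by rw [← add_dotProduct, hab, zero_dotProduct]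
    have h3 : 0 ≤ a ⬝ᵥ v := by exact_mod_cast h1
    have h4 : 0 ≤ b ⬝ᵥ v := by exact_mod_cast h2
    omega
  obtain ⟨y, -, ψ, -, -, h, -⟩ := T.exists_tangent (n := n) σ (fun j => (I.equivFin.symm j : Fin d → ℤ))
    (fun j => hI _ (I.equivFin.symm j).2) (Subtype.val_injective.comp I.equivFin.symm.injective) hp
  omega

end

/-! ### The support of the fan, by the valuative criterion -/

/-- The valuation ring of the field of Hahn series with real exponents. -/
def hahnIntegers (k : Type u) [Field k] : ValuationSubring (HahnSeries ℝ k) where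
  carrier := {x | 0 ≤ x.orderTop}
  zero_mem' := by simp
  one_mem' := by simp
  add_mem' := fun {a b} ha hb => by
    have h : 0 ≤ min a.orderTop b.orderTop := le_min ha hb
    exact h.trans HahnSeries.min_orderTop_le_orderTop_add
  mul_mem' := fun {a b} ha hb => by
    change 0 ≤ (a * b).orderTop
    rw [HahnSeries.orderTop_mul]; exact add_nonneg ha hb
  neg_mem' := fun {a} ha => by
    change 0 ≤ (-a).orderTop
    rwa [HahnSeries.orderTop_neg]
  mem_or_inv_mem' := fun x => by
    by_cases hx : x = 0
    · left; simp [hx]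
    have h1 : x.orderTop + x⁻¹.orderTop = 0 := by
      rw [← HahnSeries.orderTop_mul, mul_inv_cancel₀ hx, HahnSeries.orderTop_one]
    rcases le_total 0 x.orderTop with h | h
    · exact Or.inl h
    · right
      change 0 ≤ x⁻¹.orderTop
      by_contra h2
      have h3 := add_le_add h le_rfl (a := x.orderTop) (c := x⁻¹.orderTop)
      rw [h1, zero_add] at h3
      exact h2 h3

theorem mem_hahnIntegers {k : Type u} [Field k] {x : HahnSeries ℝ k} :
    x ∈ hahnIntegers k ↔ 0 ≤ x.orderTop := by
  rw [← ValuationSubring.mem_carrier]; rfl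

/-- The homomorphism `χ^m ↦ t^{⟨m, v⟩}` to the field of Hahn series. -/
def hahnHom (k : Type u) [Field k] {d : ℕ} (v : Fin d → ℝ) (S : AddSubmonoid (Fin d → ℤ)) :
    AddMonoidAlgebra k S →+* HahnSeries ℝ k :=
  AddMonoidAlgebra.liftNCRingHom HahnSeries.C
    { toFun := fun m => HahnSeries.single (dotR (m.toAdd : Fin d → ℤ) v) 1
      map_one' := by
        simp [dotR_zero]
      map_mul' := fun a b => by
        rw [HahnSeries.single_mul_single, toAdd_mul, AddSubmonoid.coe_add, dotR_add, one_mul,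
          LinearMap.add_apply] }
    fun _ _ => Commute.all _ _

theorem hahnHom_single {k : Type u} [Field k] {d : ℕ} (v : Fin d → ℝ)
    (S : AddSubmonoid (Fin d → ℤ)) (m : S) (c : k) :
    hahnHom k v S (AddMonoidAlgebra.single m c) = HahnSeries.single (dotR (m : Fin d → ℤ) v) c := by
  refine (AddMonoidAlgebra.liftNC_single _ _ _ _).trans ?_
  refine HahnSeries.single_mul_single.trans ?_
  rw [zero_add, mul_one]
  rfl

theorem hahnHom_mem {k : Type u} [Field k] {d : ℕ} {σ : PointedCone ℝ (Fin d → ℝ)} {v : Fin d → ℝ}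
    (hv : v ∈ σ) (a : AddMonoidAlgebra k (dualMonoid σ)) :
    hahnHom k v (dualMonoid σ) a ∈ hahnIntegers k := by
  induction a using AddMonoidAlgebra.induction_linear with
  | zero => rw [map_zero]; exact zero_mem _
  | add a b ha hb => rw [map_add]; exact add_mem ha hb
  | single m c =>
    rw [hahnHom_single, mem_hahnIntegers]
    refine le_trans ?_ HahnSeries.orderTop_single_le
    exact_mod_cast mem_dualMonoid.1 m.2 v hv

namespace ToricStructure

variable {k : Type u} [Field k] {Y : Scheme.{u}} {s : Y ⟶ Spec (CommRingCat.of k)} {d : ℕ}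
  {F : Fan d} (T : ToricStructure s F)

/-- If `Y ⟶ Spec A` is universally closed and the Hahn series valued point of the torus defined by
`v` maps to an integral point of `Spec A`, then `v` is in the support of the fan. -/
theorem exists_mem_cone (T : ToricStructure s F) {A : CommRingCat.{u}} (p : Y ⟶ Spec A)
    [UniversallyClosed p] (v : Fin d → ℝ)
    (o : F.cones) (ho : o.1 = ⊥) (q : A ⟶ CommRingCat.of (AddMonoidAlgebra k (dualMonoid o.1)))
    (hq : T.chart o ≫ p = Spec.map q)
    (hv : ∀ a, hahnHom k v (dualMonoid o.1) (q.hom a) ∈ hahnIntegers k) :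
    ∃ σ ∈ F.cones, v ∈ σ := by
  let β : A →+* hahnIntegers k :=
    RingHom.codRestrict ((hahnHom k v (dualMonoid o.1)).comp q.hom) (hahnIntegers k) hv
  let S : ValuativeCommSq p :=
    { R := hahnIntegers k
      K := HahnSeries ℝ k
      i₁ := Spec.map (CommRingCat.ofHom (hahnHom k v (dualMonoid o.1))) ≫ T.chart o
      i₂ := Spec.map (CommRingCat.ofHom β)
      commSq := ⟨by
        rw [Category.assoc, hq, ← Spec.map_comp, ← Spec.map_comp]
        rfl⟩ }
  have hE : ValuativeCriterion.Existence p := by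
    have h : UniversallyClosed p := inferInstance
    rw [UniversallyClosed.eq_valuativeCriterion] at h
    exact h.1
  obtain ⟨⟨l, hl, -⟩⟩ := (hE S).exists_lift
  -- the lift maps the spectrum of the valuation ring to the chart containing the closed point
  obtain ⟨σ, hσ⟩ := T.cover (l (IsLocalRing.closedPoint (hahnIntegers k)))
  have hr : Set.range l ⊆ Set.range (T.chart σ) := by
    rintro _ ⟨z, rfl⟩
    have h1 : z ⤳ IsLocalRing.closedPoint (hahnIntegers k) := IsLocalRing.specializes_closedPoint z
    exact (h1.map l.continuous).mem_open (T.chart σ).isOpenEmbedding.isOpen_range hσ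
  let g := IsOpenImmersion.lift (T.chart σ) l hr
  have hg : g ≫ T.chart σ = l := IsOpenImmersion.lift_fac _ _ _
  let φ := Spec.preimage g
  have hφ : Spec.map φ = g := Spec.map_preimage g
  have hoσ : o.1 ≤ σ.1 := ho ▸ bot_le
  have h2 : (Spec.map (CommRingCat.ofHom (algebraMap (hahnIntegers k) (HahnSeries ℝ k))) ≫
      Spec.map φ) ≫ T.chart σ = (Spec.map (CommRingCat.ofHom
        (hahnHom k v (dualMonoid o.1))) ≫ affineToricMap k hoσ) ≫ T.chart σ := by
    rw [Category.assoc, Category.assoc, hφ, hg, T.compatible]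
    exact hl
  rw [cancel_mono, affineToricMap, ← Spec.map_comp, ← Spec.map_comp] at h2
  have h3 := Spec.map_injective h2
  obtain ⟨P, hP⟩ := F.exists_isStronglyConvexHull σ.2
  -- so `χ^m` has nonnegative valuation `⟨m, v⟩` for all `m` in the dual monoid
  refine ⟨σ.1, σ.2, hP.mem_iff.2 fun m hm => ?_⟩
  have h4 := congr($(h3).hom (AddMonoidAlgebra.single ⟨m, hm⟩ 1))
  have h5 : ((φ.hom (AddMonoidAlgebra.single ⟨m, hm⟩ 1) : hahnIntegers k) : HahnSeries ℝ k) =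
      HahnSeries.single (dotR m v) 1 := by
    refine h4.trans ?_
    change hahnHom k v _ (AddMonoidAlgebra.mapDomainRingHom k _ (AddMonoidAlgebra.single _ 1)) = _
    rw [AddMonoidAlgebra.mapDomainRingHom_apply, AddMonoidAlgebra.mapDomain_single]
    exact hahnHom_single v (dualMonoid o.1) ⟨m, _⟩ 1
  have h6 := (φ.hom (AddMonoidAlgebra.single ⟨m, hm⟩ 1) : hahnIntegers k).2
  rw [h5, mem_hahnIntegers, HahnSeries.orderTop_single one_ne_zero] at h6
  exact_mod_cast h6

end ToricStructure

/-- The units of the group algebra of a lattice are monomials. -/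
theorem exists_eq_single_of_isUnit {k : Type*} [Field k] {d : ℕ} {S : AddSubmonoid (Fin d → ℤ)}
    {a : AddMonoidAlgebra k S} (ha : IsUnit a) :
    ∃ (m : S) (c : k), c ≠ 0 ∧ a = AddMonoidAlgebra.single m c := by
  classical
  have : TwoUniqueSums S := TwoUniqueSums.of_injective_addHom S.subtype.toAddHom
    Subtype.val_injective inferInstance
  obtain ⟨b, hb⟩ := ha.exists_right_inv
  have ha0 : a ≠ 0 := ha.ne_zero
  have hb0 : b ≠ 0 := by rintro rfl; simp at hb
  -- a sum of exponents of `a` and its inverse that is attained once only is an exponent of `1`;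
  -- if one of the supports had two elements, there would be two such pairs
  have key : ∀ p : S × S, p.1 ∈ a.coeff.support → p.2 ∈ b.coeff.support →
      UniqueAdd a.coeff.support b.coeff.support p.1 p.2 → p.1 + p.2 = 0 := by
    intro p h1 h2 h3
    by_contra h0
    have h4 := AddMonoidAlgebra.coeff_mul_add_of_uniqueAdd h3
    rw [hb] at h4
    have h5 : (1 : AddMonoidAlgebra k S).coeff (p.1 + p.2) = 0 := by
      rw [AddMonoidAlgebra.one_def]
      simp [Ne.symm h0]
    rw [h5] at h4
    rcases mul_eq_zero.1 h4.symm with h | h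
    exacts [Finsupp.mem_support_iff.1 h1 h, Finsupp.mem_support_iff.1 h2 h]
  have hna : a.coeff.support.Nonempty := by
    rw [Finsupp.support_nonempty_iff]
    exact fun h => ha0 (by ext; simp [h])
  have hnb : b.coeff.support.Nonempty := by
    rw [Finsupp.support_nonempty_iff]
    exact fun h => hb0 (by ext; simp [h])
  have hc : a.coeff.support.card * b.coeff.support.card ≤ 1 := by
    by_contra hlt
    obtain ⟨p, hp, q, hq, hpq, hp', hq'⟩ :=
      TwoUniqueSums.uniqueAdd_of_one_lt_card (not_le.1 hlt)
    rw [Finset.mem_product] at hp hq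
    have h1 := key p hp.1 hp.2 hp'
    have h2 := key q hq.1 hq.2 hq'
    have h3 := hp' hq.1 hq.2 (h2.trans h1.symm)
    exact hpq (Prod.ext h3.1.symm h3.2.symm)
  have hc1 : a.coeff.support.card = 1 := by
    have h1 := hna.card_pos
    have h2 := hnb.card_pos
    nlinarith
  obtain ⟨m, hm⟩ := Finset.card_eq_one.1 hc1
  obtain ⟨h1, h2⟩ := Finsupp.support_eq_singleton'.1 hm |>.imp fun c hc => hc
  exact ⟨m, h1, h2.1, by ext x; rw [h2.2]; rfl⟩

/-! ### The support of the fan of a stratum -/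

namespace SNCDivisor

variable {X : Scheme.{u}} [IsIntegral X] {ι : Type} (D : SNCDivisor X ι)

theorem genericPoint_notMem_supp (i : ι) : genericPoint X ∉ D.supp i := by
  rw [D.mem_supp_iff, not_not]
  have h0 : D.loc i (genericPoint X) ≠ 0 := fun h => (D.comp i).eqn_ne_zero (genericPoint X) (by
    rw [D.comp_eqn, h, map_zero])
  let _ : Field (X.presheaf.stalk (genericPoint X)) := inferInstanceAs (Field X.functionField)
  exact isUnit_iff_ne_zero.2 h0

/-- If the hypersurface `a = 0` is contained in `D`, then it contains a component of `D` through
each of its points. -/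
theorem exists_supp_subset [IsLocallyNoetherian X] {A : CommRingCat.{u}} (p : X ⟶ Spec A) (a : A)
    (hp : ∀ x : X, a ∈ (p x).asIdeal → ∃ i, x ∈ D.supp i) (x : X) (hx : a ∈ (p x).asIdeal) :
    ∃ i, x ∈ D.supp i ∧ ∀ y ∈ D.supp i, a ∈ (p y).asIdeal := by
  have hclosed : ∀ y z : X, y ⤳ z → a ∈ (p y).asIdeal → a ∈ (p z).asIdeal := fun y z h hy =>
    (PrimeSpectrum.le_iff_specializes _ _).2 (h.map p.continuous) hy
  let α := Spec.preimage (X.fromSpecStalk x ≫ p)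
  have hα : Spec.map α = X.fromSpecStalk x ≫ p := Spec.map_preimage _
  have hmem : ∀ q : Spec (X.presheaf.stalk x),
      a ∈ (p (X.fromSpecStalk x q)).asIdeal ↔ α.hom a ∈ q.asIdeal := by
    intro q
    rw [← Scheme.Hom.comp_apply, ← hα]
    rfl
  have hrange : ∀ y : X, y ⤳ x → ∃ q, X.fromSpecStalk x q = y := fun y hy => by
    have : y ∈ Set.range (X.fromSpecStalk x) := by rw [Scheme.range_fromSpecStalk]; exact hy
    exact this
  have hspec : ∀ q, X.fromSpecStalk x q ⤳ x := fun q => by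
    have : X.fromSpecStalk x q ∈ Set.range (X.fromSpecStalk x) := ⟨q, rfl⟩
    rwa [Scheme.range_fromSpecStalk] at this
  by_cases h0 : α.hom a = 0
  · obtain ⟨i, hi⟩ := hp x hx
    refine ⟨i, hi, fun y _ => ?_⟩
    obtain ⟨q, hq⟩ := hrange _ (genericPoint_specializes x)
    refine hclosed _ _ (genericPoint_specializes y) ?_
    rw [← hq, hmem, h0]
    exact zero_mem _
  obtain ⟨c, hc⟩ := hrange x specializes_rfl
  have hac : Ideal.span {α.hom a} ≤ c.asIdeal := by
    rw [Ideal.span_singleton_le_iff_mem, ← hmem, hc]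
    exact hx
  have hcp : c.asIdeal.IsPrime := PrimeSpectrum.isPrime c
  -- a minimal prime over `a` in the local ring at `x` has height at most one and contains the
  -- prime of a component of `D`, which is not zero, so the two are equal
  obtain ⟨P, hP, -⟩ := Ideal.exists_minimalPrimes_le hac
  have hPp : P.IsPrime := hP.1.1
  have hh : P.height ≤ 1 := Ideal.height_le_one_of_isPrincipal_of_mem_minimalPrimes _ P hP
  let x' := X.fromSpecStalk x ⟨P, hPp⟩
  have hx' : a ∈ (p x').asIdeal := (hmem _).2 (hP.1.2 (Ideal.mem_span_singleton_self _))
  obtain ⟨j, hj⟩ := hp x' hx'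
  let η := (D.irreducible j).genericPoint
  have hη : IsGenericPoint η (D.supp j) := by
    exact (D.irreducible j).isGenericPoint_genericPoint (D.isClosed_supp j)
  have hηx' : η ⤳ x' := hη.specializes hj
  obtain ⟨Q, hQ⟩ := hrange η (hηx'.trans (hspec _))
  have hind := (X.fromSpecStalk x).isEmbedding.isInducing
  have hQP : Q.asIdeal ≤ P := by
    refine (PrimeSpectrum.le_iff_specializes Q ⟨P, hPp⟩).2 (hind.specializes_iff.1 ?_)
    rw [hQ]
    exact hηx'
  have hQ0 : Q.asIdeal ≠ ⊥ := by
    intro hb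
    obtain ⟨G, hG⟩ := hrange _ (genericPoint_specializes x)
    have h1 : Q ⤳ G := (PrimeSpectrum.le_iff_specializes Q G).1
      ((PrimeSpectrum.asIdeal_le_asIdeal Q G).1 (hb.le.trans bot_le))
    have h2 := h1.map (X.fromSpecStalk x).continuous
    rw [hQ, hG] at h2
    exact D.genericPoint_notMem_supp j (h2.mem_closed (D.isClosed_supp j) hη.mem)
  have hQP' : Q.asIdeal = P := by
    by_contra hne
    have h1 := (Ideal.height_le_iff).1 hh Q.asIdeal Q.2 (lt_of_le_of_ne hQP hne)
    have h2 : Q.asIdeal.height = 0 := by simpa using h1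
    exact hQ0 (Ideal.height_eq_zero_iff_eq_bot.1 h2)
  have hPQ : (⟨P, hPp⟩ : Spec (X.presheaf.stalk x)) = Q := PrimeSpectrum.ext hQP'.symm
  refine ⟨j, (hspec _).mem_closed (D.isClosed_supp j) hj, fun y hy => ?_⟩
  refine hclosed _ _ (hη.specializes hy) ?_
  rw [← hQ, ← hPQ]
  exact hx'

end SNCDivisor

section

variable {k : Type u} [Field k] {X : Scheme.{u}} [IsIntegral X]
  {s : X ⟶ Spec (CommRingCat.of k)} {ι : Type} {D : SNCDivisor X ι} {τ : Finset ι} {d : ℕ}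
  {F : Fan d}

theorem SNCDivisor.IsCone.nonempty_redSubscheme {ρ : Finset ι} (h : D.IsCone ρ) :
    Nonempty (redSubscheme (D.stratum ρ)) := by
  obtain ⟨x, hx⟩ := h
  rw [← range_redι] at hx
  exact ⟨hx.choose⟩

theorem SNCDivisor.mem_stratum {ρ : Finset ι} {x : X} :
    x ∈ (D.stratum ρ : Set X) ↔ ∀ i ∈ ρ, x ∈ D.supp i := Set.mem_iInter₂

theorem ToricStructure.isIntegral_stratum (T : ToricStructure (redι (D.stratum τ) ≫ s) F)
    (hτ : D.IsCone τ) : IsIntegral (redSubscheme (D.stratum τ)) :=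
  have := hτ.nonempty_redSubscheme
  T.isIntegral

theorem SNCDivisor.StratificationAgrees.exists_eq
    {T : ToricStructure (redι (D.stratum τ) ≫ s) F} (hT : D.StratificationAgrees τ T)
    {ρ : Finset ι} (hρ : D.IsCone ρ) (hτρ : τ ⊆ ρ) :
    ∃ ω, (D.stratum ρ : Set X) = redι (D.stratum τ) '' T.closedStratum ω := by
  have : (D.stratum ρ : Set X) ∈ {Z : Set X | ∃ ρ, D.IsCone ρ ∧ τ ⊆ ρ ∧ Z = D.stratum ρ} :=
    ⟨ρ, hρ, hτρ, rfl⟩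
  rw [hT] at this
  exact this

theorem SNCDivisor.StratificationAgrees.exists_cone_eq
    {T : ToricStructure (redι (D.stratum τ) ≫ s) F} (hT : D.StratificationAgrees τ T)
    (ω : F.cones) : ∃ ρ, D.IsCone ρ ∧ τ ⊆ ρ ∧
      (D.stratum ρ : Set X) = redι (D.stratum τ) '' T.closedStratum ω := by
  have : redι (D.stratum τ) '' T.closedStratum ω ∈
      {Z : Set X | ∃ σ, Z = redι (D.stratum τ) '' T.closedStratum σ} := ⟨ω, rfl⟩
  rw [← hT] at this
  obtain ⟨ρ, h1, h2, h3⟩ := this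
  exact ⟨ρ, h1, h2, h3.symm⟩

/-- A component of `D` through a point of the open torus contains the stratum. -/
theorem SNCDivisor.StratificationAgrees.mem_supp_of_mem_torus [DecidableEq ι]
    {T : ToricStructure (redι (D.stratum τ) ≫ s) F} (hT : D.StratificationAgrees τ T)
    (hτ : D.IsCone τ) (o : F.cones) (ho : o.1 = ⊥) (z : affineToric k o.1) {i : ι}
    (hi : T.emb o z ∈ D.supp i) (y : redSubscheme (D.stratum τ)) :
    redι (D.stratum τ) y ∈ D.supp i := by
  have hz : T.emb o z ∈ (D.stratum (insert i τ) : Set X) := by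
    rw [SNCDivisor.mem_stratum]
    intro j hj
    rcases Finset.mem_insert.1 hj with rfl | hj
    · exact hi
    · exact T.emb_mem_supp o hj z
  obtain ⟨ω, hω⟩ := hT.exists_eq ⟨_, hz⟩ (Finset.subset_insert i τ)
  have := T.isIntegral_stratum hτ
  rw [hω] at hz
  obtain ⟨w, hw, hwz⟩ := hz
  rw [ToricStructure.emb, Scheme.Hom.comp_apply] at hwz
  have h1 := (redι (D.stratum τ)).isEmbedding.injective hwz
  have h2 : ω.1 ≤ o.1 := T.le_of_mem_closedStratum hw (h1 ▸ ⟨z, rfl⟩)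
  rw [ho, le_bot_iff] at h2
  have h3 : redι (D.stratum τ) y ∈ (D.stratum (insert i τ) : Set X) := by
    rw [hω, T.closedStratum_eq_univ_of_eq_bot ω h2]
    exact ⟨y, trivial, rfl⟩
  exact SNCDivisor.mem_stratum.1 h3 i (Finset.mem_insert_self _ _)

/-- The support of the fan of a toric stratum is a rational half-space or the whole space, the
latter if `X` is proper. In the relative case the stratum is proper over the affine line, and the
restriction of the coordinate to the torus is zero or a unit, hence a monomial `c χ^m`, as its zeros
are in components of `D`, which do not meet the torus unless they contain the stratum. The support
is then given by `0 ≤ m`. -/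
theorem ToricStructure.exists_support_eq (T : ToricStructure (redι (D.stratum τ) ≫ s) F)
    [LocallyOfFiniteType s] (hτ : D.IsCone τ) (hT : D.StratificationAgrees τ T)
    (hX : D.AbsoluteOrRelative s) :
    ∃ m : Fin d → ℤ, (∀ x, (∃ σ ∈ F.cones, x ∈ σ) ↔ 0 ≤ dotR m x) ∧ (IsProper s → m = 0) := by
  classical
  have hne := hτ.nonempty_redSubscheme
  have hint := T.isIntegral_stratum hτ
  let o : F.cones := ⟨⊥, F.bot_mem T.cones_nonempty⟩
  by_cases hs : IsProper s
  · refine ⟨0, fun x => ⟨fun _ => by rw [dotR_zero]; rfl, fun _ => ?_⟩, fun _ => rfl⟩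
    refine T.exists_mem_cone (redι (D.stratum τ) ≫ s) x o rfl _ (T.chart_over o) fun a => ?_
    have : (algebraMap k (AddMonoidAlgebra k (dualMonoid o.1)) a) = AddMonoidAlgebra.single 0 a := rfl
    change hahnHom k x (dualMonoid o.1) (algebraMap k _ a) ∈ _
    rw [this, hahnHom_single, mem_hahnIntegers]
    refine le_trans ?_ HahnSeries.orderTop_single_le
    rw [AddSubmonoid.coe_zero, dotR_zero]
    rfl
  obtain ⟨p, hps, hp, hpD⟩ := hX.resolve_left hs
  have hnoeth : IsLocallyNoetherian X := LocallyOfFiniteType.isLocallyNoetherian s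
  let pY : redSubscheme (D.stratum τ) ⟶ Spec (CommRingCat.of (Polynomial k)) :=
    redι (D.stratum τ) ≫ p
  have hpY : IsProper pY := inferInstance
  let q := fun σ : F.cones => Spec.preimage (T.chart σ ≫ pY)
  have hq : ∀ σ, T.chart σ ≫ pY = Spec.map (q σ) := fun σ => (Spec.map_preimage _).symm
  have hqC : ∀ c, (q o).hom (Polynomial.C c) = AddMonoidAlgebra.single 0 c := by
    have h1 : T.chart o ≫ pY ≫ Spec.map (CommRingCat.ofHom Polynomial.C) = _ :=
      (by rw [Category.assoc, hps] : _ = T.chart o ≫ redι (D.stratum τ) ≫ s).trans (T.chart_over o)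
    rw [← Category.assoc, hq, ← Spec.map_comp] at h1
    intro c
    exact congr($(Spec.map_injective h1).hom c)
  -- the restriction of the coordinate of the affine line to the torus
  let Q := (q o).hom Polynomial.X
  have hin : ∀ x : Fin d → ℝ, hahnHom k x (dualMonoid o.1) Q ∈ hahnIntegers k →
      ∃ σ ∈ F.cones, x ∈ σ := by
    intro x hx
    refine T.exists_mem_cone pY x o rfl (q o) (hq o) fun a => ?_
    induction a using Polynomial.induction_on' with
    | add f g hf hg => rw [map_add, map_add]; exact add_mem hf hg
    | monomial j c =>
      rw [← Polynomial.C_mul_X_pow_eq_monomial, map_mul, map_mul, map_pow, map_pow, hqC,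
        hahnHom_single]
      refine mul_mem ?_ (pow_mem hx _)
      rw [mem_hahnIntegers]
      refine le_trans ?_ HahnSeries.orderTop_single_le
      rw [AddSubmonoid.coe_zero, dotR_zero]
      rfl
  have hout : ∀ x : Fin d → ℝ, (∃ σ ∈ F.cones, x ∈ σ) →
      hahnHom k x (dualMonoid o.1) Q ∈ hahnIntegers k := by
    rintro x ⟨σ, hσ, hx⟩
    have h1 : q o = q ⟨σ, hσ⟩ ≫ CommRingCat.ofHom (AddMonoidAlgebra.mapDomainRingHom k
        (AddSubmonoid.inclusion (dualMonoid_anti (bot_le : o.1 ≤ σ)))) := by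
      apply Spec.map_injective
      rw [Spec.map_comp, ← hq, ← hq, ← Category.assoc]
      exact congrArg (· ≫ pY) (T.compatible o ⟨σ, hσ⟩ bot_le).symm
    have h2 : ∀ b, hahnHom k x (dualMonoid o.1) (AddMonoidAlgebra.mapDomainRingHom k
        (AddSubmonoid.inclusion (dualMonoid_anti (bot_le : o.1 ≤ σ))) b) =
          hahnHom k x (dualMonoid σ) b := by
      intro b
      induction b using AddMonoidAlgebra.induction_linear with
      | zero => simp only [map_zero]
      | add a b ha hb => simp only [map_add, ha, hb]
      | single m c =>
        rw [AddMonoidAlgebra.mapDomainRingHom_apply, AddMonoidAlgebra.mapDomain_single,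
          hahnHom_single]
        exact (hahnHom_single x (dualMonoid σ) m c).symm
    have h3 : Q = AddMonoidAlgebra.mapDomainRingHom k
        (AddSubmonoid.inclusion (dualMonoid_anti (bot_le : o.1 ≤ σ)))
        ((q ⟨σ, hσ⟩).hom Polynomial.X) := congr($(h1).hom Polynomial.X)
    rw [h3, h2]
    exact hahnHom_mem hx _
  by_cases hQ0 : Q = 0
  · refine ⟨0, fun x => ⟨fun _ => by rw [dotR_zero]; rfl, fun _ => hin x ?_⟩, fun _ => rfl⟩
    rw [hQ0, map_zero]
    exact zero_mem _
  by_cases hQu : IsUnit Q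
  · obtain ⟨m, c, hc, hm⟩ := exists_eq_single_of_isUnit hQu
    have hiff : ∀ x, hahnHom k x (dualMonoid o.1) Q ∈ hahnIntegers k ↔ 0 ≤ dotR (m : Fin d → ℤ) x := by
      intro x
      rw [hm, hahnHom_single, mem_hahnIntegers, HahnSeries.orderTop_single hc]
      exact_mod_cast Iff.rfl
    exact ⟨m, fun x => ⟨fun h => (hiff x).1 (hout x h), fun h => hin x ((hiff x).2 h)⟩,
      fun h => (hs h).elim⟩
  exfalso
  obtain ⟨I, hI, hQI⟩ := exists_max_ideal_of_mem_nonunits hQu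
  have hmem : ∀ z : affineToric k o.1, Polynomial.X ∈ (p (T.emb o z)).asIdeal ↔ Q ∈ z.asIdeal := by
    intro z
    have h1 : T.emb o ≫ p = Spec.map (q o) := (Category.assoc _ _ _).trans (hq o)
    rw [← Scheme.Hom.comp_apply, h1]
    rfl
  obtain ⟨i, hi, hi'⟩ := D.exists_supp_subset p Polynomial.X hpD (T.emb o ⟨I, hI.isPrime⟩)
    ((hmem _).2 hQI)
  have hall : ∀ z : affineToric k o.1, Q ∈ z.asIdeal := fun z => (hmem z).1 (hi' _ (by
    have := hT.mem_supp_of_mem_torus hτ o rfl ⟨I, hI.isPrime⟩ hi (T.chart o z)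
    rwa [ToricStructure.emb, Scheme.Hom.comp_apply]))
  exact hQ0 (by simpa using hall ⟨⊥, Ideal.isPrime_bot⟩)

end

/-! ### Cartier divisors and their restrictions -/

/-- Two rational functions differ by a unit of the local ring at `y`. -/
def UnitEq {Y : Scheme.{u}} [IsIntegral Y] (y : Y) (a b : Y.functionField) : Prop :=
  ∃ v : (Y.presheaf.stalk y)ˣ,
    a = algebraMap (Y.presheaf.stalk y) Y.functionField (v : Y.presheaf.stalk y) * b

namespace UnitEq

variable {Y : Scheme.{u}} [IsIntegral Y] {y : Y} {a b c a' b' : Y.functionField}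

theorem refl (a : Y.functionField) : UnitEq y a a := ⟨1, by simp⟩

theorem symm (h : UnitEq y a b) : UnitEq y b a := by
  obtain ⟨v, rfl⟩ := h
  refine ⟨v⁻¹, ?_⟩
  rw [← mul_assoc, ← map_mul, Units.inv_mul, map_one, one_mul]

theorem trans (h : UnitEq y a b) (h' : UnitEq y b c) : UnitEq y a c := by
  obtain ⟨v, rfl⟩ := h
  obtain ⟨w, rfl⟩ := h'
  exact ⟨v * w, by rw [Units.val_mul, map_mul, mul_assoc]⟩

theorem mul (h : UnitEq y a b) (h' : UnitEq y a' b') : UnitEq y (a * a') (b * b') := by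
  obtain ⟨v, rfl⟩ := h
  obtain ⟨w, rfl⟩ := h'
  exact ⟨v * w, by rw [Units.val_mul, map_mul]; ring⟩

theorem inv (h : UnitEq y a b) : UnitEq y a⁻¹ b⁻¹ := by
  obtain ⟨v, rfl⟩ := h
  refine ⟨v⁻¹, ?_⟩
  rw [mul_inv]
  congr 1
  refine (eq_inv_of_mul_eq_one_left ?_).symm
  rw [← map_mul, Units.inv_mul, map_one]

theorem div (h : UnitEq y a b) (h' : UnitEq y a' b') : UnitEq y (a / a') (b / b') := by
  rw [div_eq_mul_inv, div_eq_mul_inv]; exact h.mul h'.inv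

theorem of_isUnit {v : Y.presheaf.stalk y} (hv : IsUnit v) :
    UnitEq y (algebraMap (Y.presheaf.stalk y) Y.functionField v) 1 :=
  ⟨hv.unit, by rw [mul_one]; rfl⟩

end UnitEq

namespace CartierDivisor

variable {X C : Scheme.{u}} [IsIntegral X] [IsIntegral C] (E : CartierDivisor X) (i : C ⟶ X)

theorem unitEq_of_specializes {y z : X} (h : y ⤳ z) : UnitEq y (E.eqn z) (E.eqn y) := by
  obtain ⟨U, hz, hU⟩ := E.locally_eq z
  exact UnitEq.symm (hU y (h.mem_open U.isOpen hz))

theorem ratSection_eq {z : C} {a : X.presheaf.stalk (i (genericPoint C))}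
    (ha : E.eqn (i z) = algebraMap _ X.functionField a * E.eqn (i (genericPoint C))) :
    E.ratSection i z = (i.stalkMap (genericPoint C)).hom a := by
  obtain ⟨v, hv⟩ := E.unitEq_of_specializes
    ((genericPoint_specializes z).map i.continuous : i (genericPoint C) ⤳ i z)
  have h : ∃ a : (X.presheaf.stalk (i (genericPoint C)))ˣ,
      E.eqn (i z) = algebraMap (X.presheaf.stalk (i (genericPoint C))) X.functionField
        (a : X.presheaf.stalk (i (genericPoint C))) * E.eqn (i (genericPoint C)) := ⟨v, hv⟩
  rw [ratSection, dif_pos h]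
  congr 1
  exact IsFractionRing.injective (X.presheaf.stalk (i (genericPoint C))) X.functionField
    (mul_right_cancel₀ (E.eqn_ne_zero _) (h.choose_spec.symm.trans ha))

theorem exists_unit_eqn_eq (z : C) : ∃ a : (X.presheaf.stalk (i (genericPoint C)))ˣ,
    E.eqn (i z) = algebraMap _ X.functionField (a : X.presheaf.stalk (i (genericPoint C))) *
      E.eqn (i (genericPoint C)) :=
  E.unitEq_of_specializes
    ((genericPoint_specializes z).map i.continuous : i (genericPoint C) ⤳ i z)

omit [IsIntegral X] in
/-- The stalk maps commute with the passage to the generic point. -/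
theorem algebraMap_stalkMap (z : C) (b : X.presheaf.stalk (i z)) :
    algebraMap (C.presheaf.stalk z) C.functionField (i.stalkMap z b) =
      (i.stalkMap (genericPoint C)).hom ((X.presheaf.stalkSpecializes
        ((genericPoint_specializes z).map i.continuous)).hom b) :=
  (Scheme.Hom.stalkSpecializes_stalkMap_apply i (genericPoint C) z
    (genericPoint_specializes z) b).symm

theorem algebraMap_stalkSpecializes {y z : X} (h : y ⤳ z) (b : X.presheaf.stalk z) :
    algebraMap (X.presheaf.stalk y) X.functionField ((X.presheaf.stalkSpecializes h).hom b) =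
      algebraMap (X.presheaf.stalk z) X.functionField b :=
  congr($(X.presheaf.stalkSpecializes_comp ((genericPoint_spec X).specializes trivial) h).hom b)

/-- The restriction of a Cartier divisor, normalized at the generic point. -/
def restrict : CartierDivisor C where
  eqn := E.ratSection i
  eqn_ne_zero z := by
    obtain ⟨a, ha⟩ := E.exists_unit_eqn_eq i z
    rw [E.ratSection_eq i ha]
    exact (a.isUnit.map (i.stalkMap (genericPoint C)).hom).ne_zero
  locally_eq z := by
    obtain ⟨U, hzU, hU⟩ := E.locally_eq (i z)
    refine ⟨i ⁻¹ᵁ U, hzU, fun w hw => ?_⟩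
    obtain ⟨b, hb⟩ := hU (i w) hw
    obtain ⟨a, ha⟩ := E.exists_unit_eqn_eq i z
    have hs := ((genericPoint_specializes w).map i.continuous : i (genericPoint C) ⤳ i w)
    have h1 : E.eqn (i w) = algebraMap _ X.functionField
        ((X.presheaf.stalkSpecializes hs).hom (b : X.presheaf.stalk (i w)) *
          (a : X.presheaf.stalk (i (genericPoint C)))) * E.eqn (i (genericPoint C)) := by
      rw [map_mul, algebraMap_stalkSpecializes, mul_assoc, ← ha, hb]
    refine ⟨Units.map (i.stalkMap w).hom b, ?_⟩
    rw [E.ratSection_eq i h1, E.ratSection_eq i ha, map_mul]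
    congr 1
    exact (algebraMap_stalkMap i w b).symm

/-- The restriction of Cartier divisors is functorial. -/
theorem ratSection_comp {Y : Scheme.{u}} [IsIntegral Y] (h : C ⟶ Y) (i : Y ⟶ X) (z : C) :
    (E.restrict i).ratSection h z = E.ratSection (h ≫ i) z := by
  obtain ⟨a, ha⟩ : ∃ a : (X.presheaf.stalk (i (h (genericPoint C))))ˣ, E.eqn (i (h z)) =
      algebraMap _ X.functionField (a : X.presheaf.stalk (i (h (genericPoint C)))) *
        E.eqn (i (h (genericPoint C))) := E.exists_unit_eqn_eq (h ≫ i) z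
  refine Eq.trans ?_ (E.ratSection_eq (h ≫ i) (z := z)
    (a := (a : X.presheaf.stalk (i (h (genericPoint C))))) ha).symm
  obtain ⟨b, hb⟩ := E.exists_unit_eqn_eq i (h (genericPoint C))
  have hs := ((genericPoint_specializes (h (genericPoint C))).map i.continuous :
    i (genericPoint Y) ⤳ i (h (genericPoint C)))
  have h1 : E.eqn (i (h z)) = algebraMap _ X.functionField
        ((X.presheaf.stalkSpecializes hs).hom (a : X.presheaf.stalk (i (h (genericPoint C)))) *
          (b : X.presheaf.stalk (i (genericPoint Y)))) * E.eqn (i (genericPoint Y)) := by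
    rw [map_mul, algebraMap_stalkSpecializes, mul_assoc, ← hb]
    exact ha
  have h2 : (E.restrict i).eqn (h z) = algebraMap _ Y.functionField
      (i.stalkMap (h (genericPoint C)) (a : X.presheaf.stalk (i (h (genericPoint C))))) *
        (E.restrict i).eqn (h (genericPoint C)) := by
    change E.ratSection i (h z) = _ * E.ratSection i (h (genericPoint C))
    rw [E.ratSection_eq i h1, E.ratSection_eq i hb, map_mul]
    congr 1
    exact (algebraMap_stalkMap i (h (genericPoint C)) _).symm
  rw [(E.restrict i).ratSection_eq h h2]
  exact congr($(Scheme.Hom.stalkMap_comp h i (genericPoint C)).hom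
    (a : X.presheaf.stalk (i (h (genericPoint C))))).symm

end CartierDivisor

/-- The rational section of a component not containing the image of `i` is given by its local
equations. -/
theorem SNCDivisor.ratSection_comp_eq {X C : Scheme.{u}} [IsIntegral X] [IsIntegral C] {ι : Type}
    (D : SNCDivisor X ι) (i : C ⟶ X) {l : ι} (hl : i (genericPoint C) ∉ D.supp l) (z : C) :
    (D.comp l).ratSection i z * (i.stalkMap (genericPoint C)).hom (D.loc l (i (genericPoint C))) =
      algebraMap (C.presheaf.stalk z) C.functionField (i.stalkMap z (D.loc l (i z))) := by
  rw [D.mem_supp_iff, not_not] at hl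
  have hs := ((genericPoint_specializes z).map i.continuous : i (genericPoint C) ⤳ i z)
  have h1 : (D.comp l).eqn (i z) = algebraMap _ X.functionField
      ((X.presheaf.stalkSpecializes hs).hom (D.loc l (i z)) *
        ((hl.unit⁻¹ : (X.presheaf.stalk (i (genericPoint C)))ˣ) :
          X.presheaf.stalk (i (genericPoint C)))) * (D.comp l).eqn (i (genericPoint C)) := by
    rw [map_mul, CartierDivisor.algebraMap_stalkSpecializes, mul_assoc, D.comp_eqn, D.comp_eqn,
      ← map_mul, IsUnit.val_inv_mul, map_one, mul_one]
  rw [(D.comp l).ratSection_eq i h1, ← map_mul, mul_assoc, IsUnit.val_inv_mul, mul_one]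
  exact (CartierDivisor.algebraMap_stalkMap i z _).symm

/-! ### Affine charts of integral schemes -/

section

/-- The localization map from a ring to a stalk of its spectrum. -/
def toStalkHom (R : CommRingCat.{u}) (x : Spec R) : R →+* (Spec R).presheaf.stalk x :=
  (StructureSheaf.toStalk R x).hom

theorem isUnit_toStalkHom_iff {R : Type u} [CommRing R] (x : PrimeSpectrum R) (r : R) :
    IsUnit (toStalkHom (CommRingCat.of R) x r) ↔ r ∉ x.asIdeal :=
  IsLocalization.AtPrime.isUnit_to_map_iff
    ((Spec.structureSheaf R).presheaf.stalk x) x.asIdeal r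

theorem exists_mul_toStalkHom_eq {R : Type u} [CommRing R] (x : PrimeSpectrum R)
    (v : (Spec (CommRingCat.of R)).presheaf.stalk x) : ∃ (r : R) (t : R), t ∉ x.asIdeal ∧
      v * toStalkHom (CommRingCat.of R) x t = toStalkHom (CommRingCat.of R) x r := by
  obtain ⟨⟨r, t⟩, hrt⟩ := IsLocalization.surj (S := (Spec.structureSheaf R).presheaf.stalk x)
    x.asIdeal.primeCompl v
  exact ⟨r, t, t.2, hrt⟩

variable {R : CommRingCat.{u}} {Y : Scheme.{u}} (j : Spec R ⟶ Y) [IsOpenImmersion j]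

/-- The value in the stalk of a function on an affine chart. -/
def evalStalk (x : Spec R) : R →+* Y.presheaf.stalk (j x) :=
  (inv (j.stalkMap x)).hom.comp (toStalkHom R x)

theorem stalkMap_evalStalk (x : Spec R) (r : R) :
    j.stalkMap x (evalStalk j x r) = toStalkHom R x r := by
  change (inv (j.stalkMap x) ≫ j.stalkMap x).hom (toStalkHom R x r) = _
  rw [IsIso.inv_hom_id]
  rfl

theorem stalkMap_injective_of_isOpenImmersion {X : Scheme.{u}} (j : X ⟶ Y) [IsOpenImmersion j]
    (x : X) : Function.Injective (j.stalkMap x) :=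
  (ConcreteCategory.bijective_of_isIso (j.stalkMap x)).1

theorem isUnit_evalStalk_iff (x : Spec R) (r : R) : IsUnit (evalStalk j x r) ↔ r ∉ x.asIdeal := by
  have h1 : IsUnit (toStalkHom R x r) ↔ r ∉ x.asIdeal := isUnit_toStalkHom_iff (R := R) x r
  rw [← h1, ← stalkMap_evalStalk j x r]
  exact ⟨fun h => h.map (j.stalkMap x).hom, fun h => by
    have := h.map (inv (j.stalkMap x)).hom
    have h2 : (inv (j.stalkMap x)).hom (j.stalkMap x (evalStalk j x r)) = evalStalk j x r :=
      congr($(IsIso.hom_inv_id (j.stalkMap x)).hom (evalStalk j x r))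
    exact h2 ▸ this⟩

theorem exists_mul_evalStalk_eq (x : Spec R) (v : Y.presheaf.stalk (j x)) :
    ∃ r, ∃ t ∉ x.asIdeal, v * evalStalk j x t = evalStalk j x r := by
  obtain ⟨r, t, ht, hrt⟩ := exists_mul_toStalkHom_eq (R := R) x (j.stalkMap x v)
  refine ⟨r, t, ht, stalkMap_injective_of_isOpenImmersion j x ?_⟩
  rw [map_mul, stalkMap_evalStalk, stalkMap_evalStalk]
  exact hrt

theorem evalStalk_specializes {x y : Spec R} (h : x ⤳ y) (r : R) :
    (Y.presheaf.stalkSpecializes (h.map j.continuous)).hom (evalStalk j y r) = evalStalk j x r := by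
  apply stalkMap_injective_of_isOpenImmersion j x
  rw [stalkMap_evalStalk]
  refine (Scheme.Hom.stalkSpecializes_stalkMap_apply j x y h _).trans ?_
  rw [stalkMap_evalStalk]
  exact congr($(StructureSheaf.toStalk_stalkSpecializes h).hom r)

variable [IsIntegral Y] [IsDomain R]

/-- The rational function defined by a function on an affine chart. -/
def evalHom : R →+* Y.functionField :=
  (algebraMap (Y.presheaf.stalk (j (⊥ : PrimeSpectrum R))) Y.functionField).comp (evalStalk j _)

theorem algebraMap_evalStalk (x : Spec R) (r : R) :
    algebraMap (Y.presheaf.stalk (j x)) Y.functionField (evalStalk j x r) = evalHom j r := by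
  have h : (⊥ : PrimeSpectrum R) ⤳ x := (PrimeSpectrum.le_iff_specializes _ _).1 bot_le
  rw [evalHom, RingHom.comp_apply]
  refine Eq.trans ?_ (congrArg _ (evalStalk_specializes j h r))
  exact (CartierDivisor.algebraMap_stalkSpecializes (h.map j.continuous) _).symm

theorem evalHom_injective : Function.Injective (evalHom j) := by
  rw [injective_iff_map_eq_zero]
  intro r hr
  by_contra h0
  have h1 : IsUnit (evalStalk j (⊥ : PrimeSpectrum R) r) := (isUnit_evalStalk_iff j _ r).2 h0
  exact (h1.map (algebraMap (Y.presheaf.stalk (j (⊥ : PrimeSpectrum R))) Y.functionField)).ne_zero hr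

theorem isFractionRing_evalHom :
    @IsFractionRing R _ Y.functionField _ (evalHom j).toAlgebra := by
  let _ := (evalHom j).toAlgebra
  have hinj : Function.Injective (algebraMap R Y.functionField) := evalHom_injective j
  have hs : ∀ v : Y.presheaf.stalk (j (⊥ : PrimeSpectrum R)), ∃ r t, t ≠ 0 ∧
      algebraMap _ Y.functionField v * evalHom j t = evalHom j r := fun v => by
    obtain ⟨r, t, ht, h⟩ := exists_mul_evalStalk_eq j (⊥ : PrimeSpectrum R) v
    refine ⟨r, t, ht, ?_⟩
    rw [← algebraMap_evalStalk j (⊥ : PrimeSpectrum R), ← algebraMap_evalStalk j (⊥ : PrimeSpectrum R),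
      ← map_mul, h]
  have : FaithfulSMul R Y.functionField := (faithfulSMul_iff_algebraMap_injective _ _).2 hinj
  refine IsFractionRing.of_field R Y.functionField fun z => ?_
  obtain ⟨a, b, hb, rfl⟩ :=
    IsFractionRing.div_surjective (A := Y.presheaf.stalk (j (⊥ : PrimeSpectrum R))) z
  have hb0 : algebraMap _ Y.functionField b ≠ 0 :=
    IsFractionRing.to_map_ne_zero_of_mem_nonZeroDivisors hb
  obtain ⟨r, t, ht, h⟩ := hs a
  obtain ⟨r', t', ht', h'⟩ := hs b
  have ht0 : evalHom j t ≠ 0 := (map_ne_zero_iff _ (evalHom_injective j)).2 ht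
  have ht0' : evalHom j t' ≠ 0 := (map_ne_zero_iff _ (evalHom_injective j)).2 ht'
  have hr0 : evalHom j r' ≠ 0 := h' ▸ mul_ne_zero hb0 ht0'
  refine ⟨r * t', r' * t, ?_⟩
  change _ = evalHom j _ / evalHom j _
  rw [div_eq_div_iff hb0 (by rw [map_mul]; exact mul_ne_zero hr0 ht0), map_mul, map_mul, ← h, ← h']
  ring

theorem unitEq_iff (x : Spec R) (a b : Y.functionField) : UnitEq (j x) a b ↔
    ∃ r ∉ x.asIdeal, ∃ t ∉ x.asIdeal, evalHom j t * a = evalHom j r * b := by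
  constructor
  · rintro ⟨v, rfl⟩
    obtain ⟨r, t, ht, h⟩ := exists_mul_evalStalk_eq j x v
    refine ⟨r, ?_, t, ht, ?_⟩
    · rw [← isUnit_evalStalk_iff j, ← h]
      exact v.isUnit.mul ((isUnit_evalStalk_iff j x t).2 ht)
    · rw [← algebraMap_evalStalk j x t, ← algebraMap_evalStalk j x r, ← h, map_mul]
      ring
  · rintro ⟨r, hr, t, ht, h⟩
    have h1 := UnitEq.of_isUnit ((isUnit_evalStalk_iff j x r).2 hr)
    have h2 := UnitEq.of_isUnit ((isUnit_evalStalk_iff j x t).2 ht)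
    rw [algebraMap_evalStalk] at h1 h2
    have ht0 : evalHom j t ≠ 0 := by
      rw [← algebraMap_evalStalk j x]
      exact (((isUnit_evalStalk_iff j x t).2 ht).map _).ne_zero
    have h3 : a = (evalHom j t)⁻¹ * (evalHom j r * b) := by
      rw [← h, inv_mul_cancel_left₀ ht0]
    rw [h3]
    have h4 := h2.inv.mul (h1.mul (UnitEq.refl (y := j x) b))
    rwa [inv_one, one_mul, one_mul] at h4

theorem evalHom_comp {R' : CommRingCat.{u}} [IsDomain R'] (φ : R ⟶ R') (j' : Spec R' ⟶ Y)
    [IsOpenImmersion j'] (h : Spec.map φ ≫ j = j') (r : R) :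
    evalHom j' (φ.hom r) = evalHom j r := by
  subst h
  let x : Spec R' := (⊥ : PrimeSpectrum R')
  rw [← algebraMap_evalStalk (Spec.map φ ≫ j) x, ← algebraMap_evalStalk j ((Spec.map φ) x)]
  refine congrArg (algebraMap (Y.presheaf.stalk (j ((Spec.map φ) x))) Y.functionField) ?_
  apply stalkMap_injective_of_isOpenImmersion (Spec.map φ ≫ j) x
  rw [stalkMap_evalStalk]
  refine Eq.trans ?_ (congr($(Scheme.Hom.stalkMap_comp (Spec.map φ) j x).hom
    (evalStalk j ((Spec.map φ) x) r))).symm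
  change _ = (Spec.map φ).stalkMap x (j.stalkMap ((Spec.map φ) x) (evalStalk j ((Spec.map φ) x) r))
  rw [stalkMap_evalStalk]
  exact (stalkMap_toStalk_apply φ x r).symm

end

/-! ### Factorial charts -/

section

variable {R : CommRingCat.{u}} {Y : Scheme.{u}} (j : Spec R ⟶ Y) [IsOpenImmersion j]
  [IsIntegral Y] [IsDomain R]

theorem unitEq_evalHom_one {x : Spec R} {r : R} (hr : r ∉ x.asIdeal) :
    UnitEq (j x) (evalHom j r) 1 := by
  rw [← algebraMap_evalStalk j x]
  exact UnitEq.of_isUnit ((isUnit_evalStalk_iff j x r).2 hr)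

/-- A rational function that is regular on an affine chart comes from the ring. -/
theorem exists_evalHom_eq (c : Y.functionField) (h : ∀ x : Spec R, ∃ v : Y.presheaf.stalk (j x),
    algebraMap _ Y.functionField v = c) : ∃ r, evalHom j r = c := by
  -- the ideal of denominators of `c` is not contained in any maximal ideal
  let I : Ideal R :=
    { carrier := {t | ∃ r, evalHom j t * c = evalHom j r}
      zero_mem' := ⟨0, by simp⟩
      add_mem' := by
        rintro t t' ⟨r, h⟩ ⟨r', h'⟩
        exact ⟨r + r', by rw [map_add, add_mul, h, h', map_add]⟩
      smul_mem' := by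
        rintro e t ⟨r, h⟩
        exact ⟨e * r, by rw [smul_eq_mul, map_mul, mul_assoc, h, map_mul]⟩ }
  have hI : I = ⊤ := by
    by_contra hne
    obtain ⟨M, hM, hIM⟩ := Ideal.exists_le_maximal I hne
    let x : Spec R := (⟨M, hM.isPrime⟩ : PrimeSpectrum R)
    obtain ⟨v, hv⟩ := h x
    obtain ⟨r, t, ht, hrt⟩ := exists_mul_evalStalk_eq j x v
    refine ht (hIM ⟨r, ?_⟩)
    rw [← algebraMap_evalStalk j x, ← algebraMap_evalStalk j x, ← hrt, map_mul, hv, mul_comm]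
  obtain ⟨r, hr⟩ : (1 : R) ∈ I := hI ▸ Submodule.mem_top
  exact ⟨r, by rw [← hr, map_one, one_mul]⟩

/-- A rational function without zeros and poles on an affine chart is a unit of the ring. -/
theorem exists_isUnit_evalHom_eq (c : Y.functionField) (h : ∀ x : Spec R, UnitEq (j x) c 1) :
    ∃ r, IsUnit r ∧ evalHom j r = c := by
  have h1 : ∀ c : Y.functionField, (∀ x : Spec R, UnitEq (j x) c 1) → ∃ r, evalHom j r = c := by
    intro c h
    refine exists_evalHom_eq j c fun x => ?_
    obtain ⟨v, hv⟩ := h x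
    exact ⟨v, by rw [hv, mul_one]⟩
  obtain ⟨r, hr⟩ := h1 c h
  obtain ⟨r', hr'⟩ := h1 c⁻¹ fun x => by simpa using (h x).inv
  refine ⟨r, IsUnit.of_mul_eq_one r' (evalHom_injective j ?_), hr⟩
  have hc : c ≠ 0 := by
    obtain ⟨v, rfl⟩ := h (⊥ : PrimeSpectrum R)
    rw [mul_one]
    exact (v.isUnit.map _).ne_zero
  rw [map_mul, hr, hr', map_one, mul_inv_cancel₀ hc]

omit [IsDomain R] in
theorem exists_prime_dvd_mem [UniqueFactorizationMonoid R] (P : Ideal R) [P.IsPrime] (b : R)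
    (hb0 : b ≠ 0) (hb : b ∈ P) : ∃ q, Prime q ∧ q ∣ b ∧ q ∈ P := by
  induction b using UniqueFactorizationMonoid.induction_on_prime with
  | h₁ => exact (hb0 rfl).elim
  | h₂ b h => exact (Ideal.IsPrime.ne_top ‹_› (Ideal.eq_top_of_isUnit_mem _ hb h)).elim
  | h₃ a p ha hp ih =>
    rcases (Ideal.IsPrime.mem_or_mem ‹_› hb) with h | h
    · exact ⟨p, hp, dvd_mul_right _ _, h⟩
    · obtain ⟨q, h1, h2, h3⟩ := ih ha h
      exact ⟨q, h1, h2.mul_left _, h3⟩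

/-- The order of a rational function along a prime divisor of a factorial chart. -/
theorem exists_zpow_mul [UniqueFactorizationMonoid R] {p : R} (hp : Prime p)
    (c : Y.functionField) (hc : c ≠ 0) : ∃ (n : ℤ) (r t : R), ¬ p ∣ r ∧ ¬ p ∣ t ∧
      c = evalHom j p ^ n * (evalHom j r / evalHom j t) := by
  let _ := (evalHom j).toAlgebra
  have := isFractionRing_evalHom j
  obtain ⟨a, b, hb, rfl⟩ := IsFractionRing.div_surjective (A := R) c
  have hb0 : b ≠ 0 := nonZeroDivisors.ne_zero hb
  have ha0 : a ≠ 0 := by rintro rfl; simp at hc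
  obtain ⟨r, hr', hr⟩ := (FiniteMultiplicity.of_prime_left hp ha0).exists_eq_pow_mul_and_not_dvd
  obtain ⟨t, ht', ht⟩ := (FiniteMultiplicity.of_prime_left hp hb0).exists_eq_pow_mul_and_not_dvd
  generalize multiplicity p a = i at hr'
  generalize multiplicity p b = l at ht'
  subst hr' ht'
  have hp0 : evalHom j p ≠ 0 := (map_ne_zero_iff _ (evalHom_injective j)).2 hp.ne_zero
  refine ⟨i - l, r, t, hr, ht, ?_⟩
  change evalHom j _ / evalHom j _ = _
  rw [map_mul, map_mul, map_pow, map_pow, zpow_sub₀ hp0, zpow_natCast, zpow_natCast]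
  rw [mul_div_mul_comm]

/-- Cartier divisors on the spectrum of a factorial ring are principal. -/
theorem CartierDivisor.exists_unitEq_chart [UniqueFactorizationMonoid R] (E : CartierDivisor Y) :
    ∃ h ≠ 0, ∀ x : Spec R, UnitEq (j x) (E.eqn (j x)) h := by
  -- Induction on the prime factors of a function `f` such that the divisor is trivial where `f ≠ 0`:
  -- a factor `p` is removed by dividing the equations by `p ^ n`, `n` the order along `p = 0`.
  have main : ∀ f : R, f ≠ 0 → ∀ G : Spec R → Y.functionField,
      (∀ x, G x ≠ 0) → (∀ x y, x ⤳ y → UnitEq (j x) (G y) (G x)) →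
      (∀ x : Spec R, f ∉ x.asIdeal → UnitEq (j x) (G x) 1) →
      ∃ h ≠ 0, ∀ x : Spec R, UnitEq (j x) (G x) h := by
    intro f
    induction f using UniqueFactorizationMonoid.induction_on_prime with
    | h₁ => exact fun h => (h rfl).elim
    | h₂ f hf =>
      intro _ G _ _ h
      exact ⟨1, one_ne_zero, fun x => h x fun hx =>
        (PrimeSpectrum.isPrime x).ne_top (Ideal.eq_top_of_isUnit_mem _ hx hf)⟩
    | h₃ a p ha hp ih =>
      intro _ G hG0 hspec h
      have hpI : (Ideal.span {p}).IsPrime := (Ideal.span_singleton_prime hp.ne_zero).2 hp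
      let P : Spec R := (⟨Ideal.span {p}, hpI⟩ : PrimeSpectrum R)
      have hmemP : ∀ r, r ∈ P.asIdeal ↔ p ∣ r := fun r => Ideal.mem_span_singleton
      obtain ⟨n, r, t, hr, ht, hrt⟩ := exists_zpow_mul j hp (G P) (hG0 P)
      have hp0 : evalHom j p ≠ 0 := (map_ne_zero_iff _ (evalHom_injective j)).2 hp.ne_zero
      let c := evalHom j p ^ n
      have hc : c ≠ 0 := zpow_ne_zero _ hp0
      let G' : Spec R → Y.functionField := fun x => G x / c
      have hspec' : ∀ x y, x ⤳ y → UnitEq (j x) (G' y) (G' x) := fun x y hxy =>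
        (hspec x y hxy).div (UnitEq.refl c)
      have hP : UnitEq (j P) (G' P) 1 := by
        have h1 : G' P = evalHom j r / evalHom j t := by
          change G P / c = _
          rw [hrt, mul_div_cancel_left₀ _ hc]
        rw [h1]
        have := (unitEq_evalHom_one j (x := P) (fun h => hr ((hmemP _).1 h))).div
          (unitEq_evalHom_one j (x := P) (fun h => ht ((hmemP _).1 h)))
        rwa [div_one] at this
      have hpc : ∀ x : Spec R, p ∉ x.asIdeal → UnitEq (j x) c 1 := by
        intro x hx
        refine (unitEq_iff j x c 1).2 ?_
        have hpow : ∀ l : ℕ, p ^ l ∉ x.asIdeal := fun l hl =>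
          hx ((PrimeSpectrum.isPrime x).mem_of_pow_mem l hl)
        rcases Int.eq_nat_or_neg n with ⟨l, hl | hl⟩
        · refine ⟨p ^ l, hpow l, 1, (PrimeSpectrum.isPrime x).one_notMem, ?_⟩
          simp only [c, hl, map_one, map_pow, zpow_natCast, one_mul, mul_one]
        · refine ⟨1, (PrimeSpectrum.isPrime x).one_notMem, p ^ l, hpow l, ?_⟩
          simp only [c, hl, map_one, map_pow, zpow_natCast, mul_one, zpow_neg]
          exact mul_inv_cancel₀ (pow_ne_zero _ hp0)
      have h' : ∀ x : Spec R, p * a ∉ x.asIdeal → UnitEq (j x) (G' x) 1 := fun x hx => by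
        have := (h x hx).div (hpc x fun hpx => hx (Ideal.mul_mem_right _ _ hpx))
        rwa [div_one] at this
      obtain ⟨g, hg0, hg⟩ := ih ha G' (fun x => div_ne_zero (hG0 x) hc) hspec' (by
        intro y hay
        let _ := (evalHom j).toAlgebra
        have := isFractionRing_evalHom j
        obtain ⟨b, e, hbe, hG'⟩ := IsFractionRing.exists_reduced_fraction (A := R) (G' y)
        have he0 : (e : R) ≠ 0 := nonZeroDivisors.ne_zero e.2
        have heq : evalHom j e * G' y = evalHom j b := by
          rw [← hG']
          exact IsLocalization.mk'_spec' _ _ _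
        have hb0 : b ≠ 0 := by
          rintro rfl
          rw [map_zero] at heq
          exact mul_ne_zero ((map_ne_zero_iff _ (evalHom_injective j)).2 he0)
            (div_ne_zero (hG0 y) hc) heq
        -- a prime through `y` divides the numerator of the equation at `y` if and only if it divides
        -- the denominator, so it divides neither of them, the fraction being reduced
        have key : ∀ q : R, Prime q → q ∈ y.asIdeal → (q ∣ b ↔ q ∣ e) := by
          intro q hq hqy
          have hqI : (Ideal.span {q}).IsPrime := (Ideal.span_singleton_prime hq.ne_zero).2 hq
          let Q : Spec R := (⟨Ideal.span {q}, hqI⟩ : PrimeSpectrum R)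
          have hmemQ : ∀ r, r ∈ Q.asIdeal ↔ q ∣ r := fun r => Ideal.mem_span_singleton
          have hQy : Q ⤳ y := (PrimeSpectrum.le_iff_specializes _ _).1
            ((Ideal.span_singleton_le_iff_mem _).2 hqy)
          have hQ : UnitEq (j Q) (G' Q) 1 := by
            by_cases hpQ : p ∈ Q.asIdeal
            · have hass : Associated q p := hq.associated_of_dvd hp ((hmemQ p).1 hpQ)
              have hQP : Q = P := PrimeSpectrum.ext (Ideal.span_singleton_eq_span_singleton.2 hass)
              rw [hQP]
              exact hP
            · refine h' Q fun hpa => ?_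
              rcases (PrimeSpectrum.isPrime Q).mem_or_mem hpa with h1 | h1
              · exact hpQ h1
              · exact hay ((Ideal.span_singleton_le_iff_mem _).2 hqy h1)
          obtain ⟨r, hr, t, ht, hrt⟩ := (unitEq_iff j Q _ _).1 ((hspec' Q y hQy).trans hQ)
          have hbe' : t * b = r * e := by
            apply evalHom_injective j
            rw [map_mul, map_mul, ← heq]
            rw [mul_one] at hrt
            rw [← hrt]
            ring
          rw [hmemQ] at hr ht
          constructor
          · intro hqb
            exact (hq.dvd_or_dvd (hbe' ▸ hqb.mul_left t)).resolve_left hr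
          · intro hqe
            exact (hq.dvd_or_dvd (hbe'.symm ▸ hqe.mul_left r)).resolve_left ht
        have hyp : y.asIdeal.IsPrime := PrimeSpectrum.isPrime y
        have hb : b ∉ y.asIdeal := fun hb => by
          obtain ⟨q, hq, hqb, hqy⟩ := exists_prime_dvd_mem y.asIdeal b hb0 hb
          exact hq.not_isUnit (hbe hqb ((key q hq hqy).1 hqb))
        have he : (e : R) ∉ y.asIdeal := fun hb => by
          obtain ⟨q, hq, hqb, hqy⟩ := exists_prime_dvd_mem y.asIdeal e he0 hb
          exact hq.not_isUnit (hbe ((key q hq hqy).2 hqb) hqb)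
        exact (unitEq_iff j y _ _).2 ⟨b, hb, e, he, by rw [heq, mul_one]⟩)
      refine ⟨g * c, mul_ne_zero hg0 hc, fun x => ?_⟩
      have := (hg x).mul (UnitEq.refl (y := j x) c)
      rwa [div_mul_cancel₀ _ hc] at this
  -- the equation at the generic point defines the divisor on a non-empty open subset
  let b : Spec R := (⊥ : PrimeSpectrum R)
  let g := E.eqn (j b)
  obtain ⟨U, hbU, hU⟩ := E.locally_eq (j b)
  obtain ⟨_, ⟨f, rfl⟩, hfb, hfU⟩ := PrimeSpectrum.isTopologicalBasis_basic_opens.exists_subset_of_mem_open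
    (show b ∈ ((j ⁻¹ᵁ U : (Spec R).Opens) : Set (Spec R)) from hbU) (j ⁻¹ᵁ U).isOpen
  have hg0 : g ≠ 0 := E.eqn_ne_zero _
  have hf0 : f ≠ 0 := fun h => hfb (by rw [h]; exact zero_mem _)
  obtain ⟨h, hh0, hh⟩ := main f hf0 (fun x => E.eqn (j x) / g)
    (fun x => div_ne_zero (E.eqn_ne_zero _) hg0)
    (fun x y hxy => (E.unitEq_of_specializes (hxy.map j.continuous)).div (UnitEq.refl g))
    (fun x hx => by
      have h1 : UnitEq (j x) (E.eqn (j x)) g := hU (j x) (hfU hx)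
      have h2 := h1.div (UnitEq.refl g)
      rwa [div_self hg0] at h2)
  refine ⟨h * g, mul_ne_zero hh0 hg0, fun x => ?_⟩
  have := (hh x).mul (UnitEq.refl (y := j x) g)
  rwa [div_mul_cancel₀ _ hg0] at this

end

/-! ### Monomials as rational functions on a toric variety -/

/-- The dual monoid of a smooth cone is free. -/
def IsSmoothBasis.dualMonoidEquiv {d : ℕ} {σ : PointedCone ℝ (Fin d → ℝ)}
    {u m : Fin d → Fin d → ℤ} (h : IsSmoothBasis σ u m) : (Fin d →₀ ℕ) ≃+ dualMonoid σ where
  toFun a := ⟨∑ j, (a j : ℤ) • m j, sum_mem fun j _ => by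
    rw [Nat.cast_smul_eq_nsmul]; exact nsmul_mem (h.dual_mem j) _⟩
  invFun a := Finsupp.equivFunOnFinite.symm fun j => ((a : Fin d → ℤ) ⬝ᵥ u j).toNat
  left_inv a := by
    ext j
    change ((∑ i, (a i : ℤ) • m i) ⬝ᵥ u j).toNat = a j
    have h1 : (∑ i, (a i : ℤ) • m i) ⬝ᵥ u j = a j := by
      rw [sum_dotProduct, Finset.sum_eq_single j]
      · rw [smul_dotProduct, h.pair, if_pos rfl, smul_eq_mul, mul_one]
      · intro i _ hij
        rw [smul_dotProduct, h.pair, if_neg hij, smul_zero]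
      · exact fun h => (h (Finset.mem_univ j)).elim
    rw [h1, Int.toNat_natCast]
  right_inv a := by
    apply Subtype.ext
    refine Eq.trans (b := ∑ j, ((((a : Fin d → ℤ) ⬝ᵥ u j).toNat : ℕ) : ℤ) • m j) rfl
      (Eq.trans ?_ (h.sum_dual (a : Fin d → ℤ)))
    refine Finset.sum_congr rfl fun j _ => ?_
    congr 1
    exact Int.toNat_of_nonneg ((h.mem_dualMonoid_iff _).1 a.2 j)
  map_add' a b := by
    apply Subtype.ext
    simp [add_smul, Finset.sum_add_distrib]

theorem IsSmoothBasis.uniqueFactorizationMonoid {d : ℕ} {σ : PointedCone ℝ (Fin d → ℝ)}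
    {u m : Fin d → Fin d → ℤ} (h : IsSmoothBasis σ u m) (k : Type*) [Field k] :
    UniqueFactorizationMonoid (AddMonoidAlgebra k (dualMonoid σ)) :=
  have : UniqueFactorizationMonoid (AddMonoidAlgebra k (Fin d →₀ ℕ)) :=
    inferInstanceAs (UniqueFactorizationMonoid (MvPolynomial (Fin d) k))
  (AddMonoidAlgebra.domCongr k k h.dualMonoidEquiv).toMulEquiv.uniqueFactorizationMonoid this

namespace ToricStructure

variable {k : Type u} [Field k] {Y : Scheme.{u}} {s : Y ⟶ Spec (CommRingCat.of k)} {d : ℕ}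
  {F : Fan d} (T : ToricStructure s F) [IsIntegral Y]

/-- The zero cone, corresponding to the open torus. -/
def torus (T : ToricStructure s F) : F.cones := ⟨⊥, F.bot_mem T.cones_nonempty⟩

theorem torus_le (σ : F.cones) : T.torus.1 ≤ σ.1 := bot_le (a := σ.1)

theorem mem_dualMonoid_torus (m : Fin d → ℤ) : m ∈ dualMonoid T.torus.1 := by
  rw [mem_dualMonoid]
  intro x hx
  rw [(Submodule.mem_bot _).1 hx, map_zero]

/-- The monomial `χ^m` as a rational function on the toric variety. -/
def chi (m : Fin d → ℤ) : Y.functionField :=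
  evalHom (T.chart T.torus) (AddMonoidAlgebra.single ⟨m, T.mem_dualMonoid_torus m⟩ (1 : k))

theorem chi_zero : T.chi 0 = 1 := map_one (evalHom (T.chart T.torus))

theorem chi_add (m m' : Fin d → ℤ) : T.chi (m + m') = T.chi m * T.chi m' := by
  rw [chi, chi, chi]
  refine Eq.trans ?_ (map_mul (evalHom (T.chart T.torus)) _ _)
  congr 1
  refine Eq.symm ((AddMonoidAlgebra.single_mul_single ..).trans ?_)
  rw [one_mul]
  rfl

theorem chi_ne_zero (m : Fin d → ℤ) : T.chi m ≠ 0 := by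
  have h := T.chi_add m (-m)
  rw [add_neg_cancel, chi_zero] at h
  exact left_ne_zero_of_mul (h ▸ one_ne_zero)

theorem chi_neg (m : Fin d → ℤ) : T.chi (-m) = (T.chi m)⁻¹ := by
  refine eq_inv_of_mul_eq_one_left ?_
  rw [← chi_add, neg_add_cancel, chi_zero]

theorem chi_sub (m m' : Fin d → ℤ) : T.chi (m - m') = T.chi m / T.chi m' := by
  rw [sub_eq_add_neg, chi_add, chi_neg, div_eq_mul_inv]

theorem evalHom_mapDomain {ω σ : F.cones} (h : ω.1 ≤ σ.1)
    (a : AddMonoidAlgebra k (dualMonoid σ.1)) :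
    evalHom (T.chart ω) (AddMonoidAlgebra.mapDomainRingHom k
      (AddSubmonoid.inclusion (dualMonoid_anti h)) a) = evalHom (T.chart σ) a :=
  evalHom_comp (T.chart σ) _ (T.chart ω) (T.compatible ω σ h) a

theorem evalHom_single (σ : F.cones) (m : dualMonoid σ.1) :
    evalHom (T.chart σ) (AddMonoidAlgebra.single m (1 : k)) = T.chi m := by
  rw [← T.evalHom_mapDomain (T.torus_le σ), AddMonoidAlgebra.mapDomainRingHom_apply,
    AddMonoidAlgebra.mapDomain_single]
  rfl

/-- A monomial regular on an affine toric chart is in the dual monoid. -/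
theorem mem_dualMonoid_of_regular (σ : F.cones) (m : Fin d → ℤ)
    (h : ∀ x, ∃ v : Y.presheaf.stalk (T.chart σ x), algebraMap _ Y.functionField v = T.chi m) :
    m ∈ dualMonoid σ.1 := by
  classical
  obtain ⟨r, hr⟩ := exists_evalHom_eq (T.chart σ) _ h
  rw [← T.evalHom_mapDomain (T.torus_le σ), chi] at hr
  have h1 := evalHom_injective _ hr
  have h2 : (⟨m, T.mem_dualMonoid_torus m⟩ : dualMonoid T.torus.1) ∈
      (AddMonoidAlgebra.mapDomainRingHom k (AddSubmonoid.inclusion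
        (dualMonoid_anti (T.torus_le σ))) r).coeff.support := by
    rw [h1]
    simp
  rw [AddMonoidAlgebra.mapDomainRingHom_apply] at h2
  obtain ⟨a, -, ha⟩ := Finset.mem_image.1 (Finsupp.mapDomain_support h2)
  have := congrArg Subtype.val ha
  rw [← show (a : Fin d → ℤ) = m from this]
  exact a.2

theorem mem_dualMonoid_of_unitEq (σ : F.cones) (m : Fin d → ℤ)
    (h : ∀ x, UnitEq (T.chart σ x) (T.chi m) 1) :
    m ∈ dualMonoid σ.1 ∧ -m ∈ dualMonoid σ.1 := by
  have h1 : ∀ m : Fin d → ℤ, (∀ x, UnitEq (T.chart σ x) (T.chi m) 1) → m ∈ dualMonoid σ.1 :=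
    fun m h => T.mem_dualMonoid_of_regular σ m fun x => by
      obtain ⟨v, hv⟩ := h x
      exact ⟨v, by rw [hv, mul_one]⟩
  refine ⟨h1 m h, h1 _ fun x => ?_⟩
  rw [chi_neg]
  simpa using (h x).inv

/-- A Cartier divisor on a toric variety that is principal on the torus is given by a monomial on
every smooth chart. -/
theorem exists_unitEq_chi (E : CartierDivisor Y) (h : Y.functionField) (h0 : h ≠ 0)
    (hE : ∀ x, UnitEq (T.chart T.torus x) (E.eqn (T.chart T.torus x)) h) (σ : F.cones)
    {u m : Fin d → Fin d → ℤ} (hσ : IsSmoothBasis σ.1 u m) :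
    ∃ a, ∀ x, UnitEq (T.chart σ x) (E.eqn (T.chart σ x)) (h * T.chi a) := by
  have := hσ.uniqueFactorizationMonoid k
  obtain ⟨g, hg0, hg⟩ := E.exists_unitEq_chart (T.chart σ)
  obtain ⟨r, hr, hrg⟩ := exists_isUnit_evalHom_eq (T.chart T.torus) (g / h) (fun x => by
    obtain ⟨z, hz⟩ := T.range_chart_mono (T.torus_le σ) ⟨x, rfl⟩
    have h1 := hg z
    rw [hz] at h1
    have h2 := (h1.symm.trans (hE x)).div (UnitEq.refl h)
    rwa [div_self h0] at h2)
  obtain ⟨a, c, hc, rfl⟩ := exists_eq_single_of_isUnit hr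
  refine ⟨a, fun x => (hg x).trans ?_⟩
  have h3 : g = evalHom (T.chart T.torus) (algebraMap k _ c) * (h * T.chi a) := by
    have h4 : (AddMonoidAlgebra.single a c : AddMonoidAlgebra k (dualMonoid T.torus.1)) =
        algebraMap k _ c * AddMonoidAlgebra.single a 1 := by
      rw [← Algebra.smul_def, AddMonoidAlgebra.smul_single, smul_eq_mul, mul_one]
    rw [← div_mul_cancel₀ g h0, ← hrg, h4, map_mul, T.evalHom_single]
    ring
  have h5 : evalHom (T.chart T.torus) (algebraMap k _ c) =
      evalHom (T.chart σ) (algebraMap k (AddMonoidAlgebra k (dualMonoid σ.1)) c) := by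
    refine Eq.trans ?_ (T.evalHom_mapDomain (T.torus_le σ) _)
    congr 1
    exact ((AddMonoidAlgebra.mapDomainRingHom_apply (R := k) (AddSubmonoid.inclusion
      (dualMonoid_anti (T.torus_le σ))) (AddMonoidAlgebra.single 0 c)).trans
      AddMonoidAlgebra.mapDomain_single).symm
  rw [h3, h5]
  have h6 := (unitEq_evalHom_one (T.chart σ) (x := x)
    (r := algebraMap k (AddMonoidAlgebra k (dualMonoid σ.1)) c) fun hx =>
      (PrimeSpectrum.isPrime x).ne_top (Ideal.eq_top_of_isUnit_mem _ hx
        ((isUnit_iff_ne_zero.2 hc).map _))).mul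
      (UnitEq.refl (h * T.chi a))
  rwa [one_mul] at h6

end ToricStructure

theorem _root_.LinearIndependent.false_of_parallel {K V I : Type*} [Field K] [AddCommGroup V]
    [Module K V] {v : I → V} (hv : LinearIndependent K v) {p p' : I} (hpp : p ≠ p') {c c' : K}
    (hc' : c' ≠ 0) {w : V} (h : v p = c • w) (h' : v p' = c' • w) : False := by
  have h1 : c' • v p = c • v p' := by rw [h, h', smul_smul, smul_smul, mul_comm]
  have h2 := (LinearIndepOn.pair_iff v hpp).1 (hv.comp (Subtype.val : ({p, p'} : Set I) → I)
    Subtype.val_injective) c' (-c) (by rw [h1, neg_smul, add_neg_cancel])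
  exact hc' h2.1

/-! ### The components of the divisor on the charts of a toric stratum -/

section

variable {k : Type u} [Field k] {X : Scheme.{u}} [IsIntegral X]
  {s : X ⟶ Spec (CommRingCat.of k)} {ι : Type} {D : SNCDivisor X ι} {τ : Finset ι} {d : ℕ}
  {F : Fan d} (T : ToricStructure (redι (D.stratum τ) ≫ s) F)

/-- The restriction to the stratum `D_τ` of the local equation of a component. -/
def SNCDivisor.resLoc (D : SNCDivisor X ι) (τ : Finset ι) (i : ι) (y : redSubscheme (D.stratum τ)) :
    (redSubscheme (D.stratum τ)).presheaf.stalk y :=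
  (redι (D.stratum τ)).stalkMap y (D.loc i (redι (D.stratum τ) y))

theorem SNCDivisor.isUnit_resLoc_iff (i : ι) (y : redSubscheme (D.stratum τ)) :
    IsUnit (D.resLoc τ i y) ↔ redι (D.stratum τ) y ∉ D.supp i := by
  rw [D.mem_supp_iff, not_not]
  exact isUnit_map_iff ((redι (D.stratum τ)).stalkMap y).hom _

variable [IsIntegral (redSubscheme (D.stratum τ))]

/-- On the chart of `σ`, the component `D_i` is defined by the monomial `χ^a`. -/
def ToricStructure.IsExponent (σ : F.cones) (i : ι) (a : Fin d → ℤ) : Prop :=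
  ∀ y, UnitEq (T.chart σ y)
    (algebraMap _ (redSubscheme (D.stratum τ)).functionField (D.resLoc τ i (T.chart σ y))) (T.chi a)

variable {T}

theorem ToricStructure.IsExponent.mem_dualMonoid {σ : F.cones} {i : ι} {a : Fin d → ℤ}
    (h : T.IsExponent σ i a) : a ∈ dualMonoid σ.1 := by
  refine T.mem_dualMonoid_of_regular σ a fun y => ?_
  obtain ⟨v, hv⟩ := (h y).symm
  exact ⟨v * D.resLoc τ i (T.chart σ y), by rw [hv, map_mul]⟩

theorem ToricStructure.IsExponent.exists_unit {σ : F.cones} {i : ι} {a : Fin d → ℤ}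
    (h : T.IsExponent σ i a) (y : affineToric k σ.1) :
    ∃ v : ((redSubscheme (D.stratum τ)).presheaf.stalk (T.chart σ y))ˣ,
      D.resLoc τ i (T.chart σ y) = v * evalStalk (T.chart σ) y
        (AddMonoidAlgebra.single ⟨a, h.mem_dualMonoid⟩ (1 : k)) := by
  obtain ⟨v, hv⟩ := h y
  refine ⟨v, ?_⟩
  apply IsFractionRing.injective ((redSubscheme (D.stratum τ)).presheaf.stalk (T.chart σ y))
    (redSubscheme (D.stratum τ)).functionField
  rw [hv, map_mul, algebraMap_evalStalk, T.evalHom_single]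

theorem ToricStructure.IsExponent.mem_supp_iff {σ : F.cones} {i : ι} {a : Fin d → ℤ}
    (h : T.IsExponent σ i a) (y : affineToric k σ.1) : T.emb σ y ∈ D.supp i ↔
      AddMonoidAlgebra.single ⟨a, h.mem_dualMonoid⟩ (1 : k) ∈ y.asIdeal := by
  obtain ⟨v, hv⟩ := h.exists_unit y
  have h1 := SNCDivisor.isUnit_resLoc_iff (D := D) (τ := τ) i (T.chart σ y)
  rw [hv, Units.isUnit_units_mul, isUnit_evalStalk_iff] at h1
  rw [ToricStructure.emb, Scheme.Hom.comp_apply]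
  exact not_iff_not.1 h1.symm

theorem IsSmoothBasis.isIndecomposable {σ : PointedCone ℝ (Fin d → ℝ)}
    {u m : Fin d → Fin d → ℤ} (h : IsSmoothBasis σ u m) (j : Fin d) : IsIndecomposable σ (m j) := by
  refine ⟨h.dual_mem j, fun h0 => ?_, fun a ha b hb hab => ?_⟩
  · have := h.pair j j
    rw [h0, zero_dotProduct, if_pos rfl] at this
    exact zero_ne_one this
  · have ha' := (h.mem_dualMonoid_iff a).1 ha
    have hb' := (h.mem_dualMonoid_iff b).1 hb
    have hl : ∀ l, a ⬝ᵥ u l + b ⬝ᵥ u l = if j = l then 1 else 0 := fun l => by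
      rw [← add_dotProduct, hab, h.pair]
    have hz : ∀ c : Fin d → ℤ, (∀ l, c ⬝ᵥ u l = 0) → c = 0 := fun c hc => by
      rw [← h.sum_dual c]
      exact Finset.sum_eq_zero fun l _ => by rw [hc, zero_smul]
    have hother : ∀ l, j ≠ l → a ⬝ᵥ u l = 0 ∧ b ⬝ᵥ u l = 0 := fun l hjl => by
      have h1 := hl l
      rw [if_neg hjl] at h1
      have := ha' l
      have := hb' l
      omega
    have hj := hl j
    rw [if_pos rfl] at hj
    have h1 := ha' j
    have h2 := hb' j
    by_cases h0 : a ⬝ᵥ u j = 0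
    · left
      refine hz a fun l => ?_
      by_cases hjl : j = l
      · exact hjl ▸ h0
      · exact (hother l hjl).1
    · right
      refine hz b fun l => ?_
      by_cases hjl : j = l
      · subst hjl; omega
      · exact (hother l hjl).2

theorem IsSmoothBasis.eq_zero_of_add {σ : PointedCone ℝ (Fin d → ℝ)}
    {u m : Fin d → Fin d → ℤ} (h : IsSmoothBasis σ u m) :
    ∀ a ∈ dualMonoid σ, ∀ b ∈ dualMonoid σ, a + b = 0 → a = 0 := by
  intro a ha b hb hab
  rw [← h.sum_dual a]
  refine Finset.sum_eq_zero fun l _ => ?_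
  have h1 := (h.mem_dualMonoid_iff a).1 ha l
  have h2 := (h.mem_dualMonoid_iff b).1 hb l
  have h3 : a ⬝ᵥ u l + b ⬝ᵥ u l = 0 := by rw [← add_dotProduct, hab, zero_dotProduct]
  rw [show a ⬝ᵥ u l = 0 by omega, zero_smul]

theorem IsSmoothBasis.dual_injective {σ : PointedCone ℝ (Fin d → ℝ)}
    {u m : Fin d → Fin d → ℤ} (h : IsSmoothBasis σ u m) : Function.Injective m := by
  intro i j hij
  by_contra hne
  have h1 := h.pair i j
  rw [hij, h.pair, if_pos rfl, if_neg hne] at h1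
  exact one_ne_zero h1

variable [Fintype ι] {n : ℕ} [SmoothOfRelativeDimension n s]

variable (T) in
/-- At the fixed point of a smooth chart, the components of `D` not containing the stratum are
defined by distinct elements of the dual basis: the derivatives of their equations along the
tangent vectors dual to the basis are independent, so none is zero and no two are parallel. -/
theorem ToricStructure.exists_fixedPoint (hd : τ.card + d = n) (σ : F.cones)
    {u m : Fin d → Fin d → ℤ} (h : IsSmoothBasis σ.1 u m) :
    ∃ x : affineToric k σ.1,
      (∀ i ∉ τ, T.emb σ x ∈ D.supp i → redι (D.stratum τ) (genericPoint _) ∉ D.supp i) ∧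
      (∀ i ∉ τ, ∀ a, T.IsExponent σ i a → T.emb σ x ∈ D.supp i → ∃ j, a = m j) ∧
      (∀ i ∉ τ, ∀ a, T.IsExponent σ i a → T.emb σ x ∉ D.supp i → a = 0) ∧
      (∀ i ∉ τ, ∀ i' ∉ τ, ∀ j, T.IsExponent σ i (m j) → T.IsExponent σ i' (m j) → i = i') := by
  classical
  obtain ⟨x, hx, ψ, hψl, hψ, -, hli⟩ := T.exists_tangent (n := n) σ m h.isIndecomposable
    h.dual_injective h.eq_zero_of_add
  have hli := hli (by omega)
  -- the derivatives of the equation of `D_i` are those of `χ^a`, up to a nonzero constant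
  have hval : ∀ i a (hi : T.IsExponent σ i a), ∃ c : k, c ≠ 0 ∧ ∃ v : TrivSqZeroExt k (Fin d → k),
      v.fst = c ∧ ψ ((T.emb σ).stalkMap x (D.loc i (T.emb σ x))) =
        v * tangentHom k m h.isIndecomposable h.eq_zero_of_add
          (AddMonoidAlgebra.single ⟨a, hi.mem_dualMonoid⟩ 1) := by
    intro i a hi
    obtain ⟨v, hv⟩ := hi.exists_unit x
    have hu : IsUnit (ψ ((T.chart σ).stalkMap x (v : _))) :=
      (v.isUnit.map ((T.chart σ).stalkMap x).hom).map ψ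
    refine ⟨_, ?_, ψ ((T.chart σ).stalkMap x (v : _)), rfl, ?_⟩
    · exact (TrivSqZeroExt.isUnit_iff_isUnit_fst.1 hu).ne_zero
    · have h1 : (T.emb σ).stalkMap x (D.loc i (T.emb σ x)) =
          (T.chart σ).stalkMap x (D.resLoc τ i (T.chart σ x)) :=
        congr($(Scheme.Hom.stalkMap_comp (T.chart σ) (redι (D.stratum τ)) x).hom
          (D.loc i (T.emb σ x)))
      rw [h1, hv, map_mul, stalkMap_evalStalk, map_mul]
      exact congrArg _ (hψ _)
  have hfst : ∀ a (ha : a ∈ dualMonoid σ.1),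
      AddMonoidAlgebra.single ⟨a, ha⟩ (1 : k) ∈ x.asIdeal ↔ a ≠ 0 := by
    intro a ha
    rw [hx, tangentHom_single]
    by_cases h0 : a = 0
    · simp [h0]
    · simp [h0]
  have hsnd : ∀ i a (_ : T.IsExponent σ i a), a ≠ 0 → ∃ c : k, c ≠ 0 ∧
      (ψ ((T.emb σ).stalkMap x (D.loc i (T.emb σ x)))).snd =
        fun j => c * if a = m j then 1 else 0 := by
    intro i a hi h0
    obtain ⟨c, hc, v, hvc, hv⟩ := hval i a hi
    refine ⟨c, hc, ?_⟩
    rw [hv, tangentHom_single, if_neg h0, TrivSqZeroExt.snd_mul, TrivSqZeroExt.snd_inr,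
      TrivSqZeroExt.fst_inr, hvc]
    funext j
    simp
  refine ⟨x, fun i hi hxi hg => ?_, fun i hi a ha hxi => ?_, fun i hi a ha hxi => ?_,
    fun i hi i' hi' j h1 h2 => ?_⟩
  · have h0 := D.stalkMap_loc_eq_zero (T.emb σ) i (fun z => by
      rw [ToricStructure.emb, Scheme.Hom.comp_apply]
      exact ((genericPoint_specializes (T.chart σ z)).map
        (redι (D.stratum τ)).continuous).mem_closed (D.isClosed_supp i) hg) x
    refine hli.ne_zero ⟨i, hxi, hi⟩ ?_
    change (ψ ((T.emb σ).stalkMap x (D.loc i (T.emb σ x)))).snd = 0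
    rw [h0, map_zero, TrivSqZeroExt.snd_zero]
  · have h0 : a ≠ 0 := (hfst a ha.mem_dualMonoid).1 ((ha.mem_supp_iff x).1 hxi)
    obtain ⟨c, hc, hs⟩ := hsnd i a ha h0
    by_contra! hne
    refine hli.ne_zero ⟨i, hxi, hi⟩ (hs.trans ?_)
    funext j
    rw [if_neg (hne j), mul_zero]
    rfl
  · by_contra h0
    exact hxi ((ha.mem_supp_iff x).2 ((hfst a ha.mem_dualMonoid).2 h0))
  · by_contra hne
    have hm0 : m j ≠ 0 := (h.isIndecomposable j).2.1
    have hx1 := (h1.mem_supp_iff x).2 ((hfst _ h1.mem_dualMonoid).2 hm0)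
    have hx2 := (h2.mem_supp_iff x).2 ((hfst _ h2.mem_dualMonoid).2 hm0)
    obtain ⟨c, hc, hs⟩ := hsnd i _ h1 hm0
    obtain ⟨c', hc', hs'⟩ := hsnd i' _ h2 hm0
    let p : {i // T.emb σ x ∈ D.supp i ∧ i ∉ τ} := ⟨i, hx1, hi⟩
    let p' : {i // T.emb σ x ∈ D.supp i ∧ i ∉ τ} := ⟨i', hx2, hi'⟩
    have hpp : p ≠ p' := fun h => hne (congrArg Subtype.val h)
    exact hli.false_of_parallel hpp hc' (w := fun l => if m j = m l then 1 else 0) hs hs'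

end

/-! ### Simplicial cones -/

/-- The cone generated by the vectors `u i`, `i ∈ K`. -/
def coneOf {α : Type*} {d : ℕ} (u : α → Fin d → ℤ) (K : Finset α) : PointedCone ℝ (Fin d → ℝ) where
  carrier := {x | ∃ c : α → ℝ, (∀ i ∈ K, 0 ≤ c i) ∧ x = ∑ i ∈ K, c i • castR (u i)}
  zero_mem' := ⟨0, fun _ _ => le_rfl, by simp⟩
  add_mem' := by
    rintro _ _ ⟨c, hc, rfl⟩ ⟨e, he, rfl⟩
    exact ⟨c + e, fun i hi => add_nonneg (hc i hi) (he i hi), by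
      simp only [Pi.add_apply, add_smul, Finset.sum_add_distrib]⟩
  smul_mem' := by
    rintro r _ ⟨c, hc, rfl⟩
    refine ⟨fun i => (r : ℝ) * c i, fun i hi => mul_nonneg r.2 (hc i hi), ?_⟩
    rw [Finset.smul_sum]
    exact Finset.sum_congr rfl fun i _ => smul_smul (r : ℝ) (c i) _

theorem mem_coneOf {α : Type*} {d : ℕ} {u : α → Fin d → ℤ} {K : Finset α} {x : Fin d → ℝ} :
    x ∈ coneOf u K ↔ ∃ c : α → ℝ, (∀ i ∈ K, 0 ≤ c i) ∧ x = ∑ i ∈ K, c i • castR (u i) := Iff.rfl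

theorem castR_mem_coneOf {α : Type*} {d : ℕ} {u : α → Fin d → ℤ} {K : Finset α} {i : α}
    (hi : i ∈ K) : castR (u i) ∈ coneOf u K := by
  classical
  refine mem_coneOf.2 ⟨fun j => if j = i then 1 else 0, fun j _ => by dsimp only; split_ifs <;> norm_num, ?_⟩
  simp [Finset.sum_ite_eq', hi]

theorem coneOf_mono {α : Type*} {d : ℕ} {u : α → Fin d → ℤ} {K L : Finset α} (h : K ⊆ L) :
    coneOf u K ≤ coneOf u L := by
  intro x hx
  obtain ⟨c, hc, rfl⟩ := mem_coneOf.1 hx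
  exact Submodule.sum_mem _ fun i hi => PointedCone.smul_mem _ (hc i hi) (castR_mem_coneOf (h hi))

theorem coneOf_congr {α : Type*} {d : ℕ} {u v : α → Fin d → ℤ} {K : Finset α}
    (h : ∀ i ∈ K, u i = v i) : coneOf u K = coneOf v K := by
  ext x
  rw [mem_coneOf, mem_coneOf]
  refine exists_congr fun c => and_congr_right fun _ => ?_
  rw [Finset.sum_congr rfl fun i hi => by rw [h i hi]]

theorem mem_dualMonoid_coneOf {α : Type*} {d : ℕ} {u : α → Fin d → ℤ} {K : Finset α} {a : Fin d → ℤ} :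
    a ∈ dualMonoid (coneOf u K) ↔ ∀ i ∈ K, 0 ≤ a ⬝ᵥ u i := by
  rw [mem_dualMonoid]
  constructor
  · intro ha i hi
    have := ha _ (castR_mem_coneOf hi)
    rw [dotR_castR] at this
    exact_mod_cast this
  · intro ha x hx
    obtain ⟨c, hc, rfl⟩ := mem_coneOf.1 hx
    rw [map_sum]
    refine Finset.sum_nonneg fun i hi => ?_
    rw [map_smul, dotR_castR, smul_eq_mul]
    exact mul_nonneg (hc i hi) (by exact_mod_cast ha i hi)

/-- The cone `σ` is generated by the lattice basis `u i`, `i ∈ I`, with dual basis `m i`. -/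
structure IsDualBasis {α : Type*} [DecidableEq α] {d : ℕ} (I : Finset α) (u m : α → Fin d → ℤ)
    (σ : PointedCone ℝ (Fin d → ℝ)) : Prop where
  pair : ∀ i ∈ I, ∀ j ∈ I, m i ⬝ᵥ u j = if i = j then 1 else 0
  mem_iff : ∀ x, x ∈ σ ↔ ∀ i ∈ I, 0 ≤ dotR (m i) x
  sum_eq : ∀ x, ∑ i ∈ I, dotR (m i) x • castR (u i) = x

namespace IsDualBasis

variable {α : Type*} [DecidableEq α] {d : ℕ} {I : Finset α} {u m : α → Fin d → ℤ}
  {σ : PointedCone ℝ (Fin d → ℝ)} (h : IsDualBasis I u m σ)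

include h

theorem dotR_pair {i j : α} (hi : i ∈ I) (hj : j ∈ I) :
    dotR (m i) (castR (u j)) = if i = j then 1 else 0 := by
  rw [dotR_castR, h.pair i hi j hj]
  split_ifs <;> norm_num

theorem dotR_sum {i : α} (hi : i ∈ I) {K : Finset α} (hK : K ⊆ I) (c : α → ℝ) :
    dotR (m i) (∑ j ∈ K, c j • castR (u j)) = if i ∈ K then c i else 0 := by
  rw [map_sum, Finset.sum_congr rfl fun j hj => by
    rw [map_smul, h.dotR_pair hi (hK hj), smul_eq_mul, mul_ite, mul_one, mul_zero]]
  rw [Finset.sum_ite_eq K i c]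

theorem mem_coneOf_iff {K : Finset α} (hK : K ⊆ I) {x : Fin d → ℝ} :
    x ∈ coneOf u K ↔ (∀ i ∈ K, 0 ≤ dotR (m i) x) ∧ ∀ i ∈ I, i ∉ K → dotR (m i) x = 0 := by
  constructor
  · intro hx
    obtain ⟨c, hc, rfl⟩ := mem_coneOf.1 hx
    exact ⟨fun i hi => by rw [h.dotR_sum (hK hi) hK, if_pos hi]; exact hc i hi,
      fun i hi hiK => by rw [h.dotR_sum hi hK, if_neg hiK]⟩
  · rintro ⟨h1, h2⟩
    refine mem_coneOf.2 ⟨fun i => dotR (m i) x, h1, ?_⟩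
    nth_rw 1 [← h.sum_eq x]
    refine (Finset.sum_subset hK fun i hi hiK => ?_).symm
    rw [h2 i hi hiK, zero_smul]

theorem eq_coneOf : σ = coneOf u I := by
  ext x
  rw [h.mem_iff, h.mem_coneOf_iff subset_rfl]
  exact ⟨fun hx => ⟨hx, fun i hi hi' => (hi' hi).elim⟩, fun hx => hx.1⟩

theorem castR_mem {i : α} (hi : i ∈ I) : castR (u i) ∈ σ := by
  rw [h.eq_coneOf]; exact castR_mem_coneOf hi

theorem isFaceOf {K : Finset α} (hK : K ⊆ I) : IsFaceOf (coneOf u K) σ := by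
  have hsum : ∀ x, ∑ j, ((∑ i ∈ I \ K, m i : Fin d → ℤ) j : ℝ) * x j =
      ∑ i ∈ I \ K, dotR (m i) x := fun x => by
    rw [← dotR_apply]
    have : ∀ L : Finset α, dotR (∑ i ∈ L, m i) x = ∑ i ∈ L, dotR (m i) x := fun L => by
      induction L using Finset.induction_on with
      | empty => simp [dotR_zero]
      | insert a L ha ih => rw [Finset.sum_insert ha, Finset.sum_insert ha, dotR_add,
          LinearMap.add_apply, ih]
    exact this _
  refine ⟨fun j => ((∑ i ∈ I \ K, m i : Fin d → ℤ) j : ℝ), fun x hx => ?_, fun x => ?_⟩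
  · rw [hsum]
    exact Finset.sum_nonneg fun i hi => (h.mem_iff x).1 hx i (Finset.mem_sdiff.1 hi).1
  · rw [hsum, h.mem_coneOf_iff hK, h.mem_iff]
    constructor
    · rintro ⟨h1, h2⟩
      refine ⟨fun i hi => ?_, Finset.sum_eq_zero fun i hi => ?_⟩
      · by_cases hiK : i ∈ K
        · exact h1 i hiK
        · exact (h2 i hi hiK).ge
      · exact h2 i (Finset.mem_sdiff.1 hi).1 (Finset.mem_sdiff.1 hi).2
    · rintro ⟨h1, h2⟩
      refine ⟨fun i hi => h1 i (hK hi), fun i hi hiK => ?_⟩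
      exact (Finset.sum_eq_zero_iff_of_nonneg fun i hi => h1 i (Finset.mem_sdiff.1 hi).1).1 h2 i
        (Finset.mem_sdiff.2 ⟨hi, hiK⟩)

theorem exists_eq_coneOf {ω : PointedCone ℝ (Fin d → ℝ)} (hω : IsFaceOf ω σ) :
    ∃ K ⊆ I, ω = coneOf u K := by
  obtain ⟨a, ha, hω⟩ := hω
  let f : (Fin d → ℝ) → ℝ := fun x => ∑ j, a j * x j
  have hf : ∀ (L : Finset α) (c : α → ℝ), f (∑ i ∈ L, c i • castR (u i)) =
      ∑ i ∈ L, c i * f (castR (u i)) := fun L c => by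
    simp only [f, Finset.sum_apply, Pi.smul_apply, smul_eq_mul, Finset.mul_sum]
    rw [Finset.sum_comm]
    exact Finset.sum_congr rfl fun i _ => Finset.sum_congr rfl fun j _ => by ring
  let K := I.filter fun i => f (castR (u i)) = 0
  refine ⟨K, Finset.filter_subset _ _, ?_⟩
  ext x
  rw [h.mem_coneOf_iff (Finset.filter_subset _ _), hω, h.mem_iff]
  have hx : f x = ∑ i ∈ I, dotR (m i) x * f (castR (u i)) := by
    nth_rw 1 [← h.sum_eq x]
    exact hf I _
  change (_ ∧ f x = 0) ↔ _
  constructor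
  · rintro ⟨h1, h2⟩
    refine ⟨fun i hi => h1 i (Finset.mem_filter.1 hi).1, fun i hi hiK => ?_⟩
    rw [hx, Finset.sum_eq_zero_iff_of_nonneg fun i hi =>
      mul_nonneg (h1 i hi) (ha _ (h.castR_mem hi))] at h2
    exact (mul_eq_zero.1 (h2 i hi)).resolve_right fun h0 => hiK (Finset.mem_filter.2 ⟨hi, h0⟩)
  · rintro ⟨h1, h2⟩
    refine ⟨fun i hi => ?_, ?_⟩
    · by_cases hiK : i ∈ K
      · exact h1 i hiK
      · exact (h2 i hi hiK).ge
    · rw [hx]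
      refine Finset.sum_eq_zero fun i hi => ?_
      by_cases hiK : i ∈ K
      · rw [(Finset.mem_filter.1 hiK).2, mul_zero]
      · rw [h2 i hi hiK, zero_mul]

theorem mem_dualMonoid_iff {a : Fin d → ℤ} : a ∈ dualMonoid σ ↔ ∀ i ∈ I, 0 ≤ a ⬝ᵥ u i := by
  rw [h.eq_coneOf, mem_dualMonoid_coneOf]

theorem sum_basis_int (x : Fin d → ℤ) : ∑ i ∈ I, (m i ⬝ᵥ x) • u i = x := by
  apply castR_injective
  rw [map_sum]
  refine Eq.trans ?_ (h.sum_eq (castR x))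
  refine Finset.sum_congr rfl fun i _ => ?_
  rw [map_zsmul, dotR_castR, Int.cast_smul_eq_zsmul]

theorem sum_dual (a : Fin d → ℤ) : ∑ i ∈ I, (a ⬝ᵥ u i) • m i = a := by
  have h1 : ∀ x, (∑ i ∈ I, (a ⬝ᵥ u i) • m i) ⬝ᵥ x = a ⬝ᵥ x := fun x => by
    nth_rw 2 [← h.sum_basis_int x]
    rw [sum_dotProduct, dotProduct_sum]
    refine Finset.sum_congr rfl fun i _ => ?_
    rw [smul_dotProduct, dotProduct_smul, smul_eq_mul, smul_eq_mul, mul_comm]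
  funext j
  have := h1 (Pi.single j 1)
  rwa [dotProduct_single, dotProduct_single, mul_one, mul_one] at this

theorem ext_dual {a b : Fin d → ℤ} (hab : ∀ i ∈ I, a ⬝ᵥ u i = b ⬝ᵥ u i) : a = b := by
  rw [← h.sum_dual a, ← h.sum_dual b]
  exact Finset.sum_congr rfl fun i hi => by rw [hab i hi]

end IsDualBasis

theorem IsSmoothBasis.isDualBasis {d : ℕ} {σ : PointedCone ℝ (Fin d → ℝ)}
    {u m : Fin d → Fin d → ℤ} (h : IsSmoothBasis σ u m) {S : Finset (Fin d → ℤ)}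
    (hS : IsStronglyConvexHull σ S) : IsDualBasis Finset.univ u m σ where
  pair i _ j _ := h.pair i j
  mem_iff x := by rw [h.mem_iff hS]; simp
  sum_eq x := h.sum_basis x

/-! ### The charts of a toric stratum -/

section

variable {k : Type u} [Field k] {X : Scheme.{u}} [IsIntegral X]
  {s : X ⟶ Spec (CommRingCat.of k)} {ι : Type} {D : SNCDivisor X ι} {τ : Finset ι} {d : ℕ}
  {F : Fan d} {T : ToricStructure (redι (D.stratum τ) ≫ s) F}
  [IsIntegral (redSubscheme (D.stratum τ))]

/-- A monomial that is constant on `ω` is invertible on the chart of `ω`. -/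
theorem ToricStructure.unitEq_chi_one {ω : F.cones} {a : Fin d → ℤ} (ha : a ∈ dualMonoid ω.1)
    (ha' : -a ∈ dualMonoid ω.1) (y : affineToric k ω.1) :
    UnitEq (T.chart ω y) (T.chi a) 1 := by
  rw [← T.evalHom_single ω ⟨a, ha⟩]
  refine unitEq_evalHom_one _ fun hy => (PrimeSpectrum.isPrime y).ne_top
    (Ideal.eq_top_of_isUnit_mem _ hy (IsUnit.of_mul_eq_one (AddMonoidAlgebra.single ⟨-a, ha'⟩ 1) ?_))
  refine (AddMonoidAlgebra.single_mul_single ..).trans ?_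
  have : (⟨a, ha⟩ + ⟨-a, ha'⟩ : dualMonoid ω.1) = 0 := Subtype.ext (add_neg_cancel a)
  rw [this, one_mul]
  rfl

theorem ToricStructure.IsExponent.notMem_supp {σ ω : F.cones} {i : ι} {a : Fin d → ℤ}
    (h : T.IsExponent σ i a) (ha : a ∈ dualMonoid ω.1) (ha' : -a ∈ dualMonoid ω.1)
    (hω : ω.1 ≤ σ.1) (y : affineToric k ω.1) : T.emb ω y ∉ D.supp i := by
  obtain ⟨z, hz⟩ := T.range_chart_mono hω ⟨y, rfl⟩
  have h1 := h z
  rw [hz] at h1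
  obtain ⟨v, hv⟩ := h1.trans (ToricStructure.unitEq_chi_one ha ha' y)
  rw [mul_one] at hv
  have h2 := IsFractionRing.injective ((redSubscheme (D.stratum τ)).presheaf.stalk (T.chart ω y))
    (redSubscheme (D.stratum τ)).functionField hv
  have h3 := (SNCDivisor.isUnit_resLoc_iff (D := D) (τ := τ) i (T.chart ω y)).1 (h2 ▸ v.isUnit)
  rwa [ToricStructure.emb, Scheme.Hom.comp_apply]

/-- The orbit of a ray of a smooth cone is not empty: the dual monomial of the ray is not invertible
on the chart of the ray, but it is on the charts of its proper faces. -/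
theorem ToricStructure.orbit_ray_nonempty (T : ToricStructure (redι (D.stratum τ) ≫ s) F)
    {σ : F.cones} {α : Type*} [DecidableEq α] {I : Finset α}
    {u m : α → Fin d → ℤ} (h : IsDualBasis I u m σ.1) {j : α} (hj : j ∈ I) (ω : F.cones)
    (hω : ω.1 = coneOf u {j}) : (T.orbit ω).Nonempty := by
  have hjI : ({j} : Finset α) ⊆ I := Finset.singleton_subset_iff.2 hj
  have hωσ : ω.1 ≤ σ.1 := by rw [hω, h.eq_coneOf]; exact coneOf_mono hjI
  have hm : m j ∈ dualMonoid ω.1 := dualMonoid_anti hωσ (by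
    rw [h.mem_dualMonoid_iff]
    intro i hi
    rw [h.pair j hj i hi]
    split_ifs <;> norm_num)
  have hmn : -m j ∉ dualMonoid ω.1 := by
    rw [hω, mem_dualMonoid_coneOf]
    intro h1
    have := h1 j (Finset.mem_singleton_self j)
    rw [neg_dotProduct, h.pair j hj j hj, if_pos rfl] at this
    norm_num at this
  have hnu : ¬ ∀ y : affineToric k ω.1, AddMonoidAlgebra.single ⟨m j, hm⟩ (1 : k) ∉ y.asIdeal := by
    intro hall
    refine hmn (T.mem_dualMonoid_of_unitEq ω _ fun y => ?_).2
    rw [← T.evalHom_single ω ⟨m j, hm⟩]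
    exact unitEq_evalHom_one _ (hall y)
  push Not at hnu
  obtain ⟨y, hy⟩ := hnu
  refine ⟨T.chart ω y, ⟨y, rfl⟩, ?_⟩
  simp only [Set.mem_iUnion, not_exists]
  rintro ω' hω' ⟨z, hz⟩
  have hω'' : ω'.1 < ω.1 := hω'
  obtain ⟨K, hK, hωK⟩ := h.exists_eq_coneOf (F.isFaceOf_of_le ω'.2 σ.2 (hω''.le.trans hωσ))
  have hKj : ∀ i ∈ K, i = j := by
    intro i hi
    have h1 : castR (u i) ∈ ω.1 := hω''.le (hωK ▸ castR_mem_coneOf hi)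
    rw [hω, h.mem_coneOf_iff hjI] at h1
    by_contra hne
    have h2 := h1.2 i (hK hi) (by simpa using hne)
    rw [h.dotR_pair (hK hi) (hK hi), if_pos rfl] at h2
    exact one_ne_zero h2
  have hjK : j ∉ K := fun hjK => hω''.ne (by
    rw [hωK, hω]
    congr 1
    exact Finset.eq_singleton_iff_unique_mem.2 ⟨hjK, hKj⟩)
  have hK0 : K = ∅ := Finset.eq_empty_of_forall_notMem fun i hi => hjK (hKj i hi ▸ hi)
  have h1 : ∀ a : Fin d → ℤ, a ∈ dualMonoid ω'.1 := fun a => by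
    rw [hωK, hK0, mem_dualMonoid_coneOf]
    simp
  have h2 := ToricStructure.unitEq_chi_one (T := T) (h1 (m j)) (h1 (-m j)) z
  rw [hz, ← T.evalHom_single ω ⟨m j, hm⟩, ← algebraMap_evalStalk _ y] at h2
  obtain ⟨v, hv⟩ := h2
  rw [mul_one] at hv
  have h3 := IsFractionRing.injective ((redSubscheme (D.stratum τ)).presheaf.stalk (T.chart ω y))
    (redSubscheme (D.stratum τ)).functionField hv
  exact (isUnit_evalStalk_iff (T.chart ω) y _).1 (h3 ▸ v.isUnit) hy

end

/-! ### Rays and components -/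

section

variable {k : Type u} [Field k] {X : Scheme.{u}} [IsIntegral X]
  {s : X ⟶ Spec (CommRingCat.of k)} {ι : Type} {D : SNCDivisor X ι} {τ : Finset ι} {d : ℕ}
  {F : Fan d} {T : ToricStructure (redι (D.stratum τ) ≫ s) F}
  [IsIntegral (redSubscheme (D.stratum τ))]

/-- A component not containing the stratum is defined by a monomial on a smooth chart, since it does
not meet the torus. -/
theorem ToricStructure.exists_isExponent [DecidableEq ι]
    (T : ToricStructure (redι (D.stratum τ) ≫ s) F) (hτ : D.IsCone τ)
    (hT : D.StratificationAgrees τ T) (σ : F.cones)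
    {u m : Fin d → Fin d → ℤ} (h : IsSmoothBasis σ.1 u m) (i : ι)
    (hi : redι (D.stratum τ) (genericPoint _) ∉ D.supp i) : ∃ a, T.IsExponent σ i a := by
  let Y := redSubscheme (D.stratum τ)
  let g : Y.functionField := ((redι (D.stratum τ)).stalkMap (genericPoint Y)).hom
    (D.loc i (redι (D.stratum τ) (genericPoint Y)))
  have hg0 : g ≠ 0 := by
    rw [D.mem_supp_iff, not_not] at hi
    exact (hi.map ((redι (D.stratum τ)).stalkMap (genericPoint Y)).hom).ne_zero
  have hE : ∀ y : Y, ((D.comp i).restrict (redι (D.stratum τ))).eqn y =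
      algebraMap _ Y.functionField (D.resLoc τ i y) * g⁻¹ := fun y => by
    rw [eq_mul_inv_iff_mul_eq₀ hg0]
    exact D.ratSection_comp_eq (redι (D.stratum τ)) hi y
  obtain ⟨a, ha⟩ := T.exists_unitEq_chi ((D.comp i).restrict (redι (D.stratum τ))) g⁻¹
    (inv_ne_zero hg0) (fun x => by
      rw [hE]
      have h1 : IsUnit (D.resLoc τ i (T.chart T.torus x)) := by
        rw [SNCDivisor.isUnit_resLoc_iff]
        intro hx
        exact hi (hT.mem_supp_of_mem_torus hτ T.torus rfl x (by
          rwa [ToricStructure.emb, Scheme.Hom.comp_apply]) _)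
      have := (UnitEq.of_isUnit h1).mul (UnitEq.refl g⁻¹)
      rwa [one_mul] at this) σ h
  refine ⟨a, fun y => ?_⟩
  have h2 := (ha y).mul (UnitEq.refl g)
  rw [hE, mul_assoc, inv_mul_cancel₀ hg0, mul_one, mul_right_comm, inv_mul_cancel₀ hg0,
    one_mul] at h2
  exact h2

/-- The components `D_i`, `i ∈ I`, are those that meet the stratum `D_τ` in the toric divisors of
the chart of `σ`, and `u i` is the primitive generator of the corresponding ray of `σ`; the monomial
`χ^(m i)` is an equation of `D_i`. -/
structure ToricStructure.IsChart [DecidableEq ι] (T : ToricStructure (redι (D.stratum τ) ≫ s) F)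
    (σ : F.cones) (I : Finset ι) (u m : ι → Fin d → ℤ) : Prop where
  dual : IsDualBasis I u m σ.1
  card : I.card = d
  disj : ∀ i ∈ I, i ∉ τ
  exponent : ∀ i ∈ I, T.IsExponent σ i (m i)
  exponent_zero : ∀ i ∉ τ, i ∉ I → T.IsExponent σ i 0
  ray : ∀ i ∈ I, ∀ ω : F.cones, ω.1 = coneOf u {i} →
    (D.stratum (insert i τ) : Set X) = redι (D.stratum τ) '' T.closedStratum ω
  fixed : ∃ x : affineToric k σ.1, ∀ i ∈ I, T.emb σ x ∈ D.supp i
  smooth : ∃ u m, IsSmoothBasis σ.1 u m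

variable [Fintype ι] {n : ℕ} [SmoothOfRelativeDimension n s]

/-- On the chart of a full cone, the components of `D` through the fixed point correspond to the rays
of the cone. -/
theorem ToricStructure.exists_isChart [DecidableEq ι]
    (T : ToricStructure (redι (D.stratum τ) ≫ s) F) (hd : τ.card + d = n) (hτ : D.IsCone τ)
    (hT : D.StratificationAgrees τ T) (σ : F.cones) (hσ : F.IsFull σ.1) :
    ∃ I u m, T.IsChart σ I u m := by
  classical
  obtain ⟨v, p, h⟩ := T.exists_isSmoothBasis hd σ hσ
  obtain ⟨S, hS⟩ := F.exists_isStronglyConvexHull σ.2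
  have hdual := h.isDualBasis hS
  obtain ⟨x, hx1, hx2, hx3, hx4⟩ := T.exists_fixedPoint hd σ h
  have hgen : ∀ i ∉ τ, redι (D.stratum τ) (genericPoint _) ∉ D.supp i := by
    intro i hi hg
    by_cases hxi : T.emb σ x ∈ D.supp i
    · exact hx1 i hi hxi hg
    · refine hxi ?_
      rw [ToricStructure.emb, Scheme.Hom.comp_apply]
      exact ((genericPoint_specializes (T.chart σ x)).map
        (redι (D.stratum τ)).continuous).mem_closed (D.isClosed_supp i) hg
  have hex : ∀ i : ι, ∃ a, i ∉ τ → T.IsExponent σ i a := fun i => by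
    by_cases hi : i ∈ τ
    · exact ⟨0, fun h => (h hi).elim⟩
    · obtain ⟨a, ha⟩ := T.exists_isExponent hτ hT σ h i (hgen i hi)
      exact ⟨a, fun _ => ha⟩
  choose a ha using hex
  let I := Finset.univ.filter fun i => i ∉ τ ∧ T.emb σ x ∈ D.supp i
  have hI : ∀ i, i ∈ I ↔ i ∉ τ ∧ T.emb σ x ∈ D.supp i := fun i => by simp [I]
  -- the stratum of the ray `j` is cut out by components whose monomial is that dual to `j`
  have hray : ∀ (j : Fin d) (ω : F.cones), ω.1 = coneOf v {j} → ∃ ρ, D.IsCone ρ ∧ τ ⊆ ρ ∧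
      (D.stratum ρ : Set X) = redι (D.stratum τ) '' T.closedStratum ω ∧
      (∃ i ∈ ρ, i ∉ τ) ∧ ∀ i ∈ ρ, i ∉ τ → i ∈ I ∧ a i = p j := by
    intro j ω hω
    obtain ⟨ρ, hρ, hτρ, hρω⟩ := hT.exists_cone_eq ω
    have hωσ : ω.1 ≤ σ.1 := by
      rw [hω, hdual.eq_coneOf]; exact coneOf_mono (Finset.subset_univ _)
    refine ⟨ρ, hρ, hτρ, hρω, ?_, fun i hi hiτ => ?_⟩
    · by_contra! hcon
      have hρτ : ρ = τ := (Finset.Subset.antisymm hτρ fun i hi => by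
        by_contra h; exact h (hcon i hi)).symm
      have h1 := redι_mem (D.stratum τ) (T.chart T.torus (⊥ : PrimeSpectrum _))
      have h0 : (D.stratum τ : Set X) = redι (D.stratum τ) '' T.closedStratum ω := by
        rw [← hρω, hρτ]
      obtain ⟨w, hw, hw'⟩ := h0.le h1
      have h2 := (redι (D.stratum τ)).isEmbedding.injective hw'
      have h3 : ω.1 ≤ T.torus.1 := T.le_of_mem_closedStratum hw (h2 ▸ ⟨_, rfl⟩)
      have h4 : castR (v j) ∈ T.torus.1 := h3 (hω ▸ castR_mem_coneOf (Finset.mem_singleton_self j))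
      have h5 := hdual.dotR_pair (Finset.mem_univ j) (Finset.mem_univ j)
      rw [(Submodule.mem_bot _).1 h4, map_zero, if_pos rfl] at h5
      exact zero_ne_one h5
    · obtain ⟨z, hz⟩ := T.orbit_ray_nonempty hdual (Finset.mem_univ j) ω hω
      obtain ⟨w, rfl⟩ := hz.1
      have h1 : redι (D.stratum τ) (T.chart ω w) ∈ (D.stratum ρ : Set X) := by
        rw [hρω]
        exact ⟨_, subset_closure hz, rfl⟩
      have h2 : T.emb ω w ∈ D.supp i := by
        rw [ToricStructure.emb, Scheme.Hom.comp_apply]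
        exact SNCDivisor.mem_stratum.1 h1 i hi
      have h3 := (ha i hiτ).mem_dualMonoid
      have h4 : -a i ∉ dualMonoid ω.1 := fun h4 =>
        (ha i hiτ).notMem_supp (dualMonoid_anti hωσ h3) h4 hωσ w h2
      have h5 : T.emb σ x ∈ D.supp i := by
        by_contra h5
        rw [hx3 i hiτ _ (ha i hiτ) h5, neg_zero] at h4
        exact h4 (zero_mem _)
      obtain ⟨l, hl⟩ := hx2 i hiτ _ (ha i hiτ) h5
      refine ⟨(hI i).2 ⟨hiτ, h5⟩, ?_⟩
      by_contra hne
      have hlj : l ≠ j := fun h => hne (h ▸ hl)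
      refine h4 ?_
      rw [hω, mem_dualMonoid_coneOf]
      intro l' hl'
      rw [Finset.mem_singleton.1 hl', neg_dotProduct, hl, h.pair, if_neg hlj, neg_zero]
  have hface : ∀ j : Fin d, coneOf v {j} ∈ F.cones := fun j =>
    F.face_mem σ.1 σ.2 _ (hdual.isFaceOf (Finset.subset_univ _))
  have hsurj : ∀ j : Fin d, ∃ i, i ∈ I ∧ a i = p j := fun j => by
    obtain ⟨ρ, -, -, -, ⟨i, hi, hiτ⟩, hρ⟩ := hray j ⟨_, hface j⟩ rfl
    exact ⟨i, hρ i hi hiτ⟩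
  -- `f j` is the component of the ray `j`
  choose f hfI hf using hsurj
  have hfinj : Function.Injective f := fun j l hjl => h.dual_injective (by rw [← hf, ← hf, hjl])
  have hfex : ∀ j, T.IsExponent σ (f j) (p j) := fun j =>
    hf j ▸ ha (f j) ((hI _).1 (hfI j)).1
  have hsurj' : ∀ i ∈ I, ∃ j, f j = i := fun i hi => by
    obtain ⟨h1, h2⟩ := (hI i).1 hi
    obtain ⟨j, hj⟩ := hx2 i h1 _ (ha i h1) h2
    exact ⟨j, hx4 _ ((hI _).1 (hfI j)).1 i h1 j (hfex j) (hj ▸ ha i h1)⟩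
  let u := Function.extend f v 0
  let m := Function.extend f p 0
  have hu : ∀ j, u (f j) = v j := fun j => hfinj.extend_apply _ _ _
  have hm : ∀ j, m (f j) = p j := fun j => hfinj.extend_apply _ _ _
  have hIf : I = Finset.univ.image f := by
    ext i
    rw [Finset.mem_image]
    exact ⟨fun hi => (hsurj' i hi).imp fun j hj => ⟨Finset.mem_univ j, hj⟩, by
      rintro ⟨j, -, rfl⟩; exact hfI j⟩
  refine ⟨I, u, m, ⟨?_, ?_, ?_⟩, ?_, fun i hi => ((hI i).1 hi).1, ?_, ?_, ?_, ⟨x, fun i hi =>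
    ((hI i).1 hi).2⟩, ⟨v, p, h⟩⟩
  · intro i hi i' hi'
    obtain ⟨j, rfl⟩ := hsurj' i hi
    obtain ⟨j', rfl⟩ := hsurj' i' hi'
    rw [hu, hm, h.pair]
    simp only [hfinj.eq_iff]
  · intro y
    rw [h.mem_iff hS]
    constructor
    · intro hy i hi
      obtain ⟨j, rfl⟩ := hsurj' i hi
      rw [hm]
      exact hy j
    · intro hy j
      rw [← hm]
      exact hy _ (hfI j)
  · intro y
    rw [hIf, Finset.sum_image fun _ _ _ _ h => hfinj h]
    refine Eq.trans (Finset.sum_congr rfl fun j _ => ?_) (h.sum_basis y)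
    rw [hu, hm]
  · rw [hIf, Finset.card_image_of_injective _ hfinj, Finset.card_univ, Fintype.card_fin]
  · intro i hi
    obtain ⟨j, rfl⟩ := hsurj' i hi
    rw [hm]
    exact hfex j
  · intro i hi hiI
    have h1 : T.emb σ x ∉ D.supp i := fun h1 => hiI ((hI i).2 ⟨hi, h1⟩)
    exact hx3 i hi _ (ha i hi) h1 ▸ ha i hi
  · intro i hi ω hω
    obtain ⟨j, rfl⟩ := hsurj' i hi
    have hω' : ω.1 = coneOf v {j} := by
      rw [hω]
      ext y
      simp only [mem_coneOf, Finset.mem_singleton, forall_eq, Finset.sum_singleton, hu]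
      exact ⟨fun ⟨c, hc⟩ => ⟨fun _ => c (f j), hc⟩, fun ⟨c, hc⟩ => ⟨fun _ => c j, hc⟩⟩
    obtain ⟨ρ, -, hτρ, hρω, ⟨i', hi', hiτ'⟩, hρ⟩ := hray j ω hω'
    have huniq : ∀ i ∈ ρ, i ∉ τ → i = f j := fun i hi hiτ =>
      hx4 i hiτ _ ((hI _).1 (hfI j)).1 j ((hρ i hi hiτ).2 ▸ ha i hiτ) (hfex j)
    have : ρ = insert (f j) τ := by
      ext i
      rw [Finset.mem_insert]
      constructor
      · intro hi
        by_cases hiτ : i ∈ τ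
        · exact Or.inr hiτ
        · exact Or.inl (huniq i hi hiτ)
      · rintro (rfl | hi)
        · exact huniq i' hi' hiτ' ▸ hi'
        · exact hτρ hi
    rw [← this]
    exact hρω

end

/-! ### Gluing the charts -/

namespace ToricStructure.IsChart

variable {k : Type u} [Field k] {X : Scheme.{u}} [IsIntegral X]
  {s : X ⟶ Spec (CommRingCat.of k)} {ι : Type} {D : SNCDivisor X ι} {τ : Finset ι} {d : ℕ}
  {F : Fan d} {T : ToricStructure (redι (D.stratum τ) ≫ s) F}
  [IsIntegral (redSubscheme (D.stratum τ))] [DecidableEq ι]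
  {σ σ' : F.cones} {I I' : Finset ι} {u m u' m' : ι → Fin d → ℤ}

theorem coneOf_mem (h : T.IsChart σ I u m) {K : Finset ι} (hK : K ⊆ I) : coneOf u K ∈ F.cones :=
  F.face_mem σ.1 σ.2 _ (h.dual.isFaceOf hK)

/-- The components through a point of a chart. -/
theorem mem_of_mem_supp (h : T.IsChart σ I u m) {y : redSubscheme (D.stratum τ)}
    (hy : y ∈ Set.range (T.chart σ)) {i : ι} (hi : i ∉ τ)
    (hyi : redι (D.stratum τ) y ∈ D.supp i) : i ∈ I := by
  by_contra hiI
  obtain ⟨z, rfl⟩ := hy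
  have h1 := (h.exponent_zero i hi hiI).mem_supp_iff z
  rw [ToricStructure.emb, Scheme.Hom.comp_apply] at h1
  exact (PrimeSpectrum.isPrime z).ne_top (Ideal.eq_top_of_isUnit_mem _ (h1.1 hyi) isUnit_one)

theorem mem_of_castR_mem (h : T.IsChart σ I u m) (h' : T.IsChart σ' I' u' m') {i : ι} (hi : i ∈ I)
    (hu : castR (u i) ∈ σ'.1) : i ∈ I' := by
  let ω : F.cones := ⟨_, h.coneOf_mem (Finset.singleton_subset_iff.2 hi)⟩
  have hω : ω.1 ≤ σ'.1 := by
    intro x hx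
    obtain ⟨c, hc, rfl⟩ := mem_coneOf.1 hx
    rw [Finset.sum_singleton]
    exact PointedCone.smul_mem _ (hc i (Finset.mem_singleton_self i)) hu
  obtain ⟨z, hz⟩ := T.orbit_ray_nonempty h.dual hi ω rfl
  have h1 : redι (D.stratum τ) z ∈ (D.stratum (insert i τ) : Set X) := by
    rw [h.ray i hi ω rfl]
    exact ⟨z, subset_closure hz, rfl⟩
  exact h'.mem_of_mem_supp (T.range_chart_mono hω hz.1) (h.disj i hi)
    (SNCDivisor.mem_stratum.1 h1 i (Finset.mem_insert_self _ _))

/-- The generators of the rays do not depend on the chart. -/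
theorem eq_of_mem (h : T.IsChart σ I u m) (h' : T.IsChart σ' I' u' m') {i : ι} (hi : i ∈ I)
    (hi' : i ∈ I') : u i = u' i := by
  let ω : F.cones := ⟨_, h.coneOf_mem (Finset.singleton_subset_iff.2 hi)⟩
  let ω' : F.cones := ⟨_, h'.coneOf_mem (Finset.singleton_subset_iff.2 hi')⟩
  have hst : T.closedStratum ω = T.closedStratum ω' :=
    (redι (D.stratum τ)).isEmbedding.injective.image_injective
      ((h.ray i hi ω rfl).symm.trans (h'.ray i hi' ω' rfl))
  obtain ⟨z, hz⟩ := T.orbit_ray_nonempty h.dual hi ω rfl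
  obtain ⟨z', hz'⟩ := T.orbit_ray_nonempty h'.dual hi' ω' rfl
  have h1 : ω'.1 ≤ ω.1 := T.le_of_mem_closedStratum (hst ▸ subset_closure hz) hz.1
  have h2 : ω.1 ≤ ω'.1 := T.le_of_mem_closedStratum (hst ▸ subset_closure hz') hz'.1
  obtain ⟨c, hc, hcu⟩ := mem_coneOf.1 (h1 (castR_mem_coneOf (Finset.mem_singleton_self i)))
  obtain ⟨c', hc', hcu'⟩ := mem_coneOf.1 (h2 (castR_mem_coneOf (Finset.mem_singleton_self i)))
  rw [Finset.sum_singleton] at hcu hcu'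
  have e1 : dotR (m i) (castR (u' i)) = c i := by
    rw [hcu, map_smul, h.dual.dotR_pair hi hi, if_pos rfl, smul_eq_mul, mul_one]
  have e2 : dotR (m' i) (castR (u i)) = c' i := by
    rw [hcu', map_smul, h'.dual.dotR_pair hi' hi', if_pos rfl, smul_eq_mul, mul_one]
  have e3 : c' i * c i = 1 := by
    have : dotR (m i) (castR (u i)) = 1 := by rw [h.dual.dotR_pair hi hi, if_pos rfl]
    rw [hcu', map_smul, e1, smul_eq_mul] at this
    exact this
  rw [dotR_castR] at e1 e2
  have hc0 := hc i (Finset.mem_singleton_self i)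
  rw [← e1, ← e2] at e3
  rw [← e1] at hc0
  have e4 : (m' i ⬝ᵥ u i) * (m i ⬝ᵥ u' i) = 1 := by exact_mod_cast e3
  have e5 : 0 ≤ m i ⬝ᵥ u' i := by exact_mod_cast hc0
  have e6 : m i ⬝ᵥ u' i = 1 := by
    rcases Int.isUnit_iff.1 (IsUnit.of_mul_eq_one_right _ e4) with h | h
    · exact h
    · omega
  apply castR_injective
  rw [hcu, ← e1, e6]
  simp

/-- Two cones meet in the cone generated by their common rays. -/
theorem inf_eq (h : T.IsChart σ I u m) (h' : T.IsChart σ' I' u' m') :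
    σ.1 ⊓ σ'.1 = coneOf u (I ∩ I') := by
  apply le_antisymm
  · obtain ⟨K, hK, hKe⟩ := h.dual.exists_eq_coneOf (F.inf_face σ.1 σ.2 σ'.1 σ'.2)
    rw [hKe]
    refine coneOf_mono fun i hi => Finset.mem_inter.2 ⟨hK hi, ?_⟩
    have h1 : castR (u i) ∈ σ.1 ⊓ σ'.1 := hKe ▸ castR_mem_coneOf hi
    exact h.mem_of_castR_mem h' (hK hi) h1.2
  · refine le_inf ?_ ?_
    · rw [h.dual.eq_coneOf]
      exact coneOf_mono Finset.inter_subset_left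
    · rw [coneOf_congr fun i hi => h.eq_of_mem h' (Finset.mem_inter.1 hi).1 (Finset.mem_inter.1 hi).2,
        h'.dual.eq_coneOf]
      exact coneOf_mono Finset.inter_subset_right

end ToricStructure.IsChart

/-! ### Degrees on the projective line -/

section Ord

variable {C : Scheme.{u}} [IsIntegral C] [IsLocallyNoetherian C]

theorem UnitEq.ord_eq {z : C} {a b : C.functionField} (h : UnitEq z a b) (hb : b ≠ 0) :
    Scheme.ord a z = Scheme.ord b z := by
  obtain ⟨v, rfl⟩ := h
  have hv : algebraMap (C.presheaf.stalk z) C.functionField (v : C.presheaf.stalk z) ≠ 0 :=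
    (v.isUnit.map _).ne_zero
  rw [Scheme.ord_mul hv hb, add_eq_right]
  by_cases hz : Order.coheight z = 1
  · rw [Scheme.ord_eq_iff hz hv]
    have : Ring.KrullDimLE 1 (C.presheaf.stalk z) := krullDimLE_of_coheight_le hz.le
    exact Ring.ordFrac_of_isUnit v.isUnit
  · exact Scheme.ord_eq_zero_of_coheight_neq_one hz _

theorem ord_one (z : C) : Scheme.ord (1 : C.functionField) z = 0 := by
  have := Scheme.ord_mul (x := z) (one_ne_zero (α := C.functionField)) one_ne_zero
  rw [mul_one] at this
  omega

theorem ord_pow (z : C) {f : C.functionField} (hf : f ≠ 0) (n : ℕ) :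
    Scheme.ord (f ^ n) z = n * Scheme.ord f z := by
  induction n with
  | zero => simp [ord_one]
  | succ n ih => rw [pow_succ, Scheme.ord_mul (pow_ne_zero _ hf) hf, ih]; push_cast; ring

theorem ord_inv (z : C) {f : C.functionField} (hf : f ≠ 0) :
    Scheme.ord f⁻¹ z = -Scheme.ord f z := by
  have := Scheme.ord_mul (x := z) hf (inv_ne_zero hf)
  rw [mul_inv_cancel₀ hf, ord_one] at this
  omega

theorem ord_zpow (z : C) {f : C.functionField} (hf : f ≠ 0) (n : ℤ) :
    Scheme.ord (f ^ n) z = n * Scheme.ord f z := by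
  obtain ⟨n, rfl | rfl⟩ := n.eq_nat_or_neg
  · rw [zpow_natCast, ord_pow z hf]
  · rw [zpow_neg, zpow_natCast, ord_inv z (pow_ne_zero _ hf), ord_pow z hf]; ring

variable {R : CommRingCat.{u}} [IsDomain R] (j : Spec R ⟶ C) [IsOpenImmersion j]

theorem ord_evalHom_of_notMem {x : Spec R} {r : R} (hr : r ∉ x.asIdeal) :
    Scheme.ord (evalHom j r) (j x) = 0 := by
  rw [(unitEq_evalHom_one j hr).ord_eq one_ne_zero, ord_one]

/-- A generator of a prime ideal is a uniformizer. -/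
theorem ord_evalHom_of_span {x : Spec R} {p : R} (hp : p ≠ 0) (hx : x.asIdeal = Ideal.span {p}) :
    Scheme.ord (evalHom j p) (j x) = 1 := by
  let S := C.presheaf.stalk (j x)
  let π : S := evalStalk j x p
  have hπ0 : π ≠ 0 := fun h => (map_ne_zero_iff _ (evalHom_injective j)).2 hp (by
    rw [← algebraMap_evalStalk j x]
    exact (congrArg _ h).trans (map_zero _))
  have hpx : p ∈ x.asIdeal := hx ▸ Ideal.mem_span_singleton_self p
  have hπu : ¬ IsUnit π := fun h => (isUnit_evalStalk_iff j x p).1 h hpx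
  have hmax : IsLocalRing.maximalIdeal S = Ideal.span {π} := by
    apply le_antisymm
    · intro v hv
      obtain ⟨r, t, ht, h⟩ := exists_mul_evalStalk_eq j x v
      have htu := (isUnit_evalStalk_iff j x t).2 ht
      have hr : r ∈ x.asIdeal := by
        by_contra hr
        have := (isUnit_evalStalk_iff j x r).2 hr
        rw [← h] at this
        exact hv (isUnit_of_mul_isUnit_left this)
      rw [hx, Ideal.mem_span_singleton] at hr
      obtain ⟨q, rfl⟩ := hr
      rw [Ideal.mem_span_singleton, ← htu.dvd_mul_right, h, map_mul]
      exact dvd_mul_right _ _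
    · rw [Ideal.span_singleton_le_iff_mem]
      exact hπu
  have hnf : ¬ IsField S := fun h => by
    obtain ⟨b, hb⟩ := h.mul_inv_cancel hπ0
    exact hπu (IsUnit.of_mul_eq_one b hb)
  have hdvr : IsDiscreteValuationRing S :=
    ((IsDiscreteValuationRing.TFAE S hnf).out 0 4).2 (by rw [hmax]; exact ⟨⟨π, rfl⟩⟩)
  have hirr : Irreducible π := by
    rw [IsDiscreteValuationRing.irreducible_iff_uniformizer, hmax]
  have hco : Order.coheight (j x) = 1 := by
    have h1 := ringKrullDim_stalk_eq_coheight (j x)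
    rw [IsPrincipalIdealRing.ringKrullDim_eq_one _ hnf] at h1
    exact_mod_cast h1.symm
  have : Ring.KrullDimLE 1 (C.presheaf.stalk (j x)) := krullDimLE_of_coheight_le hco.le
  rw [Scheme.ord_eq_iff hco ((map_ne_zero_iff _ (evalHom_injective j)).2 hp),
    ← algebraMap_evalStalk j x]
  refine (Ring.ordFrac_eq_ord _ hπ0).trans ?_
  exact Ring.ordMonoidWithZeroHom_eq_coe _ (mem_nonZeroDivisors_of_ne_zero hπ0)
    (n := 1) (by exact_mod_cast Ring.ord_of_irreducible hirr)

end Ord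

section ProjectiveLine

open Polynomial

variable {C : Scheme.{u}} [IsIntegral C] {k : Type u} [Field k]
  (j₁ j₂ : Spec (CommRingCat.of k[X]) ⟶ C) [IsOpenImmersion j₁] [IsOpenImmersion j₂]

/-- `C` is covered by two affine lines with inverse coordinates; the second one is only needed at
its origin. -/
structure IsProjectiveLine : Prop where
  mul_eq_one : evalHom j₁ X * evalHom j₂ X = 1
  const : ∀ c : k, evalHom j₁ (Polynomial.C c) = evalHom j₂ (Polynomial.C c)
  cover : ∀ z, z ∈ Set.range j₁ ∨ ∃ x : Spec (CommRingCat.of k[X]), X ∈ x.asIdeal ∧ z = j₂ x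

namespace IsProjectiveLine

variable {j₁ j₂}

/-- The point of the affine line with coordinate `r`. -/
def pt (r : k) : Spec (CommRingCat.of k[X]) :=
  ⟨Ideal.span {X - Polynomial.C r}, (Ideal.span_singleton_prime (X_sub_C_ne_zero r)).2
    (prime_X_sub_C r)⟩

theorem mem_pt {r : k} {p : k[X]} : p ∈ (pt r).asIdeal ↔ p.eval r = 0 := by
  change p ∈ Ideal.span {X - Polynomial.C r} ↔ _
  rw [Ideal.mem_span_singleton, dvd_iff_isRoot, IsRoot.def]

theorem pt_injective : Function.Injective (pt (k := k)) := fun r r' h => by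
  have : X - Polynomial.C r ∈ (pt r').asIdeal := h ▸ mem_pt.2 (by simp)
  rw [mem_pt] at this
  simp only [eval_sub, eval_X, eval_C] at this
  exact (sub_eq_zero.1 this).symm

theorem infty_notMem_range (h : IsProjectiveLine j₁ j₂) : j₂ (pt 0) ∉ Set.range j₁ := by
  rintro ⟨x, hx⟩
  have h1 : evalStalk j₂ (pt 0) X ∈ IsLocalRing.maximalIdeal _ := fun h =>
    (isUnit_evalStalk_iff j₂ (pt 0) X).1 h (mem_pt.2 (by simp))
  have h2 : ∃ v : C.presheaf.stalk (j₂ (pt 0)),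
      algebraMap _ C.functionField v = evalHom j₁ X := by
    rw [← hx]
    exact ⟨_, algebraMap_evalStalk j₁ x X⟩
  obtain ⟨v, hv⟩ := h2
  refine (IsLocalRing.mem_maximalIdeal _).1 h1 (IsUnit.of_mul_eq_one_right v ?_)
  apply IsFractionRing.injective (C.presheaf.stalk (j₂ (pt 0))) C.functionField
  rw [map_mul, map_one, algebraMap_evalStalk, hv, h.mul_eq_one]

variable [IsLocallyNoetherian C]

theorem ord_pt (j : Spec (CommRingCat.of k[X]) ⟶ C) [IsOpenImmersion j] {p : k[X]} (hp : p ≠ 0)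
    (r : k) : Scheme.ord (evalHom j p) (j (pt r)) = p.rootMultiplicity r := by
  obtain ⟨q, hq, hqr⟩ := exists_eq_pow_rootMultiplicity_mul_and_not_dvd p hp r
  have h1 : evalHom j (X - Polynomial.C r) ≠ 0 :=
    (map_ne_zero_iff _ (evalHom_injective j)).2 (X_sub_C_ne_zero r)
  have h2 : q ≠ 0 := fun h => hqr (h ▸ dvd_zero _)
  conv_lhs => rw [hq]
  rw [map_mul, Scheme.ord_mul (by rw [map_pow]; exact pow_ne_zero _ h1)
    ((map_ne_zero_iff _ (evalHom_injective j)).2 h2), map_pow, ord_pow _ h1,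
    ord_evalHom_of_span j (x := pt r) (X_sub_C_ne_zero r) rfl,
    ord_evalHom_of_notMem j (x := pt r) (fun h => hqr (Ideal.mem_span_singleton.1 h))]
  ring

theorem eq_pt_or [IsAlgClosed k] (x : Spec (CommRingCat.of k[X])) :
    x = (⊥ : PrimeSpectrum k[X]) ∨ ∃ r, x = pt r := by
  by_cases hx : x.asIdeal = ⊥
  · exact Or.inl (PrimeSpectrum.ext hx)
  · right
    obtain ⟨p, hp, hp0⟩ := Submodule.exists_mem_ne_zero_of_ne_bot hx
    have hprime := PrimeSpectrum.isPrime x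
    have : ∃ r, X - Polynomial.C r ∈ x.asIdeal := by
      have hs := IsAlgClosed.splits p
      rw [hs.eq_prod_roots] at hp
      rcases hprime.mem_or_mem hp with h | h
      · exact (hprime.ne_top (Ideal.eq_top_of_isUnit_mem _ h
          (isUnit_C.2 (isUnit_iff_ne_zero.2 (leadingCoeff_ne_zero.2 hp0))))).elim
      · obtain ⟨q, hq, hqx⟩ := hprime.multiset_prod_mem_iff_exists_mem _ |>.1 h
        obtain ⟨r, -, rfl⟩ := Multiset.mem_map.1 hq
        exact ⟨r, hqx⟩
    obtain ⟨r, hr⟩ := this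
    refine ⟨r, PrimeSpectrum.ext ?_⟩
    have hmax : (Ideal.span {X - Polynomial.C r}).IsMaximal :=
      PrincipalIdealRing.isMaximal_of_irreducible (irreducible_X_sub_C r)
    exact (hmax.eq_of_le hprime.ne_top ((Ideal.span_singleton_le_iff_mem _).2 hr)).symm

theorem ord_infty (h : IsProjectiveLine j₁ j₂) {p : k[X]} (hp : p ≠ 0) :
    Scheme.ord (evalHom j₁ p) (j₂ (pt 0)) = -p.natDegree := by
  let f := (evalHom j₂).comp Polynomial.C
  have h1 : ∀ q : k[X], evalHom j₁ q = q.eval₂ f (evalHom j₁ X) := fun q => by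
    conv_lhs => rw [← eval₂_C_X (p := q), hom_eval₂]
    congr 1
    exact RingHom.ext h.const
  have h2 : ∀ q : k[X], evalHom j₂ q = q.eval₂ f (evalHom j₂ X) := fun q => by
    conv_lhs => rw [← eval₂_C_X (p := q), hom_eval₂]
  let _ : Invertible (evalHom j₁ X) := ⟨evalHom j₂ X, by rw [mul_comm, h.mul_eq_one], h.mul_eq_one⟩
  have h3 := eval₂_reverse_mul_pow f (evalHom j₁ X) p
  have h4 : (⅟(evalHom j₁ X) : C.functionField) = evalHom j₂ X := rfl
  rw [h4, ← h2, ← h1] at h3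
  have hX : evalHom j₂ X ≠ 0 := (map_ne_zero_iff _ (evalHom_injective j₂)).2 X_ne_zero
  have h5 : evalHom j₁ X = (evalHom j₂ X)⁻¹ := eq_inv_of_mul_eq_one_left h.mul_eq_one
  have h6 : evalHom j₂ p.reverse ≠ 0 :=
    (map_ne_zero_iff _ (evalHom_injective j₂)).2 (by rwa [Ne, reverse_eq_zero])
  have h7 : Scheme.ord (evalHom j₂ X) (j₂ (pt 0)) = 1 :=
    ord_evalHom_of_span j₂ (x := pt 0) X_ne_zero (by simp [pt])
  rw [← h3, h5, Scheme.ord_mul h6 (pow_ne_zero _ (inv_ne_zero hX)), ord_pow _ (inv_ne_zero hX),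
    ord_inv _ hX, h7, ord_evalHom_of_notMem j₂ (x := pt 0)]
  · ring
  · rw [mem_pt, ← coeff_zero_eq_eval_zero, coeff_zero_reverse]
    exact leadingCoeff_ne_zero.2 hp

/-- The degree of a line bundle on the projective line, in terms of a transition function. -/
theorem finsum_ord [IsAlgClosed k] (h : IsProjectiveLine j₁ j₂) (G : C → C.functionField)
    (c : C.functionField) (hc : c ≠ 0) (e : ℤ) (h₁ : ∀ x, UnitEq (j₁ x) (G (j₁ x)) c)
    (h₂ : ∀ x, UnitEq (j₂ x) (G (j₂ x)) (c * evalHom j₂ X ^ e)) :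
    ∑ᶠ z, Scheme.ord (G z) z = e := by
  classical
  let _ := (evalHom j₁).toAlgebra
  have hfr := isFractionRing_evalHom j₁
  obtain ⟨p, q, hq, hpq⟩ := IsFractionRing.div_surjective (A := k[X]) c
  replace hpq : evalHom j₁ p / evalHom j₁ q = c := hpq
  have hq0 : q ≠ 0 := nonZeroDivisors.ne_zero hq
  have hp0 : p ≠ 0 := by
    rintro rfl
    exact hc (by rw [← hpq, map_zero, zero_div])
  have hP := (map_ne_zero_iff _ (evalHom_injective j₁)).2 hp0
  have hQ := (map_ne_zero_iff _ (evalHom_injective j₁)).2 hq0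
  have hcz : ∀ z, Scheme.ord c z = Scheme.ord (evalHom j₁ p) z - Scheme.ord (evalHom j₁ q) z := by
    intro z
    rw [← hpq, div_eq_mul_inv, Scheme.ord_mul hP (inv_ne_zero hQ), ord_inv z hQ]
    ring
  have hX : evalHom j₂ X ≠ 0 := (map_ne_zero_iff _ (evalHom_injective j₂)).2 X_ne_zero
  have hbot : ∀ x : Spec (CommRingCat.of k[X]), x.asIdeal = ⊥ →
      Scheme.ord (G (j₁ x)) (j₁ x) = 0 := fun x hx => by
    rw [(h₁ _).ord_eq hc, hcz, ord_evalHom_of_notMem j₁ (hx ▸ fun h => hp0 ((Submodule.mem_bot _).1 h)),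
      ord_evalHom_of_notMem j₁ (hx ▸ fun h => hq0 ((Submodule.mem_bot _).1 h)), sub_zero]
  have hpt : ∀ r, Scheme.ord (G (j₁ (pt r))) (j₁ (pt r)) =
      p.rootMultiplicity r - q.rootMultiplicity r := fun r => by
    rw [(h₁ _).ord_eq hc, hcz, ord_pt j₁ hp0, ord_pt j₁ hq0]
  have hinf : Scheme.ord (G (j₂ (pt 0))) (j₂ (pt 0)) = e - p.natDegree + q.natDegree := by
    rw [(h₂ _).ord_eq (mul_ne_zero hc (zpow_ne_zero _ hX)), Scheme.ord_mul hc (zpow_ne_zero _ hX),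
      hcz, h.ord_infty hp0, h.ord_infty hq0, ord_zpow _ hX,
      ord_evalHom_of_span j₂ (x := pt 0) X_ne_zero (by simp [pt])]
    ring
  let S : Finset k := p.roots.toFinset ∪ q.roots.toFinset
  have hsum : ∀ f : k[X], f.roots.toFinset ⊆ S →
      ∑ r ∈ S, (f.rootMultiplicity r : ℤ) = f.natDegree := fun f hf => by
    rw [← IsAlgClosed.card_roots_eq_natDegree, ← Multiset.sum_count_eq_card (s := S)
      (fun r hr => hf (Multiset.mem_toFinset.2 hr))]
    push_cast
    simp only [count_roots]
  have hinj : Function.Injective fun r => j₁ (pt r) := fun r r' hr =>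
    pt_injective (j₁.isOpenEmbedding.injective hr)
  have hnot : j₂ (pt 0) ∉ S.image fun r => j₁ (pt r) := fun hmem => by
    obtain ⟨r, -, hr⟩ := Finset.mem_image.1 hmem
    exact h.infty_notMem_range ⟨_, hr⟩
  rw [finsum_eq_sum_of_support_subset (s := insert (j₂ (pt 0)) (S.image fun r => j₁ (pt r)))]
  · rw [Finset.sum_insert hnot, Finset.sum_image fun _ _ _ _ hr => hinj hr, hinf,
      Finset.sum_congr rfl fun r _ => hpt r, Finset.sum_sub_distrib,
      hsum p Finset.subset_union_left, hsum q Finset.subset_union_right]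
    ring
  · intro z hz
    rw [Function.mem_support] at hz
    rw [Finset.mem_coe, Finset.mem_insert]
    rcases h.cover z with ⟨x, rfl⟩ | ⟨x, hx, rfl⟩
    · right
      rcases eq_pt_or x with rfl | ⟨r, rfl⟩
      · exact (hz (hbot _ rfl)).elim
      · refine Finset.mem_image.2 ⟨r, ?_, rfl⟩
        by_contra hr
        simp only [S, Finset.mem_union, Multiset.mem_toFinset, not_or] at hr
        rw [hpt, ← count_roots, ← count_roots, Multiset.count_eq_zero_of_notMem hr.1,
          Multiset.count_eq_zero_of_notMem hr.2] at hz
        exact hz (by norm_num)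
    · left
      rcases eq_pt_or x with rfl | ⟨r, rfl⟩
      · exact (X_ne_zero ((Submodule.mem_bot _).1 hx)).elim
      · rw [mem_pt, eval_X] at hx
        rw [hx]

end IsProjectiveLine

end ProjectiveLine

/-! ### Toric curves -/

section

open Polynomial

variable {α : Type*} [DecidableEq α] {d : ℕ} {K : Finset α} {a : α}
  {u m : α → Fin d → ℤ} {σ : PointedCone ℝ (Fin d → ℝ)}

theorem IsDualBasis.dual_mem (h : IsDualBasis K u m σ) {i : α} (hi : i ∈ K) :
    m i ∈ dualMonoid σ := by
  rw [h.mem_dualMonoid_iff]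
  intro j hj
  rw [h.pair i hi j hj]
  split_ifs <;> norm_num

open Classical in
/-- The restriction of functions from the affine toric variety of a smooth cone, generated by
`u_i`, `i ∈ K ∪ {a}`, to the toric curve defined by the face generated by the `u_i`, `i ∈ K`. -/
def lineHom (k : Type*) [Field k] (h : IsDualBasis (insert a K) u m σ) :
    AddMonoidAlgebra k (dualMonoid σ) →ₐ[k] k[X] :=
  AddMonoidAlgebra.lift k k[X] (dualMonoid σ)
    { toFun := fun t => if ∀ l ∈ K, (t.toAdd : Fin d → ℤ) ⬝ᵥ u l = 0
        then X ^ ((t.toAdd : Fin d → ℤ) ⬝ᵥ u a).toNat else 0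
      map_one' := by
        change (if ∀ l ∈ K, (0 : Fin d → ℤ) ⬝ᵥ u l = 0
          then (X : k[X]) ^ ((0 : Fin d → ℤ) ⬝ᵥ u a).toNat else 0) = 1
        simp
      map_mul' := fun t t' => by
        have h0 := h.mem_dualMonoid_iff.1 t.toAdd.2
        have h0' := h.mem_dualMonoid_iff.1 t'.toAdd.2
        change (if ∀ l ∈ K, ((t.toAdd : Fin d → ℤ) + (t'.toAdd : Fin d → ℤ)) ⬝ᵥ u l = 0
          then (X : k[X]) ^ (((t.toAdd : Fin d → ℤ) + (t'.toAdd : Fin d → ℤ)) ⬝ᵥ u a).toNat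
          else 0) = _
        have hiff : (∀ l ∈ K, ((t.toAdd : Fin d → ℤ) + (t'.toAdd : Fin d → ℤ)) ⬝ᵥ u l = 0) ↔
            (∀ l ∈ K, (t.toAdd : Fin d → ℤ) ⬝ᵥ u l = 0) ∧
              ∀ l ∈ K, (t'.toAdd : Fin d → ℤ) ⬝ᵥ u l = 0 := by
          rw [← forall₂_and]
          refine forall₂_congr fun l hl => ?_
          have h1 := h0 l (Finset.mem_insert_of_mem hl)
          have h1' := h0' l (Finset.mem_insert_of_mem hl)
          rw [add_dotProduct]
          omega
        rw [if_congr hiff rfl rfl, ite_and, ite_mul, zero_mul]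
        refine if_congr Iff.rfl ?_ rfl
        rw [mul_ite, mul_zero]
        refine if_congr Iff.rfl ?_ rfl
        rw [add_dotProduct, Int.toNat_add (h0 a (Finset.mem_insert_self _ _))
          (h0' a (Finset.mem_insert_self _ _)), pow_add] }

variable {k : Type u} [Field k]

open Classical in
theorem lineHom_single (h : IsDualBasis (insert a K) u m σ) (s : dualMonoid σ) (c : k) :
    lineHom k h (AddMonoidAlgebra.single s c) = c • if ∀ l ∈ K, (s : Fin d → ℤ) ⬝ᵥ u l = 0
        then X ^ ((s : Fin d → ℤ) ⬝ᵥ u a).toNat else 0 :=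
  AddMonoidAlgebra.lift_single ..

theorem lineHom_dual (h : IsDualBasis (insert a K) u m σ) (haK : a ∉ K) :
    lineHom k h (AddMonoidAlgebra.single
      ⟨m a, h.dual_mem (Finset.mem_insert_self a K)⟩ (1 : k)) = X := by
  rw [lineHom_single, if_pos, one_smul, h.pair _ (Finset.mem_insert_self a K) _
    (Finset.mem_insert_self a K), if_pos rfl, Int.toNat_one, pow_one]
  intro l hl
  rw [h.pair _ (Finset.mem_insert_self a K) _ (Finset.mem_insert_of_mem hl), if_neg]
  rintro rfl
  exact haK hl

theorem lineHom_surjective (h : IsDualBasis (insert a K) u m σ) (haK : a ∉ K) :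
    Function.Surjective (lineHom k h) := by
  intro p
  refine ⟨aeval (AddMonoidAlgebra.single
    ⟨m a, h.dual_mem (Finset.mem_insert_self a K)⟩ (1 : k)) p, ?_⟩
  rw [← aeval_algHom_apply, lineHom_dual h haK, aeval_X_left_apply]

theorem range_lineHom (h : IsDualBasis (insert a K) u m σ) (haK : a ∉ K) (x : affineToric k σ) :
    x ∈ Set.range (Spec.map (CommRingCat.ofHom (lineHom k h).toRingHom)) ↔
      ∀ l (hl : l ∈ K), AddMonoidAlgebra.single
        ⟨m l, h.dual_mem (Finset.mem_insert_of_mem hl)⟩ (1 : k) ∈ x.asIdeal := by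
  have hr : Set.range (Spec.map (CommRingCat.ofHom (lineHom k h).toRingHom)) =
      PrimeSpectrum.zeroLocus (RingHom.ker (lineHom k h).toRingHom) :=
    range_comap_of_surjective _ (lineHom k h).toRingHom (lineHom_surjective h haK)
  rw [hr]
  have hz : x ∈ PrimeSpectrum.zeroLocus (RingHom.ker (lineHom k h).toRingHom) ↔
      ∀ f, lineHom k h f = 0 → f ∈ x.asIdeal := Iff.rfl
  refine hz.trans ?_
  constructor
  · intro hx l hl
    refine hx _ ?_
    rw [lineHom_single, if_neg, smul_zero]
    intro hl'
    have := hl' l hl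
    rw [h.pair _ (Finset.mem_insert_of_mem hl) _ (Finset.mem_insert_of_mem hl), if_pos rfl] at this
    exact one_ne_zero this
  · intro hx
    let ma : dualMonoid σ := ⟨m a, h.dual_mem (Finset.mem_insert_self a K)⟩
    -- modulo the monomials vanishing on the curve, every function comes from the line
    have key : ∀ f, f - aeval (AddMonoidAlgebra.single ma (1 : k)) (lineHom k h f) ∈ x.asIdeal := by
      intro f
      induction f using AddMonoidAlgebra.induction_linear with
      | zero => rw [map_zero, map_zero, sub_zero]; exact zero_mem _
      | add f g hf hg =>
        rw [map_add, map_add, add_sub_add_comm]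
        exact add_mem hf hg
      | single s c =>
        have h0 := h.mem_dualMonoid_iff.1 s.2
        by_cases hs : ∀ l ∈ K, (s : Fin d → ℤ) ⬝ᵥ u l = 0
        · rw [lineHom_single, if_pos hs, map_smul, map_pow, aeval_X, AddMonoidAlgebra.single_pow]
          have hsa : ((s : Fin d → ℤ) ⬝ᵥ u a).toNat • ma = s := by
            apply Subtype.ext
            have h1 := h.sum_dual s
            rw [Finset.sum_insert haK, Finset.sum_eq_zero (fun l hl => by rw [hs l hl, zero_smul]),
              add_zero] at h1
            refine Eq.trans ?_ h1
            refine Eq.trans ?_ (congrArg (· • m a)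
              (Int.toNat_of_nonneg (h0 a (Finset.mem_insert_self a K))))
            exact (natCast_zsmul _ _).symm
          rw [hsa, one_pow, AddMonoidAlgebra.smul_single, smul_eq_mul, mul_one, sub_self]
          exact zero_mem _
        · rw [lineHom_single, if_neg hs, smul_zero, map_zero, sub_zero]
          push Not at hs
          obtain ⟨l, hl, hne⟩ := hs
          have hmem : (s : Fin d → ℤ) - m l ∈ dualMonoid σ := by
            rw [h.mem_dualMonoid_iff]
            intro i hi
            have h1 := h0 i hi
            rw [sub_dotProduct, h.pair _ (Finset.mem_insert_of_mem hl) i hi]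
            split_ifs with hli
            · subst hli; omega
            · omega
          have : AddMonoidAlgebra.single s c = AddMonoidAlgebra.single ⟨_, hmem⟩ c *
              AddMonoidAlgebra.single
                ⟨m l, h.dual_mem (Finset.mem_insert_of_mem hl)⟩ (1 : k) := by
            refine Eq.trans ?_ (AddMonoidAlgebra.single_mul_single ..).symm
            rw [mul_one]
            congr 1
            exact Subtype.ext (sub_add_cancel _ _).symm
          rw [this]
          exact Ideal.mul_mem_left _ _ (hx l hl)
    intro f hf
    have h1 := key f
    rw [hf, map_zero, sub_zero] at h1
    exact h1

/-- The affine toric variety of a facet is the locus where the complementary coordinate does not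
vanish. -/
theorem mem_range_affineToricMap (h : IsDualBasis (insert a K) u m σ) (haK : a ∉ K)
    (hle : coneOf u K ≤ σ) (x : affineToric k σ)
    (hx : AddMonoidAlgebra.single ⟨m a, h.dual_mem (Finset.mem_insert_self a K)⟩ (1 : k) ∉
      x.asIdeal) : x ∈ Set.range (affineToricMap k hle) := by
  let ma : dualMonoid σ := ⟨m a, h.dual_mem (Finset.mem_insert_self a K)⟩
  let φ := AddMonoidAlgebra.mapDomainRingHom k (AddSubmonoid.inclusion (dualMonoid_anti hle))
  let _ := φ.toAlgebra
  have hφ : ∀ s c, φ (AddMonoidAlgebra.single s c) =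
      AddMonoidAlgebra.single (AddSubmonoid.inclusion (dualMonoid_anti hle) s) c := fun s c =>
    (AddMonoidAlgebra.mapDomainRingHom_apply (R := k) _ _).trans AddMonoidAlgebra.mapDomain_single
  have hneg : -m a ∈ dualMonoid (coneOf u K) := by
    rw [mem_dualMonoid_coneOf]
    intro i hi
    rw [neg_dotProduct, h.pair _ (Finset.mem_insert_self a K) _ (Finset.mem_insert_of_mem hi),
      if_neg (by rintro rfl; exact haK hi), neg_zero]
  have hloc : IsLocalization.Away (AddMonoidAlgebra.single ma (1 : k))
      (AddMonoidAlgebra k (dualMonoid (coneOf u K))) := by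
    refine IsLocalization.Away.mk _ ?_ ?_ ?_
    · change IsUnit (φ _)
      rw [hφ]
      refine IsUnit.of_mul_eq_one (AddMonoidAlgebra.single ⟨-m a, hneg⟩ 1) ?_
      refine (AddMonoidAlgebra.single_mul_single ..).trans ?_
      rw [one_mul]
      congr 1
      exact Subtype.ext (add_neg_cancel (m a))
    · have hpow : ∀ n : ℕ, φ (AddMonoidAlgebra.single ma (1 : k)) ^ n =
          AddMonoidAlgebra.single (n • AddSubmonoid.inclusion (dualMonoid_anti hle) ma) 1 := fun n => by
        rw [hφ, AddMonoidAlgebra.single_pow, one_pow]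
      intro z
      change ∃ n f, z * φ _ ^ n = φ f
      induction z using AddMonoidAlgebra.induction_linear with
      | zero => exact ⟨0, 0, by rw [zero_mul, map_zero]⟩
      | add z w hz hw =>
        obtain ⟨n, f, hf⟩ := hz
        obtain ⟨n', f', hf'⟩ := hw
        refine ⟨n + n', f * AddMonoidAlgebra.single ma 1 ^ n' +
          f' * AddMonoidAlgebra.single ma 1 ^ n, ?_⟩
        rw [map_add, map_mul, map_mul, ← hf, ← hf', map_pow, map_pow]
        ring
      | single s c =>
        have hmem : (s : Fin d → ℤ) + (-((s : Fin d → ℤ) ⬝ᵥ u a)).toNat • m a ∈ dualMonoid σ := by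
          rw [h.mem_dualMonoid_iff]
          intro i hi
          rw [add_dotProduct, smul_dotProduct, h.pair _ (Finset.mem_insert_self a K) i hi]
          rcases Finset.mem_insert.1 hi with rfl | hi
          · rw [if_pos rfl, nsmul_one]
            have := Int.self_le_toNat (-((s : Fin d → ℤ) ⬝ᵥ u i))
            omega
          · rw [if_neg (by rintro rfl; exact haK hi), smul_zero, add_zero]
            exact mem_dualMonoid_coneOf.1 s.2 i hi
        refine ⟨(-((s : Fin d → ℤ) ⬝ᵥ u a)).toNat, AddMonoidAlgebra.single ⟨_, hmem⟩ c, ?_⟩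
        rw [hpow, hφ]
        refine (AddMonoidAlgebra.single_mul_single ..).trans ?_
        rw [mul_one]
        congr 1
    · intro f g hfg
      refine ⟨0, ?_⟩
      have hinj : Function.Injective (AddSubmonoid.inclusion (dualMonoid_anti hle)) :=
        AddSubmonoid.inclusion_injective _
      rw [AddMonoidAlgebra.mapDomain_injective (R := k) hinj hfg]
  have := PrimeSpectrum.localization_away_comap_range
    (AddMonoidAlgebra k (dualMonoid (coneOf u K))) (AddMonoidAlgebra.single ma (1 : k))
  have hx' : x ∈ Set.range (PrimeSpectrum.comap (algebraMap (AddMonoidAlgebra k (dualMonoid σ))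
      (AddMonoidAlgebra k (dualMonoid (coneOf u K))))) := by
    rw [this]; exact hx
  exact hx'

end

/-! ### Restriction of monomials to toric curves -/

theorem map_units_zpow {A B : Type*} [CommRing A] [Field B] (f : A →+* B) (t : Aˣ) (n : ℤ) :
    f ((t ^ n : Aˣ) : A) = f t ^ n := by
  have := congrArg Units.val (map_zpow (Units.map (f : A →* B)) t n)
  rwa [Units.val_zpow_eq_zpow_val] at this

/-- A morphism to a scheme that identifies `Z` with a reduced closed subscheme on an open subset is
an open immersion to the closed subscheme. -/
theorem isOpenImmersion_of_closed {W U C Y : Scheme.{u}} [IsReduced C] (q : C ⟶ Y)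
    [IsClosedImmersion q] (c : U ⟶ Y) [IsOpenImmersion c] (g : W ⟶ U) [IsClosedImmersion g]
    (j : W ⟶ C) (hj : j ≫ q = g ≫ c) (hg : ∀ x : U, c x ∈ Set.range q → x ∈ Set.range g) :
    IsOpenImmersion j ∧ Set.range j = q ⁻¹' Set.range c := by
  let P := Limits.pullback q c
  let e : W ⟶ P := Limits.pullback.lift j g hj
  have he1 : e ≫ Limits.pullback.fst q c = j := Limits.pullback.lift_fst _ _ _
  have he2 : e ≫ Limits.pullback.snd q c = g := Limits.pullback.lift_snd _ _ _
  have hred : IsReduced P := isReduced_of_isOpenImmersion (Limits.pullback.fst q c)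
  have hcl : IsClosedImmersion e := by
    have : IsClosedImmersion (e ≫ Limits.pullback.snd q c) := he2 ▸ inferInstance
    exact IsClosedImmersion.of_comp e (Limits.pullback.snd q c)
  have hsurj : Surjective e := ⟨fun p => by
    obtain ⟨x, hx⟩ := hg (Limits.pullback.snd q c p) ⟨Limits.pullback.fst q c p, by
      rw [← Scheme.Hom.comp_apply, ← Scheme.Hom.comp_apply, Limits.pullback.condition]⟩
    refine ⟨x, (Limits.pullback.snd q c).isEmbedding.injective ?_⟩
    rw [← Scheme.Hom.comp_apply, he2, hx]⟩
  have hiso : IsIso e := isIso_of_isClosedImmersion_of_surjective e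
  constructor
  · rw [← he1]; infer_instance
  · ext z
    constructor
    · rintro ⟨x, rfl⟩
      exact ⟨g x, by rw [← Scheme.Hom.comp_apply, ← Scheme.Hom.comp_apply, hj]⟩
    · rintro ⟨x, hx⟩
      obtain ⟨w, rfl⟩ := hg x ⟨z, hx.symm⟩
      refine ⟨w, q.isEmbedding.injective ?_⟩
      rw [← hx, ← Scheme.Hom.comp_apply, ← Scheme.Hom.comp_apply, hj]

/-- Restriction of functions, computed on compatible affine charts. -/
theorem stalkMap_evalHom {C Y : Scheme.{u}} [IsIntegral C] [IsIntegral Y] (q : C ⟶ Y)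
    {R R' : CommRingCat.{u}} [IsDomain R] [IsDomain R'] (j : Spec R' ⟶ C) [IsOpenImmersion j]
    (c : Spec R ⟶ Y) [IsOpenImmersion c] (φ : R ⟶ R') (h : j ≫ q = Spec.map φ ≫ c) (r : R)
    (b : Y.presheaf.stalk (q (genericPoint C)))
    (hb : algebraMap _ Y.functionField b = evalHom c r) :
    (q.stalkMap (genericPoint C)).hom b = evalHom j (φ.hom r) := by
  let x : Spec R' := (⊥ : PrimeSpectrum R')
  have hx : q (j x) = c (Spec.map φ x) := by
    rw [← Scheme.Hom.comp_apply, ← Scheme.Hom.comp_apply, h]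
  let b' : Y.presheaf.stalk (q (j x)) :=
    (Y.presheaf.stalkSpecializes (specializes_of_eq hx)).hom (evalStalk c (Spec.map φ x) r)
  have h1 : q.stalkMap (j x) b' = evalStalk j x (φ.hom r) := by
    apply stalkMap_injective_of_isOpenImmersion j x
    rw [stalkMap_evalStalk]
    have e1 : j.stalkMap x (q.stalkMap (j x) b') = (j ≫ q).stalkMap x b' :=
      (congr($(Scheme.Hom.stalkMap_comp j q x).hom b')).symm
    have e2 := congr($(Scheme.Hom.stalkMap_congr_hom (Spec.map φ ≫ c) (j ≫ q) h.symm x).hom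
      (evalStalk c (Spec.map φ x) r))
    have e3 : (Spec.map φ ≫ c).stalkMap x (evalStalk c (Spec.map φ x) r) = toStalkHom R' x (φ.hom r) := by
      refine (congr($(Scheme.Hom.stalkMap_comp (Spec.map φ) c x).hom
        (evalStalk c (Spec.map φ x) r))).trans ?_
      change (Spec.map φ).stalkMap x (c.stalkMap (Spec.map φ x) (evalStalk c (Spec.map φ x) r)) = _
      rw [stalkMap_evalStalk]
      exact stalkMap_toStalk_apply φ x r
    rw [e1, ← e3]
    exact e2.symm
  have h2 : b = (Y.presheaf.stalkSpecializes
      ((genericPoint_specializes (j x)).map q.continuous)).hom b' := by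
    apply IsFractionRing.injective (Y.presheaf.stalk (q (genericPoint C))) Y.functionField
    rw [hb, CartierDivisor.algebraMap_stalkSpecializes]
    exact (algebraMap_evalStalk c _ r).symm.trans
      (CartierDivisor.algebraMap_stalkSpecializes (specializes_of_eq hx) _).symm
  rw [h2]
  refine (CartierDivisor.algebraMap_stalkMap q (j x) b').symm.trans ?_
  rw [← algebraMap_evalStalk j x]
  exact congrArg _ h1

section

variable {k : Type u} [Field k] {Y : Scheme.{u}} {s : Y ⟶ Spec (CommRingCat.of k)} {d : ℕ}
  {F : Fan d} (T : ToricStructure s F) [IsIntegral Y]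

theorem ToricStructure.chi_nsmul (m : Fin d → ℤ) (n : ℕ) : T.chi (n • m) = T.chi m ^ n := by
  induction n with
  | zero => rw [zero_smul, T.chi_zero, pow_zero]
  | succ n ih => rw [succ_nsmul, T.chi_add, ih, pow_succ]

theorem ToricStructure.chi_zsmul (m : Fin d → ℤ) (n : ℤ) : T.chi (n • m) = T.chi m ^ n := by
  obtain ⟨n, rfl | rfl⟩ := n.eq_nat_or_neg
  · rw [natCast_zsmul, T.chi_nsmul, zpow_natCast]
  · rw [neg_smul, natCast_zsmul, T.chi_neg, T.chi_nsmul, zpow_neg, zpow_natCast]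

theorem ToricStructure.evalHom_algebraMap (σ σ' : F.cones) (c : k) :
    evalHom (T.chart σ) (algebraMap k (AddMonoidAlgebra k (dualMonoid σ.1)) c) =
      evalHom (T.chart σ') (algebraMap k (AddMonoidAlgebra k (dualMonoid σ'.1)) c) := by
  have h5 : ∀ σ : F.cones, evalHom (T.chart T.torus) (algebraMap k _ c) =
      evalHom (T.chart σ) (algebraMap k (AddMonoidAlgebra k (dualMonoid σ.1)) c) := fun σ => by
    refine Eq.trans ?_ (T.evalHom_mapDomain (T.torus_le σ) _)
    congr 1
    exact ((AddMonoidAlgebra.mapDomainRingHom_apply (R := k) (AddSubmonoid.inclusion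
      (dualMonoid_anti (T.torus_le σ))) (AddMonoidAlgebra.single 0 c)).trans
      AddMonoidAlgebra.mapDomain_single).symm
  exact (h5 σ).symm.trans (h5 σ')

open Polynomial

variable {α : Type*} [DecidableEq α] {K : Finset α} {a b : α} {u m m' : α → Fin d → ℤ}
  {σ σ' : F.cones} (h : IsDualBasis (insert a K) u m σ.1) (h' : IsDualBasis (insert b K) u m' σ'.1)
  (haK : a ∉ K) (hbK : b ∉ K)
  {C : Scheme.{u}} [IsIntegral C] (q : C ⟶ Y)
  {j₁ j₂ : Spec (CommRingCat.of k[X]) ⟶ C} [IsOpenImmersion j₁] [IsOpenImmersion j₂]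
  (hj₁ : j₁ ≫ q = Spec.map (CommRingCat.ofHom (lineHom k h).toRingHom) ≫ T.chart σ)
  (hj₂ : j₂ ≫ q = Spec.map (CommRingCat.ofHom (lineHom k h').toRingHom) ≫ T.chart σ')

omit [IsIntegral Y] in
include hj₁ in
theorem ToricStructure.exists_genericPoint_eq : ∃ x, q (genericPoint C) = T.chart σ x := by
  have h1 : genericPoint C ∈ Set.range j₁ :=
    (genericPoint_specializes (j₁ (⊥ : PrimeSpectrum k[X]))).mem_open
      j₁.isOpenEmbedding.isOpen_range ⟨_, rfl⟩
  obtain ⟨x, hx⟩ := h1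
  refine ⟨Spec.map (CommRingCat.ofHom (lineHom k h).toRingHom) x, ?_⟩
  rw [← hx, ← Scheme.Hom.comp_apply, hj₁, Scheme.Hom.comp_apply]

include hj₁ haK in
/-- The coordinate on the toric curve is the restriction of a monomial. -/
theorem ToricStructure.exists_germ : ∃ v : Y.presheaf.stalk (q (genericPoint C)),
    algebraMap _ Y.functionField v = T.chi (m a) ∧
      (q.stalkMap (genericPoint C)).hom v = evalHom j₁ X := by
  obtain ⟨x, hx⟩ := T.exists_genericPoint_eq h q hj₁
  have h1 : ∃ v : Y.presheaf.stalk (q (genericPoint C)),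
      algebraMap _ Y.functionField v = T.chi (m a) := by
    rw [hx]
    exact ⟨evalStalk (T.chart σ) x (AddMonoidAlgebra.single
      ⟨m a, h.dual_mem (Finset.mem_insert_self a K)⟩ 1), by
      rw [algebraMap_evalStalk, T.evalHom_single]⟩
  obtain ⟨v, hv⟩ := h1
  refine ⟨v, hv, ?_⟩
  rw [stalkMap_evalHom q j₁ (T.chart σ) _ hj₁ (AddMonoidAlgebra.single
      ⟨m a, h.dual_mem (Finset.mem_insert_self a K)⟩ 1) v (by rw [hv, T.evalHom_single])]
  congr 1
  exact lineHom_dual h haK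

omit [IsIntegral Y] in
include hbK in
theorem ToricStructure.chart_lineHom_mem_range
    (hinf : (⟨_, F.face_mem σ'.1 σ'.2 _ (h'.isFaceOf (Finset.subset_insert b K))⟩ : F.cones).1 ≤ σ.1)
    {x : Spec (CommRingCat.of k[X])} (hx : X ∉ x.asIdeal) :
    T.chart σ' (Spec.map (CommRingCat.ofHom (lineHom k h').toRingHom) x) ∈
      Set.range (T.chart σ) := by
  let σ'' : F.cones := ⟨_, F.face_mem σ'.1 σ'.2 _ (h'.isFaceOf (Finset.subset_insert b K))⟩
  have hle : σ''.1 ≤ σ'.1 := (h'.isFaceOf (Finset.subset_insert b K)).le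
  obtain ⟨y, hy⟩ := mem_range_affineToricMap h' hbK hle
    (Spec.map (CommRingCat.ofHom (lineHom k h').toRingHom) x) (fun hmem => hx (by
      have h2 : lineHom k h' (AddMonoidAlgebra.single
        ⟨m' b, h'.dual_mem (Finset.mem_insert_self b K)⟩ (1 : k)) ∈ x.asIdeal := hmem
      rwa [lineHom_dual h' hbK] at h2))
  refine T.range_chart_mono hinf ⟨y, ?_⟩
  rw [← hy, ← Scheme.Hom.comp_apply, T.compatible σ'' σ' hle]

include hj₁ hj₂ haK hbK in
/-- The toric curve of a wall is a projective line. -/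
theorem ToricStructure.isProjectiveLine (hm : m' b = -m a)
    (hr : Set.range j₁ = q ⁻¹' Set.range (T.chart σ))
    (hcov : ∀ z, q z ∈ Set.range (T.chart σ) ∨ z ∈ Set.range j₂)
    (hinf : (⟨_, F.face_mem σ'.1 σ'.2 _ (h'.isFaceOf (Finset.subset_insert b K))⟩ : F.cones).1 ≤ σ.1) :
    IsProjectiveLine j₁ j₂ where
  mul_eq_one := by
    obtain ⟨v, hv, hv'⟩ := T.exists_germ h haK q hj₁
    obtain ⟨w, hw, hw'⟩ := T.exists_germ h' hbK q hj₂
    rw [← hv', ← hw', ← map_mul, ← map_one (q.stalkMap (genericPoint C)).hom]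
    congr 1
    apply IsFractionRing.injective (Y.presheaf.stalk (q (genericPoint C))) Y.functionField
    rw [map_mul, hv, hw, hm, T.chi_neg, map_one, mul_inv_cancel₀ (T.chi_ne_zero _)]
  const c := by
    obtain ⟨x, hx⟩ := T.exists_genericPoint_eq h q hj₁
    have h1 : ∃ v : Y.presheaf.stalk (q (genericPoint C)), algebraMap _ Y.functionField v =
        evalHom (T.chart σ) (algebraMap k (AddMonoidAlgebra k (dualMonoid σ.1)) c) := by
      rw [hx]
      exact ⟨evalStalk (T.chart σ) x (algebraMap k (AddMonoidAlgebra k (dualMonoid σ.1)) c), by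
        rw [algebraMap_evalStalk]⟩
    obtain ⟨v, hv⟩ := h1
    have e1 := stalkMap_evalHom q j₁ (T.chart σ) _ hj₁ _ v hv
    have e2 := stalkMap_evalHom q j₂ (T.chart σ') _ hj₂ _ v
      (hv.trans (T.evalHom_algebraMap σ σ' c))
    have e3 : (lineHom k h) (algebraMap k _ c) = Polynomial.C c := (lineHom k h).commutes c
    have e4 : (lineHom k h') (algebraMap k _ c) = Polynomial.C c := (lineHom k h').commutes c
    rw [← e3]
    refine e1.symm.trans (e2.trans ?_)
    rw [e3, ← e4]
    rfl
  cover z := by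
    rcases hcov z with hz | ⟨x, rfl⟩
    · left; rw [hr]; exact hz
    · by_cases hx : X ∈ x.asIdeal
      · exact Or.inr ⟨x, hx, rfl⟩
      · left
        rw [hr, Set.mem_preimage, ← Scheme.Hom.comp_apply, hj₂, Scheme.Hom.comp_apply]
        exact T.chart_lineHom_mem_range h' hbK hinf hx

include hj₁ hj₂ haK hbK in
/-- The degree on the toric curve of a wall of a line bundle given by the monomials `χ^(a₁)` and
`χ^(a₂)` on the two adjacent charts. -/
theorem ToricStructure.finsum_ord_ratSection [IsAlgClosed k] [IsLocallyNoetherian C]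
    (hC : IsProjectiveLine j₁ j₂) (hm : m' b = -m a) (E : CartierDivisor Y) (g : Y.functionField)
    (a₁ a₂ : Fin d → ℤ)
    (h₁ : ∀ x, UnitEq (T.chart σ x) (E.eqn (T.chart σ x)) (g * T.chi a₁))
    (h₂ : ∀ x, UnitEq (T.chart σ' x) (E.eqn (T.chart σ' x)) (g * T.chi a₂))
    (hK : ∀ l ∈ K, a₁ ⬝ᵥ u l = a₂ ⬝ᵥ u l) :
    ∑ᶠ z, Scheme.ord (E.ratSection q z) z = (a₂ - a₁) ⬝ᵥ u b := by
  obtain ⟨x, hx⟩ := T.exists_genericPoint_eq h q hj₁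
  obtain ⟨w, hw⟩ : UnitEq (q (genericPoint C)) (E.eqn (q (genericPoint C))) (g * T.chi a₁) := by
    rw [hx]; exact h₁ x
  obtain ⟨t, ht, ht'⟩ := T.exists_germ h' hbK q hj₂
  let Q := (q.stalkMap (genericPoint C)).hom
  let wi : Y.presheaf.stalk (q (genericPoint C)) :=
    ((w⁻¹ : (Y.presheaf.stalk (q (genericPoint C)))ˣ) : Y.presheaf.stalk (q (genericPoint C)))
  have hw1 : algebraMap _ Y.functionField wi * E.eqn (q (genericPoint C)) = g * T.chi a₁ := by
    rw [hw, ← mul_assoc, ← map_mul, Units.inv_mul, map_one, one_mul]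
  have hc : Q wi ≠ 0 := ((w⁻¹).isUnit.map Q).ne_zero
  have hdiff : T.chi a₂ = T.chi a₁ * T.chi (m' b) ^ ((a₂ - a₁) ⬝ᵥ u b) := by
    rw [← T.chi_zsmul, ← T.chi_add]
    congr 1
    rw [← sub_eq_iff_eq_add']
    apply h'.ext_dual
    intro i hi
    rw [smul_dotProduct, h'.pair _ (Finset.mem_insert_self b K) i hi]
    rcases Finset.mem_insert.1 hi with rfl | hiK
    · rw [if_pos rfl, smul_eq_mul, mul_one]
    · rw [if_neg (by rintro rfl; exact hbK hiK), smul_zero, sub_dotProduct, hK i hiK, sub_self]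
  have htu : IsUnit t := by
    obtain ⟨y, hy⟩ : ∃ t' : Y.presheaf.stalk (q (genericPoint C)),
        algebraMap _ Y.functionField t' = (T.chi (m' b))⁻¹ := by
      obtain ⟨t', ht', -⟩ := T.exists_germ h haK q hj₁
      exact ⟨t', by rw [ht', hm, T.chi_neg, inv_inv]⟩
    refine IsUnit.of_mul_eq_one y ?_
    apply IsFractionRing.injective (Y.presheaf.stalk (q (genericPoint C))) Y.functionField
    rw [map_mul, ht, hy, map_one, mul_inv_cancel₀ (T.chi_ne_zero _)]
  obtain ⟨t, rfl⟩ := htu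
  refine hC.finsum_ord _ (Q wi) hc _ (fun y => ?_) (fun y => ?_)
  · have hy : q (j₁ y) = T.chart σ (Spec.map (CommRingCat.ofHom (lineHom k h).toRingHom) y) := by
      rw [← Scheme.Hom.comp_apply, hj₁, Scheme.Hom.comp_apply]
    obtain ⟨v, hv⟩ : UnitEq (q (j₁ y)) (E.eqn (q (j₁ y))) (g * T.chi a₁) := by
      rw [hy]; exact h₁ _
    refine ⟨Units.map (q.stalkMap (j₁ y)).hom v, ?_⟩
    have hs := (genericPoint_specializes (j₁ y)).map q.continuous
    rw [E.ratSection_eq q (z := j₁ y)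
      (a := (Y.presheaf.stalkSpecializes hs).hom (v : Y.presheaf.stalk (q (j₁ y))) * wi) (by
        rw [map_mul, CartierDivisor.algebraMap_stalkSpecializes, mul_assoc, hw1, hv]), map_mul]
    congr 1
    exact (CartierDivisor.algebraMap_stalkMap q (j₁ y) _).symm
  · have hy : q (j₂ y) = T.chart σ' (Spec.map (CommRingCat.ofHom (lineHom k h').toRingHom) y) := by
      rw [← Scheme.Hom.comp_apply, hj₂, Scheme.Hom.comp_apply]
    obtain ⟨v, hv⟩ : UnitEq (q (j₂ y)) (E.eqn (q (j₂ y))) (g * T.chi a₂) := by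
      rw [hy]; exact h₂ _
    refine ⟨Units.map (q.stalkMap (j₂ y)).hom v, ?_⟩
    have hs := (genericPoint_specializes (j₂ y)).map q.continuous
    rw [E.ratSection_eq q (z := j₂ y)
      (a := (Y.presheaf.stalkSpecializes hs).hom (v : Y.presheaf.stalk (q (j₂ y))) * (wi *
        ((t ^ ((a₂ - a₁) ⬝ᵥ u b) : (Y.presheaf.stalk (q (genericPoint C)))ˣ) :
          Y.presheaf.stalk (q (genericPoint C))))) (by
        rw [map_mul, CartierDivisor.algebraMap_stalkSpecializes, map_mul, map_units_zpow, ht, mul_assoc,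
          mul_right_comm, hw1, hv, hdiff]
        ring), map_mul, map_mul]
    congr 1
    · exact (CartierDivisor.algebraMap_stalkMap q (j₂ y) _).symm
    · congr 1
      exact (map_units_zpow Q t _).trans (by rw [ht'])

end

/-! ### Smooth fans with convex support -/

/-- The cones generated by the vectors `u i`, `i ∈ I`, for `I ∈ 𝓜`, are the maximal cones of a
smooth fan in `ℝᵈ` whose support is the half-space `μ ≥ 0` (the whole space if `μ = 0`); `m I` is
the dual basis of `(u i)_{i ∈ I}`. -/
structure IsHalfSpaceFan {ι : Type*} [DecidableEq ι] {d : ℕ} (𝓜 : Set (Finset ι))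
    (u : ι → Fin d → ℤ) (m : Finset ι → ι → Fin d → ℤ) (μ : Fin d → ℤ) : Prop where
  dual : ∀ I ∈ 𝓜, IsDualBasis I u (m I) (coneOf u I)
  card : ∀ I ∈ 𝓜, I.card = d
  inter : ∀ I ∈ 𝓜, ∀ I' ∈ 𝓜, coneOf u I ⊓ coneOf u I' = coneOf u (I ∩ I')
  supp : ∀ x, (∃ I ∈ 𝓜, x ∈ coneOf u I) ↔ 0 ≤ dotR μ x
  finite : 𝓜.Finite

namespace IsHalfSpaceFan

variable {ι : Type*} [DecidableEq ι] {d : ℕ} {𝓜 : Set (Finset ι)}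
    {u : ι → Fin d → ℤ} {m : Finset ι → ι → Fin d → ℤ} {μ : Fin d → ℤ}
    (h : IsHalfSpaceFan 𝓜 u m μ)
include h

theorem mu_nonneg {I : Finset ι} (hI : I ∈ 𝓜) {i : ι} (hi : i ∈ I) : 0 ≤ μ ⬝ᵥ u i := by
  have := (h.supp (castR (u i))).1 ⟨I, hI, castR_mem_coneOf hi⟩
  rw [dotR_castR] at this
  exact_mod_cast this

variable {K : Finset ι} {a b : ι} (ha : insert a K ∈ 𝓜) (haK : a ∉ K) (hb : insert b K ∈ 𝓜)
  (hbK : b ∉ K) (hab : a ≠ b)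
include ha hb haK hbK hab

/-- Two adjacent maximal cones lie on different sides of the common wall. -/
theorem pair_eq_neg_one : m (insert a K) a ⬝ᵥ u b = -1 := by
  have hA := h.dual _ ha
  have hB := h.dual _ hb
  have haI := Finset.mem_insert_self a K
  have hbI := Finset.mem_insert_self b K
  have hsum := hA.sum_basis_int (u b)
  rw [Finset.sum_insert haK] at hsum
  have h1 : (m (insert a K) a ⬝ᵥ u b) * (m (insert b K) b ⬝ᵥ u a) = 1 := by
    have h2 := congrArg (m (insert b K) b ⬝ᵥ ·) hsum
    simp only [dotProduct_add, dotProduct_smul, dotProduct_sum, smul_eq_mul] at h2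
    rw [hB.pair b hbI b hbI, if_pos rfl, Finset.sum_eq_zero, add_zero] at h2
    · exact h2
    · intro l hl
      rw [hB.pair b hbI l (Finset.mem_insert_of_mem hl), if_neg (by rintro rfl; exact hbK hl),
        mul_zero]
  rcases Int.isUnit_iff.1 (IsUnit.of_mul_eq_one _ h1) with h2 | h2
  · exfalso
    -- a point of the cone of `b` close to the wall would be in the cone of `a`
    let N : ℤ := ∑ l ∈ K, |m (insert a K) l ⬝ᵥ u b|
    let x : Fin d → ℤ := u b + N • ∑ l ∈ K, u l
    have hx : ∀ l ∈ insert a K, 0 ≤ m (insert a K) l ⬝ᵥ x := by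
      intro l hl
      rw [dotProduct_add, dotProduct_smul, dotProduct_sum, Finset.sum_congr rfl fun j hj =>
        hA.pair l hl j (Finset.mem_insert_of_mem hj), Finset.sum_ite_eq]
      rcases Finset.mem_insert.1 hl with rfl | hlK
      · rw [if_neg haK, h2]; norm_num
      · rw [if_pos hlK, smul_eq_mul, mul_one]
        have h3 : |m (insert a K) l ⬝ᵥ u b| ≤ N :=
          Finset.single_le_sum (f := fun l => |m (insert a K) l ⬝ᵥ u b|)
            (fun _ _ => abs_nonneg _) hlK
        have := neg_abs_le (m (insert a K) l ⬝ᵥ u b)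
        omega
    have hxA : castR x ∈ coneOf u (insert a K) := by
      rw [hA.mem_iff]
      intro l hl
      rw [dotR_castR]
      exact_mod_cast hx l hl
    have hN : 0 ≤ N := Finset.sum_nonneg fun _ _ => abs_nonneg _
    have hxB : castR x ∈ coneOf u (insert b K) := by
      rw [hB.mem_iff]
      intro l hl
      rw [dotR_castR]
      have : 0 ≤ m (insert b K) l ⬝ᵥ x := by
        rw [dotProduct_add, dotProduct_smul, dotProduct_sum]
        refine add_nonneg ?_ (mul_nonneg hN (Finset.sum_nonneg fun j hj => ?_))
        · rw [hB.pair l hl b hbI]; split_ifs <;> norm_num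
        · rw [hB.pair l hl j (Finset.mem_insert_of_mem hj)]; split_ifs <;> norm_num
      exact_mod_cast this
    have hxK : castR x ∈ coneOf u (insert a K ∩ insert b K) := by
      rw [← h.inter _ ha _ hb]; exact ⟨hxA, hxB⟩
    have h4 := (hA.mem_coneOf_iff Finset.inter_subset_left).1 hxK
    have h5 := h4.2 a haI (fun h6 => by
      rcases Finset.mem_insert.1 (Finset.mem_inter.1 h6).2 with h7 | h7
      · exact hab h7
      · exact haK h7)
    rw [dotR_castR] at h5
    have h6 : m (insert a K) a ⬝ᵥ x = 0 := by exact_mod_cast h5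
    rw [dotProduct_add, dotProduct_smul, dotProduct_sum, Finset.sum_congr rfl fun j hj =>
        hA.pair a haI j (Finset.mem_insert_of_mem hj), Finset.sum_ite_eq, if_neg haK, h2,
        smul_zero] at h6
    norm_num at h6
  · exact h2

theorem dual_eq_neg : m (insert b K) b = -m (insert a K) a := by
  have hA := h.dual _ ha
  have hB := h.dual _ hb
  apply hA.ext_dual
  intro i hi
  rw [neg_dotProduct, hA.pair a (Finset.mem_insert_self a K) i hi]
  rcases Finset.mem_insert.1 hi with rfl | hiK
  · rw [if_pos rfl, h.pair_eq_neg_one hb hbK ha haK hab.symm]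
  · rw [if_neg (by rintro rfl; exact haK hiK), hB.pair b (Finset.mem_insert_self b K) i
      (Finset.mem_insert_of_mem hiK), if_neg (by rintro rfl; exact hbK hiK), neg_zero]

/-- The linear relation of a wall. -/
theorem wall_relation :
    u a + u b + ∑ l ∈ K, -(m (insert a K) l ⬝ᵥ u b) • u l = 0 := by
  have hA := h.dual _ ha
  have hsum := hA.sum_basis_int (u b)
  rw [Finset.sum_insert haK, h.pair_eq_neg_one ha haK hb hbK hab] at hsum
  simp only [neg_smul, Finset.sum_neg_distrib]
  rw [neg_smul, one_smul] at hsum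
  generalize ∑ l ∈ K, (m (insert a K) l ⬝ᵥ u b) • u l = S at hsum
  rw [← hsum]
  abel

/-- There are no more than two maximal cones along a wall. -/
theorem eq_of_insert_mem {c : ι} (hc : insert c K ∈ 𝓜) (hcK : c ∉ K) : c = a ∨ c = b := by
  by_contra! hcon
  have h1 := h.pair_eq_neg_one ha haK hc hcK hcon.1.symm
  have h2 := h.pair_eq_neg_one hb hbK hc hcK hcon.2.symm
  rw [h.dual_eq_neg ha haK hb hbK hab, neg_dotProduct, h1] at h2
  norm_num at h2

omit hb hbK hab
/-- The two maximal cones of a wall are on different sides, so a wall in the boundary of the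
half-space is in one maximal cone only. -/
theorem mu_eq_zero_of_insert_mem (hb : insert b K ∈ 𝓜) (hbK : b ∉ K) (hab : a ≠ b)
    (hμ : ∀ l ∈ K, μ ⬝ᵥ u l = 0) : μ = 0 := by
  have hA := h.dual _ ha
  have h1 := congrArg (μ ⬝ᵥ ·) (h.wall_relation ha haK hb hbK hab)
  simp only [dotProduct_add, dotProduct_sum, dotProduct_smul, dotProduct_zero] at h1
  rw [Finset.sum_eq_zero (fun l hl => by rw [hμ l hl, smul_zero]), add_zero] at h1
  have h2 := h.mu_nonneg ha (Finset.mem_insert_self a K)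
  have h3 := h.mu_nonneg hb (Finset.mem_insert_self b K)
  apply hA.ext_dual
  intro i hi
  rw [zero_dotProduct]
  rcases Finset.mem_insert.1 hi with rfl | hiK
  · omega
  · exact hμ i hiK

omit ha haK in
theorem isClosed_coneOf {I : Finset ι} (hI : I ∈ 𝓜) :
    IsClosed (coneOf u I : Set (Fin d → ℝ)) := by
  have : (coneOf u I : Set (Fin d → ℝ)) = ⋂ i ∈ I, {x | 0 ≤ dotR (m I i) x} := by
    ext x
    rw [SetLike.mem_coe, (h.dual I hI).mem_iff]
    simp
  rw [this]
  exact isClosed_biInter fun i _ => isClosed_le continuous_const (continuous_dotR _)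

/-- A wall not contained in the boundary of the half-space is in two maximal cones. -/
theorem exists_insert_mem {l₀ : ι} (hμ : μ = 0 ∨ l₀ ∈ K ∧ μ ⬝ᵥ u l₀ ≠ 0) :
    ∃ b, b ∉ K ∧ a ≠ b ∧ insert b K ∈ 𝓜 := by
  have hA := h.dual _ ha
  have haI := Finset.mem_insert_self a K
  -- move slightly across the wall from a point in its interior
  let p : Fin d → ℝ := castR (∑ l ∈ K, u l)
  let x : ℕ → Fin d → ℝ := fun n => p - (1 / ((n : ℝ) + 1)) • castR (u a)
  have hlim : Filter.Tendsto x Filter.atTop (𝓝 p) := by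
    have h1 := (tendsto_one_div_add_atTop_nhds_zero_nat (𝕜 := ℝ)).smul_const (castR (u a))
    have h2 := (tendsto_const_nhds (x := p)).sub h1
    rwa [zero_smul, sub_zero] at h2
  have hx : ∀ᶠ n in Filter.atTop, ∃ I ∈ 𝓜, x n ∈ coneOf u I := by
    simp only [h.supp]
    rcases hμ with rfl | ⟨hl, hμl⟩
    · simp [dotR_zero]
    · have hp : 0 < dotR μ p := by
        rw [dotR_castR, dotProduct_sum]
        have h1 : 0 < ∑ l ∈ K, μ ⬝ᵥ u l := Finset.sum_pos'
          (fun l hl => h.mu_nonneg ha (Finset.mem_insert_of_mem hl))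
          ⟨l₀, hl, lt_of_le_of_ne (h.mu_nonneg ha (Finset.mem_insert_of_mem hl)) hμl.symm⟩
        exact_mod_cast h1
      filter_upwards [((continuous_dotR μ).continuousAt.tendsto.comp hlim).eventually
        (lt_mem_nhds hp)] with n hn using hn.le
  obtain ⟨I, hI, hfr⟩ : ∃ I ∈ 𝓜, ∃ᶠ n in Filter.atTop, x n ∈ coneOf u I := by
    by_contra! hcon
    have h1 : ∀ᶠ n in Filter.atTop, ∀ I ∈ 𝓜, x n ∉ coneOf u I :=
      (Filter.eventually_all_finite h.finite).2 fun I hI => hcon I hI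
    obtain ⟨n, ⟨I, hI, hn⟩, hn'⟩ := (hx.and h1).exists
    exact hn' I hI hn
  have hp : p ∈ coneOf u I :=
    (h.isClosed_coneOf hI).mem_of_frequently_of_tendsto hfr hlim
  have hpair : ∀ l ∈ insert a K, dotR (m (insert a K) l) p = if l ∈ K then 1 else 0 := fun l hl => by
    rw [dotR_castR, dotProduct_sum, Finset.sum_congr rfl fun j hj =>
      hA.pair l hl j (Finset.mem_insert_of_mem hj), Finset.sum_ite_eq]
    split_ifs <;> norm_num
  have hpA : p ∈ coneOf u (insert a K) := by
    rw [hA.mem_iff]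
    intro l hl
    rw [hpair l hl]
    split_ifs <;> norm_num
  have hKI : K ⊆ I := by
    intro l hl
    by_contra hlI
    have h1 : p ∈ coneOf u (insert a K ∩ I) := by rw [← h.inter _ ha _ hI]; exact ⟨hpA, hp⟩
    have h2 := ((hA.mem_coneOf_iff Finset.inter_subset_left).1 h1).2 l (Finset.mem_insert_of_mem hl)
      (fun h3 => hlI (Finset.mem_inter.1 h3).2)
    rw [hpair l (Finset.mem_insert_of_mem hl), if_pos hl] at h2
    exact one_ne_zero h2
  have hne : I ≠ insert a K := by
    rintro rfl
    obtain ⟨n, hn⟩ := hfr.exists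
    have h1 := (hA.mem_iff _).1 hn a haI
    rw [map_sub, hpair a haI, if_neg haK, map_smul, hA.dotR_pair haI haI, if_pos rfl, smul_eq_mul,
      mul_one, zero_sub] at h1
    have : (0 : ℝ) < 1 / ((n : ℝ) + 1) := Nat.one_div_pos_of_nat
    linarith
  obtain ⟨b, hbK, rfl⟩ := Finset.exists_eq_insert_iff.2 ⟨hKI, by
    rw [h.card I hI, ← h.card _ ha, Finset.card_insert_of_notMem haK]⟩
  exact ⟨b, hbK, by rintro rfl; exact hne rfl, hI⟩

end IsHalfSpaceFan

/-! ### Schemes covered by two affine lines -/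

section

open Polynomial

variable {C : Scheme.{u}} {k : Type u} [Field k]
  (j₁ j₂ : Spec (CommRingCat.of k[X]) ⟶ C) [IsOpenImmersion j₁] [IsOpenImmersion j₂]
  (hcov : ∀ z, z ∈ Set.range j₁ ∨ z ∈ Set.range j₂)
include hcov

omit [IsOpenImmersion j₂] in
theorem denseRange_of_cover (hne : (Set.range j₁ ∩ Set.range j₂).Nonempty) : DenseRange j₁ := by
  rw [DenseRange, dense_iff_closure_eq, Set.eq_univ_iff_forall]
  have hirr : IsIrreducible (Set.range j₂) := by
    rw [← Set.image_univ]
    exact (IrreducibleSpace.isIrreducible_univ _).image _ j₂.continuous.continuousOn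
  intro z
  rcases hcov z with hz | hz
  · exact subset_closure hz
  · rw [Set.inter_comm] at hne
    exact closure_mono Set.inter_subset_right
      (subset_closure_inter_of_isPreirreducible_of_isOpen hirr.2
        j₁.isOpenEmbedding.isOpen_range hne hz)

omit [IsOpenImmersion j₂] in
theorem isIntegral_of_cover [IsReduced C] (hne : (Set.range j₁ ∩ Set.range j₂).Nonempty) :
    IsIntegral C := by
  have : IrreducibleSpace C := by
    have h3 : IsIrreducible (Set.range j₁) := by
      rw [← Set.image_univ]
      exact (IrreducibleSpace.isIrreducible_univ _).image _ j₁.continuous.continuousOn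
    have h4 := h3.closure
    rw [(denseRange_of_cover j₁ j₂ hcov hne).closure_range] at h4
    exact (irreducibleSpace_def C).2 h4
  exact isIntegral_of_irreducibleSpace_of_isReduced C

theorem isLocallyNoetherian_of_cover : IsLocallyNoetherian C := by
  have hsurj : ∀ z, ∃ (b : Bool) (y : Spec (CommRingCat.of k[X])), (bif b then j₁ else j₂) y = z :=
    fun z => by
      rcases hcov z with ⟨y, hy⟩ | ⟨y, hy⟩
      · exact ⟨true, y, hy⟩
      · exact ⟨false, y, hy⟩
  refine (isLocallyNoetherian_iff_openCover (Scheme.Cover.mkOfCovers (P := @IsOpenImmersion) Bool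
    (fun _ => Spec (CommRingCat.of k[X])) (fun b => bif b then j₁ else j₂) hsurj
    (by rintro (b | b) <;> (dsimp; infer_instance)))).2 fun i => ?_
  change IsLocallyNoetherian (Spec (CommRingCat.of k[X]))
  infer_instance

theorem topologicalKrullDim_of_cover : topologicalKrullDim C = 1 := by
  have hA : topologicalKrullDim (Spec (CommRingCat.of k[X])) = 1 := by
    refine (PrimeSpectrum.topologicalKrullDim_eq_ringKrullDim k[X]).trans ?_
    exact IsPrincipalIdealRing.ringKrullDim_eq_one _ (Polynomial.not_isField k)
  have hpts : ∀ Y : Scheme.{u}, topologicalKrullDim Y = Order.krullDim Y := fun Y =>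
    Order.krullDim_eq_of_orderIso irreducibleSetEquivPoints
  apply le_antisymm
  · rw [hpts, Order.krullDim_eq_iSup_coheight]
    refine iSup_le fun z => ?_
    have hle : ∀ y : Spec (CommRingCat.of k[X]), (Order.coheight y : WithBot ℕ∞) ≤ 1 := fun y => by
      rw [← hA, hpts]
      exact Order.coheight_le_krullDim y
    rcases hcov z with ⟨y, rfl⟩ | ⟨y, rfl⟩
    · have := coheight_eq_of_isOpenImmersion (x := y) j₁
      exact (congrArg _ this).trans_le (hle y)
    · have := coheight_eq_of_isOpenImmersion (x := y) j₂
      exact (congrArg _ this).trans_le (hle y)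
  · rw [← hA]
    exact j₁.isOpenEmbedding.isInducing.topologicalKrullDim_le

end

section

open Polynomial

variable {C : Scheme.{u}} [IsIntegral C] {k : Type u} [Field k]
  {j₁ j₂ : Spec (CommRingCat.of k[X]) ⟶ C} [IsOpenImmersion j₁] [IsOpenImmersion j₂]

/-- Regular functions on the projective line are constant. -/
theorem IsProjectiveLine.natDegree_eq_zero [IsLocallyNoetherian C] (h : IsProjectiveLine j₁ j₂)
    {f g : k[X]} (hfg : evalHom j₁ f = evalHom j₂ g) : f.natDegree = 0 := by
  by_cases hf : f = 0
  · rw [hf, natDegree_zero]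
  · have hg : g ≠ 0 := by
      rintro rfl
      rw [map_zero] at hfg
      exact hf ((map_eq_zero_iff _ (evalHom_injective j₁)).1 hfg)
    have h1 := h.ord_infty hf
    rw [hfg, ord_pt j₂ hg] at h1
    omega

/-- A morphism from the projective line to the affine line is constant. -/
theorem IsProjectiveLine.exists_const [IsLocallyNoetherian C] (h : IsProjectiveLine j₁ j₂)
    (hd : DenseRange j₁) (t : C ⟶ Spec (CommRingCat.of k)) (p : C ⟶ Spec (CommRingCat.of k[X]))
    (hpt : p ≫ Spec.map (CommRingCat.ofHom Polynomial.C) = t)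
    (ht : j₁ ≫ t = Spec.map (CommRingCat.ofHom Polynomial.C)) :
    ∃ c : k, p = t ≫ Spec.map (CommRingCat.ofHom (Polynomial.evalRingHom c)) := by
  let φ₁ := Spec.preimage (j₁ ≫ p)
  let φ₂ := Spec.preimage (j₂ ≫ p)
  have hφ₁ : j₁ ≫ p = Spec.map φ₁ ≫ 𝟙 _ := by rw [Category.comp_id, Spec.map_preimage]
  have hφ₂ : j₂ ≫ p = Spec.map φ₂ ≫ 𝟙 _ := by rw [Category.comp_id, Spec.map_preimage]
  have hv : ∃ v : (Spec (CommRingCat.of k[X])).presheaf.stalk (p (genericPoint C)),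
      algebraMap _ (Spec (CommRingCat.of k[X])).functionField v =
        evalHom (𝟙 (Spec (CommRingCat.of k[X]))) X :=
    ⟨evalStalk (𝟙 (Spec (CommRingCat.of k[X]))) (p (genericPoint C)) X,
      algebraMap_evalStalk (𝟙 (Spec (CommRingCat.of k[X]))) _ _⟩
  obtain ⟨v, hv⟩ := hv
  have e1 := stalkMap_evalHom p j₁ (𝟙 _) φ₁ hφ₁ X v hv
  have e2 := stalkMap_evalHom p j₂ (𝟙 _) φ₂ hφ₂ X v hv
  have h3 := h.natDegree_eq_zero (e1.symm.trans e2)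
  obtain ⟨c, hc⟩ : ∃ c : k, φ₁.hom X = Polynomial.C c := ⟨_, eq_C_of_natDegree_eq_zero h3⟩
  refine ⟨c, ?_⟩
  have : IsDominant j₁ := ⟨hd⟩
  refine ext_of_isDominant j₁ ?_
  rw [hφ₁, Category.comp_id, ← Category.assoc, ht, ← Spec.map_comp]
  congr 1
  have hC : CommRingCat.ofHom Polynomial.C ≫ φ₁ = CommRingCat.ofHom Polynomial.C := by
    apply Spec.map_injective
    rw [Spec.map_comp, Spec.map_preimage, Category.assoc, hpt, ht]
  refine CommRingCat.hom_ext (Polynomial.ringHom_ext (fun a => ?_) ?_)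
  · refine congr($(hC).hom a).trans ?_
    change _ = Polynomial.C ((Polynomial.evalRingHom c) (Polynomial.C a))
    simp
  · refine hc.trans ?_
    change _ = Polynomial.C ((Polynomial.evalRingHom c) X)
    simp

end

/-! ### The fan of a stratum -/

theorem IsDualBasis.congr {α : Type*} [DecidableEq α] {d : ℕ} {I : Finset α}
    {u m u' : α → Fin d → ℤ} {σ : PointedCone ℝ (Fin d → ℝ)} (h : IsDualBasis I u m σ)
    (hu : ∀ i ∈ I, u i = u' i) : IsDualBasis I u' m σ where
  pair i hi j hj := by rw [← hu j hj]; exact h.pair i hi j hj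
  mem_iff := h.mem_iff
  sum_eq x := (Finset.sum_congr rfl fun i hi => by rw [hu i hi]).trans (h.sum_eq x)

section

variable {k : Type u} [Field k] {X : Scheme.{u}} [IsIntegral X]
  {s : X ⟶ Spec (CommRingCat.of k)} {ι : Type} {D : SNCDivisor X ι} {τ : Finset ι} {d : ℕ}
  {F : Fan d} {T : ToricStructure (redι (D.stratum τ) ≫ s) F}
  [IsIntegral (redSubscheme (D.stratum τ))] [DecidableEq ι]

theorem ToricStructure.IsChart.congr {σ : F.cones} {I : Finset ι} {u m u' : ι → Fin d → ℤ}
    (h : T.IsChart σ I u m) (hu : ∀ i ∈ I, u i = u' i) : T.IsChart σ I u' m where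
  dual := h.dual.congr hu
  card := h.card
  disj := h.disj
  exponent := h.exponent
  exponent_zero := h.exponent_zero
  ray i hi ω hω := h.ray i hi ω (hω.trans (coneOf_congr fun j hj =>
    (hu j (Finset.mem_singleton.1 hj ▸ hi)).symm))
  fixed := h.fixed
  smooth := h.smooth

/-- The charts of the maximal cones of the fan of a stratum, with the rays labelled by the
components of the divisor: `𝓜` is the set of the index sets of the maximal cones. -/
structure ToricStructure.IsAtlas (T : ToricStructure (redι (D.stratum τ) ≫ s) F)
    (𝓜 : Set (Finset ι)) (u : ι → Fin d → ℤ) (m : Finset ι → ι → Fin d → ℤ) : Prop where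
  chart : ∀ I ∈ 𝓜, ∃ σ : F.cones, T.IsChart σ I u (m I)
  exists_le : ∀ ω : F.cones, ∃ I ∈ 𝓜, ∃ σ : F.cones, T.IsChart σ I u (m I) ∧ ω.1 ≤ σ.1

/-- The charts of the full cones form an atlas: the fan is covered by full cones because its support
is a half-space, and the rays of different charts agree if they belong to the same component. -/
theorem ToricStructure.exists_isAtlas [Fintype ι] {n : ℕ} [SmoothOfRelativeDimension n s]
    (T : ToricStructure (redι (D.stratum τ) ≫ s) F) (hd : τ.card + d = n) (hτ : D.IsCone τ)
    (hT : D.StratificationAgrees τ T) (hX : D.AbsoluteOrRelative s) :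
    ∃ 𝓜 u m μ, T.IsAtlas 𝓜 u m ∧ IsHalfSpaceFan 𝓜 u m μ ∧ (IsProper s → μ = 0) := by
  classical
  have : Smooth s := SmoothOfRelativeDimension.smooth n s
  obtain ⟨μ, hμ, hμ0⟩ := T.exists_support_eq hτ hT hX
  have hch : ∀ σ : {σ : F.cones // F.IsFull σ.1}, ∃ I u m, T.IsChart σ.1 I u m := fun σ =>
    T.exists_isChart hd hτ hT σ.1 σ.2
  choose I v p h using hch
  have hex : ∀ i : ι, ∃ u, ∀ σ, i ∈ I σ → v σ i = u := fun i => by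
    by_cases hi : ∃ σ, i ∈ I σ
    · obtain ⟨σ, hσ⟩ := hi
      exact ⟨v σ i, fun σ' hσ' => (h σ').eq_of_mem (h σ) hσ' hσ⟩
    · exact ⟨0, fun σ hσ => (hi ⟨σ, hσ⟩).elim⟩
  choose u hu using hex
  let q : Finset ι → ι → Fin d → ℤ := fun J => if hJ : ∃ σ, I σ = J then p hJ.choose else 0
  have hq : ∀ J, (∃ σ, I σ = J) → ∃ σ, T.IsChart σ J u (q J) := fun J hJ => by
    refine ⟨hJ.choose.1, ?_⟩
    have h1 := (h hJ.choose).congr fun i hi => hu i _ hi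
    have h2 : q J = p hJ.choose := dif_pos hJ
    rw [h2]
    rw [hJ.choose_spec] at h1
    exact h1
  have hle : ∀ ω : F.cones, ∃ J, (∃ σ, I σ = J) ∧
      ∃ σ : F.cones, T.IsChart σ J u (q J) ∧ ω.1 ≤ σ.1 := fun ω => by
    obtain ⟨σ, hσ, hωσ⟩ := F.exists_isFull_le μ hμ ω.2
    let σ₁ : {σ : F.cones // F.IsFull σ.1} := ⟨⟨σ, hσ.1⟩, hσ⟩
    obtain ⟨σ₂, h2⟩ := hq (I σ₁) ⟨σ₁, rfl⟩
    have h1 := (h σ₁).congr fun i hi => hu i _ hi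
    refine ⟨I σ₁, ⟨σ₁, rfl⟩, σ₂, h2, hωσ.trans ?_⟩
    rw [h2.dual.eq_coneOf, ← h1.dual.eq_coneOf]
  refine ⟨{J | ∃ σ, I σ = J}, u, q, μ, ⟨fun J hJ => hq J hJ, hle⟩, ⟨?_, ?_, ?_, ?_, ?_⟩, hμ0⟩
  · intro J hJ
    obtain ⟨σ, hσ⟩ := hq J hJ
    rw [← hσ.dual.eq_coneOf]
    exact hσ.dual
  · intro J hJ
    obtain ⟨σ, hσ⟩ := hq J hJ
    exact hσ.card
  · intro J hJ J' hJ'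
    obtain ⟨σ, hσ⟩ := hq J hJ
    obtain ⟨σ', hσ'⟩ := hq J' hJ'
    rw [← hσ.inf_eq hσ', ← hσ.dual.eq_coneOf, ← hσ'.dual.eq_coneOf]
  · intro x
    rw [← hμ]
    constructor
    · rintro ⟨J, hJ, hx⟩
      obtain ⟨σ, hσ⟩ := hq J hJ
      rw [← hσ.dual.eq_coneOf] at hx
      exact ⟨σ.1, σ.2, hx⟩
    · rintro ⟨ω, hω, hx⟩
      obtain ⟨J, hJ, σ, hσ, hle⟩ := hle ⟨ω, hω⟩
      refine ⟨J, hJ, ?_⟩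
      rw [← hσ.dual.eq_coneOf]
      exact hle hx
  · exact Set.toFinite _

namespace ToricStructure.IsAtlas

variable {𝓜 : Set (Finset ι)} {u : ι → Fin d → ℤ} {m : Finset ι → ι → Fin d → ℤ}
  (h : T.IsAtlas 𝓜 u m)
include h

theorem notMem {I : Finset ι} (hI : I ∈ 𝓜) {i : ι} (hi : i ∈ I) : i ∉ τ := by
  obtain ⟨σ, hσ⟩ := h.chart I hI
  exact hσ.disj i hi

/-- Every point of the stratum is in a chart containing all components through it. -/
theorem exists_chart (y : redSubscheme (D.stratum τ)) : ∃ I ∈ 𝓜, ∃ σ : F.cones,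
    T.IsChart σ I u (m I) ∧ y ∈ Set.range (T.chart σ) ∧
      ∀ i ∉ τ, redι (D.stratum τ) y ∈ D.supp i → i ∈ I := by
  obtain ⟨ω, hω⟩ := T.cover y
  obtain ⟨I, hI, σ, hσ, hle⟩ := h.exists_le ω
  have hy := T.range_chart_mono hle hω
  exact ⟨I, hI, σ, hσ, hy, fun i hi hyi => hσ.mem_of_mem_supp hy hi hyi⟩

/-- A non-empty stratum contained in `D_τ` contains the fixed point of a chart. -/
theorem isCone_iff {ρ : Finset ι} (hρ : τ ⊆ ρ) : D.IsCone ρ ↔ ∃ I ∈ 𝓜, ρ \ τ ⊆ I := by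
  constructor
  · rintro ⟨x, hx⟩
    have hxτ : x ∈ (D.stratum τ : Set X) :=
      SNCDivisor.mem_stratum.2 fun i hi => SNCDivisor.mem_stratum.1 hx i (hρ hi)
    rw [← range_redι] at hxτ
    obtain ⟨y, rfl⟩ := hxτ
    obtain ⟨I, hI, -, -, -, hy⟩ := h.exists_chart y
    refine ⟨I, hI, fun i hi => ?_⟩
    rw [Finset.mem_sdiff] at hi
    exact hy i hi.2 (SNCDivisor.mem_stratum.1 hx i hi.1)
  · rintro ⟨I, hI, hρI⟩
    obtain ⟨σ, hσ⟩ := h.chart I hI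
    obtain ⟨x, hx⟩ := hσ.fixed
    refine ⟨T.emb σ x, SNCDivisor.mem_stratum.2 fun i hi => ?_⟩
    by_cases hiτ : i ∈ τ
    · exact T.emb_mem_supp σ hiτ x
    · exact hx i (hρI (Finset.mem_sdiff.2 ⟨hi, hiτ⟩))

theorem exists_eq_coneOf {ω : PointedCone ℝ (Fin d → ℝ)} (hω : ω ∈ F.cones) :
    ∃ I ∈ 𝓜, ∃ K ⊆ I, ω = coneOf u K := by
  obtain ⟨I, hI, σ, hσ, hle⟩ := h.exists_le ⟨ω, hω⟩
  refine ⟨I, hI, ?_⟩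
  have h1 : IsFaceOf ω σ.1 := by
    have := F.inf_face σ.1 σ.2 ω hω
    rw [inf_eq_right.2 hle] at this
    exact this
  exact hσ.dual.exists_eq_coneOf h1

/-- A Cartier divisor restricts to a piecewise linear function on the fan of the stratum. -/
theorem exists_exponents (hne : 𝓜.Nonempty) (E : CartierDivisor X) :
    ∃ (g : (redSubscheme (D.stratum τ)).functionField) (a : Finset ι → Fin d → ℤ) (e : ι → ℤ),
      ∀ I ∈ 𝓜, (∀ i ∈ I, a I ⬝ᵥ u i = e i) ∧ ∀ σ : F.cones, T.IsChart σ I u (m I) →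
        ∀ x, UnitEq (T.chart σ x) ((E.restrict (redι (D.stratum τ))).eqn (T.chart σ x))
          (g * T.chi (a I)) := by
  obtain ⟨I₀, hI₀⟩ := hne
  obtain ⟨σ₀, hσ₀⟩ := h.chart I₀ hI₀
  have hufd : UniqueFactorizationMonoid (AddMonoidAlgebra k (dualMonoid σ₀.1)) := by
    obtain ⟨v, p, hv⟩ := hσ₀.smooth
    exact hv.uniqueFactorizationMonoid k
  obtain ⟨g, hg0, hg⟩ := (E.restrict (redι (D.stratum τ))).exists_unitEq_chart (T.chart σ₀)
  have hex : ∀ I, ∃ a, I ∈ 𝓜 → ∀ σ : F.cones, T.IsChart σ I u (m I) →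
        ∀ x, UnitEq (T.chart σ x) ((E.restrict (redι (D.stratum τ))).eqn (T.chart σ x))
          (g * T.chi a) := fun I => by
    by_cases hI : I ∈ 𝓜
    · obtain ⟨σ, hσ⟩ := h.chart I hI
      obtain ⟨v, p, hv⟩ := hσ.smooth
      obtain ⟨a, ha⟩ := T.exists_unitEq_chi (E.restrict (redι (D.stratum τ))) g hg0 (fun x => by
        obtain ⟨y, hy⟩ := T.range_chart_mono (T.torus_le σ₀) ⟨x, rfl⟩
        rw [← hy]
        exact hg y) σ hv
      refine ⟨a, fun _ σ' hσ' => ?_⟩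
      obtain rfl : σ = σ' := Subtype.ext (hσ.dual.eq_coneOf.trans hσ'.dual.eq_coneOf.symm)
      exact ha
    · exact ⟨0, fun hI' => (hI hI').elim⟩
  choose a ha using hex
  -- the quotient of the monomials of two charts is invertible on their intersection
  have hcomp : ∀ I ∈ 𝓜, ∀ I' ∈ 𝓜, ∀ i ∈ I, i ∈ I' → a I ⬝ᵥ u i = a I' ⬝ᵥ u i := by
    intro I hI I' hI' i hi hi'
    obtain ⟨σ, hσ⟩ := h.chart I hI
    obtain ⟨σ', hσ'⟩ := h.chart I' hI'
    let ω : F.cones := ⟨σ.1 ⊓ σ'.1, F.face_mem _ σ.2 _ (F.inf_face _ σ.2 _ σ'.2)⟩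
    have h1 := T.mem_dualMonoid_of_unitEq ω (a I - a I') fun x => by
      obtain ⟨y, hy⟩ := T.range_chart_mono (inf_le_left : ω.1 ≤ σ.1) ⟨x, rfl⟩
      obtain ⟨y', hy'⟩ := T.range_chart_mono (inf_le_right : ω.1 ≤ σ'.1) ⟨x, rfl⟩
      have e1 := ha I hI σ hσ y
      have e2 := ha I' hI' σ' hσ' y'
      rw [hy] at e1
      rw [hy'] at e2
      have e3 := (e1.symm.trans e2).div (UnitEq.refl (g * T.chi (a I')))
      rwa [div_self (mul_ne_zero hg0 (T.chi_ne_zero _)), mul_div_mul_left _ _ hg0,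
        ← T.chi_sub] at e3
    have hω : ω.1 = coneOf u (I ∩ I') := hσ.inf_eq hσ'
    rw [hω, mem_dualMonoid_coneOf, mem_dualMonoid_coneOf] at h1
    have h2 := h1.1 i (Finset.mem_inter.2 ⟨hi, hi'⟩)
    have h3 := h1.2 i (Finset.mem_inter.2 ⟨hi, hi'⟩)
    rw [sub_dotProduct] at h2
    rw [neg_dotProduct, sub_dotProduct] at h3
    omega
  have hex' : ∀ i, ∃ e, ∀ I ∈ 𝓜, i ∈ I → a I ⬝ᵥ u i = e := fun i => by
    by_cases hi : ∃ I ∈ 𝓜, i ∈ I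
    · obtain ⟨I, hI, hiI⟩ := hi
      exact ⟨a I ⬝ᵥ u i, fun I' hI' hi' => hcomp I' hI' I hI i hi' hiI⟩
    · exact ⟨0, fun I hI hiI => (hi ⟨I, hI, hiI⟩).elim⟩
  choose e he using hex'
  exact ⟨g, a, e, fun I hI => ⟨fun i hi => he i I hI hi, fun σ hσ => ha I hI σ hσ⟩⟩

end ToricStructure.IsAtlas

end

/-! ### The curves of the interior walls -/

namespace ToricStructure.IsAtlas

open Polynomial

variable {k : Type u} [Field k] {X : Scheme.{u}} [IsIntegral X]
  {s : X ⟶ Spec (CommRingCat.of k)} {ι : Type} {D : SNCDivisor X ι} {τ : Finset ι} {d : ℕ}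
  {F : Fan d} {T : ToricStructure (redι (D.stratum τ) ≫ s) F}
  [IsIntegral (redSubscheme (D.stratum τ))] [DecidableEq ι]
  {𝓜 : Set (Finset ι)} {u : ι → Fin d → ℤ} {m : Finset ι → ι → Fin d → ℤ} {μ : Fin d → ℤ}

theorem mem_range_lineHom {I : Finset ι} {σ : F.cones} {K : Finset ι} {a : ι} (haK : a ∉ K)
    (hI : insert a K = I) (hσ : T.IsChart σ I u (m I))
    (h' : IsDualBasis (insert a K) u (m I) σ.1) (x : affineToric k σ.1) :
    x ∈ Set.range (Spec.map (CommRingCat.ofHom (lineHom k h').toRingHom)) ↔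
      T.emb σ x ∈ (D.stratum (τ ∪ K) : Set X) := by
  rw [range_lineHom h' haK, SNCDivisor.mem_stratum]
  subst hI
  constructor
  · intro hx i hi
    rcases Finset.mem_union.1 hi with hi | hi
    · exact T.emb_mem_supp σ hi x
    · exact ((hσ.exponent i (Finset.mem_insert_of_mem hi)).mem_supp_iff x).2 (hx i hi)
  · intro hx l hl
    exact ((hσ.exponent l (Finset.mem_insert_of_mem hl)).mem_supp_iff x).1
      (hx l (Finset.mem_union_right _ hl))

/-- The affine line in the curve of a wall, in the chart of an adjacent maximal cone. -/
theorem exists_line {σ : F.cones} {K : Finset ι} {a : ι} (haK : a ∉ K)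
    (hσ : T.IsChart σ (insert a K) u (m (insert a K)))
    (q : redSubscheme (D.stratum (τ ∪ K)) ⟶ redSubscheme (D.stratum τ))
    (hq : q ≫ redι (D.stratum τ) = redι (D.stratum (τ ∪ K))) [IsClosedImmersion q] :
    ∃ j : Spec (CommRingCat.of k[X]) ⟶ redSubscheme (D.stratum (τ ∪ K)), IsOpenImmersion j ∧
      j ≫ q = Spec.map (CommRingCat.ofHom (lineHom k hσ.dual).toRingHom) ≫ T.chart σ ∧
      Set.range j = q ⁻¹' Set.range (T.chart σ) := by
  have hred := isReduced_redSubscheme (D.stratum (τ ∪ K))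
  let g := Spec.map (CommRingCat.ofHom (lineHom k hσ.dual).toRingHom)
  have hg : IsClosedImmersion g :=
    IsClosedImmersion.spec_of_surjective _ (lineHom_surjective hσ.dual haK)
  have : IsLocallyNoetherian (Spec (CommRingCat.of k[X])) := inferInstance
  have hgc : QuasiCompact (g ≫ T.emb σ) := quasiCompact_of_noetherianSpace_source _
  obtain ⟨j, hj⟩ := exists_lift_redι (g ≫ T.emb σ) (D.stratum (τ ∪ K)) (fun y => by
    rw [Scheme.Hom.comp_apply]
    exact (mem_range_lineHom haK rfl hσ hσ.dual _).1 ⟨y, rfl⟩)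
  have hjq : j ≫ q = g ≫ T.chart σ := by
    rw [← cancel_mono (redι (D.stratum τ)), Category.assoc, hq, hj, Category.assoc]
    rfl
  have := isOpenImmersion_of_closed q (T.chart σ) g j hjq (fun x hx => by
    refine (mem_range_lineHom haK rfl hσ hσ.dual _).2 ?_
    obtain ⟨z, hz⟩ := hx
    rw [ToricStructure.emb, Scheme.Hom.comp_apply, ← hz, ← Scheme.Hom.comp_apply, hq]
    exact redι_mem _ _)
  exact ⟨j, this.1, hjq, this.2⟩

variable (h : T.IsAtlas 𝓜 u m) (H : IsHalfSpaceFan 𝓜 u m μ) {K : Finset ι} {a b : ι}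
  (ha : insert a K ∈ 𝓜) (haK : a ∉ K) (hb : insert b K ∈ 𝓜) (hbK : b ∉ K) (hab : a ≠ b)
  {σ σ' : F.cones} (hσ : T.IsChart σ (insert a K) u (m (insert a K)))
  (hσ' : T.IsChart σ' (insert b K) u (m (insert b K)))
include h H ha haK hb hbK hab

/-- The stratum of an interior wall is a projective line. -/
theorem exists_isProjectiveLine :
    ∃ (q : redSubscheme (D.stratum (τ ∪ K)) ⟶ redSubscheme (D.stratum τ))
      (j₁ j₂ : Spec (CommRingCat.of k[X]) ⟶ redSubscheme (D.stratum (τ ∪ K)))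
      (_ : IsOpenImmersion j₁) (_ : IsOpenImmersion j₂)
      (_ : IsIntegral (redSubscheme (D.stratum (τ ∪ K))))
      (_ : IsLocallyNoetherian (redSubscheme (D.stratum (τ ∪ K)))),
      q ≫ redι (D.stratum τ) = redι (D.stratum (τ ∪ K)) ∧
      topologicalKrullDim (redSubscheme (D.stratum (τ ∪ K))) = 1 ∧
      j₁ ≫ q = Spec.map (CommRingCat.ofHom (lineHom k hσ.dual).toRingHom) ≫ T.chart σ ∧
      j₂ ≫ q = Spec.map (CommRingCat.ofHom (lineHom k hσ'.dual).toRingHom) ≫ T.chart σ' ∧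
      DenseRange j₁ ∧ IsProjectiveLine j₁ j₂ := by
  have hred := isReduced_redSubscheme (D.stratum (τ ∪ K))
  obtain ⟨q, hq⟩ := exists_lift_redι (redι (D.stratum (τ ∪ K))) (D.stratum τ) (fun y =>
    SNCDivisor.mem_stratum.2 fun i hi =>
      SNCDivisor.mem_stratum.1 (redι_mem _ y) i (Finset.mem_union_left _ hi))
  have hqc : IsClosedImmersion q := by
    have : IsClosedImmersion (q ≫ redι (D.stratum τ)) := hq ▸ inferInstance
    exact IsClosedImmersion.of_comp q (redι (D.stratum τ))
  obtain ⟨j₁, hj₁o, hj₁, hr₁⟩ := exists_line haK hσ q hq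
  obtain ⟨j₂, hj₂o, hj₂, hr₂⟩ := exists_line hbK hσ' q hq
  have hcov : ∀ z, z ∈ Set.range j₁ ∨ z ∈ Set.range j₂ := by
    intro z
    obtain ⟨I, hI, σ'', hσ'', hz, hsupp⟩ := h.exists_chart (q z)
    have hKI : K ⊆ I := fun l hl => by
      refine hsupp l (h.notMem ha (Finset.mem_insert_of_mem hl)) ?_
      rw [← Scheme.Hom.comp_apply, hq]
      exact SNCDivisor.mem_stratum.1 (redι_mem _ z) l (Finset.mem_union_right _ hl)
    obtain ⟨c, hcK, rfl⟩ := Finset.exists_eq_insert_iff.2 ⟨hKI, by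
      rw [H.card I hI, ← H.card _ ha, Finset.card_insert_of_notMem haK]⟩
    rcases H.eq_of_insert_mem ha haK hb hbK hab hI hcK with rfl | rfl
    · left
      obtain rfl : σ'' = σ := Subtype.ext (hσ''.dual.eq_coneOf.trans hσ.dual.eq_coneOf.symm)
      rw [hr₁]; exact hz
    · right
      obtain rfl : σ'' = σ' := Subtype.ext (hσ''.dual.eq_coneOf.trans hσ'.dual.eq_coneOf.symm)
      rw [hr₂]; exact hz
  have hinf : (⟨_, F.face_mem σ'.1 σ'.2 _ (hσ'.dual.isFaceOf (Finset.subset_insert b K))⟩ :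
      F.cones).1 ≤ σ.1 := by
    rw [hσ.dual.eq_coneOf]
    exact coneOf_mono (Finset.subset_insert a K)
  have hne : (Set.range j₁ ∩ Set.range j₂).Nonempty := by
    have h1 : ∀ x : Spec (CommRingCat.of k[X]), Polynomial.X ∉ x.asIdeal →
        j₂ x ∈ Set.range j₁ := fun x hx => by
      rw [hr₁, Set.mem_preimage, ← Scheme.Hom.comp_apply, hj₂, Scheme.Hom.comp_apply]
      exact T.chart_lineHom_mem_range hσ'.dual hbK hinf hx
    exact ⟨_, h1 (⊥ : PrimeSpectrum k[X]) (fun hx => X_ne_zero ((Submodule.mem_bot _).1 hx)),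
      ⟨_, rfl⟩⟩
  have hint := isIntegral_of_cover j₁ j₂ hcov hne
  have hnoeth := isLocallyNoetherian_of_cover j₁ j₂ hcov
  refine ⟨q, j₁, j₂, hj₁o, hj₂o, hint, hnoeth, hq, topologicalKrullDim_of_cover j₁ j₂ hcov, hj₁, hj₂,
    denseRange_of_cover j₁ j₂ hcov hne, ?_⟩
  exact T.isProjectiveLine hσ.dual hσ'.dual haK hbK q hj₁ hj₂
    (H.dual_eq_neg ha haK hb hbK hab) hr₁ (fun z => by
      rcases hcov z with hz | hz
      · left; rw [hr₁] at hz; exact hz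
      · exact Or.inr hz) hinf

include hσ hσ' in
/-- The intersection number of a Cartier divisor with the curve of an interior wall is the bend of
the corresponding piecewise linear function. -/
theorem inter_eq_of_unitEq [IsAlgClosed k] (E : CartierDivisor X)
    (g : (redSubscheme (D.stratum τ)).functionField) (a₁ a₂ : Fin d → ℤ)
    (h₁ : ∀ x, UnitEq (T.chart σ x) ((E.restrict (redι (D.stratum τ))).eqn (T.chart σ x))
      (g * T.chi a₁))
    (h₂ : ∀ x, UnitEq (T.chart σ' x) ((E.restrict (redι (D.stratum τ))).eqn (T.chart σ' x))
      (g * T.chi a₂))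
    (hK : ∀ l ∈ K, a₁ ⬝ᵥ u l = a₂ ⬝ᵥ u l) :
    E.inter (D.stratum (τ ∪ K)) = (a₂ - a₁) ⬝ᵥ u b := by
  obtain ⟨q, j₁, j₂, hj₁o, hj₂o, hint, hnoeth, hq, -, hj₁, hj₂, -, hP⟩ :=
    h.exists_isProjectiveLine H ha haK hb hbK hab hσ hσ'
  rw [CartierDivisor.inter, dif_pos ⟨hint, hnoeth⟩,
    ← T.finsum_ord_ratSection hσ.dual hσ'.dual haK hbK q hj₁ hj₂ hP
      (H.dual_eq_neg ha haK hb hbK hab) (E.restrict (redι (D.stratum τ))) g a₁ a₂ h₁ h₂ hK]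
  refine finsum_congr fun z => ?_
  rw [E.ratSection_comp q (redι (D.stratum τ)) z]
  have : ∀ f : redSubscheme (D.stratum (τ ∪ K)) ⟶ X, f = redι (D.stratum (τ ∪ K)) →
      E.ratSection (redι (D.stratum (τ ∪ K))) z = E.ratSection f z := by
    rintro f rfl; rfl
  rw [this _ hq]

omit hσ hσ' in
/-- The intersection numbers of the components through the wall are the coefficients of the linear
relation of the wall. -/
theorem inter_comp [IsAlgClosed k] {l : ι} (hl : l ∈ K) :
    (D.comp l).inter (D.stratum (τ ∪ K)) = -(m (insert a K) l ⬝ᵥ u b) := by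
  obtain ⟨σ, hσ⟩ := h.chart _ ha
  obtain ⟨σ', hσ'⟩ := h.chart _ hb
  have hla : l ∈ insert a K := Finset.mem_insert_of_mem hl
  have hlb : l ∈ insert b K := Finset.mem_insert_of_mem hl
  let Y := redSubscheme (D.stratum τ)
  have hgen : redι (D.stratum τ) (genericPoint Y) ∉ D.supp l := by
    intro hg
    have h1 : ∀ x : affineToric k σ.1, AddMonoidAlgebra.single
        ⟨m (insert a K) l, (hσ.exponent l hla).mem_dualMonoid⟩ (1 : k) ∈ x.asIdeal := fun x => by
      rw [← (hσ.exponent l hla).mem_supp_iff, ToricStructure.emb, Scheme.Hom.comp_apply]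
      exact ((genericPoint_specializes _).map
        (redι (D.stratum τ)).continuous).mem_closed (D.isClosed_supp l) hg
    have h2 := (Submodule.mem_bot _).1 (h1 (⊥ : PrimeSpectrum (AddMonoidAlgebra k _)))
    rw [AddMonoidAlgebra.single_eq_zero] at h2
    exact one_ne_zero h2
  let g : Y.functionField := ((redι (D.stratum τ)).stalkMap (genericPoint Y)).hom
    (D.loc l (redι (D.stratum τ) (genericPoint Y)))
  have hg0 : g ≠ 0 := by
    rw [D.mem_supp_iff, not_not] at hgen
    exact (hgen.map ((redι (D.stratum τ)).stalkMap (genericPoint Y)).hom).ne_zero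
  have hE : ∀ y : Y, ((D.comp l).restrict (redι (D.stratum τ))).eqn y =
      g⁻¹ * algebraMap _ Y.functionField (D.resLoc τ l y) := fun y => by
    rw [eq_inv_mul_iff_mul_eq₀ hg0, mul_comm]
    exact D.ratSection_comp_eq (redι (D.stratum τ)) hgen y
  rw [h.inter_eq_of_unitEq H ha haK hb hbK hab hσ hσ' (D.comp l) g⁻¹ (m (insert a K) l)
    (m (insert b K) l) (fun x => by rw [hE]; exact (UnitEq.refl _).mul (hσ.exponent l hla x))
    (fun x => by rw [hE]; exact (UnitEq.refl _).mul (hσ'.exponent l hlb x))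
    (fun i hi => by
      rw [hσ.dual.pair l hla i (Finset.mem_insert_of_mem hi),
        hσ'.dual.pair l hlb i (Finset.mem_insert_of_mem hi)]),
    sub_dotProduct, hσ'.dual.pair l hlb b (Finset.mem_insert_self b K),
    if_neg (by rintro rfl; exact hbK hl), zero_sub]

omit ha haK hb hbK hab hσ hσ' in
/-- The intersection numbers of a Cartier divisor with the curves of the interior walls. -/
theorem exists_inter_eq [IsAlgClosed k] (hne : 𝓜.Nonempty) (E : CartierDivisor X) :
    ∃ e : ι → ℤ, ∀ K a b, insert a K ∈ 𝓜 → a ∉ K → insert b K ∈ 𝓜 → b ∉ K → a ≠ b →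
      E.inter (D.stratum (τ ∪ K)) =
        e a + e b + ∑ l ∈ K, -(m (insert a K) l ⬝ᵥ u b) * e l := by
  obtain ⟨g, A, e, he⟩ := h.exists_exponents hne E
  refine ⟨e, fun K a b ha haK hb hbK hab => ?_⟩
  obtain ⟨σ, hσ⟩ := h.chart _ ha
  obtain ⟨σ', hσ'⟩ := h.chart _ hb
  obtain ⟨e1, e1'⟩ := he _ ha
  obtain ⟨e2, e2'⟩ := he _ hb
  rw [h.inter_eq_of_unitEq H ha haK hb hbK hab hσ hσ' E g _ _ (e1' σ hσ) (e2' σ' hσ')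
    (fun l hl => by rw [e1 l (Finset.mem_insert_of_mem hl), e2 l (Finset.mem_insert_of_mem hl)]),
    sub_dotProduct, e2 b (Finset.mem_insert_self b K)]
  have h1 := congrArg (A (insert a K) ⬝ᵥ ·) (H.wall_relation ha haK hb hbK hab)
  simp only [dotProduct_add, dotProduct_sum, dotProduct_smul, dotProduct_zero, smul_eq_mul] at h1
  rw [e1 a (Finset.mem_insert_self a K), Finset.sum_congr rfl fun l hl => by
    rw [e1 l (Finset.mem_insert_of_mem hl)]] at h1
  linarith

omit hσ hσ' in
/-- The stratum of an interior wall is a proper curve. In the relative case, the morphism to the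
affine line is constant on the projective line, so the stratum is closed in a proper fibre. -/
theorem exists_properCurve [IsSeparated s] (hX : D.AbsoluteOrRelative s) :
    ∃ C : ProperCurve s, C.carrier = D.stratum (τ ∪ K) := by
  obtain ⟨σ, hσ⟩ := h.chart _ ha
  obtain ⟨σ', hσ'⟩ := h.chart _ hb
  obtain ⟨q, j₁, j₂, hj₁o, hj₂o, hint, hnoeth, hq, hdim, hj₁, hj₂, hdense, hP⟩ :=
    h.exists_isProjectiveLine H ha haK hb hbK hab hσ hσ'
  refine ⟨⟨D.stratum (τ ∪ K), hint, ?_, hdim⟩, rfl⟩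
  rcases hX with hs | ⟨p, hp, hpp, -⟩
  · infer_instance
  · have ht : j₁ ≫ redι (D.stratum (τ ∪ K)) ≫ s = Spec.map (CommRingCat.ofHom Polynomial.C) := by
      rw [← hq, Category.assoc, ← Category.assoc j₁, hj₁, Category.assoc, T.chart_over,
        ← Spec.map_comp]
      congr 1
      refine CommRingCat.hom_ext (RingHom.ext fun c => ?_)
      exact (lineHom k hσ.dual).commutes c
    obtain ⟨c, hc⟩ := hP.exists_const hdense (redι (D.stratum (τ ∪ K)) ≫ s)
      (redι (D.stratum (τ ∪ K)) ≫ p) (by rw [Category.assoc, hp]) ht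
    have h1 : IsProper ((redι (D.stratum (τ ∪ K)) ≫ s) ≫
        Spec.map (CommRingCat.ofHom (Polynomial.evalRingHom c))) := hc ▸ inferInstance
    exact IsProper.of_comp _ (Spec.map (CommRingCat.ofHom (Polynomial.evalRingHom c)))

end ToricStructure.IsAtlas

/-! ### Coordinates, chambers and boundary of a smooth fan -/

theorem IsDualBasis.intrinsicInterior_coneOf {α : Type*} [DecidableEq α] {d : ℕ} {I : Finset α}
    {u m : α → Fin d → ℤ} {σ : PointedCone ℝ (Fin d → ℝ)} (h : IsDualBasis I u m σ)
    {K : Finset α} (hK : K ⊆ I) : intrinsicInterior ℝ (coneOf u K : Set (Fin d → ℝ)) =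
      {x | (∀ i ∈ K, 0 < dotR (m i) x) ∧ ∀ i ∈ I, i ∉ K → dotR (m i) x = 0} := by
  let S : Set (Fin d → ℝ) := coneOf u K
  have hS : ∀ {x}, x ∈ S ↔ (∀ i ∈ K, 0 ≤ dotR (m i) x) ∧ ∀ i ∈ I, i ∉ K → dotR (m i) x = 0 :=
    h.mem_coneOf_iff hK
  have haff : ∀ x ∈ affineSpan ℝ S, ∀ i ∈ I, i ∉ K → dotR (m i) x = 0 := by
    intro x hx i hi hiK
    have h1 : affineSpan ℝ S ≤ (LinearMap.ker (dotR (m i))).toAffineSubspace :=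
      affineSpan_le.2 fun y hy => LinearMap.mem_ker.2 ((hS.1 hy).2 i hi hiK)
    exact LinearMap.mem_ker.1 (h1 hx)
  ext x
  rw [mem_intrinsicInterior]
  constructor
  · rintro ⟨y, hy, rfl⟩
    have hyS : (y : Fin d → ℝ) ∈ S := Set.mem_preimage.1 (interior_subset hy)
    refine ⟨fun i hi => lt_of_le_of_ne ((hS.1 hyS).1 i hi) fun h0 => ?_, (hS.1 hyS).2⟩
    -- otherwise one can leave the cone inside its affine span
    have hmem : ∀ t : ℝ, (y : Fin d → ℝ) + t • castR (u i) ∈ affineSpan ℝ S := fun t => by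
      have h1 := AffineSubspace.smul_vsub_vadd_mem (affineSpan ℝ S) t
        (subset_affineSpan ℝ S (castR_mem_coneOf hi)) (subset_affineSpan ℝ S
          (show (0 : Fin d → ℝ) ∈ S from (coneOf u K).zero_mem)) y.2
      rwa [vsub_eq_sub, sub_zero, vadd_eq_add, add_comm] at h1
    let g : ℝ → affineSpan ℝ S := fun t => ⟨_, hmem t⟩
    have hg : Continuous g := by
      refine Continuous.subtype_mk ?_ _
      fun_prop
    have h0' : g 0 = y := Subtype.ext (by simp [g])
    have h1 : ∀ᶠ t in 𝓝 (0 : ℝ), g t ∈ interior ((↑) ⁻¹' S : Set (affineSpan ℝ S)) :=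
      hg.continuousAt.eventually_mem (isOpen_interior.mem_nhds (by rw [h0']; exact hy))
    obtain ⟨t, ht, ht0⟩ := ((h1.filter_mono nhdsWithin_le_nhds).and
      (self_mem_nhdsWithin : ∀ᶠ t in 𝓝[<] (0 : ℝ), t ∈ Set.Iio 0)).exists
    have h2 : g t ∈ ((↑) ⁻¹' S : Set (affineSpan ℝ S)) := interior_subset ht
    have h3 : 0 ≤ dotR (m i) ((y : Fin d → ℝ) + t • castR (u i)) := (hS.1 h2).1 i hi
    rw [map_add, ← h0, map_smul, h.dotR_pair (hK hi) (hK hi), if_pos rfl, smul_eq_mul, mul_one,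
      zero_add] at h3
    exact absurd h3 (not_le.2 ht0)
  · rintro ⟨h1, h2⟩
    have hxS : x ∈ S := hS.2 ⟨fun i hi => (h1 i hi).le, h2⟩
    refine ⟨⟨x, subset_affineSpan ℝ S hxS⟩, ?_, rfl⟩
    rw [mem_interior]
    refine ⟨(↑) ⁻¹' (⋂ i ∈ K, {x | 0 < dotR (m i) x}), fun y hy => ?_, ?_, ?_⟩
    · refine hS.2 ⟨fun i hi => ?_, haff y y.2⟩
      exact le_of_lt (Set.mem_iInter₂.1 hy i hi)
    · exact (isOpen_biInter_finset fun i _ =>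
        isOpen_lt continuous_const (continuous_dotR (m i))).preimage continuous_subtype_val
    · exact Set.mem_iInter₂.2 h1

open Classical in
/-- The coordinates of a point of the support of a smooth fan with respect to the rays of a cone
containing it. -/
def fanCoord {ι : Type*} {d : ℕ} (𝓜 : Set (Finset ι)) (u : ι → Fin d → ℤ)
    (m : Finset ι → ι → Fin d → ℤ) (x : Fin d → ℝ) (i : ι) : ℝ :=
  if h : ∃ I ∈ 𝓜, x ∈ coneOf u I ∧ i ∈ I then dotR (m h.choose i) x else 0

namespace IsHalfSpaceFan

variable {ι : Type*} [DecidableEq ι] {d : ℕ} {𝓜 : Set (Finset ι)}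
    {u : ι → Fin d → ℤ} {m : Finset ι → ι → Fin d → ℤ} {μ : Fin d → ℤ}
    (h : IsHalfSpaceFan 𝓜 u m μ)
include h

/-- The coordinates do not depend on the choice of the cone. -/
theorem fanCoord_eq {I : Finset ι} (hI : I ∈ 𝓜) {x : Fin d → ℝ} (hx : x ∈ coneOf u I) (i : ι) :
    fanCoord 𝓜 u m x i = if i ∈ I then dotR (m I i) x else 0 := by
  have key : ∀ I' ∈ 𝓜, x ∈ coneOf u I' → i ∈ I' →
      dotR (m I' i) x = if i ∈ I then dotR (m I i) x else 0 := by
    intro I' hI' hx' hi'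
    have h1 : x ∈ coneOf u (I ∩ I') := by rw [← h.inter I hI I' hI']; exact ⟨hx, hx'⟩
    split_ifs with hi
    · obtain ⟨c, -, rfl⟩ := mem_coneOf.1 h1
      rw [(h.dual I hI).dotR_sum hi Finset.inter_subset_left,
        (h.dual I' hI').dotR_sum hi' Finset.inter_subset_right]
    · exact (((h.dual I' hI').mem_coneOf_iff Finset.inter_subset_right).1 h1).2 i hi'
        fun h2 => hi (Finset.mem_inter.1 h2).1
  rw [fanCoord]
  split_ifs with h1 h2 h2
  · rw [key _ h1.choose_spec.1 h1.choose_spec.2.1 h1.choose_spec.2.2, if_pos h2]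
  · rw [key _ h1.choose_spec.1 h1.choose_spec.2.1 h1.choose_spec.2.2, if_neg h2]
  · exact (h1 ⟨I, hI, hx, h2⟩).elim
  · rfl

theorem fanCoord_sum {I : Finset ι} (hI : I ∈ 𝓜) {c : ι → ℝ} (hc : ∀ i ∈ I, 0 ≤ c i)
    (hc0 : ∀ i ∉ I, c i = 0) : fanCoord 𝓜 u m (∑ i ∈ I, c i • castR (u i)) = c := by
  ext i
  rw [h.fanCoord_eq hI (mem_coneOf.2 ⟨c, hc, rfl⟩)]
  split_ifs with hi
  · rw [(h.dual I hI).dotR_sum hi subset_rfl, if_pos hi]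
  · rw [hc0 i hi]

theorem fanCoord_nonneg {x : Fin d → ℝ} (hx : 0 ≤ dotR μ x) (i : ι) :
    0 ≤ fanCoord 𝓜 u m x i := by
  obtain ⟨I, hI, hxI⟩ := (h.supp x).2 hx
  rw [h.fanCoord_eq hI hxI]
  split_ifs with hi
  · exact ((h.dual I hI).mem_iff x).1 hxI i hi
  · rfl

theorem sum_fanCoord {I : Finset ι} (hI : I ∈ 𝓜) {x : Fin d → ℝ} (hx : x ∈ coneOf u I) :
    ∑ i ∈ I, fanCoord 𝓜 u m x i • castR (u i) = x := by
  refine (Finset.sum_congr rfl fun i hi => ?_).trans ((h.dual I hI).sum_eq x)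
  rw [h.fanCoord_eq hI hx, if_pos hi]

theorem continuousOn_fanCoord (i : ι) :
    ContinuousOn (fun x => fanCoord 𝓜 u m x i) {x | 0 ≤ dotR μ x} := by
  have hU : {x | 0 ≤ dotR μ x} = ⋃ I : 𝓜, (coneOf u (I : Finset ι) : Set (Fin d → ℝ)) := by
    ext x
    simp only [Set.mem_ofPred_eq, ← h.supp, Set.mem_iUnion, Subtype.exists, exists_prop,
      SetLike.mem_coe]
  have := h.finite.to_subtype
  rw [hU]
  refine (locallyFinite_of_finite _).continuousOn_iUnion (fun I => h.isClosed_coneOf I.2)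
    fun I => ?_
  by_cases hi : i ∈ I.1
  · refine (continuous_dotR (m I.1 i)).continuousOn.congr fun x hx => ?_
    rw [h.fanCoord_eq I.2 hx, if_pos hi]
  · refine (continuousOn_const (c := (0 : ℝ))).congr fun x hx => ?_
    rw [h.fanCoord_eq I.2 hx, if_neg hi]

/-- The maximal cones are connected by crossing walls. -/
theorem adjacent_induction [Finite ι] {P : Finset ι → Prop} {I₀ : Finset ι} (hI₀ : I₀ ∈ 𝓜)
    (h0 : P I₀) (step : ∀ K a b, insert a K ∈ 𝓜 → a ∉ K → insert b K ∈ 𝓜 → b ∉ K → a ≠ b →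
      P (insert a K) → P (insert b K)) : ∀ I ∈ 𝓜, P I := by
  have := Fintype.ofFinite ι
  intro I₁ hI₁
  by_contra hP
  let p : Fin d → ℝ := ∑ i ∈ I₀, (1 : ℝ) • castR (u i)
  have hp : p ∈ coneOf u I₀ := mem_coneOf.2 ⟨fun _ => 1, fun _ _ => zero_le_one, rfl⟩
  -- a generic point `q` of the cone of `I₁`, for which the segment `[p, q]` avoids the cones of
  -- codimension two
  let W : Finset ι → Submodule ℝ (Fin d → ℝ) := fun J =>
    Submodule.span ℝ ((insert p (J.image fun i => castR (u i)) : Finset (Fin d → ℝ)) :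
      Set (Fin d → ℝ))
  have hW : ∀ J : Finset ι, J.card + 1 < d → W J ≠ ⊤ := by
    intro J hJ htop
    have h1 := finrank_span_finset_le_card (R := ℝ) (insert p (J.image fun i => castR (u i)))
    have h2 : Module.finrank ℝ (W J) = d := by rw [htop, finrank_top]; simp
    have h3 := (Finset.card_insert_le p (J.image fun i => castR (u i))).trans
      (Nat.succ_le_succ Finset.card_image_le)
    have h4 : Module.finrank ℝ (W J) ≤ J.card + 1 := h1.trans h3
    omega
  let O : Set (Fin d → ℝ) := ⋂ i ∈ I₁, {x | 0 < dotR (m I₁ i) x}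
  have hO : IsOpen O := isOpen_biInter_finset fun i _ =>
    isOpen_lt continuous_const (continuous_dotR _)
  have hOne : O.Nonempty := by
    refine ⟨∑ i ∈ I₁, (1 : ℝ) • castR (u i), Set.mem_iInter₂.2 fun i hi => ?_⟩
    rw [Set.mem_ofPred_eq, (h.dual I₁ hI₁).dotR_sum hi subset_rfl (fun _ => 1), if_pos hi]
    exact zero_lt_one
  obtain ⟨q, hqO, hq⟩ : ∃ q ∈ O, ∀ J : Finset ι, J.card + 1 < d → q ∉ W J := by
    by_contra! hcon
    have h1 : O ⊆ ⋃ J ∈ {J : Finset ι | J.card + 1 < d}, (W J : Set (Fin d → ℝ)) :=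
      fun q hq => by
        obtain ⟨J, hJ, hqJ⟩ := hcon q hq
        exact Set.mem_biUnion hJ hqJ
    refine (hO.measure_pos MeasureTheory.volume hOne).ne' (MeasureTheory.measure_mono_null h1 ?_)
    rw [MeasureTheory.measure_biUnion_null_iff (Set.to_countable _)]
    exact fun J hJ => MeasureTheory.Measure.addHaar_submodule _ _ (hW J hJ)
  have hqpos : ∀ i ∈ I₁, 0 < dotR (m I₁ i) q := fun i hi => Set.mem_iInter₂.1 hqO i hi
  have hqI₁ : ∀ I ∈ 𝓜, q ∈ coneOf u I → I = I₁ := by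
    intro I hI hqI
    have hq1 : q ∈ coneOf u I₁ :=
      ((h.dual I₁ hI₁).mem_iff q).2 fun i hi => (hqpos i hi).le
    refine (Finset.eq_of_subset_of_card_le (fun i hi => ?_) ?_).symm
    · by_contra hiI
      have h1 := h.fanCoord_eq hI hqI i
      rw [h.fanCoord_eq hI₁ hq1, if_pos hi, if_neg hiI] at h1
      exact (hqpos i hi).ne' h1
    · rw [h.card I hI, h.card I₁ hI₁]
  have hpI₀ : ∀ I ∈ 𝓜, p ∈ coneOf u I → I = I₀ := by
    intro I hI hpI
    refine (Finset.eq_of_subset_of_card_le (fun i hi => ?_) ?_).symm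
    · by_contra hiI
      have h1 := h.fanCoord_eq hI hpI i
      rw [h.fanCoord_eq hI₀ hp, if_pos hi, if_neg hiI,
        (h.dual I₀ hI₀).dotR_sum hi subset_rfl (fun _ => 1), if_pos hi] at h1
      exact one_ne_zero h1
    · rw [h.card I hI, h.card I₀ hI₀]
  let γ : ℝ → Fin d → ℝ := fun t => (1 - t) • p + t • q
  have hγ : Continuous γ := by fun_prop
  have hcl : ∀ 𝒱 : Set (Finset ι), 𝒱 ⊆ 𝓜 → IsClosed {t | ∃ I ∈ 𝒱, γ t ∈ coneOf u I} := by
    intro 𝒱 h𝒱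
    have h1 : {t | ∃ I ∈ 𝒱, γ t ∈ coneOf u I} = ⋃ I ∈ 𝒱, γ ⁻¹' (coneOf u I) := by
      ext t; simp
    rw [h1]
    exact (h.finite.subset h𝒱).isClosed_biUnion fun I hI =>
      (h.isClosed_coneOf (h𝒱 hI)).preimage hγ
  have hqμ : 0 ≤ dotR μ q := (h.supp q).1 ⟨I₁, hI₁,
    ((h.dual I₁ hI₁).mem_iff q).2 fun i hi => (hqpos i hi).le⟩
  have hpμ : 0 ≤ dotR μ p := (h.supp p).1 ⟨I₀, hI₀, hp⟩
  obtain ⟨t, ht, ⟨I, ⟨hI, hPI⟩, hγI⟩, I', ⟨hI', hPI'⟩, hγI'⟩ :=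
    isPreconnected_closed_iff.1 (isPreconnected_Icc (a := (0 : ℝ)) (b := 1))
      _ _ (hcl {I | I ∈ 𝓜 ∧ P I} fun I hI => hI.1) (hcl {I | I ∈ 𝓜 ∧ ¬ P I} fun I hI => hI.1)
      (fun t ht => by
        obtain ⟨I, hI, hγI⟩ := (h.supp (γ t)).2 (by
          rw [map_add, map_smul, map_smul]
          exact add_nonneg (mul_nonneg (sub_nonneg.2 ht.2) hpμ) (mul_nonneg ht.1 hqμ))
        by_cases hPI : P I
        · exact Or.inl ⟨I, ⟨hI, hPI⟩, hγI⟩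
        · exact Or.inr ⟨I, ⟨hI, hPI⟩, hγI⟩)
      ⟨0, ⟨le_rfl, zero_le_one⟩, I₀, ⟨hI₀, h0⟩, by simpa [γ] using hp⟩
      ⟨1, ⟨zero_le_one, le_rfl⟩, I₁, ⟨hI₁, hP⟩, by
        have : γ 1 = q := by simp [γ]
        rw [this, (h.dual I₁ hI₁).mem_iff q]
        exact fun i hi => (hqpos i hi).le⟩
  have ht0 : t ≠ 0 := by
    rintro rfl
    have : γ 0 = p := by simp [γ]
    rw [this] at hγI'
    exact hPI' (hpI₀ I' hI' hγI' ▸ h0)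
  have hne : I ≠ I' := by rintro rfl; exact hPI' hPI
  have hγint : γ t ∈ coneOf u (I ∩ I') := by rw [← h.inter I hI I' hI']; exact ⟨hγI, hγI'⟩
  have hcard : d ≤ (I ∩ I').card + 1 := by
    by_contra! hlt
    refine hq _ hlt ?_
    have h1 : γ t ∈ W (I ∩ I') := by
      obtain ⟨c, -, hc⟩ := mem_coneOf.1 hγint
      rw [hc]
      exact Submodule.sum_mem _ fun i hi => Submodule.smul_mem _ _ (Submodule.subset_span
        (Finset.mem_coe.2 (Finset.mem_insert_of_mem (Finset.mem_image_of_mem _ hi))))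
    have h2 : p ∈ W (I ∩ I') :=
      Submodule.subset_span (Finset.mem_coe.2 (Finset.mem_insert_self _ _))
    have h3 : q = t⁻¹ • (γ t - (1 - t) • p) := by
      rw [add_sub_cancel_left, smul_smul, inv_mul_cancel₀ ht0, one_smul]
    rw [h3]
    exact Submodule.smul_mem _ _ (Submodule.sub_mem _ h1 (Submodule.smul_mem _ _ h2))
  have hlt : (I ∩ I').card < d := by
    rw [← h.card I hI]
    refine Finset.card_lt_card ⟨Finset.inter_subset_left, fun hsub => hne ?_⟩
    exact Finset.eq_of_subset_of_card_le (hsub.trans Finset.inter_subset_right)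
      (by rw [h.card I hI, h.card I' hI'])
  obtain ⟨a, haK, ha⟩ := Finset.exists_eq_insert_iff.2
    ⟨(Finset.inter_subset_left : I ∩ I' ⊆ I), by rw [h.card I hI]; omega⟩
  obtain ⟨b, hbK, hb⟩ := Finset.exists_eq_insert_iff.2
    ⟨(Finset.inter_subset_right : I ∩ I' ⊆ I'), by rw [h.card I' hI']; omega⟩
  refine hPI' ?_
  rw [← hb]
  exact step _ a b (by rwa [ha]) haK (by rwa [hb]) hbK
    (by rintro rfl; exact hne (ha.symm.trans hb)) (by rwa [ha])

/-- The faces in the boundary of the half-space are in walls in the boundary. -/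
theorem exists_boundary_insert {I₁ K₁ : Finset ι} (hI₁ : I₁ ∈ 𝓜) (hK₁ : K₁ ⊆ I₁) (hμ : μ ≠ 0)
    (hK₁μ : ∀ i ∈ K₁, μ ⬝ᵥ u i = 0) :
    ∃ K a, insert a K ∈ 𝓜 ∧ a ∉ K ∧ K₁ ⊆ K ∧ ∀ l ∈ K, μ ⬝ᵥ u l = 0 := by
  let V : Submodule ℝ (Fin d → ℝ) := LinearMap.ker (dotR μ)
  let W : Finset ι → Submodule ℝ (Fin d → ℝ) := fun I =>
    Submodule.span ℝ ((fun i => castR (u i)) '' {i | i ∈ I ∧ μ ⬝ᵥ u i = 0})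
  have hmemW : ∀ I ∈ 𝓜, ∀ x ∈ coneOf u I, dotR μ x = 0 → x ∈ W I := by
    intro I hI x hx hx0
    obtain ⟨c, hc, rfl⟩ := mem_coneOf.1 hx
    rw [map_sum, Finset.sum_eq_zero_iff_of_nonneg fun i hi => by
      rw [map_smul, dotR_castR]
      exact mul_nonneg (hc i hi) (by exact_mod_cast h.mu_nonneg hI hi)] at hx0
    refine Submodule.sum_mem _ fun i hi => ?_
    have h1 := hx0 i hi
    rw [map_smul, dotR_castR, smul_eq_mul, mul_eq_zero] at h1
    rcases h1 with h1 | h1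
    · rw [h1, zero_smul]; exact Submodule.zero_mem _
    · exact Submodule.smul_mem _ _ (Submodule.subset_span ⟨i, ⟨hi, by exact_mod_cast h1⟩, rfl⟩)
  obtain ⟨q, hqV, hq⟩ : ∃ q ∈ V, ∀ I ∈ 𝓜, ¬ V ≤ W I → q ∉ W I := by
    by_contra! hcon
    have := (h.finite.subset (Set.sep_subset 𝓜 fun I => ¬ V ≤ W I)).to_subtype
    obtain ⟨I, hI⟩ := Subspace.exists_eq_top_of_iUnion_eq_univ (k := ℝ) (E := V)
      (ι := {I | I ∈ 𝓜 ∧ ¬ V ≤ W I}) (p := fun I => (W I.1).comap V.subtype) (by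
        rw [Set.eq_univ_iff_forall]
        rintro ⟨q, hqV⟩
        obtain ⟨I, hI, hVI, hqI⟩ := hcon q hqV
        exact Set.mem_iUnion.2 ⟨⟨I, hI, hVI⟩, hqI⟩)
    rw [Submodule.comap_subtype_eq_top] at hI
    exact I.2.2 hI
  let y : Fin d → ℝ := ∑ i ∈ K₁, (1 : ℝ) • castR (u i)
  have hyI₁ : y ∈ coneOf u I₁ :=
    coneOf_mono hK₁ (mem_coneOf.2 ⟨fun _ => 1, fun _ _ => zero_le_one, rfl⟩)
  have hy0 : dotR μ y = 0 := by
    rw [map_sum]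
    refine Finset.sum_eq_zero fun i hi => ?_
    rw [map_smul, dotR_castR, hK₁μ i hi, Int.cast_zero, smul_zero]
  let x : ℕ → Fin d → ℝ := fun n => y + (1 / ((n : ℝ) + 1)) • q
  have hx0 : ∀ n, dotR μ (x n) = 0 := fun n => by
    rw [map_add, hy0, map_smul, LinearMap.mem_ker.1 hqV, smul_zero, add_zero]
  have hlim : Filter.Tendsto x Filter.atTop (𝓝 y) := by
    have h1 := (tendsto_one_div_add_atTop_nhds_zero_nat (𝕜 := ℝ)).smul_const q
    have h2 := (tendsto_const_nhds (x := y)).add h1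
    rwa [zero_smul, add_zero] at h2
  obtain ⟨I, hI, hfr⟩ : ∃ I ∈ 𝓜, ∃ᶠ n in Filter.atTop, x n ∈ coneOf u I := by
    by_contra! hcon
    have h1 : ∀ᶠ n in Filter.atTop, ∀ I ∈ 𝓜, x n ∉ coneOf u I :=
      (Filter.eventually_all_finite h.finite).2 fun I hI => hcon I hI
    obtain ⟨n, hn'⟩ := h1.exists
    obtain ⟨I, hI, hn⟩ := (h.supp (x n)).2 (hx0 n).ge
    exact hn' I hI hn
  have hyI : y ∈ coneOf u I := (h.isClosed_coneOf hI).mem_of_frequently_of_tendsto hfr hlim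
  have hK₁I : K₁ ⊆ I := fun i hi => by
    by_contra hiI
    have h1 := h.fanCoord_eq hI hyI i
    rw [h.fanCoord_eq hI₁ hyI₁, if_pos (hK₁ hi), if_neg hiI,
      (h.dual I₁ hI₁).dotR_sum (hK₁ hi) hK₁ (fun _ => 1), if_pos hi] at h1
    exact one_ne_zero h1
  have hVW : V ≤ W I := by
    by_contra hVW
    refine hq I hI hVW ?_
    obtain ⟨n, hn⟩ := hfr.exists
    have h1 := Submodule.sub_mem _ (hmemW I hI _ hn (hx0 n)) (hmemW I hI _ hyI hy0)
    rw [add_sub_cancel_left] at h1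
    exact (Submodule.smul_mem_iff _ (by positivity)).1 h1
  have hB := h.dual I hI
  obtain ⟨a, haI, ha⟩ : ∃ a ∈ I, μ ⬝ᵥ u a ≠ 0 := by
    by_contra! hcon
    exact hμ (hB.ext_dual fun i hi => by rw [hcon i hi, zero_dotProduct])
  refine ⟨I.erase a, a, by rwa [Finset.insert_erase haI], Finset.notMem_erase _ _,
    fun i hi => Finset.mem_erase.2 ⟨by rintro rfl; exact ha (hK₁μ _ hi), hK₁I hi⟩, ?_⟩
  intro c hc
  obtain ⟨hca, hcI⟩ := Finset.mem_erase.1 hc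
  by_contra hc0
  let v : Fin d → ℝ := (((μ ⬝ᵥ u a : ℤ) : ℝ)) • castR (u c) - ((μ ⬝ᵥ u c : ℤ) : ℝ) • castR (u a)
  have hvV : v ∈ V := by
    rw [LinearMap.mem_ker, map_sub, map_smul, map_smul, dotR_castR, dotR_castR, smul_eq_mul,
      smul_eq_mul, mul_comm, sub_self]
  have hker : W I ≤ LinearMap.ker (dotR (m I c)) := by
    refine Submodule.span_le.2 ?_
    rintro _ ⟨i, ⟨hi, hi0⟩, rfl⟩
    rw [SetLike.mem_coe, LinearMap.mem_ker, hB.dotR_pair hcI hi,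
      if_neg (by rintro rfl; exact hc0 hi0)]
  have h1 := LinearMap.mem_ker.1 (hker (hVW hvV))
  rw [map_sub, map_smul, map_smul, hB.dotR_pair hcI hcI, hB.dotR_pair hcI haI, if_pos rfl,
    if_neg hca, smul_zero, sub_zero, smul_eq_mul, mul_one] at h1
  exact ha (by exact_mod_cast h1)

end IsHalfSpaceFan

/-! ### Lattice bases -/

namespace SNCDivisor

variable {ι : Type}

theorem isLatticeBasis_of_span {n : ℕ} {w : ι → Fin n → ℤ} {σ : Finset ι} (hσ : σ.card = n)
    (h : ∀ x, x ∈ Submodule.span ℤ (w '' (σ : Set ι))) : IsLatticeBasis w σ := by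
  have hspan : Submodule.span ℤ (w '' (σ : Set ι)) = ⊤ := eq_top_iff.2 fun x _ => h x
  refine ⟨linearIndependent_of_top_le_span_of_card_eq_finrank ?_ ?_, hspan⟩
  · rw [← hspan, Set.image_eq_range]
    exact le_rfl
  · rw [Module.finrank_fin_fun, Fintype.card_coe, hσ]

/-- The basis of `ℤⁿ` given by a family which is a lattice basis. -/
def IsLatticeBasis.basis {n : ℕ} {w : ι → Fin n → ℤ} {σ : Finset ι} (h : IsLatticeBasis w σ) :
    Module.Basis σ ℤ (Fin n → ℤ) :=
  Module.Basis.mk h.1 (by rw [← h.2, Set.image_eq_range]; exact le_rfl)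

theorem IsLatticeBasis.basis_apply {n : ℕ} {w : ι → Fin n → ℤ} {σ : Finset ι}
    (h : IsLatticeBasis w σ) (i : σ) : h.basis i = w i := Module.Basis.mk_apply _ _ _

/-- Two lattice bases differ by an element of `GL_n(ℤ)`. -/
theorem IsLatticeBasis.exists_GL {n : ℕ} {w w' : ι → Fin n → ℤ} {σ : Finset ι}
    (h : IsLatticeBasis w σ) (h' : IsLatticeBasis w' σ) :
    ∃ A : GL (Fin n) ℤ, ∀ i ∈ σ, (A : Matrix (Fin n) (Fin n) ℤ).mulVec (w' i) = w i := by
  let f := h'.basis.equiv h.basis (Equiv.refl _)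
  refine ⟨⟨LinearMap.toMatrix' f.toLinearMap, LinearMap.toMatrix' f.symm.toLinearMap, ?_, ?_⟩, ?_⟩
  · rw [← LinearMap.toMatrix'_comp, LinearEquiv.comp_symm, LinearMap.toMatrix'_id]
  · rw [← LinearMap.toMatrix'_comp, LinearEquiv.symm_comp, LinearMap.toMatrix'_id]
  · intro i hi
    have h1 := h'.basis.equiv_apply ⟨i, hi⟩ h.basis (Equiv.refl _)
    rw [h.basis_apply, h'.basis_apply] at h1
    exact (LinearMap.toMatrix'_mulVec f.toLinearMap (w' i)).trans h1

variable [Fintype ι]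

theorem mulVec_plMap {n m : ℕ} (A : Matrix (Fin m) (Fin n) ℤ) (w : ι → Fin n → ℤ) (v : ι → ℝ) :
    (A.map (Int.cast : ℤ → ℝ)).mulVec (plMap w v) = plMap (fun i => A.mulVec (w i)) v := by
  ext l
  simp only [Matrix.mulVec, dotProduct, plMap, Matrix.map_apply, Finset.mul_sum]
  rw [Finset.sum_comm]
  refine Finset.sum_congr rfl fun i _ => ?_
  push_cast
  rw [Finset.mul_sum]
  exact Finset.sum_congr rfl fun j _ => by ring

end SNCDivisor

/-! ### Stars modelled on a smooth fan -/

/-- The cones of `𝒫` containing `τ` are modelled on the smooth fan given by `𝓜`, `u` and `m`, and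
the intersection numbers with the curves of the interior walls are those of the toric variety of
this fan. -/
structure SNCDivisor.IsStarFan {X : Scheme.{u}} [IsIntegral X] {ι : Type} [DecidableEq ι]
    (D : SNCDivisor X ι) (τ : Finset ι) {d : ℕ} (𝓜 : Set (Finset ι)) (u : ι → Fin d → ℤ)
    (m : Finset ι → ι → Fin d → ℤ) (μ : Fin d → ℤ) : Prop where
  fan : IsHalfSpaceFan 𝓜 u m μ
  isCone_iff : ∀ ρ, τ ⊆ ρ → (D.IsCone ρ ↔ ∃ I ∈ 𝓜, ρ \ τ ⊆ I)
  disjoint : ∀ I ∈ 𝓜, Disjoint τ I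
  nonempty : 𝓜.Nonempty
  inter_comp : ∀ K a b, insert a K ∈ 𝓜 → a ∉ K → insert b K ∈ 𝓜 → b ∉ K → a ≠ b → ∀ l ∈ K,
    (D.comp l).inter (D.stratum (τ ∪ K)) = -(m (insert a K) l ⬝ᵥ u b)
  exists_inter : ∀ E : CartierDivisor X, ∃ e : ι → ℤ, ∀ K a b,
    insert a K ∈ 𝓜 → a ∉ K → insert b K ∈ 𝓜 → b ∉ K → a ≠ b → E.inter (D.stratum (τ ∪ K)) =
      e a + e b + ∑ l ∈ K, (D.comp l).inter (D.stratum (τ ∪ K)) * e l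

namespace SNCDivisor.IsStarFan

variable {X : Scheme.{u}} [IsIntegral X] {ι : Type} [DecidableEq ι] {D : SNCDivisor X ι}
  {τ : Finset ι} {d n : ℕ} {𝓜 : Set (Finset ι)} {u : ι → Fin d → ℤ}
  {m : Finset ι → ι → Fin d → ℤ} {μ : Fin d → ℤ} (S : D.IsStarFan τ 𝓜 u m μ)
  (hd : τ.card + d = n)
include S

theorem notMem {I : Finset ι} (hI : I ∈ 𝓜) {i : ι} (hi : i ∈ I) : i ∉ τ :=
  Finset.disjoint_right.1 (S.disjoint I hI) hi

theorem exists_subset {ρ : Finset ι} (hρ : D.IsCone ρ) (hτρ : τ ⊆ ρ) : ∃ I ∈ 𝓜, ρ ⊆ τ ∪ I := by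
  obtain ⟨I, hI, h⟩ := (S.isCone_iff ρ hτρ).1 hρ
  refine ⟨I, hI, fun i hi => ?_⟩
  by_cases hiτ : i ∈ τ
  · exact Finset.mem_union_left _ hiτ
  · exact Finset.mem_union_right _ (h (Finset.mem_sdiff.2 ⟨hi, hiτ⟩))

theorem isCone_union {I K : Finset ι} (hI : I ∈ 𝓜) (hK : K ⊆ I) : D.IsCone (τ ∪ K) :=
  (S.isCone_iff _ Finset.subset_union_left).2 ⟨I, hI, fun i hi => by
    rw [Finset.mem_sdiff, Finset.mem_union] at hi
    exact hK (hi.1.resolve_left hi.2)⟩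

theorem mem_star_iff {v : ι → ℝ} : v ∈ D.star τ ↔ (∀ j ∈ τ, 0 < v j) ∧ (∀ i, 0 ≤ v i) ∧
    ∃ I ∈ 𝓜, ∀ i, i ∉ τ → i ∉ I → v i = 0 := by
  classical
  simp only [SNCDivisor.star, Set.mem_iUnion, Set.mem_ofPred_eq, exists_prop]
  constructor
  · rintro ⟨ρ, ⟨hρ, hτρ⟩, hv, hv0⟩
    obtain ⟨I, hI, hρI⟩ := S.exists_subset hρ hτρ
    refine ⟨fun j hj => hv j (hτρ hj), fun i => ?_, I, hI, fun i hi hiI => hv0 i fun h => ?_⟩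
    · by_cases hi : i ∈ ρ
      · exact (hv i hi).le
      · exact (hv0 i hi).ge
    · rcases Finset.mem_union.1 (hρI h) with h | h
      · exact hi h
      · exact hiI h
  · rintro ⟨hv, hv', I, hI, hv0⟩
    refine ⟨τ ∪ I.filter fun i => v i ≠ 0, ⟨S.isCone_union hI (Finset.filter_subset _ _),
      Finset.subset_union_left⟩, fun i hi => ?_, fun i hi => ?_⟩
    · rcases Finset.mem_union.1 hi with hi | hi
      · exact hv i hi
      · exact lt_of_le_of_ne (hv' i) (Finset.mem_filter.1 hi).2.symm
    · by_contra h0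
      rw [Finset.mem_union, not_or, Finset.mem_filter] at hi
      exact h0 (hv0 i hi.1 fun hiI => hi.2 ⟨hiI, h0⟩)

include hd

theorem card_union {I : Finset ι} (hI : I ∈ 𝓜) : (τ ∪ I).card = n := by
  rw [Finset.card_union_of_disjoint (S.disjoint I hI), S.fan.card I hI, hd]

theorem union_mem_maxCones {I ρ : Finset ι} (hI : I ∈ 𝓜) (hρ : ρ ⊆ τ ∪ I) :
    τ ∪ I ∈ D.maxCones n ρ :=
  ⟨S.isCone_union hI subset_rfl, S.card_union hd hI, hρ⟩

theorem exists_eq_union {σ : Finset ι} (hσ : D.IsCone σ) (hn : σ.card = n) (hτσ : τ ⊆ σ) :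
    ∃ I ∈ 𝓜, σ = τ ∪ I := by
  obtain ⟨I, hI, h⟩ := S.exists_subset hσ hτσ
  exact ⟨I, hI, Finset.eq_of_subset_of_card_le h (by rw [S.card_union hd hI, hn])⟩

/-- A codimension one cone containing `τ` corresponds to a wall of the fan. -/
theorem exists_wall {ρ I : Finset ι} (hρ : ρ.card + 1 = n) (hτρ : τ ⊆ ρ) (hI : I ∈ 𝓜)
    (hρI : ρ ⊆ τ ∪ I) : ∃ a, a ∉ ρ \ τ ∧ I = insert a (ρ \ τ) := by
  have h1 : ρ \ τ ⊆ I := fun i hi => by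
    obtain ⟨hi, hiτ⟩ := Finset.mem_sdiff.1 hi
    exact (Finset.mem_union.1 (hρI hi)).resolve_left hiτ
  obtain ⟨a, ha, h2⟩ := Finset.exists_eq_insert_iff.2 ⟨h1, by
    rw [S.fan.card I hI, Finset.card_sdiff_of_subset hτρ]
    have := Finset.card_le_card hτρ
    omega⟩
  exact ⟨a, ha, h2.symm⟩

theorem exists_of_isInteriorWall {ρ σ σ' : Finset ι} (hτρ : τ ⊆ ρ)
    (h : D.IsInteriorWall n ρ σ σ') : ∃ K a b, ρ = τ ∪ K ∧ insert a K ∈ 𝓜 ∧ a ∉ K ∧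
      insert b K ∈ 𝓜 ∧ b ∉ K ∧ a ≠ b ∧ σ = τ ∪ insert a K ∧ σ' = τ ∪ insert b K := by
  obtain ⟨hρ, hn, hne, hmax⟩ := h
  have h1 : σ ∈ D.maxCones n ρ := by rw [hmax]; exact Or.inl rfl
  have h2 : σ' ∈ D.maxCones n ρ := by rw [hmax]; exact Or.inr rfl
  obtain ⟨I, hI, rfl⟩ := S.exists_eq_union hd h1.1 h1.2.1 (hτρ.trans h1.2.2)
  obtain ⟨I', hI', rfl⟩ := S.exists_eq_union hd h2.1 h2.2.1 (hτρ.trans h2.2.2)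
  obtain ⟨a, ha, rfl⟩ := S.exists_wall hd hn hτρ hI h1.2.2
  obtain ⟨b, hb, rfl⟩ := S.exists_wall hd hn hτρ hI' h2.2.2
  exact ⟨ρ \ τ, a, b, (Finset.union_sdiff_of_subset hτρ).symm, hI, ha, hI', hb,
    by rintro rfl; exact hne rfl, rfl, rfl⟩

theorem exists_of_isBoundaryWall {ρ σ : Finset ι} (hτρ : τ ⊆ ρ) (h : D.IsBoundaryWall n ρ σ) :
    ∃ K a, ρ = τ ∪ K ∧ insert a K ∈ 𝓜 ∧ a ∉ K ∧ σ = τ ∪ insert a K ∧ μ ≠ 0 ∧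
      ∀ l ∈ K, μ ⬝ᵥ u l = 0 := by
  obtain ⟨hρ, hn, hmax⟩ := h
  have h1 : σ ∈ D.maxCones n ρ := by rw [hmax]; exact Set.mem_singleton _
  obtain ⟨I, hI, rfl⟩ := S.exists_eq_union hd h1.1 h1.2.1 (hτρ.trans h1.2.2)
  obtain ⟨a, ha, rfl⟩ := S.exists_wall hd hn hτρ hI h1.2.2
  have hno : ∀ b, b ∉ ρ \ τ → a ≠ b → insert b (ρ \ τ) ∉ 𝓜 := by
    intro b hb hab hbI
    have h2 := S.union_mem_maxCones hd hbI (ρ := ρ) (by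
      rw [← Finset.union_sdiff_of_subset hτρ]
      exact Finset.union_subset_union_right (by
        rw [Finset.union_sdiff_of_subset hτρ]; exact Finset.subset_insert _ _))
    rw [hmax, Set.mem_singleton_iff] at h2
    have h3 : b ∈ τ ∪ insert a (ρ \ τ) := by
      rw [← h2]
      exact Finset.mem_union_right _ (Finset.mem_insert_self _ _)
    rcases Finset.mem_union.1 h3 with h3 | h3
    · exact S.notMem hbI (Finset.mem_insert_self _ _) h3
    · rcases Finset.mem_insert.1 h3 with h3 | h3
      · exact hab h3.symm
      · exact hb h3
  refine ⟨ρ \ τ, a, (Finset.union_sdiff_of_subset hτρ).symm, hI, ha, rfl, fun hμ => ?_,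
    fun l hl => ?_⟩
  · obtain ⟨b, hb, hab, hbI⟩ := S.fan.exists_insert_mem hI ha (l₀ := a) (Or.inl hμ)
    exact hno b hb hab hbI
  · by_contra hl0
    obtain ⟨b, hb, hab, hbI⟩ := S.fan.exists_insert_mem hI ha (Or.inr ⟨hl, hl0⟩)
    exact hno b hb hab hbI

theorem isBoundaryWall {K : Finset ι} {a : ι} (ha : insert a K ∈ 𝓜) (haK : a ∉ K) (hμ : μ ≠ 0)
    (hK : ∀ l ∈ K, μ ⬝ᵥ u l = 0) : D.IsBoundaryWall n (τ ∪ K) (τ ∪ insert a K) := by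
  have hdisj : Disjoint τ K :=
    Finset.disjoint_of_subset_right (Finset.subset_insert a K) (S.disjoint _ ha)
  have hcard : (τ ∪ K).card + 1 = n := by
    rw [Finset.card_union_of_disjoint hdisj, ← hd, ← S.fan.card _ ha,
      Finset.card_insert_of_notMem haK, add_assoc]
  refine ⟨S.isCone_union ha (Finset.subset_insert a K), hcard, Set.eq_singleton_iff_unique_mem.2
    ⟨S.union_mem_maxCones hd ha (Finset.union_subset_union_right (Finset.subset_insert a K)), ?_⟩⟩
  rintro σ ⟨hσ, hn, hρσ⟩
  obtain ⟨I, hI, rfl⟩ := S.exists_eq_union hd hσ hn (Finset.subset_union_left.trans hρσ)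
  have hK' : (τ ∪ K) \ τ = K := Finset.union_sdiff_cancel_left hdisj
  obtain ⟨b, hb, rfl⟩ := S.exists_wall hd hcard Finset.subset_union_left hI hρσ
  rw [hK'] at hb hI ⊢
  by_cases hab : a = b
  · rw [hab]
  · exact (hμ (S.fan.mu_eq_zero_of_insert_mem ha haK hI hb hab hK)).elim

/-- The points of the star in the boundary are those over the boundary of the half-space. -/
theorem mem_boundary_iff {v : ι → ℝ} (hv : v ∈ D.star τ) :
    v ∈ D.boundary n ↔ μ ≠ 0 ∧ ∀ i, i ∉ τ → v i ≠ 0 → μ ⬝ᵥ u i = 0 := by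
  simp only [SNCDivisor.boundary, Set.mem_iUnion, Set.mem_ofPred_eq, exists_prop]
  obtain ⟨h1, h2, I, hI, h3⟩ := S.mem_star_iff.1 hv
  constructor
  · rintro ⟨ρ, ⟨σ, hρ⟩, hvρ, hvρ0⟩
    have hτρ : τ ⊆ ρ := fun j hj => by
      by_contra hjρ
      exact (h1 j hj).ne' (hvρ0 j hjρ)
    obtain ⟨K, a, rfl, -, -, -, hμ, hK⟩ := S.exists_of_isBoundaryWall hd hτρ hρ
    refine ⟨hμ, fun i hi hvi => hK i ?_⟩
    by_contra hiK
    exact hvi (hvρ0 i fun h => (Finset.mem_union.1 h).elim hi hiK)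
  · rintro ⟨hμ, hv0⟩
    obtain ⟨K, a, ha, haK, hIK, hK⟩ := S.fan.exists_boundary_insert hI
      (Finset.filter_subset (fun i => v i ≠ 0) I) hμ (fun i hi => by
        obtain ⟨hi, hi0⟩ := Finset.mem_filter.1 hi
        exact hv0 i (S.notMem hI hi) hi0)
    refine ⟨τ ∪ K, ⟨_, S.isBoundaryWall hd ha haK hμ hK⟩, fun i _ => h2 i, fun i hi => ?_⟩
    rw [Finset.mem_union, not_or] at hi
    by_contra h0
    by_cases hiI : i ∈ I
    · exact hi.2 (hIK (Finset.mem_filter.2 ⟨hiI, h0⟩))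
    · exact h0 (h3 i hi.1 hiI)

end SNCDivisor.IsStarFan

/-! ### The chart on a star -/

/-- The `ℝᵈ`-component of a vector of `ℝⁿ ≃ ℝᵈ × ℝ^τ`. -/
def headR {ι : Type} {τ : Finset ι} {d n : ℕ} (ε : Fin n ≃ Fin d ⊕ τ) :
    (Fin n → ℝ) →ₗ[ℝ] (Fin d → ℝ) :=
  LinearMap.funLeft ℝ ℝ fun p => ε.symm (Sum.inl p)

theorem headR_apply {ι : Type} {τ : Finset ι} {d n : ℕ} (ε : Fin n ≃ Fin d ⊕ τ) (y : Fin n → ℝ)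
    (p : Fin d) : headR ε y p = y (ε.symm (Sum.inl p)) := rfl

theorem continuous_headR {ι : Type} {τ : Finset ι} {d n : ℕ} (ε : Fin n ≃ Fin d ⊕ τ) :
    Continuous (headR ε) := continuous_pi fun p => continuous_apply (ε.symm (Sum.inl p))

section

variable {ι : Type} [DecidableEq ι] {τ : Finset ι} {d n : ℕ} (ε : Fin n ≃ Fin d ⊕ τ)
  (u : ι → Fin d → ℤ) (e : ι → ι → ℤ)

/-- The vectors `(u_i, -(e_{ji})_{j ∈ τ})` (`i ∉ τ`) and the basis vectors of `ℤ^τ` in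
`ℤⁿ ≃ ℤᵈ × ℤ^τ`. -/
def starVec (i : ι) (q : Fin n) : ℤ :=
  Sum.elim (fun p => if i ∈ τ then 0 else u i p)
    (fun j : τ => if i ∈ τ then if i = j then 1 else 0 else -e j i) (ε q)

theorem starVec_inl (i : ι) (p : Fin d) :
    starVec ε u e i (ε.symm (Sum.inl p)) = if i ∈ τ then 0 else u i p := by
  simp [starVec]

theorem starVec_inr (i : ι) (j : τ) : starVec ε u e i (ε.symm (Sum.inr j)) =
    if i ∈ τ then if i = j then 1 else 0 else -e j i := by
  simp [starVec]

omit [DecidableEq ι] in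
/-- Vectors of `ℤⁿ ≃ ℤᵈ × ℤ^τ` are equal if their components are. -/
theorem ext_sum {R : Type*} {x y : Fin n → R} (h₁ : ∀ p, x (ε.symm (Sum.inl p)) = y (ε.symm (Sum.inl p)))
    (h₂ : ∀ j, x (ε.symm (Sum.inr j)) = y (ε.symm (Sum.inr j))) : x = y := by
  ext q
  obtain ⟨z, rfl⟩ := ε.symm.surjective q
  rcases z with p | j
  · exact h₁ p
  · exact h₂ j

end

namespace SNCDivisor.IsStarFan

variable {X : Scheme.{u}} [IsIntegral X] {ι : Type} [DecidableEq ι] {D : SNCDivisor X ι}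
  {τ : Finset ι} {d n : ℕ} {𝓜 : Set (Finset ι)} {u : ι → Fin d → ℤ}
  {m : Finset ι → ι → Fin d → ℤ} {μ : Fin d → ℤ} (S : D.IsStarFan τ 𝓜 u m μ)
  (hd : τ.card + d = n) (ε : Fin n ≃ Fin d ⊕ τ) (e : ι → ι → ℤ)
include S

include hd in
theorem isLatticeBasis {I : Finset ι} (hI : I ∈ 𝓜) :
    IsLatticeBasis (starVec ε u e) (τ ∪ I) := by
  refine isLatticeBasis_of_span (S.card_union hd hI) fun x => ?_
  let M := Submodule.span ℤ (starVec ε u e '' ((τ ∪ I : Finset ι) : Set ι))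
  have hM : ∀ i ∈ τ ∪ I, starVec ε u e i ∈ M := fun i hi =>
    Submodule.subset_span ⟨i, Finset.mem_coe.2 hi, rfl⟩
  let z : Fin d → ℤ := fun p => x (ε.symm (Sum.inl p))
  let y : Fin n → ℤ := ∑ i ∈ I, (m I i ⬝ᵥ z) • starVec ε u e i
  have hy : y ∈ M := Submodule.sum_mem _ fun i hi =>
    Submodule.smul_mem _ _ (hM i (Finset.mem_union_right _ hi))
  have hyz : ∀ p, y (ε.symm (Sum.inl p)) = x (ε.symm (Sum.inl p)) := fun p => by
    have h1 := congrFun ((S.fan.dual I hI).sum_basis_int z) p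
    refine Eq.trans ?_ h1
    simp only [y, Finset.sum_apply, Pi.smul_apply]
    exact Finset.sum_congr rfl fun i hi => by rw [starVec_inl, if_neg (S.notMem hI hi)]
  have h2 : x = y + ∑ j : τ, (x (ε.symm (Sum.inr j)) - y (ε.symm (Sum.inr j))) •
      starVec ε u e j := by
    refine ext_sum ε (fun p => ?_) fun j => ?_
    · rw [Pi.add_apply, hyz, Finset.sum_apply, Finset.sum_eq_zero, add_zero]
      intro j _
      rw [Pi.smul_apply, starVec_inl, if_pos j.2, smul_zero]
    · rw [Pi.add_apply, Finset.sum_apply, Finset.sum_eq_single j]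
      · rw [Pi.smul_apply, starVec_inr, if_pos j.2, if_pos rfl, smul_eq_mul, mul_one,
          add_sub_cancel]
      · intro i _ hij
        rw [Pi.smul_apply, starVec_inr, if_pos i.2, if_neg fun h => hij (Subtype.ext h), smul_zero]
      · exact fun h => (h (Finset.mem_univ j)).elim
  rw [h2]
  exact Submodule.add_mem _ hy (Submodule.sum_mem _ fun j _ =>
    Submodule.smul_mem _ _ (hM j (Finset.mem_union_left _ j.2)))

/-- The relation of an interior wall between the vectors of the chart. -/
theorem starVec_relation {K : Finset ι} {a b : ι} (ha : insert a K ∈ 𝓜) (haK : a ∉ K)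
    (hb : insert b K ∈ 𝓜) (hbK : b ∉ K) (hab : a ≠ b)
    (he : ∀ j ∈ τ, (D.comp j).inter (D.stratum (τ ∪ K)) =
      e j a + e j b + ∑ l ∈ K, (D.comp l).inter (D.stratum (τ ∪ K)) * e j l) :
    starVec ε u e a + starVec ε u e b =
      -∑ j ∈ τ ∪ K, (D.comp j).inter (D.stratum (τ ∪ K)) • starVec ε u e j := by
  have haτ := S.notMem ha (Finset.mem_insert_self a K)
  have hbτ := S.notMem hb (Finset.mem_insert_self b K)
  have hKτ : ∀ l ∈ K, l ∉ τ := fun l hl => S.notMem ha (Finset.mem_insert_of_mem hl)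
  rw [Finset.sum_union (Finset.disjoint_of_subset_right (Finset.subset_insert a K)
    (S.disjoint _ ha)), ← add_eq_zero_iff_eq_neg]
  refine ext_sum ε (fun p => ?_) fun j => ?_
  · have h1 := congrFun (S.fan.wall_relation ha haK hb hbK hab) p
    simp only [Pi.add_apply, Finset.sum_apply, Pi.smul_apply, starVec_inl, if_neg haτ,
      if_neg hbτ] at h1 ⊢
    rw [Finset.sum_eq_zero (fun l hl => by rw [if_pos hl, smul_zero]), zero_add]
    refine Eq.trans ?_ h1
    congr 1
    exact Finset.sum_congr rfl fun l hl => by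
      rw [if_neg (hKτ l hl), S.inter_comp K a b ha haK hb hbK hab l hl]
  · have h1 := he j j.2
    simp only [Pi.add_apply, Finset.sum_apply, Pi.smul_apply, starVec_inr, if_neg haτ,
      if_neg hbτ, Pi.zero_apply]
    rw [Finset.sum_eq_single (j : ι), if_pos j.2, if_pos rfl, smul_eq_mul, mul_one,
      Finset.sum_congr rfl fun l hl => by rw [if_neg (hKτ l hl)]]
    · simp only [smul_eq_mul, mul_neg, Finset.sum_neg_distrib]
      linarith
    · intro i hi hij
      rw [if_pos hi, if_neg hij, smul_zero]
    · exact fun h => (h j.2).elim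

variable [Fintype ι]

omit S in
theorem headR_plMap (v : ι → ℝ) : headR ε (plMap (starVec ε u e) v) =
    ∑ i, (if i ∈ τ then 0 else v i) • castR (u i) := by
  ext p
  rw [headR_apply, plMap, Finset.sum_apply]
  refine Finset.sum_congr rfl fun i _ => ?_
  rw [starVec_inl]
  split_ifs <;> simp

theorem headR_plMap_of_mem {v : ι → ℝ} {I : Finset ι} (hI : I ∈ 𝓜)
    (hv : ∀ i, i ∉ τ → i ∉ I → v i = 0) : headR ε (plMap (starVec ε u e) v) =
    ∑ i ∈ I, (if i ∈ I then v i else 0) • castR (u i) := by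
  rw [headR_plMap, ← Finset.sum_subset (Finset.subset_univ I)]
  · exact Finset.sum_congr rfl fun i hi => by rw [if_pos hi, if_neg (S.notMem hI hi)]
  · intro i _ hi
    split_ifs with hiτ
    · rw [zero_smul]
    · rw [hv i hiτ hi, zero_smul]

theorem headR_mem_coneOf {v : ι → ℝ} (hv : v ∈ D.star τ) {I : Finset ι} (hI : I ∈ 𝓜)
    (hvI : ∀ i, i ∉ τ → i ∉ I → v i = 0) :
    headR ε (plMap (starVec ε u e) v) ∈ coneOf u I := by
  rw [S.headR_plMap_of_mem ε e hI hvI]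
  refine mem_coneOf.2 ⟨_, fun i hi => ?_, rfl⟩
  rw [if_pos hi]
  exact (S.mem_star_iff.1 hv).2.1 i

/-- The chart takes the star to the half-space. -/
theorem dotR_headR_nonneg {v : ι → ℝ} (hv : v ∈ D.star τ) :
    0 ≤ dotR μ (headR ε (plMap (starVec ε u e) v)) := by
  obtain ⟨-, -, I, hI, hvI⟩ := S.mem_star_iff.1 hv
  exact (S.fan.supp _).1 ⟨I, hI, S.headR_mem_coneOf ε e hv hI hvI⟩

theorem fanCoord_headR {v : ι → ℝ} (hv : v ∈ D.star τ) (i : ι) :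
    fanCoord 𝓜 u m (headR ε (plMap (starVec ε u e) v)) i = if i ∈ τ then 0 else v i := by
  obtain ⟨-, h2, I, hI, h3⟩ := S.mem_star_iff.1 hv
  rw [S.headR_plMap_of_mem ε e hI h3, S.fan.fanCoord_sum hI (c := fun i => if i ∈ I then v i else 0)
    (fun i hi => by rw [if_pos hi]; exact h2 i) (fun i hi => if_neg hi)]
  dsimp only
  by_cases hiI : i ∈ I
  · rw [if_pos hiI, if_neg (S.notMem hI hiI)]
  · rw [if_neg hiI]
    split_ifs with hiτ
    · rfl
    · exact (h3 i hiτ hiI).symm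

theorem dotR_headR_eq_zero_iff {v : ι → ℝ} (hv : v ∈ D.star τ) :
    dotR μ (headR ε (plMap (starVec ε u e) v)) = 0 ↔ ∀ i, i ∉ τ → v i ≠ 0 → μ ⬝ᵥ u i = 0 := by
  obtain ⟨-, h2, I, hI, h3⟩ := S.mem_star_iff.1 hv
  rw [S.headR_plMap_of_mem ε e hI h3, map_sum, Finset.sum_eq_zero_iff_of_nonneg fun i hi => by
    rw [map_smul, dotR_castR, if_pos hi]
    exact mul_nonneg (h2 i) (by exact_mod_cast S.fan.mu_nonneg hI hi)]
  constructor
  · intro h i hiτ hi0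
    have hiI : i ∈ I := by
      by_contra hiI
      exact hi0 (h3 i hiτ hiI)
    have h1 := h i hiI
    rw [map_smul, dotR_castR, if_pos hiI, smul_eq_mul, mul_eq_zero] at h1
    exact_mod_cast h1.resolve_left hi0
  · intro h i hi
    rw [map_smul, dotR_castR, if_pos hi, smul_eq_mul, mul_eq_zero]
    by_cases h0 : v i = 0
    · exact Or.inl h0
    · exact Or.inr (by exact_mod_cast h i (S.notMem hI hi) h0)

omit S in
theorem plMap_starVec_inr (v : ι → ℝ) (j : τ) : plMap (starVec ε u e) v (ε.symm (Sum.inr j)) =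
    v j - ∑ i, (if i ∈ τ then 0 else v i) * e j i := by
  rw [plMap, ← Finset.add_sum_erase _ _ (Finset.mem_univ (j : ι)), starVec_inr, if_pos j.2,
    if_pos rfl, Int.cast_one, mul_one, sub_eq_add_neg, ← Finset.sum_neg_distrib,
    ← Finset.add_sum_erase (a := (j : ι)) _ (fun i => -((if i ∈ τ then 0 else v i) * (e j i : ℝ)))
      (Finset.mem_univ (j : ι)), if_pos j.2, zero_mul, neg_zero, zero_add]
  congr 1
  refine Finset.sum_congr rfl fun i hi => ?_
  rw [starVec_inr]
  split_ifs with h1 h2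
  · exact ((Finset.mem_erase.1 hi).1 h2).elim
  · simp
  · simp

omit S in
variable (𝓜 u m) in
/-- The inverse of the chart on a star. -/
def chartInv (y : Fin n → ℝ) (i : ι) : ℝ :=
  if h : i ∈ τ then
    y (ε.symm (Sum.inr ⟨i, h⟩)) + ∑ l, fanCoord 𝓜 u m (headR ε y) l * e i l
  else fanCoord 𝓜 u m (headR ε y) i

theorem chartInv_plMap {v : ι → ℝ} (hv : v ∈ D.star τ) :
    chartInv 𝓜 u m ε e (plMap (starVec ε u e) v) = v := by
  ext i
  rw [chartInv]
  split_ifs with hi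
  · rw [plMap_starVec_inr]
    simp only [S.fanCoord_headR ε e hv]
    exact sub_add_cancel _ _
  · rw [S.fanCoord_headR ε e hv, if_neg hi]

theorem plMap_chartInv {y : Fin n → ℝ} (hy : 0 ≤ dotR μ (headR ε y)) :
    plMap (starVec ε u e) (chartInv 𝓜 u m ε e y) = y := by
  obtain ⟨I, hI, hyI⟩ := (S.fan.supp _).2 hy
  have h0 : ∀ i, i ∉ I → fanCoord 𝓜 u m (headR ε y) i = 0 := fun i hi => by
    rw [S.fan.fanCoord_eq hI hyI, if_neg hi]
  have h1 : ∀ i, (if i ∈ τ then 0 else chartInv 𝓜 u m ε e y i) =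
      fanCoord 𝓜 u m (headR ε y) i := fun i => by
    split_ifs with hi
    · exact (h0 i fun h => S.notMem hI h hi).symm
    · rw [chartInv, dif_neg hi]
  refine ext_sum ε (fun p => ?_) fun j => ?_
  · have h2 : headR ε (plMap (starVec ε u e) (chartInv 𝓜 u m ε e y)) = headR ε y := by
      rw [headR_plMap, Finset.sum_congr rfl fun i _ => by rw [h1 i],
        ← Finset.sum_subset (Finset.subset_univ I) fun i _ hi => by rw [h0 i hi, zero_smul]]
      exact S.fan.sum_fanCoord hI hyI
    exact congrFun h2 p
  · rw [plMap_starVec_inr, Finset.sum_congr rfl fun i _ => by rw [h1 i], chartInv, dif_pos j.2]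
    exact add_sub_cancel_right _ _

theorem chartInv_mem_star_iff {y : Fin n → ℝ} (hy : 0 ≤ dotR μ (headR ε y)) :
    chartInv 𝓜 u m ε e y ∈ D.star τ ↔ ∀ j ∈ τ, 0 < chartInv 𝓜 u m ε e y j := by
  refine ⟨fun h => (S.mem_star_iff.1 h).1, fun h => S.mem_star_iff.2 ⟨h, fun i => ?_, ?_⟩⟩
  · by_cases hi : i ∈ τ
    · exact (h i hi).le
    · rw [chartInv, dif_neg hi]
      exact S.fan.fanCoord_nonneg hy i
  · obtain ⟨I, hI, hyI⟩ := (S.fan.supp _).2 hy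
    refine ⟨I, hI, fun i hi hiI => ?_⟩
    rw [chartInv, dif_neg hi, S.fan.fanCoord_eq hI hyI, if_neg hiI]

theorem continuousOn_chartInv :
    ContinuousOn (chartInv 𝓜 u m ε e) {y | 0 ≤ dotR μ (headR ε y)} := by
  have h1 : ∀ i, ContinuousOn (fun y => fanCoord 𝓜 u m (headR ε y) i)
      {y | 0 ≤ dotR μ (headR ε y)} := fun i =>
    (S.fan.continuousOn_fanCoord i).comp (continuous_headR ε).continuousOn fun y hy => hy
  refine continuousOn_pi.2 fun i => ?_
  by_cases hi : i ∈ τ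
  · simp only [chartInv, dif_pos hi]
    exact (continuous_apply _).continuousOn.add
      (continuousOn_finsetSum _ fun l _ => (h1 l).mul continuousOn_const)
  · simp only [chartInv, dif_neg hi]
    exact h1 i

omit S [DecidableEq ι] in
theorem continuous_plMap (w : ι → Fin n → ℤ) : Continuous (plMap w) :=
  continuous_pi fun _ => continuous_finsetSum _ fun i _ =>
    (continuous_apply i).mul continuous_const

theorem range_chart : (fun x : D.star τ => plMap (starVec ε u e) x.1) '' Set.univ =
    {y | ∀ j ∈ τ, 0 < chartInv 𝓜 u m ε e y j} ∩ {y | 0 ≤ dotR μ (headR ε y)} := by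
  ext y
  constructor
  · rintro ⟨x, -, rfl⟩
    refine ⟨fun j hj => ?_, S.dotR_headR_nonneg ε e x.2⟩
    rw [S.chartInv_plMap ε e x.2]
    exact (S.mem_star_iff.1 x.2).1 j hj
  · rintro ⟨h1, h2⟩
    exact ⟨⟨_, (S.chartInv_mem_star_iff ε e h2).2 h1⟩, trivial, S.plMap_chartInv ε e h2⟩

theorem exists_isOpen_range_chart : ∃ O : Set (Fin n → ℝ), IsOpen O ∧
    (fun x : D.star τ => plMap (starVec ε u e) x.1) '' Set.univ =
      O ∩ {y | 0 ≤ dotR μ (headR ε y)} := by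
  obtain ⟨O, hO, h⟩ := continuousOn_iff'.1 (S.continuousOn_chartInv ε e)
    (⋂ j ∈ τ, {v | 0 < v j}) (isOpen_biInter_finset fun j _ =>
      isOpen_lt continuous_const (continuous_apply j))
  refine ⟨O, hO, ?_⟩
  rw [S.range_chart ε e, ← h]
  congr 1
  ext y
  simp

theorem isEmbedding_chart : IsEmbedding
    (Set.univ.domRestrict fun x : D.star τ => plMap (starVec ε u e) x.1) := by
  let H : Set (Fin n → ℝ) := {y | 0 ≤ dotR μ (headR ε y)}
  let f : ↥(Set.univ : Set (D.star τ)) → H := fun x =>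
    ⟨plMap (starVec ε u e) x.1.1, S.dotR_headR_nonneg ε e x.1.2⟩
  have hf : Continuous f := by
    refine Continuous.subtype_mk ?_ _
    exact (continuous_plMap _).comp (continuous_subtype_val.comp continuous_subtype_val)
  have hg : Continuous (H.domRestrict (chartInv 𝓜 u m ε e)) :=
    continuousOn_iff_continuous_domRestrict.1 (S.continuousOn_chartInv ε e)
  have hgf : IsEmbedding (H.domRestrict (chartInv 𝓜 u m ε e) ∘ f) := by
    have : H.domRestrict (chartInv 𝓜 u m ε e) ∘ f = Subtype.val ∘ Subtype.val := by
      ext1 x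
      exact S.chartInv_plMap ε e x.1.2
    rw [this]
    exact IsEmbedding.subtypeVal.comp IsEmbedding.subtypeVal
  exact IsEmbedding.subtypeVal.comp (IsEmbedding.of_comp hf hg hgf)

end SNCDivisor.IsStarFan

/-! ### The integral affine structure of a star -/

theorem IsHalfSpaceFan.mem_intrinsicInterior_iff {ι : Type*} [DecidableEq ι] {d : ℕ}
    {𝓜 : Set (Finset ι)} {u : ι → Fin d → ℤ} {m : Finset ι → ι → Fin d → ℤ} {μ : Fin d → ℤ}
    (h : IsHalfSpaceFan 𝓜 u m μ) {I K : Finset ι} (hI : I ∈ 𝓜) (hK : K ⊆ I) {x : Fin d → ℝ} :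
    x ∈ intrinsicInterior ℝ (coneOf u K : Set (Fin d → ℝ)) ↔ 0 ≤ dotR μ x ∧
      (∀ i ∈ K, 0 < fanCoord 𝓜 u m x i) ∧ ∀ i ∉ K, fanCoord 𝓜 u m x i = 0 := by
  rw [(h.dual I hI).intrinsicInterior_coneOf hK]
  constructor
  · rintro ⟨h1, h2⟩
    have hx : x ∈ coneOf u I := coneOf_mono hK
      (((h.dual I hI).mem_coneOf_iff hK).2 ⟨fun i hi => (h1 i hi).le, h2⟩)
    refine ⟨(h.supp x).1 ⟨I, hI, hx⟩, fun i hi => ?_, fun i hi => ?_⟩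
    · rw [h.fanCoord_eq hI hx, if_pos (hK hi)]
      exact h1 i hi
    · rw [h.fanCoord_eq hI hx]
      split_ifs with hiI
      · exact h2 i hiI hi
      · rfl
  · rintro ⟨h0, h1, h2⟩
    obtain ⟨I', hI', hxI'⟩ := (h.supp x).2 h0
    have hx : x ∈ coneOf u I := by
      rw [← h.sum_fanCoord hI' hxI']
      refine Submodule.sum_mem _ fun i _ => ?_
      by_cases hi : i ∈ K
      · exact PointedCone.smul_mem _ (h1 i hi).le (castR_mem_coneOf (hK hi))
      · rw [h2 i hi, zero_smul]
        exact Submodule.zero_mem _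
    refine ⟨fun i hi => ?_, fun i hi hiK => ?_⟩
    · have h3 := h1 i hi
      rwa [h.fanCoord_eq hI hx, if_pos (hK hi)] at h3
    · have h3 := h2 i hiK
      rwa [h.fanCoord_eq hI hx, if_pos hi] at h3

section

variable {X : Scheme.{u}} [IsIntegral X] {ι : Type} [Fintype ι] {D : SNCDivisor X ι}
  {τ : Finset ι}

open Classical in
theorem SNCDivisor.isCone_support {v : ι → ℝ} (hv : v ∈ D.star τ) :
    D.IsCone (Finset.univ.filter fun i => v i ≠ 0) ∧
      τ ⊆ Finset.univ.filter fun i => v i ≠ 0 := by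
  simp only [SNCDivisor.star, Set.mem_iUnion, Set.mem_ofPred_eq, exists_prop] at hv
  obtain ⟨ρ, ⟨hρ, hτρ⟩, h1, h2⟩ := hv
  have : Finset.univ.filter (fun i => v i ≠ 0) = ρ := by
    ext i
    rw [Finset.mem_filter]
    refine ⟨fun h => ?_, fun h => ⟨Finset.mem_univ i, (h1 i h).ne'⟩⟩
    by_contra hi
    exact h.2 (h2 i hi)
  rw [this]
  exact ⟨hρ, hτρ⟩

theorem affCompatible_of_mulVec {n : ℕ} {U : Set (ι → ℝ)} {w w' : ι → Fin n → ℤ}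
    (h : ∀ x ∈ D.star τ, x ∈ U → ∃ A : GL (Fin n) ℤ, ∀ y ∈ D.star τ, y ∈ U → ∀ i, y i ≠ 0 →
      (A : Matrix (Fin n) (Fin n) ℤ).mulVec (w' i) = w i) :
    AffCompatible (Subtype.val ⁻¹' U, fun x : D.star τ => SNCDivisor.plMap w' x.1)
      (Set.univ, fun x : D.star τ => SNCDivisor.plMap w x.1) := by
  rintro x ⟨hx, -⟩
  obtain ⟨A, hA⟩ := h x.1 x.2 hx
  refine ⟨Set.univ, Filter.univ_mem, A, 0, fun y hy => ?_⟩
  dsimp only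
  rw [SNCDivisor.mulVec_plMap]
  ext l
  simp only [SNCDivisor.plMap, Pi.add_apply, Pi.zero_apply, Int.cast_zero, add_zero]
  refine Finset.sum_congr rfl fun i _ => ?_
  by_cases hi : y.1 i = 0
  · rw [hi, zero_mul, zero_mul]
  · rw [hA y.1 y.2 hy.2.1 i hi]

end

namespace SNCDivisor.IsStarFan

variable {X : Scheme.{u}} [IsIntegral X] {ι : Type} [DecidableEq ι] {D : SNCDivisor X ι}
  {τ : Finset ι} {d n : ℕ} {𝓜 : Set (Finset ι)} {u : ι → Fin d → ℤ}
  {m : Finset ι → ι → Fin d → ℤ} {μ : Fin d → ℤ} (S : D.IsStarFan τ 𝓜 u m μ)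
  (hd : τ.card + d = n) (ε : Fin n ≃ Fin d ⊕ τ) (e : ι → ι → ℤ) [Fintype ι]
include S

include hd in
omit [Fintype ι] in
theorem disjoint_boundary (hμ : μ = 0) : Disjoint (D.star τ) (D.boundary n) :=
  Set.disjoint_left.2 fun _ hv hv' => ((S.mem_boundary_iff hd hv).1 hv').1 hμ

include hd in
/-- A point of `Star(ρ)` and `Star(τ)` is in a common maximal cone of `ρ` and `τ`. -/
theorem exists_mem_maxCones {ρ : Finset ι} {y : ι → ℝ} (hy : y ∈ D.star τ) (hyρ : y ∈ D.star ρ) :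
    ∃ I ∈ 𝓜, τ ∪ I ∈ D.maxCones n ρ ∧ ∀ i, y i ≠ 0 → i ∈ τ ∪ I := by
  obtain ⟨h1, h2⟩ := D.isCone_support hy
  obtain ⟨-, h3⟩ := D.isCone_support hyρ
  obtain ⟨I, hI, h4⟩ := S.exists_subset h1 h2
  exact ⟨I, hI, S.union_mem_maxCones hd hI (h3.trans h4), fun i hi =>
    h4 (Finset.mem_filter.2 ⟨Finset.mem_univ i, hi⟩)⟩

include hd in
/-- The charts off the codimension two cones are compatible with the chart of a star: the vectors of
both charts are lattice bases on maximal cones, and satisfy the same relation along the walls. -/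
theorem affCompatible_chart
    (he : ∀ j ∈ τ, ∀ K a b, insert a K ∈ 𝓜 → a ∉ K → insert b K ∈ 𝓜 → b ∉ K → a ≠ b →
      (D.comp j).inter (D.stratum (τ ∪ K)) =
        e j a + e j b + ∑ l ∈ K, (D.comp l).inter (D.stratum (τ ∪ K)) * e j l)
    {U : Set (ι → ℝ)} {w' : ι → Fin n → ℤ} (hU : D.IsChartOf n U w') :
    AffCompatible (Subtype.val ⁻¹' U, fun x : D.star τ => plMap w' x.1)
      (Set.univ, fun x : D.star τ => plMap (starVec ε u e) x.1) := by
  refine affCompatible_of_mulVec fun x hx hxU => ?_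
  cases hU with
  | maximal σ w hσ hn hw =>
    have hτσ : τ ⊆ σ := fun i hi => by
      by_contra hiσ
      exact ((S.mem_star_iff.1 hx).1 i hi).ne' (hxU.2 i hiσ)
    obtain ⟨I, hI, rfl⟩ := S.exists_eq_union hd hσ hn hτσ
    obtain ⟨A, hA⟩ := (S.isLatticeBasis hd ε e hI).exists_GL hw
    refine ⟨A, fun y _ hyU i hi => hA i ?_⟩
    by_contra h
    exact hi (hyU.2 i h)
  | boundaryWall ρ σ w h hw =>
    obtain ⟨I, hI, hmax, -⟩ := S.exists_mem_maxCones hd hx hxU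
    rw [h.2.2, Set.mem_singleton_iff] at hmax
    subst hmax
    obtain ⟨A, hA⟩ := (S.isLatticeBasis hd ε e hI).exists_GL hw
    refine ⟨A, fun y hy hyU i hi => hA i ?_⟩
    obtain ⟨I', hI', hmax', h'⟩ := S.exists_mem_maxCones hd hy hyU
    rw [h.2.2, Set.mem_singleton_iff] at hmax'
    rw [← hmax']
    exact h' i hi
  | interiorWall ρ σ σ' w h hw =>
    by_cases hτρ : τ ⊆ ρ
    · obtain ⟨K, a, b, rfl, ha, haK, hb, hbK, hab, rfl, rfl⟩ :=
        S.exists_of_isInteriorWall hd hτρ h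
      obtain ⟨A, hA⟩ := (S.isLatticeBasis hd ε e ha).exists_GL hw.1
      have haτ := S.notMem ha (Finset.mem_insert_self a K)
      have hbτ := S.notMem hb (Finset.mem_insert_self b K)
      have haU : a ∈ τ ∪ insert a K := Finset.mem_union_right _ (Finset.mem_insert_self a K)
      have hsub : τ ∪ K ⊆ τ ∪ insert a K :=
        Finset.union_subset_union_right (Finset.subset_insert a K)
      have hrel := hw.2.2 a haU (fun h => (Finset.mem_union.1 h).elim haτ haK) b
        (Finset.mem_union_right _ (Finset.mem_insert_self b K))
        (fun h => (Finset.mem_union.1 h).elim hbτ hbK)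
      have hrel' := S.starVec_relation ε e ha haK hb hbK hab
        fun j hj => he j hj K a b ha haK hb hbK hab
      have hAb : (A : Matrix (Fin n) (Fin n) ℤ).mulVec (w' b) = starVec ε u e b := by
        have h1 : w' b = -w' a + -∑ j ∈ τ ∪ K, (D.comp j).inter (D.stratum (τ ∪ K)) • w' j := by
          rw [← hrel]; abel
        have h2 : starVec ε u e b = -starVec ε u e a +
            -∑ j ∈ τ ∪ K, (D.comp j).inter (D.stratum (τ ∪ K)) • starVec ε u e j := by
          rw [← hrel']; abel
        rw [h1, h2, Matrix.mulVec_add, Matrix.mulVec_neg, Matrix.mulVec_neg, hA a haU,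
          Matrix.mulVec_sum]
        congr 2
        exact Finset.sum_congr rfl fun j hj => by rw [Matrix.mulVec_smul, hA j (hsub hj)]
      refine ⟨A, fun y hy hyU i hi => ?_⟩
      obtain ⟨I', hI', hmax', h'⟩ := S.exists_mem_maxCones hd hy hyU
      have h3 := h' i hi
      rw [h.2.2.2, Set.mem_insert_iff, Set.mem_singleton_iff] at hmax'
      rcases hmax' with h4 | h4
      · exact hA i (h4 ▸ h3)
      · rw [h4] at h3
        rcases Finset.mem_union.1 h3 with h5 | h5
        · exact hA i (Finset.mem_union_left _ h5)
        · rcases Finset.mem_insert.1 h5 with rfl | h5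
          · exact hAb
          · exact hA i (hsub (Finset.mem_union_right _ h5))
    · -- the only maximal cone containing `ρ` and `τ` is `ρ ∪ τ`
      have hcard : n ≤ (ρ ∪ τ).card := by
        rw [← h.2.1, Nat.succ_le_iff]
        exact Finset.card_lt_card ⟨Finset.subset_union_left, fun hsub =>
          hτρ (Finset.subset_union_right.trans hsub)⟩
      have hmax : ∀ I, τ ∪ I ∈ D.maxCones n ρ → ρ ∪ τ = τ ∪ I := fun I hI =>
        Finset.eq_of_subset_of_card_le (Finset.union_subset hI.2.2 Finset.subset_union_left)
          (by rw [hI.2.1]; exact hcard)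
      obtain ⟨I, hI, hImax, -⟩ := S.exists_mem_maxCones hd hx hxU
      have hbasis : IsLatticeBasis w' (τ ∪ I) := by
        have h1 := hImax
        rw [h.2.2.2, Set.mem_insert_iff, Set.mem_singleton_iff] at h1
        rcases h1 with h1 | h1
        · rw [h1]; exact hw.1
        · rw [h1]; exact hw.2.1
      obtain ⟨A, hA⟩ := (S.isLatticeBasis hd ε e hI).exists_GL hbasis
      refine ⟨A, fun y hy hyU i hi => hA i ?_⟩
      obtain ⟨I', hI', hmax', h'⟩ := S.exists_mem_maxCones hd hy hyU
      rw [← hmax I hImax, hmax I' hmax']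
      exact h' i hi

omit S [Fintype ι] [DecidableEq ι] in
theorem sum_elim_mul (y : Fin n → ℝ) :
    ∑ q, ((Sum.elim μ (0 : τ → ℤ) (ε q) : ℤ) : ℝ) * y q = dotR μ (headR ε y) := by
  rw [← ε.symm.sum_comp, Fintype.sum_sum_type, dotR_apply]
  simp [headR_apply]

/-- The integral affine structure with the single chart of the star. -/
def affineStructure : IntegralAffineStructure (D.star τ) n {x | x.1 ∈ D.boundary n} where
  charts := {(Set.univ, fun x : D.star τ => plMap (starVec ε u e) x.1)}
  isOpen := by
    rintro c rfl
    exact isOpen_univ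
  isEmbedding := by
    rintro c rfl
    exact S.isEmbedding_chart ε e
  image := by
    rintro c rfl
    obtain ⟨O, hO, himage⟩ := S.exists_isOpen_range_chart ε e
    by_cases hμ : μ = 0
    · refine Or.inl ⟨Set.disjoint_left.2 fun x _ hx =>
        Set.disjoint_left.1 (S.disjoint_boundary hd hμ) x.2 hx, ?_⟩
      dsimp only
      rw [himage, hμ, dotR_zero]
      simpa using hO
    · refine Or.inr ⟨fun q => Sum.elim μ (0 : τ → ℤ) (ε q), 0, fun h0 => hμ ?_, ⟨O, hO, ?_⟩, ?_⟩
      · ext p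
        simpa using congrFun h0 (ε.symm (Sum.inl p))
      · simp only [sum_elim_mul]
        exact himage
      · intro x _
        dsimp only
        rw [sum_elim_mul, S.dotR_headR_eq_zero_iff ε e x.2, Set.mem_ofPred_eq,
          S.mem_boundary_iff hd x.2, and_iff_right hμ]
  cover x := ⟨_, rfl, trivial⟩
  compatible := by
    rintro c rfl c' rfl x -
    refine ⟨Set.univ, Filter.univ_mem, 1, 0, fun y _ => ?_⟩
    ext l
    simp [Matrix.map_one]

/-- The projection of a star to `ℝᵈ`. -/
theorem isAffineSubmersion : (S.affineStructure hd ε e).IsAffineSubmersion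
    fun x => headR ε (plMap (starVec ε u e) x.1) := by
  rintro c rfl x -
  refine ⟨Set.univ, Filter.univ_mem,
    (1 : Matrix (Fin n) (Fin n) ℤ).submatrix (fun p => ε.symm (Sum.inl p)) id, 0, fun z => ?_,
    fun y _ => ?_⟩
  · refine ⟨fun q => Sum.elim z (0 : τ → ℤ) (ε q), ?_⟩
    ext p
    simp [Matrix.mulVec, dotProduct, Matrix.one_apply]
  · ext p
    simp [Matrix.mulVec, dotProduct, Matrix.one_apply, headR_apply]

theorem preimage_intrinsicInterior {I K : Finset ι} (hI : I ∈ 𝓜) (hK : K ⊆ I) :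
    (fun x : D.star τ => headR ε (plMap (starVec ε u e) x.1)) ⁻¹'
      intrinsicInterior ℝ (coneOf u K : Set (Fin d → ℝ)) = {x | x.1 ∈ coneInt (τ ∪ K)} := by
  ext x
  rw [Set.mem_preimage, S.fan.mem_intrinsicInterior_iff hI hK,
    and_iff_right (S.dotR_headR_nonneg ε e x.2)]
  simp only [S.fanCoord_headR ε e x.2]
  constructor
  · rintro ⟨h1, h2⟩
    refine ⟨fun i hi => ?_, fun i hi => ?_⟩
    · rcases Finset.mem_union.1 hi with hi | hi
      · exact (S.mem_star_iff.1 x.2).1 i hi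
      · have := h1 i hi
        rwa [if_neg (S.notMem hI (hK hi))] at this
    · rw [Finset.mem_union, not_or] at hi
      have := h2 i hi.2
      rwa [if_neg hi.1] at this
  · rintro ⟨h1, h2⟩
    refine ⟨fun i hi => ?_, fun i hi => ?_⟩
    · rw [if_neg (S.notMem hI (hK hi))]
      exact h1 i (Finset.mem_union_right _ hi)
    · split_ifs with hiτ
      · rfl
      · exact h2 i fun h => (Finset.mem_union.1 h).elim hiτ hi

theorem image_coneInt {I K : Finset ι} (hI : I ∈ 𝓜) (hK : K ⊆ I) :
    (fun x : D.star τ => headR ε (plMap (starVec ε u e) x.1)) '' {x | x.1 ∈ coneInt (τ ∪ K)} =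
      intrinsicInterior ℝ (coneOf u K : Set (Fin d → ℝ)) := by
  rw [← S.preimage_intrinsicInterior ε e hI hK, Set.image_preimage_eq_iff]
  intro y hy
  obtain ⟨h0, h1, h2⟩ := (S.fan.mem_intrinsicInterior_iff hI hK).1 hy
  have hyI : y ∈ coneOf u I :=
    coneOf_mono hK (intrinsicInterior_subset hy)
  let v : ι → ℝ := fun i => if i ∈ τ then 1 else fanCoord 𝓜 u m y i
  have hv0 : ∀ i, i ∉ τ → i ∉ I → v i = 0 := fun i hi hiI => by
    rw [show v i = fanCoord 𝓜 u m y i from if_neg hi]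
    exact h2 i fun h => hiI (hK h)
  have hv : v ∈ D.star τ := by
    refine S.mem_star_iff.2 ⟨fun j hj => ?_, fun i => ?_, I, hI, hv0⟩
    · rw [show v j = 1 from if_pos hj]; exact zero_lt_one
    · dsimp only [v]
      split_ifs
      · exact zero_le_one
      · exact S.fan.fanCoord_nonneg h0 i
  refine ⟨⟨v, hv⟩, ?_⟩
  dsimp only
  rw [S.headR_plMap_of_mem ε e hI hv0]
  refine Eq.trans (Finset.sum_congr rfl fun i hi => ?_) (S.fan.sum_fanCoord hI hyI)
  rw [if_pos hi, show v i = fanCoord 𝓜 u m y i from if_neg (S.notMem hI hi)]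

end SNCDivisor.IsStarFan

/-! ### The piecewise linear function -/

theorem extendScalars_plMap {ι : Type} [Fintype ι] {G : Type*} [AddCommGroup G] {n : ℕ}
    (m : (Fin n → ℤ) →+ G) (w : ι → Fin n → ℤ) (v : ι → ℝ) :
    extendScalars m (SNCDivisor.plMap w v) = ∑ i, v i ⊗ₜ[ℤ] m (w i) := by
  have h1 : ∀ i, m (w i) = ∑ l, w i l • m (Pi.single l 1) := fun i => by
    have h2 : w i = ∑ l, w i l • Pi.single l (1 : ℤ) := by
      ext q
      simp [Finset.sum_apply, Pi.single_apply]
    conv_lhs => rw [h2, map_sum]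
    exact Finset.sum_congr rfl fun l _ => map_zsmul m _ _
  simp only [extendScalars, SNCDivisor.plMap, TensorProduct.sum_tmul, h1, TensorProduct.tmul_sum]
  rw [Finset.sum_comm]
  refine Finset.sum_congr rfl fun i _ => Finset.sum_congr rfl fun l _ => ?_
  rw [← TensorProduct.smul_tmul, zsmul_eq_mul, mul_comm]

theorem curveClass_eq {k : Type u} [Field k] {X : Scheme.{u}} [IsIntegral X]
    {s : X ⟶ Spec (CommRingCat.of k)} (C : ProperCurve s) :
    curveClass s C.carrier = QuotientAddGroup.mk (Finsupp.single C 1) := by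
  have h : ∃ C' : ProperCurve s, C'.carrier = C.carrier := ⟨C, rfl⟩
  have h1 : h.choose = C := by
    have h2 := h.choose_spec
    generalize h.choose = C' at h2
    cases C'; cases C
    simp only at h2
    subst h2
    rfl
  rw [curveClass, dif_pos h, h1]

namespace SNCDivisor.IsStarFan

variable {k : Type u} [Field k] {X : Scheme.{u}} [IsIntegral X]
  {s : X ⟶ Spec (CommRingCat.of k)} {ι : Type} [DecidableEq ι] {D : SNCDivisor X ι}
  {τ : Finset ι} {d n : ℕ} {𝓜 : Set (Finset ι)} {u : ι → Fin d → ℤ}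
  {m : Finset ι → ι → Fin d → ℤ} {μ : Fin d → ℤ} (S : D.IsStarFan τ 𝓜 u m μ)
  (hd : τ.card + d = n) (ε : Fin n ≃ Fin d ⊕ τ) (e : ι → ι → ℤ) [Fintype ι]
include S hd

include ε in
/-- There are slopes in `N_1(X)` along the rays for which the bend along every interior wall is the
class of the corresponding curve: the relations between the bends, which come from the relations
between the rays, hold between the classes of the curves, since the intersection numbers with a
Cartier divisor are themselves the bends of a piecewise linear function. -/
theorem exists_slopes
    (he : ∀ j ∈ τ, ∀ K a b, insert a K ∈ 𝓜 → a ∉ K → insert b K ∈ 𝓜 → b ∉ K → a ≠ b →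
      (D.comp j).inter (D.stratum (τ ∪ K)) =
        e j a + e j b + ∑ l ∈ K, (D.comp l).inter (D.stratum (τ ∪ K)) * e j l)
    (hC : ∀ K a b, insert a K ∈ 𝓜 → a ∉ K → insert b K ∈ 𝓜 → b ∉ K → a ≠ b →
      ∃ C : ProperCurve s, C.carrier = D.stratum (τ ∪ K)) :
    ∃ Φ : ι → N1 s, ∀ K a b, insert a K ∈ 𝓜 → a ∉ K → insert b K ∈ 𝓜 → b ∉ K → a ≠ b →
      Φ a + Φ b + ∑ j ∈ τ ∪ K, (D.comp j).inter (D.stratum (τ ∪ K)) • Φ j =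
        curveClass s (D.stratum (τ ∪ K)) := by
  let 𝒲 := {p : Finset ι × ι × ι // insert p.2.1 p.1 ∈ 𝓜 ∧ p.2.1 ∉ p.1 ∧
    insert p.2.2 p.1 ∈ 𝓜 ∧ p.2.2 ∉ p.1 ∧ p.2.1 ≠ p.2.2}
  let E : ι → ι → ℤ := fun i => Pi.single i 1
  let N : Finset ι → ι → ℤ := fun K j => (D.comp j).inter (D.stratum (τ ∪ K))
  let β : 𝒲 → ι → ℤ := fun p =>
    E p.1.2.1 + E p.1.2.2 + ∑ j ∈ τ ∪ p.1.1, N p.1.1 j • E j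
  have hC' : ∀ p : 𝒲, ∃ C : ProperCurve s, C.carrier = D.stratum (τ ∪ p.1.1) := fun p =>
    hC _ _ _ p.2.1 p.2.2.1 p.2.2.2.1 p.2.2.2.2.1 p.2.2.2.2.2
  choose C hC' using hC'
  let P : (𝒲 →₀ ℤ) →ₗ[ℤ] (ι → ℤ) := Finsupp.linearCombination ℤ β
  let R : (𝒲 →₀ ℤ) →ₗ[ℤ] (ProperCurve s →₀ ℤ) :=
    Finsupp.linearCombination ℤ fun p => Finsupp.single (C p) 1
  let Q : (𝒲 →₀ ℤ) →+ N1 s := (QuotientAddGroup.mk' (numTrivial s)).comp R.toAddMonoidHom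
  have hPQ : ∀ c, P c = 0 → Q c = 0 := by
    intro c hc
    refine (QuotientAddGroup.eq_zero_iff _).2 ?_
    rw [numTrivial, AddSubgroup.mem_iInf]
    intro A
    rw [AddMonoidHom.mem_ker]
    obtain ⟨f, hf⟩ := S.exists_inter A
    -- the pairing with `A` factors through the bends
    let L : (ι → ℤ) →ₗ[ℤ] ℤ := ∑ i, (if i ∈ τ then 0 else f i) • LinearMap.proj i
    have hLE : ∀ i, L (E i) = if i ∈ τ then 0 else f i := fun i => by
      simp only [L, E, LinearMap.sum_apply, LinearMap.smul_apply, LinearMap.proj_apply,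
        smul_eq_mul]
      rw [Finset.sum_eq_single i, Pi.single_eq_same, mul_one]
      · intro j _ hj
        rw [Pi.single_eq_of_ne hj, mul_zero]
      · exact fun h => (h (Finset.mem_univ i)).elim
    have h1 : ((A.pairing s).toIntLinearMap).comp R = L.comp P := by
      refine Finsupp.lhom_ext' fun p => LinearMap.ext_ring ?_
      obtain ⟨ha, haK, hb, hbK, hab⟩ := p.2
      have h2 : L (β p) = A.inter (D.stratum (τ ∪ p.1.1)) := by
        rw [hf _ _ _ ha haK hb hbK hab, map_add, map_add, hLE, hLE,
          if_neg (S.notMem ha (Finset.mem_insert_self _ _)),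
          if_neg (S.notMem hb (Finset.mem_insert_self _ _)), map_sum,
          Finset.sum_union (Finset.disjoint_of_subset_right (Finset.subset_insert _ _)
            (S.disjoint _ ha)), Finset.sum_eq_zero, zero_add]
        · congr 1
          refine Finset.sum_congr rfl fun l hl => ?_
          rw [map_zsmul, hLE, if_neg (S.notMem ha (Finset.mem_insert_of_mem hl)), smul_eq_mul]
        · intro l hl
          rw [map_zsmul, hLE, if_pos hl, smul_zero]
      have h3 : P (Finsupp.single p 1) = β p := by
        simp [P]
      have h4 : R (Finsupp.single p 1) = Finsupp.single (C p) 1 := by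
        simp [R]
      change A.pairing s (R (Finsupp.single p 1)) = L (P (Finsupp.single p 1))
      rw [h3, h4, h2, ← hC' p, CartierDivisor.pairing, Finsupp.liftAddHom_apply_single]
      exact one_mul _
    have h2 := LinearMap.congr_fun h1 c
    change A.pairing s (R c) = L (P c) at h2
    rw [hc, map_zero] at h2
    exact h2
  obtain ⟨I₀, hI₀⟩ := S.nonempty
  have hbas := S.isLatticeBasis hd ε e hI₀
  -- the difference of a ray and of its lift by the section given by a maximal cone
  let sec : (Fin n → ℤ) →ₗ[ℤ] (ι → ℤ) := hbas.basis.constr ℤ fun i => E i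
  let g : ι → ι → ℤ := fun i => E i - sec (starVec ε u e i)
  have hg0 : ∀ i ∈ τ ∪ I₀, g i = 0 := fun i hi => by
    have h1 := hbas.basis.constr_basis ℤ (fun i => E i) ⟨i, hi⟩
    rw [hbas.basis_apply] at h1
    exact sub_eq_zero.2 h1.symm
  have hgβ : ∀ p : 𝒲, g p.1.2.1 + g p.1.2.2 + ∑ j ∈ τ ∪ p.1.1, N p.1.1 j • g j = β p := by
    intro p
    obtain ⟨ha, haK, hb, hbK, hab⟩ := p.2
    have h1 := S.starVec_relation ε e ha haK hb hbK hab
      fun j hj => he j hj _ _ _ ha haK hb hbK hab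
    have h2 := congrArg sec (add_eq_zero_iff_eq_neg.2 h1)
    rw [map_add, map_add, map_sum, map_zero] at h2
    simp only [map_zsmul] at h2
    simp only [g, smul_sub, Finset.sum_sub_distrib, β]
    rw [← sub_zero (E p.1.2.1 + E p.1.2.2 + ∑ j ∈ τ ∪ p.1.1, N p.1.1 j • E j), ← h2]
    abel
  have hβ : ∀ p, β p ∈ LinearMap.range P := fun p => ⟨Finsupp.single p 1, by simp [P]⟩
  have hgτ : ∀ i ∈ τ, g i ∈ LinearMap.range P := fun i hi => by
    rw [hg0 i (Finset.mem_union_left _ hi)]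
    exact Submodule.zero_mem _
  have hg : ∀ I ∈ 𝓜, ∀ i ∈ I, g i ∈ LinearMap.range P := by
    refine S.fan.adjacent_induction hI₀ (fun i hi => ?_) fun K a b ha haK hb hbK hab h i hi => ?_
    · rw [hg0 i (Finset.mem_union_right _ hi)]
      exact Submodule.zero_mem _
    · rcases Finset.mem_insert.1 hi with rfl | hi
      · have h1 := hgβ ⟨(K, a, i), ha, haK, hb, hbK, hab⟩
        have h2 : g i = β ⟨(K, a, i), ha, haK, hb, hbK, hab⟩ - g a -
            ∑ j ∈ τ ∪ K, N K j • g j := by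
          rw [← h1]; abel
        rw [h2]
        refine Submodule.sub_mem _ (Submodule.sub_mem _ (hβ _)
          (h a (Finset.mem_insert_self a K))) (Submodule.sum_mem _ fun j hj =>
            Submodule.smul_mem _ _ ?_)
        rcases Finset.mem_union.1 hj with hj | hj
        · exact hgτ j hj
        · exact h j (Finset.mem_insert_of_mem hj)
      · exact h i (Finset.mem_insert_of_mem hi)
  have hex : ∀ i, ∃ c, g i ∈ LinearMap.range P → P c = g i := fun i => by
    by_cases h : g i ∈ LinearMap.range P
    · obtain ⟨c, hc⟩ := h
      exact ⟨c, fun _ => hc⟩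
    · exact ⟨0, fun h' => (h h').elim⟩
  choose c hc using hex
  refine ⟨fun i => Q (c i), fun K a b ha haK hb hbK hab => ?_⟩
  let p : 𝒲 := ⟨(K, a, b), ha, haK, hb, hbK, hab⟩
  have hcj : ∀ j ∈ τ ∪ K, P (c j) = g j := fun j hj => hc j (by
    rcases Finset.mem_union.1 hj with hj | hj
    · exact hgτ j hj
    · exact hg _ ha j (Finset.mem_insert_of_mem hj))
  have h1 : P (c a + c b + ∑ j ∈ τ ∪ K, N K j • c j - Finsupp.single p 1) = 0 := by
    rw [map_sub, map_add, map_add, map_sum, hc a (hg _ ha a (Finset.mem_insert_self a K)),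
      hc b (hg _ hb b (Finset.mem_insert_self b K)),
      Finset.sum_congr rfl fun j hj => by rw [map_zsmul, hcj j hj]]
    have h2 : P (Finsupp.single p 1) = β p := by simp [P]
    rw [h2, ← hgβ p]
    exact sub_self _
  have h2 := hPQ _ h1
  rw [map_sub, map_add, map_add, map_sum, sub_eq_zero] at h2
  simp only [map_zsmul] at h2
  refine h2.trans ?_
  have h3 : R (Finsupp.single p 1) = Finsupp.single (C p) 1 := by simp [R]
  have h4 : curveClass s (D.stratum (τ ∪ K)) = QuotientAddGroup.mk (Finsupp.single (C p) 1) := by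
    rw [← curveClass_eq, hC' p]
  rw [h4, ← h3]
  rfl

/-- Slopes along the rays with the bends `κ` give a single valued representative. -/
theorem isSingleValuedRepresentative {G : Type*} [AddCommGroup G] (κ : Finset ι → G) (Φ : ι → G)
    (hΦ : ∀ K a b, insert a K ∈ 𝓜 → a ∉ K → insert b K ∈ 𝓜 → b ∉ K → a ≠ b →
      Φ a + Φ b + ∑ j ∈ τ ∪ K, (D.comp j).inter (D.stratum (τ ∪ K)) • Φ j = κ (τ ∪ K)) :
    D.IsSingleValuedRepresentative n κ
      (fun x : D.star τ => ∑ i, x.1 i ⊗ₜ[ℤ] Φ i) := by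
  constructor
  · intro ρ _ _
    refine ⟨{ toFun := fun v => ∑ i, v i ⊗ₜ[ℤ] Φ i, map_add' := fun v v' => ?_,
              map_smul' := fun r v => ?_ }, fun _ _ => rfl⟩
    · simp only [Pi.add_apply, TensorProduct.add_tmul, Finset.sum_add_distrib]
    · simp only [Pi.smul_apply, RingHom.id_apply, Finset.smul_sum, TensorProduct.smul_tmul']
  · intro ρ σ σ' hτρ hρ w hw
    obtain ⟨K, a, b, rfl, ha, haK, hb, hbK, hab, rfl, rfl⟩ := S.exists_of_isInteriorWall hd hτρ hρ
    have haτ := S.notMem ha (Finset.mem_insert_self a K)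
    have hbτ := S.notMem hb (Finset.mem_insert_self b K)
    have haU : a ∈ τ ∪ insert a K := Finset.mem_union_right _ (Finset.mem_insert_self a K)
    have hbU : b ∈ τ ∪ insert b K := Finset.mem_union_right _ (Finset.mem_insert_self b K)
    have haρ : a ∉ τ ∪ K := fun h => (Finset.mem_union.1 h).elim haτ haK
    have hbρ : b ∉ τ ∪ K := fun h => (Finset.mem_union.1 h).elim hbτ hbK
    have hsub : τ ∪ K ⊆ τ ∪ insert a K :=
      Finset.union_subset_union_right (Finset.subset_insert a K)
    have hsub' : τ ∪ K ⊆ τ ∪ insert b K :=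
      Finset.union_subset_union_right (Finset.subset_insert b K)
    let q : (Fin n → ℤ) →ₗ[ℤ] G := hw.1.basis.constr ℤ fun i => Φ i
    let q' : (Fin n → ℤ) →ₗ[ℤ] G := hw.2.1.basis.constr ℤ fun i => Φ i
    have hq : ∀ i ∈ τ ∪ insert a K, q (w i) = Φ i := fun i hi => by
      have h1 := hw.1.basis.constr_basis ℤ (fun i => Φ i) ⟨i, hi⟩
      rwa [hw.1.basis_apply] at h1
    have hq' : ∀ i ∈ τ ∪ insert b K, q' (w i) = Φ i := fun i hi => by
      have h1 := hw.2.1.basis.constr_basis ℤ (fun i => Φ i) ⟨i, hi⟩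
      rwa [hw.2.1.basis_apply] at h1
    have hslope : ∀ (f : (Fin n → ℤ) →ₗ[ℤ] G) (σ : Finset ι), (∀ i ∈ σ, f (w i) = Φ i) →
        ∀ x : D.star τ, x.1 ∈ coneInt σ → ∑ i, x.1 i ⊗ₜ[ℤ] Φ i =
          extendScalars f.toAddMonoidHom (plMap w x.1) + 0 := by
      intro f σ hf x hx
      rw [add_zero, extendScalars_plMap]
      refine Finset.sum_congr rfl fun i _ => ?_
      by_cases hi : i ∈ σ
      · rw [← hf i hi]; rfl
      · rw [hx.2 i hi, TensorProduct.zero_tmul, TensorProduct.zero_tmul]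
    refine ⟨q.toAddMonoidHom, q'.toAddMonoidHom, 0, 0, hslope q _ hq, hslope q' _ hq',
      fun δ hδ hδ0 hδpos => ?_⟩
    have hcases : ∀ i ∈ τ ∪ insert b K, i ∈ τ ∪ K ∨ i = b := fun i hi => by
      rcases Finset.mem_union.1 hi with hi | hi
      · exact Or.inl (Finset.mem_union_left _ hi)
      · rcases Finset.mem_insert.1 hi with hi | hi
        · exact Or.inr hi
        · exact Or.inl (Finset.mem_union_right _ hi)
    have hδb : δ (w b) = 1 := by
      obtain ⟨x, hx⟩ := hδ 1
      have h1 : δ.toIntLinearMap = δ (w b) • hw.2.1.basis.coord ⟨b, hbU⟩ := by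
        refine hw.2.1.basis.ext fun i => ?_
        rw [LinearMap.smul_apply, Module.Basis.coord_apply, Module.Basis.repr_self,
          hw.2.1.basis_apply]
        rcases hcases i i.2 with hi | hi
        · rw [Finsupp.single_eq_of_ne (by rintro rfl; exact hbρ hi), smul_zero]
          exact hδ0 i hi
        · obtain rfl : i = ⟨b, hbU⟩ := Subtype.ext hi
          rw [Finsupp.single_eq_same, smul_eq_mul, mul_one]
          rfl
      have h2 := LinearMap.congr_fun h1 x
      have h3 : δ (w b) * hw.2.1.basis.coord ⟨b, hbU⟩ x = 1 := h2.symm.trans hx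
      exact (Int.eq_one_or_neg_one_of_mul_eq_one h3).resolve_right fun h4 => by
        have := hδpos b hbU hbρ
        omega
    have hrel := hw.2.2 a haU haρ b hbU hbρ
    have h1 : q' - q = (δ.toIntLinearMap).smulRight (κ (τ ∪ K)) := by
      refine hw.2.1.basis.ext fun i => ?_
      rw [LinearMap.sub_apply, LinearMap.smulRight_apply, hw.2.1.basis_apply, hq' i i.2]
      change _ = δ (w i) • _
      rcases hcases i i.2 with hi | hi
      · rw [hq i (hsub hi), sub_self, hδ0 i hi, zero_smul]
      · rw [hi, hδb, one_smul, ← hΦ K a b ha haK hb hbK hab]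
        have h2 : w b = -w a + -∑ j ∈ τ ∪ K, (D.comp j).inter (D.stratum (τ ∪ K)) • w j := by
          rw [← hrel]; abel
        rw [h2, map_add, map_neg, map_neg, hq a haU, map_sum,
          Finset.sum_congr rfl fun j hj => by rw [map_zsmul, hq j (hsub hj)]]
        abel
    exact fun z => LinearMap.congr_fun h1 z

end SNCDivisor.IsStarFan

/-! ### The star of a stratum which is a toric variety -/

theorem ToricStructure.IsAtlas.isStarFan {k : Type u} [Field k] [IsAlgClosed k] {X : Scheme.{u}}
    [IsIntegral X] {s : X ⟶ Spec (CommRingCat.of k)} {ι : Type} [DecidableEq ι]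
    {D : SNCDivisor X ι} {τ : Finset ι} {d : ℕ} {F : Fan d}
    {T : ToricStructure (redι (D.stratum τ) ≫ s) F} [IsIntegral (redSubscheme (D.stratum τ))]
    {𝓜 : Set (Finset ι)} {u : ι → Fin d → ℤ} {m : Finset ι → ι → Fin d → ℤ} {μ : Fin d → ℤ}
    (h : T.IsAtlas 𝓜 u m) (H : IsHalfSpaceFan 𝓜 u m μ) : D.IsStarFan τ 𝓜 u m μ where
  fan := H
  isCone_iff _ hρ := h.isCone_iff hρ
  disjoint _ hI := Finset.disjoint_right.2 fun _ hi => h.notMem hI hi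
  nonempty := by
    obtain ⟨I, hI, -⟩ := (H.supp 0).2 (map_zero (dotR μ)).ge
    exact ⟨I, hI⟩
  inter_comp _ _ _ ha haK hb hbK hab _ hl := h.inter_comp H ha haK hb hbK hab hl
  exists_inter E := by
    obtain ⟨I, hI, -⟩ := (H.supp 0).2 (map_zero (dotR μ)).ge
    obtain ⟨e, he⟩ := h.exists_inter_eq H ⟨I, hI⟩ E
    refine ⟨e, fun K a b ha haK hb hbK hab => ?_⟩
    rw [he K a b ha haK hb hbK hab]
    congr 1
    exact Finset.sum_congr rfl fun l hl => by rw [h.inter_comp H ha haK hb hbK hab hl]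

end LogPair

end

theorem proposition2p1 {k : Type u} [Field k] [IsAlgClosed k] [CharZero k]
    {X : AlgebraicGeometry.Scheme.{u}} [AlgebraicGeometry.IsIntegral X]
    (s : X ⟶ AlgebraicGeometry.Spec (CommRingCat.of k)) (n : ℕ)
    [AlgebraicGeometry.IsSeparated s] [AlgebraicGeometry.QuasiCompact s]
    [AlgebraicGeometry.SmoothOfRelativeDimension n s]
    {ι : Type} [Fintype ι] (D : LogPair.SNCDivisor X ι)
    (hX : D.AbsoluteOrRelative s)
    (hconn : ∀ I : Finset ι, (D.stratum I : Set X).Nonempty → _root_.IsConnected (D.stratum I : Set X))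
    (τ : Finset ι) (hτ : D.IsCone τ) (d : ℕ) (hd : τ.card + d = n)
    (F : LogPair.Fan d)
    (T : LogPair.ToricStructure (LogPair.redι (D.stratum τ) ≫ s) F)
    (hT : D.StratificationAgrees τ T) :
    (∃ 𝒜 : LogPair.IntegralAffineStructure (D.star τ) n {x | x.1 ∈ D.boundary n},
      D.Extends τ 𝒜 ∧
      ∃ υ : D.star τ → Fin d → ℝ,
        𝒜.IsAffineSubmersion υ ∧
        ∀ ω ∈ F.cones, ∃ ρ, D.IsCone ρ ∧ τ ⊆ ρ ∧
          υ ⁻¹' intrinsicInterior ℝ (ω : Set (Fin d → ℝ)) =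
            {x | x.1 ∈ LogPair.SNCDivisor.coneInt ρ} ∧
          υ '' {x | x.1 ∈ LogPair.SNCDivisor.coneInt ρ} =
            intrinsicInterior ℝ (ω : Set (Fin d → ℝ))) ∧
    (AlgebraicGeometry.IsProper s → Disjoint (D.star τ) (D.boundary n)) ∧
    ∃ φ : D.star τ → TensorProduct ℤ ℝ (LogPair.N1 s),
      D.IsSingleValuedRepresentative n (D.canonicalKink s) φ := by
  classical
  have hint := T.isIntegral_stratum hτ
  obtain ⟨𝓜, u, m, μ, h, H, hμ⟩ := T.exists_isAtlas hd hτ hT hX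
  have S := h.isStarFan H
  let ε : Fin n ≃ Fin d ⊕ τ := Fintype.equivOfCardEq (by
    rw [Fintype.card_fin, Fintype.card_sum, Fintype.card_fin, Fintype.card_coe]
    omega)
  choose e he using fun j => S.exists_inter (D.comp j)
  refine ⟨⟨S.affineStructure hd ε e, ?_, _, S.isAffineSubmersion hd ε e, fun ω hω => ?_⟩,
    fun hs => S.disjoint_boundary hd (hμ hs), ?_⟩
  · rintro U w hU c rfl
    exact S.affCompatible_chart hd ε e (fun j _ => he j) hU
  · obtain ⟨I, hI, K, hK, rfl⟩ := h.exists_eq_coneOf hω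
    exact ⟨τ ∪ K, S.isCone_union hI hK, Finset.subset_union_left,
      S.preimage_intrinsicInterior ε e hI hK, S.image_coneInt ε e hI hK⟩
  · obtain ⟨Φ, hΦ⟩ := S.exists_slopes (s := s) hd ε e (fun j _ => he j)
      fun K a b ha haK hb hbK hab => h.exists_properCurve H ha haK hb hbK hab hX
    exact ⟨_, S.isSingleValuedRepresentative hd (D.canonicalKink s) Φ hΦ⟩
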